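/- Let $d\ge 3$ be odd, $\mu=\frac{d-1}{2}$, $n=\frac{d-3}{2}$ and $R>0$. Let $(f,g)\in(\dot H^1\times L^2)(\mathbb R^d)$ be radial (complex-valued), and let $$u(t)=\cos(t|\nabla|)f+\frac{\sin(t|\nabla|)}{|\nabla|}g$$ be the solution of the free wave equation with data $(f,g)$. Write $\hat f(\rho),\hat g(\rho)$ for the radial profiles of the Fourier transforms on $\mathbb R^d$, with $\hat f(\xi)=\int_{\mathbb R^d}e^{-ix\cdot\xi}f(x)\,dx$. Here $\dot H^1(\mathbb R^d)$ consists of the functions whose (distributional) Fourier transform is a function $\hat f$ with $|\xi|\hat f\in L^2$. Put $$AS_d(g)=\frac12\int_0^\infty|\hat g(\rho)|^2\rho^{d-1}d\rho-\frac1{2\pi}\int_0^\infty\!\!\int_0^\infty\Big[\frac{\sin(R(\rho_1-\rho_2))}{\rho_1-\rho_2}+(-1)^\mu\frac{\sin(R(\rho_1+\rho_2))}{\rho_1+\rho_2}\Big]\hat g(\rho_1)\overline{\hat g(\rho_2)}(\rho_1\rho_2)^{\mu}\,d\rho_2\,d\rho_1,$$ $$AS_d(f)=\frac12\int_0^\infty|\hat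 f(\rho)|^2\rho^{d+1}d\rho-\frac1{2\pi}\int_0^\infty\!\!\int_0^\infty\Big[\frac{\sin(R(\rho_1-\rho_2))}{\rho_1-\rho_2}-(-1)^\mu\frac{\sin(R(\rho_1+\rho_2))}{\rho_1+\rho_2}\Big]\hat f(\rho_1)\overline{\hat f(\rho_2)}(\rho_1\rho_2)^{\mu+1}\,d\rho_2\,d\rho_1$$ (iterated integrals). Let $\kappa$ be a normalized bump function on $\mathbb R$: smooth, even, nonnegative, decreasing on $[0,\infty)$, supported in $[-1,1]$, with $\int_{\mathbb R}\kappa=1$; put $\kappa_\varepsilon(x)=\frac1\varepsilon\kappa(\frac x\varepsilon)$. Let $j_n(z)=(-z)^n\big(\frac1z\frac{d}{dz}\big)^n\frac{\sin z}{z}$ be the spherical Bessel function, $\varphi_n(z)=zj_n(z)$, $\psi_n(z)=z^2j_n(z)$, and let $\mathcal F\varphi_n,\mathcal F\psi_n$ be their Fourier transforms on $\mathbb R$ (as tempered distributions, $\mathcal F\theta(\xi)=\int e^{-ix\xi}\theta(x)\,dx$). Define $$K_{R,\varepsilon}(r_1,r_2)=\frac1{2r_1r_2}\int_{-R}^R(\kappa_\varepsilon*\mathcal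 F\varphi_n)\Big(\frac\xi{r_1}\Big)\overline{(\kappa_\varepsilon*\mathcal F\varphi_n)\Big(\frac\xi{r_2}\Big)}\,d\xi,$$ $$\tilde K_{R,\varepsilon}(r_1,r_2)=\frac1{2r_1^2r_2^2}\int_{-R}^R(\kappa_\varepsilon*\mathcal F\psi_n)\Big(\frac\xi{r_1}\Big)\overline{(\kappa_\varepsilon*\mathcal F\psi_n)\Big(\frac\xi{r_2}\Big)}\,d\xi .$$ Then: (1) The following formulas hold, where the double integrals converge absolutely for every $\varepsilon>0$ and the limits exist: $$AS_d(g)=2^{d-1}\pi^d\int_0^\infty|g(r)|^2r^{d-1}dr-2^{d-1}\pi^{d-2}\lim_{\varepsilon\to0+}\iint_{r_1,r_2>0}K_{R,\varepsilon}(r_1,r_2)\,g(r_1)\overline{g(r_2)}\,(r_1r_2)^{\frac{d-1}2}dr_1dr_2,$$ $$AS_d(f)=2^{d-1}\pi^d\int_0^\infty|f'(r)|^2r^{d-1}dr-2^{d-1}\pi^{d-2}\lim_{\varepsilon\to0+}\iint_{r_1,r_2>0}\tilde K_{R,\varepsilon}(r_1,r_2)\,f(r_1)\overline{f(r_2)}\,(r_1r_2)^{\frac{d-1}2}dr_1dr_2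 .$$ (2) The limits below as $t\to+\infty$ and as $t\to-\infty$ both exist, and $$\max_\pm\lim_{t\to\pm\infty}(2\pi)^d\Big(\|\partial_tu(t)\|^2_{L^2(r\ge|t|+R,\,r^{d-1}dr)}+\|\partial_ru(t)\|^2_{L^2(r\ge|t|+R,\,r^{d-1}dr)}\Big)\ \ge\ AS_d(f)+AS_d(g).$$ (3) If $f=0$ or $g=0$, then each of the two limits in (2), as $t\to+\infty$ and as $t\to-\infty$, is equal to $AS_d(f)+AS_d(g)$. -/

import Mathlib

open MeasureTheory Set Filter Topology
open scoped SchwartzMap ContDiff ComplexConjugate ENNReal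

noncomputable section

namespace ExteriorEnergy

/-- The space `ℝ^d` with its Euclidean norm. -/
abbrev Space (d : ℕ) : Type := EuclideanSpace ℝ (Fin d)

/-- The Fourier transform `x ↦ ∫ e^{-i⟨y,x⟩} θ(y) dy` of an integrable function. -/
def fourierInt {V : Type*} [NormedAddCommGroup V] [InnerProductSpace ℝ V] [MeasureSpace V]
    (θ : V → ℂ) (x : V) : ℂ :=
  ∫ y, Complex.exp (-(Complex.I * ((inner ℝ y x : ℝ) : ℂ))) * θ y

/-- The function `F` is the Fourier transform of the function `f` in the sense of tempered
distributions: both are integrable against Schwartz functions, and `⟨F, φ⟩ = ⟨f, φ̂⟩` for every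
Schwartz function `φ`. -/
def IsFourierTransform {d : ℕ} (f F : Space d → ℂ) : Prop :=
  (∀ φ : 𝓢(Space d, ℂ), Integrable (fun x => f x * φ x)) ∧
  (∀ φ : 𝓢(Space d, ℂ), Integrable (fun ξ => F ξ * φ ξ)) ∧
  ∀ φ : 𝓢(Space d, ℂ), ∫ ξ, F ξ * φ ξ = ∫ x, f x * fourierInt (φ : Space d → ℂ) x

/-- The same for radial functions on `ℝ^d` that are given by their profiles on `(0,∞)`:
`ξ ↦ fhat |ξ|` is the Fourier transform on `ℝ^d` of `x ↦ f |x|`. -/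
def IsRadialFourier (d : ℕ) (f fhat : ℝ → ℂ) : Prop :=
  IsFourierTransform (d := d) (fun x => f ‖x‖) (fun ξ => fhat ‖ξ‖)

/-- The measure `r^{d-1} dr` on `(0,∞)`. -/
def radialMeasure (d : ℕ) : Measure ℝ :=
  (volume.restrict (Ioi (0 : ℝ))).withDensity (fun r => ENNReal.ofReal (r ^ (d - 1)))

/-- `w'` is the weak derivative of `w` on `(0,∞)`. -/
def HasWeakDeriv (w w' : ℝ → ℂ) : Prop :=
  LocallyIntegrableOn w (Ioi 0) ∧ LocallyIntegrableOn w' (Ioi 0) ∧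
  ∀ φ : ℝ → ℝ, ContDiff ℝ ∞ φ → HasCompactSupport φ → tsupport φ ⊆ Ioi 0 →
    ∫ r in Ioi (0 : ℝ), w r * ((deriv φ r : ℝ) : ℂ) = -∫ r in Ioi (0 : ℝ), w' r * ((φ r : ℝ) : ℂ)

/-- The radial function with profile `f` belongs to `Ḣ¹(ℝ^d)`: its Fourier transform is a
function (with profile `fhat`) for which `|ξ| fhat` is in `L²`; `f'` is its radial derivative. -/
structure IsRadialHdot1 (d : ℕ) (f f' fhat : ℝ → ℂ) : Prop where
  fourier : IsRadialFourier d f fhat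
  memLp_fourier : MemLp (fun ρ : ℝ => (ρ : ℂ) * fhat ρ) 2 (radialMeasure d)
  weakDeriv : HasWeakDeriv f f'
  memLp_deriv : MemLp f' 2 (radialMeasure d)

/-- The radial function with profile `g` belongs to `L²(ℝ^d)`; its Fourier transform has
profile `ghat`. -/
structure IsRadialL2 (d : ℕ) (g ghat : ℝ → ℂ) : Prop where
  memLp : MemLp g 2 (radialMeasure d)
  fourier : IsRadialFourier d g ghat

/-- `u` is the radial energy solution `u(t) = cos(t|∇|) f + (sin(t|∇|)/|∇|) g` of the free wave
equation on `ℝ × ℝ^d` with data `(f,g)`, where `fhat`, `ghat` are the profiles of the Fourier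
transforms of `f` and `g`. The time derivative `ut` is the derivative of `u` in `L²(ℝ^d)`, and
the radial derivative `ur` is the weak one. -/
structure IsRadialEnergySolution (d : ℕ) (fhat ghat : ℝ → ℂ) (u ut ur : ℝ → ℝ → ℂ) : Prop where
  propagator : ∀ t : ℝ, IsRadialFourier d (u t) (fun ρ =>
    (Real.cos (t * ρ) : ℂ) * fhat ρ + ((Real.sin (t * ρ) / ρ : ℝ) : ℂ) * ghat ρ)
  memLp_ut : ∀ t : ℝ, MemLp (ut t) 2 (radialMeasure d)
  timeDeriv : ∀ t : ℝ, Tendsto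
    (fun h : ℝ => eLpNorm (fun r => (u (t + h) r - u t r) / (h : ℂ) - ut t r) 2 (radialMeasure d))
    (𝓝[≠] 0) (𝓝 0)
  weakDeriv : ∀ t : ℝ, HasWeakDeriv (u t) (ur t)
  memLp_ur : ∀ t : ℝ, MemLp (ur t) 2 (radialMeasure d)

/-- `‖∂ₜu(t)‖² + ‖∂ᵣu(t)‖²` in `L²(r ≥ |t| + R, r^{d-1} dr)`. -/
def extEnergy (d : ℕ) (R : ℝ) (ut ur : ℝ → ℝ → ℂ) (t : ℝ) : ℝ :=
  (∫ r in Ici (|t| + R), ‖ut t r‖ ^ 2 * r ^ (d - 1)) +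
  (∫ r in Ici (|t| + R), ‖ur t r‖ ^ 2 * r ^ (d - 1))

/-- The asymptotic exterior energy `AS_d(g)` in terms of the Fourier transform of `g`, with
`μ = (d-1)/2`. The double integrals are Hermitian forms with real symmetric kernels, hence
real. -/
def asG (d : ℕ) (R : ℝ) (ghat : ℝ → ℂ) : ℝ :=
  (1 / 2) * (∫ ρ in Ioi (0 : ℝ), ‖ghat ρ‖ ^ 2 * ρ ^ (d - 1))
  - 1 / (2 * Real.pi) * (∫ ρ₁ in Ioi (0 : ℝ), ∫ ρ₂ in Ioi (0 : ℝ),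
      ((Real.sin (R * (ρ₁ - ρ₂)) / (ρ₁ - ρ₂) * (ρ₁ * ρ₂) ^ ((d - 1) / 2) : ℝ) : ℂ)
        * (ghat ρ₁ * conj (ghat ρ₂))).re
  - (-1) ^ ((d - 1) / 2) / (2 * Real.pi) * (∫ ρ₁ in Ioi (0 : ℝ), ∫ ρ₂ in Ioi (0 : ℝ),
      ((Real.sin (R * (ρ₁ + ρ₂)) / (ρ₁ + ρ₂) * (ρ₁ * ρ₂) ^ ((d - 1) / 2) : ℝ) : ℂ)
        * (ghat ρ₁ * conj (ghat ρ₂))).re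

/-- The asymptotic exterior energy `AS_d(f)` in terms of the Fourier transform of `f`, with
`μ = (d-1)/2`. -/
def asF (d : ℕ) (R : ℝ) (fhat : ℝ → ℂ) : ℝ :=
  (1 / 2) * (∫ ρ in Ioi (0 : ℝ), ‖fhat ρ‖ ^ 2 * ρ ^ (d + 1))
  - 1 / (2 * Real.pi) * (∫ ρ₁ in Ioi (0 : ℝ), ∫ ρ₂ in Ioi (0 : ℝ),
      ((Real.sin (R * (ρ₁ - ρ₂)) / (ρ₁ - ρ₂) * (ρ₁ * ρ₂) ^ ((d - 1) / 2 + 1) : ℝ) : ℂ)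
        * (fhat ρ₁ * conj (fhat ρ₂))).re
  + (-1) ^ ((d - 1) / 2) / (2 * Real.pi) * (∫ ρ₁ in Ioi (0 : ℝ), ∫ ρ₂ in Ioi (0 : ℝ),
      ((Real.sin (R * (ρ₁ + ρ₂)) / (ρ₁ + ρ₂) * (ρ₁ * ρ₂) ^ ((d - 1) / 2 + 1) : ℝ) : ℂ)
        * (fhat ρ₁ * conj (fhat ρ₂))).re

/-- The spherical Bessel function `j_n(z) = (-z)^n ((1/z) d/dz)^n (sin z / z)`. -/
def sphBessel (n : ℕ) (z : ℝ) : ℝ :=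
  (-z) ^ n * ((fun (F : ℝ → ℝ) (x : ℝ) => (1 / x) * deriv F x)^[n] Real.sinc) z

/-- `φ_n(z) = z j_n(z)`. -/
def phiBessel (n : ℕ) (z : ℝ) : ℝ := z * sphBessel n z

/-- `ψ_n(z) = z² j_n(z)`. -/
def psiBessel (n : ℕ) (z : ℝ) : ℝ := z ^ 2 * sphBessel n z

/-- A normalized bump function on `ℝ`. -/
structure IsNormalizedBump (κ : ℝ → ℝ) : Prop where
  smooth : ContDiff ℝ ∞ κ
  even : ∀ x, κ (-x) = κ x
  nonneg : ∀ x, 0 ≤ κ x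
  decreasing : AntitoneOn κ (Ici 0)
  support : Function.support κ ⊆ Icc (-1) 1
  integral_eq_one : ∫ x, κ x = 1

/-- `κ_ε(x) = κ(x/ε)/ε`. -/
def mollifier (κ : ℝ → ℝ) (ε x : ℝ) : ℝ := (1 / ε) * κ (x / ε)

/-- The smooth function `κ_ε * 𝓕φ`, where `𝓕φ` is the Fourier transform of `φ` as a tempered
distribution on `ℝ`, `⟨𝓕φ, θ⟩ = ⟨φ, 𝓕θ⟩`, and `(κ_ε * T)(ξ) = ⟨T, κ_ε(ξ - ·)⟩`. -/
def mollifiedFourier (κ : ℝ → ℝ) (ε : ℝ) (φ : ℝ → ℝ) (ξ : ℝ) : ℂ :=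
  ∫ z : ℝ, (φ z : ℂ) * fourierInt (fun x : ℝ => (mollifier κ ε (ξ - x) : ℂ)) z

/-- The kernel `K_{R,ε}(r₁,r₂)`. -/
def kernelG (κ : ℝ → ℝ) (n : ℕ) (R ε r₁ r₂ : ℝ) : ℂ :=
  ((1 / (2 * r₁ * r₂) : ℝ) : ℂ) * ∫ ξ in (-R)..R,
    mollifiedFourier κ ε (phiBessel n) (ξ / r₁) * conj (mollifiedFourier κ ε (phiBessel n) (ξ / r₂))

/-- The kernel `K̃_{R,ε}(r₁,r₂)`. -/
def kernelF (κ : ℝ → ℝ) (n : ℕ) (R ε r₁ r₂ : ℝ) : ℂ :=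
  ((1 / (2 * r₁ ^ 2 * r₂ ^ 2) : ℝ) : ℂ) * ∫ ξ in (-R)..R,
    mollifiedFourier κ ε (psiBessel n) (ξ / r₁) * conj (mollifiedFourier κ ε (psiBessel n) (ξ / r₂))

/-- The integrand `K(r₁,r₂) w(r₁) \overline{w(r₂)} (r₁ r₂)^{(d-1)/2}`. -/
def formIntegrand (d : ℕ) (K : ℝ → ℝ → ℂ) (w : ℝ → ℂ) (r : ℝ × ℝ) : ℂ :=
  K r.1 r.2 * w r.1 * conj (w r.2) * (((r.1 * r.2) ^ ((d - 1) / 2) : ℝ) : ℂ)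

end ExteriorEnergy

end

open MeasureTheory Set Filter Topology
open scoped SchwartzMap ContDiff ComplexConjugate ENNReal

noncomputable section

namespace ExteriorEnergy

/-! Write d = 2m + 1 with m = n + 1. Multiplication of radial profiles by r^m turns L²(r^{d-1} dr)
into L²(0,∞), and the Fourier transform on ℝ^d into (2π)^{d/2} times the Hankel transform H_m with
kernel √(2/π) b_m(rρ), where b_0 = cos and b_{k+1} = φ_k. Each H_k is a unitary involution. For G =
ρ^m ĝ and F = ρ^{m+1} f̂ one has G = H_m((2π)^{d/2} r^m g) and F = -H_{m+1}((2π)^{d/2} r^m f')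
(`hankel_of_radial_fourier`, `hankel_of_hdot1`). These identities are tested on the Gaussians r^k
e^{-ar²/2}: H_k sends a to 1/a up to a scalar, and the Gaussians separate functions by uniqueness of
the Laplace transform (`ae_eq_zero_of_integral_gaussian`).

Odd dimension enters through b_k(z) = cos(z - kπ/2) + ∫_0^1 q(t) cos(zt - kπ/2) dt with a polynomial
q (`exists_bes_rep`). Hence H_k h = C_k(h + Qh), where C_k has the kernel √(2/π) cos(rρ - kπ/2), so
that up to sign it is the cosine or the sine transform, again a unitary involution, and Q is the
multiplicative convolution with q·1_{(0,1)}, bounded by Schur's test (`hankel_eq_cosT`).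

The kernels sin(R(ρ₁∓ρ₂))/(ρ₁∓ρ₂) are integrals over (0,R) of cos·cos ± sin·sin, so Plancherel gives
AS_d(g) = ½∫_R^∞ |C_m G|² and AS_d(f) = ½∫_R^∞ |C_{m+1} F|² (`asymptotic_form_eq`).

For the exterior energy, (2π)^{d/2} r^m ∂ₜu = H_m(cos(tρ) G - sin(tρ) F) and (2π)^{d/2} r^m ∂ᵣu =
-H_{m+1}(cos(tρ) F + sin(tρ) G). In the moving frame r = s + τ, H_k(cos(τρ - α)A) tends in L²(0,∞)
to half the transform of A with phase kπ/2 - α (`tendsto_hankel_cos`): the kernel is a cosine up to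
O(1/z), and of the two terms in the product of cosines one is translated to infinity. The limits as
t → ±∞ are therefore ½∫_R^∞ |C_m G ± C_{m+1} F|². By the parallelogram law their mean is AS_d(f) +
AS_d(g), which gives the lower bound for the maximum; if F or G vanishes, both limits equal the
mean.

In physical space, 𝓕b_k = π[(-i)^k(δ_1 + q) + i^k(δ_{-1} + reflected q)]. The double integral with
the mollified kernel is ∫_0^R |A_ε w|², where A_ε is the multiplicative convolution with κ_ε * 𝓕b_k
(`quadratic_form_eq`). On (0,∞) the reflected part disappears in the limit, so that A_ε h → π(-i)^k
(h + Qh) strongly (`tendsto_dil_molKer`). Since H_k and C_k are unitary, ½‖h‖² - (2π²)⁻¹ π² ∫_0^R |h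
+ Qh|² = ½∫_R^∞ |h + Qh|², and this is AS because C_k H_k h = h + Qh (`tendsto_regularized`).

For f there is a further point, as the formula contains f in the double integral but f' in the norm.
Because f̂ is a function, f is the decaying primitive of f', so r^n f is a Hardy operator applied to
r^{n+1} f' (`hdot1_eq_decayPrimitive`). Moreover ψ_n = (n+1) b_{n+2} + z b_{n+2}', so its mollified
transform is A + A₂ + (nA - uA'), with A the kernel of order n + 2 built from κ and A₂ the one built
from yκ'(y). The last bracket undoes the Hardy operator (`dil_hardy`), and the contributions of A
and A₂ cancel in the limit because ∫κ = 1 and ∫yκ' = -1. -/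

/-! ### Poisson integrals for the spherical Bessel functions -/

/-- The integral `∫_{-1}^1 q(t) cos(z t - β) dt`. -/
def cosInt (q : Polynomial ℝ) (β z : ℝ) : ℝ := ∫ t in (-1 : ℝ)..1, q.eval t * Real.cos (z * t - β)

lemma cosInt_intervalIntegrable (q : Polynomial ℝ) (β z a b : ℝ) :
    IntervalIntegrable (fun t => q.eval t * Real.cos (z * t - β)) volume a b := by
  apply Continuous.intervalIntegrable
  fun_prop

lemma cosInt_add (p q : Polynomial ℝ) (β z : ℝ) :
    cosInt (p + q) β z = cosInt p β z + cosInt q β z := by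
  unfold cosInt
  rw [← intervalIntegral.integral_add (cosInt_intervalIntegrable _ _ _ _ _)
    (cosInt_intervalIntegrable _ _ _ _ _)]
  congr 1; ext t; simp; ring

lemma cosInt_C_mul (c : ℝ) (q : Polynomial ℝ) (β z : ℝ) :
    cosInt (Polynomial.C c * q) β z = c * cosInt q β z := by
  unfold cosInt
  rw [← intervalIntegral.integral_const_mul]
  congr 1; ext t; simp; ring

lemma hasDerivAt_cosInt (q : Polynomial ℝ) (β z : ℝ) :
    HasDerivAt (cosInt q β) (-cosInt (Polynomial.X * q) (β + Real.pi / 2) z) z := by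
  have hc : ContinuousOn (fun t : ℝ => |t * q.eval t|) (uIcc (-1) 1) := by fun_prop
  have key := intervalIntegral.hasDerivAt_integral_of_dominated_loc_of_deriv_le
    (μ := volume) (a := -1) (b := 1)
    (F := fun z t => q.eval t * Real.cos (z * t - β))
    (F' := fun z t => -(t * q.eval t * Real.sin (z * t - β))) (x₀ := z) (s := univ)
    (bound := fun t => |t * q.eval t|) Filter.univ_mem
    (Eventually.of_forall fun x => by
      apply Continuous.aestronglyMeasurable; fun_prop)
    (cosInt_intervalIntegrable _ _ _ _ _)
    (by apply Continuous.aestronglyMeasurable; fun_prop)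
    (Eventually.of_forall fun t _ x _ => by
      rw [norm_neg, norm_mul, Real.norm_eq_abs, Real.norm_eq_abs]
      exact mul_le_of_le_one_right (abs_nonneg _) (Real.abs_sin_le_one _))
    hc.intervalIntegrable
    (Eventually.of_forall fun t _ x _ => by
      have h1 : HasDerivAt (fun x : ℝ => x * t - β) t x := by
        simpa using ((hasDerivAt_id x).mul_const t).sub_const β
      exact (h1.cos.const_mul (q.eval t)).congr_deriv (by ring))
  refine key.2.congr_deriv ?_
  unfold cosInt
  rw [← intervalIntegral.integral_neg]
  congr 1; ext t
  rw [← sub_sub, Real.cos_sub_pi_div_two]; simp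

lemma mul_cosInt (q : Polynomial ℝ) (β z : ℝ) (h1 : q.eval 1 = 0) (h2 : q.eval (-1) = 0) :
    z * cosInt q β z = -cosInt (Polynomial.derivative q) (β + Real.pi / 2) z := by
  have key := intervalIntegral.integral_mul_deriv_eq_deriv_mul (a := -1) (b := 1)
    (u := fun t => q.eval t) (u' := fun t => (Polynomial.derivative q).eval t)
    (v := fun t => Real.sin (z * t - β)) (v' := fun t => z * Real.cos (z * t - β))
    (fun t _ => q.hasDerivAt t)
    (fun t _ => by
      have h1 : HasDerivAt (fun x : ℝ => z * x - β) z t := by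
        simpa using ((hasDerivAt_id t).const_mul z).sub_const β
      exact h1.sin.congr_deriv (by ring))
    (by apply Continuous.intervalIntegrable; fun_prop)
    (by apply Continuous.intervalIntegrable; fun_prop)
  simp only [h1, h2, zero_mul, sub_zero, zero_sub] at key
  unfold cosInt
  rw [← intervalIntegral.integral_const_mul, ← intervalIntegral.integral_neg]
  rw [← intervalIntegral.integral_neg] at key
  convert key using 1
  · congr 1; ext t; ring
  · congr 1; ext t; rw [← sub_sub, Real.cos_sub_pi_div_two]

/-- Each factor z is one integration by parts; the boundary terms vanish k ≤ n times because (1 -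
t²)^n vanishes to order n at ±1. The phase grows by π/2 at each step. -/
lemma pow_mul_cosInt (n : ℕ) : ∀ k ≤ n, ∃ r : Polynomial ℝ, ∀ z : ℝ,
    z ^ k * cosInt ((1 - Polynomial.X ^ 2) ^ n) 0 z =
      cosInt ((1 - Polynomial.X ^ 2) ^ (n - k) * r) (k * (Real.pi / 2)) z := by
  intro k
  induction k with
  | zero => intro _; exact ⟨1, fun z => by simp⟩
  | succ k ih =>
    intro hk
    obtain ⟨r, hr⟩ := ih (by omega)
    obtain ⟨m, hm⟩ : ∃ m, n - k = m + 1 := ⟨n - k - 1, by omega⟩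
    have hm' : n - (k + 1) = m := by omega
    rw [hm] at hr
    -- The polynomial is minus the cofactor of (1 - t²)^m in the derivative of (1 - t²)^{m+1} r.
    refine ⟨-(((m : Polynomial ℝ) + 1) * (-2 * Polynomial.X) * r +
      (1 - Polynomial.X ^ 2) * Polynomial.derivative r), fun z => ?_⟩
    rw [pow_succ', mul_assoc, hr, mul_cosInt _ _ _ (by simp) (by simp), hm']
    have : ((k : ℝ) * (Real.pi / 2) + Real.pi / 2) = ((k + 1 : ℕ) : ℝ) * (Real.pi / 2) := by
      push_cast; ring
    rw [this]
    have e : (1 - Polynomial.X ^ 2 : Polynomial ℝ) ^ m * -(((m : Polynomial ℝ) + 1) * (-2 * Polynomial.X) * r +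
      (1 - Polynomial.X ^ 2) * Polynomial.derivative r) = Polynomial.C (-1) *
      Polynomial.derivative ((1 - Polynomial.X ^ 2 : Polynomial ℝ) ^ (m + 1) * r) := by
      rw [Polynomial.derivative_mul, Polynomial.derivative_pow]
      simp
      ring
    rw [e, cosInt_C_mul]; ring

/-- Poisson's formula. Differentiation produces t(1 - t²)^n, which is -1/(2(n+1)) times the
derivative of (1 - t²)^{n+1}; integration by parts gives back a factor z that cancels the 1/z of the
operator. The origin is excluded because `1 / 0 = 0` makes the iterates meaningless there. -/
lemma sphBessel_iterate (n : ℕ) (z : ℝ) (hz : z ≠ 0) :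
    ((fun (F : ℝ → ℝ) (x : ℝ) => (1 / x) * deriv F x)^[n] Real.sinc) z =
      (-1) ^ n / (2 ^ (n + 1) * (n.factorial : ℝ)) * cosInt ((1 - Polynomial.X ^ 2) ^ n) 0 z := by
  induction n generalizing z with
  | zero =>
    have h := mul_cosInt Polynomial.X 0 z
    simp only [Function.iterate_zero, id, pow_zero, Nat.factorial_zero, zero_add]
    rw [Real.sinc_of_ne_zero hz]
    unfold cosInt
    simp only [Polynomial.eval_one, one_mul, sub_zero]
    have : (fun t : ℝ => Real.cos (z * t)) = fun t => Real.cos (t * z) := by ext; rw [mul_comm]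
    rw [this, intervalIntegral.integral_comp_mul_right (f := Real.cos) hz]
    simp
    field_simp
    ring
  | succ n ih =>
    rw [Function.iterate_succ_apply']
    have e : ((fun (F : ℝ → ℝ) (x : ℝ) => (1 / x) * deriv F x)^[n] Real.sinc) =ᶠ[𝓝 z]
        fun z => (-1) ^ n / (2 ^ (n + 1) * (n.factorial : ℝ)) *
          cosInt ((1 - Polynomial.X ^ 2) ^ n) 0 z := by
      filter_upwards [isOpen_ne.mem_nhds hz] with y hy using ih y hy
    rw [e.deriv_eq, ((hasDerivAt_cosInt _ _ z).const_mul _).deriv]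
    have h := mul_cosInt ((1 - Polynomial.X ^ 2) ^ (n + 1)) 0 z (by simp) (by simp)
    have e2 : Polynomial.derivative ((1 - Polynomial.X ^ 2 : Polynomial ℝ) ^ (n + 1)) =
        Polynomial.C (-2 * (n + 1 : ℝ)) * (Polynomial.X * (1 - Polynomial.X ^ 2) ^ n) := by
      rw [Polynomial.derivative_pow]
      have : (Polynomial.C 2 : Polynomial ℝ) = 2 := rfl
      simp [this]; ring
    rw [e2, cosInt_C_mul] at h
    have h2 : cosInt (Polynomial.X * (1 - Polynomial.X ^ 2) ^ n) (0 + Real.pi / 2) z =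
        z * cosInt ((1 - Polynomial.X ^ 2) ^ (n + 1)) 0 z / (2 * (n + 1)) := by
      rw [h]; field_simp
    rw [h2, Nat.factorial_succ]
    push_cast
    field_simp
    ring

/-- The prefactor z^n in j_n uses up all the available integrations by parts in Poisson's formula,
which leaves a bounded oscillatory integral without powers of z. -/
lemma sphBessel_eq_cosInt (n : ℕ) : ∃ p : Polynomial ℝ, ∀ z : ℝ, z ≠ 0 →
    sphBessel n z = cosInt p (n * (Real.pi / 2)) z := by
  obtain ⟨r, hr⟩ := pow_mul_cosInt n n le_rfl
  refine ⟨Polynomial.C (1 / (2 ^ (n + 1) * (n.factorial : ℝ))) *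
    ((1 - Polynomial.X ^ 2) ^ (n - n) * r), fun z hz => ?_⟩
  rw [cosInt_C_mul, ← hr, sphBessel, sphBessel_iterate n z hz, neg_pow z]
  have : ((-1 : ℝ) ^ n) * (-1) ^ n = 1 := by rw [← mul_pow]; simp
  calc _ = ((-1 : ℝ) ^ n * (-1) ^ n) * (z ^ n / (2 ^ (n + 1) * (n.factorial : ℝ)) *
        cosInt ((1 - Polynomial.X ^ 2) ^ n) 0 z) := by ring
    _ = _ := by rw [this]; ring

/-! ### Recurrences and trigonometric form of the Hankel kernels -/

/-- The Hankel kernels `cos z, sin z, sin z / z - cos z, …`. -/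
def bes : ℕ → ℝ → ℝ
  | 0 => Real.cos
  | n + 1 => phiBessel n

/-- Equivalent to (z^{-k} b_k)' = -z^{-k} b_{k+1}, which is the recursive definition of the Bessel
functions. With the value cos at k = 0 it raises the order, and the inductions on the order below
rest on it. -/
lemma hasDerivAt_bes (k : ℕ) (z : ℝ) (hz : z ≠ 0) :
    HasDerivAt (bes k) (k * bes k z / z - bes (k + 1) z) z := by
  cases k with
  | zero =>
    have : bes 1 z = Real.sin z := by
      simp [bes, phiBessel, sphBessel, Real.sinc_of_ne_zero hz]; field_simp
    simp only [this, Nat.cast_zero, zero_mul, zero_div, zero_sub]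
    exact Real.hasDerivAt_cos z
  | succ n =>
    set J : ℝ → ℝ := ((fun (F : ℝ → ℝ) (x : ℝ) => (1 / x) * deriv F x)^[n] Real.sinc) with hJ
    have e : J =ᶠ[𝓝 z] fun z => (-1) ^ n / (2 ^ (n + 1) * (n.factorial : ℝ)) *
          cosInt ((1 - Polynomial.X ^ 2) ^ n) 0 z := by
      filter_upwards [isOpen_ne.mem_nhds hz] with y hy using sphBessel_iterate n y hy
    have hd : HasDerivAt J (deriv J z) z := by
      apply DifferentiableAt.hasDerivAt
      exact (((hasDerivAt_cosInt _ _ z).const_mul _).differentiableAt).congr_of_eventuallyEq e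
    have h1 : HasDerivAt (fun x : ℝ => x * ((-x) ^ n * J x))
        (1 * ((-z) ^ n * J z) + z * ((n * (-z) ^ (n - 1) * (-1)) * J z + (-z) ^ n * deriv J z)) z := by
      have h2 := ((hasDerivAt_id z).neg.pow n).mul hd
      exact (hasDerivAt_id z).mul h2
    have hb : bes (n + 1) = fun x : ℝ => x * ((-x) ^ n * J x) := by
      ext x; rfl
    have hb2 : bes (n + 2) z = z * ((-z) ^ (n + 1) * ((1 / z) * deriv J z)) := by
      simp only [bes, phiBessel, sphBessel, Function.iterate_succ_apply', hJ]
    rw [hb2, hb]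
    convert h1 using 1
    rcases n with _ | n
    · simp; field_simp
    · simp only [Nat.add_sub_cancel]; push_cast; field_simp; ring

/-- The derivative of the recurrence of order k, with the derivatives expressed by the raising
relation and b_k eliminated by the recurrence itself, is the recurrence of order k + 1. -/
lemma bes_add_two (k : ℕ) : ∀ z : ℝ, z ≠ 0 →
    bes (k + 2) z = (2 * k + 1) * bes (k + 1) z / z - bes k z := by
  induction k with
  | zero =>
    intro z hz
    have e : bes 1 =ᶠ[𝓝 z] Real.sin := by
      filter_upwards [isOpen_ne.mem_nhds hz] with y hy
      simp [bes, phiBessel, sphBessel, Real.sinc_of_ne_zero hy]; field_simp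
    have := (hasDerivAt_bes 1 z hz).unique ((Real.hasDerivAt_sin z).congr_of_eventuallyEq e)
    have h0 : bes 0 z = Real.cos z := rfl
    simp only [Nat.cast_one, one_mul, zero_add, Nat.cast_zero, mul_zero, h0] at this ⊢
    linarith
  | succ k ih =>
    intro z hz
    have e : bes (k + 2) =ᶠ[𝓝 z] fun z => (2 * k + 1) * bes (k + 1) z / z - bes k z := by
      filter_upwards [isOpen_ne.mem_nhds hz] with y hy using ih y hy
    have h1 : HasDerivAt (fun z => (2 * k + 1) * bes (k + 1) z / z - bes k z) _ z :=
      ((((hasDerivAt_bes (k + 1) z hz).const_mul (2 * k + 1 : ℝ)).div (hasDerivAt_id z) hz)).sub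
        (hasDerivAt_bes k z hz)
    have h2 := (hasDerivAt_bes (k + 2) z hz).unique (h1.congr_of_eventuallyEq e)
    have h3 := ih z hz
    have h4 : bes k z = (2 * k + 1) * bes (k + 1) z / z - bes (k + 2) z := by linarith
    have e3 : k + 2 + 1 = k + 1 + 2 := by ring
    have e4 : k + 1 + 1 = k + 2 := by ring
    rw [h4, e3, e4] at h2
    have h5 : bes (k + 1 + 2) z = (k + 2 : ℕ) * bes (k + 2) z / z - ((k + 2 : ℕ) * bes (k + 2) z / z -
      bes (k + 1 + 2) z) := by ring
    rw [h5, h2, e4]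
    simp only [id]
    push_cast
    field_simp
    ring

/-- The order n + 2 is the one that belongs to f̂, whereas ψ_n contains j_n. This relation brings
ψ_n to the right order at the price of a dilation derivative z d/dz. It follows from the raising
relation and the three-term recurrence. -/
lemma psiBessel_eq (n : ℕ) (z : ℝ) (hz : z ≠ 0) :
    psiBessel n z = (n + 1) * bes (n + 2) z + z * deriv (bes (n + 2)) z := by
  rw [(hasDerivAt_bes (n + 2) z hz).deriv]
  have h := bes_add_two (n + 1) z hz
  have e3 : n + 1 + 2 = n + 2 + 1 := by ring
  have e4 : n + 1 + 1 = n + 2 := by ring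
  rw [e3, e4] at h
  rw [h]
  have : psiBessel n z = z * bes (n + 1) z := by
    simp only [psiBessel, bes, phiBessel]; ring
  rw [this]
  push_cast
  field_simp
  ring

/-- The raising relation b_{k+1} = k b_k/z - b_k' preserves this form: differentiation shifts the
phase by π/2, and k b_k/z is a multiple of j_{k-1}, already known to be an integral of cosines. -/
lemma bes_eq_cosInt (k : ℕ) : ∃ q : Polynomial ℝ, ∀ z : ℝ, z ≠ 0 →
    bes k z = Real.cos (z - k * (Real.pi / 2)) + cosInt q (k * (Real.pi / 2)) z := by
  induction k with
  | zero => exact ⟨0, fun z _ => by simp [bes, cosInt]⟩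
  | succ k ih =>
    obtain ⟨q, hq⟩ := ih
    obtain ⟨p, hp⟩ : ∃ p : Polynomial ℝ, ∀ z : ℝ, z ≠ 0 →
        k * bes k z / z = cosInt p ((k + 1 : ℕ) * (Real.pi / 2)) z := by
      rcases k with _ | k
      · exact ⟨0, fun z _ => by simp [cosInt]⟩
      · obtain ⟨p, hp⟩ := sphBessel_eq_cosInt k
        refine ⟨Polynomial.C (-(k + 1 : ℝ)) * p, fun z hz => ?_⟩
        rw [cosInt_C_mul]
        -- The integral for j_k has the phase kπ/2; moving it to (k+2)π/2 only changes the sign,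
        -- whence the minus sign in the witness.
        have : cosInt p ((k + 1 + 1 : ℕ) * (Real.pi / 2)) z = -cosInt p (k * (Real.pi / 2)) z := by
          unfold cosInt
          rw [← intervalIntegral.integral_neg]
          congr 1; ext t
          have : z * t - ((k + 1 + 1 : ℕ) : ℝ) * (Real.pi / 2) =
            (z * t - k * (Real.pi / 2)) - Real.pi := by push_cast; ring
          rw [this, Real.cos_sub_pi]; ring
        rw [this, ← hp z hz]
        simp only [bes, phiBessel]
        push_cast
        field_simp
    refine ⟨p + Polynomial.X * q, fun z hz => ?_⟩
    have e : bes k =ᶠ[𝓝 z] fun z => Real.cos (z - k * (Real.pi / 2)) +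
        cosInt q (k * (Real.pi / 2)) z := by
      filter_upwards [isOpen_ne.mem_nhds hz] with y hy using hq y hy
    have h1 : HasDerivAt (fun z => Real.cos (z - k * (Real.pi / 2)) +
        cosInt q (k * (Real.pi / 2)) z) _ z :=
      ((hasDerivAt_id z).sub_const (k * (Real.pi / 2))).cos.add (hasDerivAt_cosInt _ _ z)
    have h2 := (hasDerivAt_bes k z hz).unique (h1.congr_of_eventuallyEq e)
    rw [cosInt_add, ← hp z hz]
    have e1 : ((k + 1 : ℕ) : ℝ) * (Real.pi / 2) = k * (Real.pi / 2) + Real.pi / 2 := by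
      push_cast; ring
    rw [e1, ← sub_sub, Real.cos_sub_pi_div_two]
    simp only [id] at h2
    linarith

/-- The Hankel kernels in terms of trigonometric functions; `q` is a polynomial on `[0,1]`. -/
lemma exists_bes_rep (k : ℕ) : ∃ q : Polynomial ℝ, ∀ z : ℝ, z ≠ 0 →
    bes k z = Real.cos (z - k * (Real.pi / 2)) +
      ∫ t in (0 : ℝ)..1, q.eval t * Real.cos (z * t - k * (Real.pi / 2)) := by
  obtain ⟨q, hq⟩ := bes_eq_cosInt k
  refine ⟨q + Polynomial.C ((-1) ^ k) * q.comp (-Polynomial.X), fun z hz => ?_⟩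
  rw [hq z hz, cosInt, ← intervalIntegral.integral_add_adjacent_intervals (b := 0)
    (cosInt_intervalIntegrable _ _ _ _ _) (cosInt_intervalIntegrable _ _ _ _ _)]
  congr 1
  have h1 : ∫ t in (-1 : ℝ)..0, q.eval t * Real.cos (z * t - k * (Real.pi / 2)) =
      ∫ t in (0 : ℝ)..1, q.eval (-t) * Real.cos (z * (-t) - k * (Real.pi / 2)) := by
    rw [intervalIntegral.integral_comp_neg
      (f := fun t => q.eval t * Real.cos (z * t - k * (Real.pi / 2)))]
    simp
  rw [h1, add_comm, ← intervalIntegral.integral_add (cosInt_intervalIntegrable _ _ _ _ _)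
    (by apply Continuous.intervalIntegrable; fun_prop)]
  congr 1; ext t
  have : Real.cos (z * (-t) - k * (Real.pi / 2)) = (-1) ^ k * Real.cos (z * t - k * (Real.pi / 2)) := by
    rw [← Real.cos_neg]
    have : -(z * -t - (k : ℝ) * (Real.pi / 2)) = (z * t - k * (Real.pi / 2)) + k * Real.pi := by ring
    rw [this, Real.cos_add_nat_mul_pi]
  rw [this]; simp; ring

lemma measurable_bes (k : ℕ) : Measurable (bes k) := by
  obtain ⟨q, hq⟩ := bes_eq_cosInt k
  have hc : Continuous fun z => Real.cos (z - k * (Real.pi / 2)) + cosInt q (k * (Real.pi / 2)) z := by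
    have : Continuous (cosInt q (k * (Real.pi / 2))) :=
      continuous_iff_continuousAt.2 fun z => (hasDerivAt_cosInt q _ z).continuousAt
    fun_prop
  refine hc.measurable.measurable_of_countable_ne ((countable_singleton (0 : ℝ)).mono ?_)
  intro z hz
  by_contra h
  exact hz (hq z h).symm

lemma exists_bes_bound (k : ℕ) : ∃ C : ℝ, 0 < C ∧ ∀ z : ℝ, z ≠ 0 → |bes k z| ≤ C := by
  obtain ⟨q, hq⟩ := exists_bes_rep k
  refine ⟨1 + ∫ t in (0 : ℝ)..1, |q.eval t|, ?_, fun z hz => ?_⟩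
  · have : 0 ≤ ∫ t in (0 : ℝ)..1, |q.eval t| :=
      intervalIntegral.integral_nonneg zero_le_one fun t _ => abs_nonneg _
    linarith
  · rw [hq z hz]
    refine (abs_add_le _ _).trans (add_le_add (Real.abs_cos_le_one _) ?_)
    refine (intervalIntegral.abs_integral_le_integral_abs zero_le_one).trans ?_
    refine intervalIntegral.integral_mono_on zero_le_one
      (by apply Continuous.intervalIntegrable; fun_prop)
      (by apply Continuous.intervalIntegrable; fun_prop) fun t _ => ?_
    rw [abs_mul]
    exact mul_le_of_le_one_right (abs_nonneg _) (Real.abs_cos_le_one _)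

/-- One integration by parts in t gains 1/z from the smooth density q. Here |q(1)| and |q(0)| come
from the boundary terms. -/
lemma exists_bes_sub_cos_bound (k : ℕ) : ∃ C : ℝ, ∀ z : ℝ, z ≠ 0 →
    |bes k z - Real.cos (z - k * (Real.pi / 2))| ≤ C / |z| := by
  obtain ⟨q, hq⟩ := exists_bes_rep k
  set β := (k : ℝ) * (Real.pi / 2) with hβ
  refine ⟨|q.eval 1| + |q.eval 0| + ∫ t in (0 : ℝ)..1, |(Polynomial.derivative q).eval t|,
    fun z hz => ?_⟩
  rw [hq z hz, add_sub_cancel_left, le_div_iff₀ (abs_pos.2 hz), ← abs_mul]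
  have key := intervalIntegral.integral_mul_deriv_eq_deriv_mul (a := 0) (b := 1)
    (u := fun t => q.eval t) (u' := fun t => (Polynomial.derivative q).eval t)
    (v := fun t => Real.sin (z * t - β)) (v' := fun t => z * Real.cos (z * t - β))
    (fun t _ => q.hasDerivAt t)
    (fun t _ => by
      have h1 : HasDerivAt (fun x : ℝ => z * x - β) z t := by
        simpa using ((hasDerivAt_id t).const_mul z).sub_const β
      exact h1.sin.congr_deriv (by ring))
    (by apply Continuous.intervalIntegrable; fun_prop)
    (by apply Continuous.intervalIntegrable; fun_prop)
  have e : (∫ t in (0 : ℝ)..1, q.eval t * Real.cos (z * t - β)) * z =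
      ∫ t in (0 : ℝ)..1, q.eval t * (z * Real.cos (z * t - β)) := by
    rw [← intervalIntegral.integral_mul_const]
    congr 1; ext t; ring
  rw [e, key]
  have b1 : ∀ (c x : ℝ), |c * Real.sin x| ≤ |c| := fun c x => by
    rw [abs_mul]; exact mul_le_of_le_one_right (abs_nonneg _) (Real.abs_sin_le_one _)
  refine (abs_sub _ _).trans (add_le_add ((abs_sub _ _).trans (add_le_add (b1 _ _) (b1 _ _))) ?_)
  refine (intervalIntegral.abs_integral_le_integral_abs zero_le_one).trans ?_
  exact intervalIntegral.integral_mono_on zero_le_one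
      (by apply Continuous.intervalIntegrable; fun_prop)
      (by apply Continuous.intervalIntegrable; fun_prop) fun t _ => b1 _ _

/-! ### Gaussian test functions -/

/-- Lebesgue measure on the half-line. -/
abbrev nu : Measure ℝ := volume.restrict (Ioi 0)

/-- The Gaussian test functions `r^m e^{-a r²/2}`. -/
def gam (m : ℕ) (a r : ℝ) : ℝ := r ^ m * Real.exp (-(a * r ^ 2 / 2))

lemma continuous_gam (m : ℕ) (a : ℝ) : Continuous (gam m a) := by
  unfold gam; fun_prop

lemma gam_nonneg (m : ℕ) (a r : ℝ) (hr : 0 < r) : 0 ≤ gam m a r := by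
  unfold gam; positivity

lemma gam_eq_rpow (m : ℕ) (a r : ℝ) :
    gam m a r = r ^ (m : ℝ) * Real.exp (-(a / 2) * r ^ (2 : ℝ)) := by
  unfold gam
  rw [Real.rpow_natCast, Real.rpow_two]
  congr 2; ring

lemma integrable_gam (m : ℕ) {a : ℝ} (ha : 0 < a) : Integrable (gam m a) nu := by
  have h := integrableOn_rpow_mul_exp_neg_mul_sq (b := a / 2) (by positivity) (s := (m : ℝ))
    (by have : (0 : ℝ) ≤ m := Nat.cast_nonneg m
        linarith)
  refine h.congr (Eventually.of_forall fun r => ?_)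
  dsimp only
  rw [gam_eq_rpow, Real.rpow_two]

lemma integral_gam (m : ℕ) {a : ℝ} (ha : 0 < a) :
    ∫ r, gam m a r ∂nu =
      (a / 2) ^ (-((m : ℝ) + 1) / 2) * (1 / 2) * Real.Gamma (((m : ℝ) + 1) / 2) := by
  rw [← integral_rpow_mul_exp_neg_mul_rpow (p := 2) (by norm_num)
    (by have : (0 : ℝ) ≤ m := Nat.cast_nonneg m
        linarith) (by positivity : 0 < a / 2)]
  exact integral_congr_ae (Eventually.of_forall fun r => gam_eq_rpow m a r)

lemma gam_mul (m m' : ℕ) (a b r : ℝ) : gam m a r * gam m' b r = gam (m + m') (a + b) r := by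
  unfold gam
  rw [mul_mul_mul_comm, ← pow_add, ← Real.exp_add]
  congr 2; ring_nf

lemma memLp_gam (m : ℕ) {a : ℝ} (ha : 0 < a) : MemLp (fun r => (gam m a r : ℂ)) 2 nu := by
  rw [memLp_two_iff_integrable_sq_norm
    (show AEStronglyMeasurable (fun r => (gam m a r : ℂ)) nu from
      (Complex.continuous_ofReal.comp (continuous_gam m a)).aestronglyMeasurable)]
  refine (integrable_gam (m + m) (add_pos ha ha)).congr (Eventually.of_forall fun r => ?_)
  dsimp only
  rw [← gam_mul, Complex.norm_real, Real.norm_eq_abs, sq_abs, sq]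

/-- Uniqueness for the Laplace transform in the variable `r²/2`. -/
lemma ae_eq_zero_of_integral_gaussian (K : ℝ → ℂ)
    (hK : ∀ a : ℝ, 0 < a → Integrable (fun r => K r * (gam 0 a r : ℂ)) nu)
    (h0 : ∀ a : ℝ, 0 < a → ∫ r, K r * (gam 0 a r : ℂ) ∂nu = 0) : ∀ᵐ r ∂nu, K r = 0 := by
  set k0 : ℝ → ℂ := fun r => K r * (gam 0 1 r : ℂ) with hk0
  have hk0i : Integrable k0 nu := hK 1 one_pos
  have hexp : ∀ (r : ℝ) (j : ℕ), k0 r * ((Real.exp (-(r ^ 2 / 2)) ^ j : ℝ) : ℂ) =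
      K r * (gam 0 (1 + j) r : ℂ) := by
    intro r j
    rw [hk0, mul_assoc, ← Complex.ofReal_mul]
    congr 2
    unfold gam
    rw [pow_zero, one_mul, one_mul, ← Real.exp_nat_mul, ← Real.exp_add]
    ring_nf
  -- The vanishing moments at the integer parameters a = 1 + j say that k0 annihilates every
  -- polynomial in e^{-r²/2}.
  have hpoly : ∀ p : Polynomial ℝ,
      Integrable (fun r => k0 r * ((p.eval (Real.exp (-(r ^ 2 / 2))) : ℝ) : ℂ)) nu ∧
      ∫ r, k0 r * ((p.eval (Real.exp (-(r ^ 2 / 2))) : ℝ) : ℂ) ∂nu = 0 := by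
    intro p
    induction p using Polynomial.induction_on' with
    | add p q hp hq =>
      have e : (fun r => k0 r * (((p + q).eval (Real.exp (-(r ^ 2 / 2))) : ℝ) : ℂ)) =
          fun r => k0 r * ((p.eval (Real.exp (-(r ^ 2 / 2))) : ℝ) : ℂ) +
            k0 r * ((q.eval (Real.exp (-(r ^ 2 / 2))) : ℝ) : ℂ) := by
        ext r; simp; ring
      rw [e]
      exact ⟨hp.1.add hq.1, by rw [integral_add hp.1 hq.1, hp.2, hq.2, add_zero]⟩
    | monomial j c =>
      have e : (fun r => k0 r * (((Polynomial.monomial j c).eval (Real.exp (-(r ^ 2 / 2))) : ℝ) : ℂ)) =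
          fun r => (c : ℂ) * (K r * (gam 0 (1 + j) r : ℂ)) := by
        ext r
        rw [← hexp, Polynomial.eval_monomial]; push_cast; ring
      rw [e]
      have hj : (0 : ℝ) < 1 + j := by positivity
      exact ⟨(hK _ hj).const_mul _, by rw [integral_const_mul, h0 _ hj, mul_zero]⟩
  have hloc : LocallyIntegrableOn k0 (Ioi 0) volume :=
    (show IntegrableOn k0 (Ioi 0) volume from hk0i).locallyIntegrableOn
  have main := isOpen_Ioi.ae_eq_zero_of_integral_contDiff_smul_eq_zero (U := Ioi (0 : ℝ)) hloc ?_
  · rw [ae_restrict_iff' measurableSet_Ioi]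
    filter_upwards [main] with r hr hr0
    have := hr hr0
    rw [hk0] at this
    rcases mul_eq_zero.1 this with h | h
    · exact h
    · exfalso
      rw [Complex.ofReal_eq_zero] at h
      unfold gam at h
      simp at h
  intro φ hφ hφc hφs
  -- The test function φ is written as a function of x = e^{-r²/2} ∈ (0,1), so that it can be
  -- approximated by polynomials in x.
  set Φ : ℝ → ℝ := fun x => φ (Real.sqrt (-2 * Real.log x)) with hΦ
  have hφ0 : ∀ r ≤ 0, φ r = 0 := fun r hr => by
    by_contra h
    exact absurd (hφs (subset_tsupport _ h)) (not_lt.2 hr)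
  -- At x = 0 the limit is 0 since φ has compact support. The formula also gives Φ 0 = φ 0 = 0
  -- because `Real.log 0 = 0` and φ vanishes off (0,∞).
  have hΦc : ContinuousOn Φ (Icc 0 1) := by
    intro x hx
    rcases eq_or_lt_of_le hx.1 with h | h
    · have hΦ0 : Φ x = 0 := by simp only [hΦ, ← h]; simp [hφ0]
      rw [ContinuousWithinAt, hΦ0]
      have t1 : Tendsto (fun x => Real.sqrt (-2 * Real.log x)) (𝓝[>] 0) atTop :=
        Real.tendsto_sqrt_atTop.comp (Real.tendsto_log_nhdsGT_zero.const_mul_atBot_of_neg (by norm_num))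
      have t2 : Tendsto Φ (𝓝[>] 0) (𝓝 0) :=
        (hφc.is_zero_at_infty.mono_left atTop_le_cocompact).comp t1
      have t3 : Tendsto Φ (𝓝[Icc 0 1] x) (𝓝 0) := by
        have hsub : Icc (0 : ℝ) 1 ⊆ insert 0 (Ioi 0) := fun y hy => by
          rcases eq_or_lt_of_le hy.1 with h' | h'
          · exact Or.inl h'.symm
          · exact Or.inr h'
        rw [← h]
        refine Tendsto.mono_left ?_ (nhdsWithin_mono _ hsub)
        rw [nhdsWithin_insert, tendsto_sup]
        refine ⟨?_, t2⟩
        rw [tendsto_pure_left]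
        intro s hs
        have : Φ 0 = 0 := h ▸ hΦ0
        rw [this]; exact mem_of_mem_nhds hs
      exact t3
    · apply ContinuousAt.continuousWithinAt
      have : ContinuousAt Real.log x := Real.continuousAt_log h.ne'
      exact hφ.continuous.continuousAt.comp
        (Real.continuous_sqrt.continuousAt.comp (continuousAt_const.mul this))
  have hΦe : ∀ r : ℝ, 0 < r → Φ (Real.exp (-(r ^ 2 / 2))) = φ r := fun r hr => by
    simp only [hΦ, Real.log_exp]
    congr 1
    rw [show -2 * -(r ^ 2 / 2) = r ^ 2 by ring, Real.sqrt_sq hr.le]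
  have hset : ∫ r, φ r • k0 r = ∫ r, φ r • k0 r ∂nu := by
    symm
    apply setIntegral_eq_integral_of_forall_compl_eq_zero
    intro r hr
    rw [hφ0 r (not_lt.1 hr), zero_smul]
  rw [hset]
  have hI : Integrable (fun r => φ r • k0 r) nu := by
    obtain ⟨C, hC⟩ := hφc.exists_bound_of_continuous hφ.continuous
    exact hk0i.bdd_smul C hφ.continuous.aestronglyMeasurable (Eventually.of_forall hC)
  have hle : ∀ ε : ℝ, 0 < ε → ‖∫ r, φ r • k0 r ∂nu‖ ≤ ε * ∫ r, ‖k0 r‖ ∂nu := by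
    intro ε hε
    obtain ⟨p, hp⟩ := exists_polynomial_near_of_continuousOn 0 1 Φ hΦc ε hε
    have e : ∫ r, φ r • k0 r ∂nu =
        ∫ r, (φ r • k0 r - k0 r * ((p.eval (Real.exp (-(r ^ 2 / 2))) : ℝ) : ℂ)) ∂nu := by
      rw [integral_sub hI (hpoly p).1, (hpoly p).2, sub_zero]
    rw [e, ← integral_const_mul]
    refine norm_integral_le_of_norm_le (hk0i.norm.const_mul ε) ?_
    rw [ae_restrict_iff' measurableSet_Ioi]
    refine Eventually.of_forall fun r hr => ?_
    have h1 : Real.exp (-(r ^ 2 / 2)) ∈ Icc (0 : ℝ) 1 :=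
      ⟨(Real.exp_pos _).le, Real.exp_le_one_iff.2 (by have := sq_nonneg r; linarith)⟩
    have h2 := hp _ h1
    rw [hΦe r hr] at h2
    have e2 : φ r • k0 r - k0 r * ((p.eval (Real.exp (-(r ^ 2 / 2))) : ℝ) : ℂ) =
        ((φ r - p.eval (Real.exp (-(r ^ 2 / 2))) : ℝ) : ℂ) * k0 r := by
      rw [Complex.real_smul]; push_cast; ring
    rw [e2, norm_mul, Complex.norm_real, Real.norm_eq_abs, abs_sub_comm]
    exact mul_le_mul_of_nonneg_right h2.le (norm_nonneg _)
  have hlim : ‖∫ r, φ r • k0 r ∂nu‖ ≤ 0 := by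
    have t : Tendsto (fun ε : ℝ => ε * ∫ r, ‖k0 r‖ ∂nu) (𝓝[>] 0) (𝓝 (0 * ∫ r, ‖k0 r‖ ∂nu)) :=
      (tendsto_nhdsWithin_of_tendsto_nhds tendsto_id).mul_const _
    rw [zero_mul] at t
    exact ge_of_tendsto t (by filter_upwards [self_mem_nhdsWithin] with ε hε using hle ε hε)
  exact norm_le_zero_iff.1 hlim

/-- The Hankel transform of a Gaussian test function. -/
lemma integral_bes_mul_gam (m : ℕ) {a : ℝ} (ha : 0 < a) {r : ℝ} (hr : 0 < r) :
    ∫ ρ, bes m (r * ρ) * gam m a ρ ∂nu =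
      Real.sqrt (Real.pi / 2) * a ^ (-((m : ℝ) + 1 / 2)) * gam m a⁻¹ r := by
  induction m generalizing r with
  | zero =>
    have h := fourierIntegral_gaussian (b := ((a / 2 : ℝ) : ℂ)) (by simpa using ha) (r : ℂ)
    have hre := congrArg Complex.re h
    have hint : Integrable fun x : ℝ => Complex.exp (Complex.I * r * x) *
        Complex.exp (-((a / 2 : ℝ) : ℂ) * (x : ℂ) ^ 2) := by
      have := integrable_cexp_neg_mul_sq (b := ((a / 2 : ℝ) : ℂ)) (by simpa using ha)
      refine this.bdd_mul (c := 1) (by apply Continuous.aestronglyMeasurable; fun_prop)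
        (Eventually.of_forall fun x => ?_)
      rw [mul_assoc, mul_comm Complex.I, ← Complex.ofReal_mul, Complex.norm_exp_ofReal_mul_I]
    have e1 : (∫ x : ℝ, Complex.exp (Complex.I * r * x) *
        Complex.exp (-((a / 2 : ℝ) : ℂ) * (x : ℂ) ^ 2)).re =
        2 * ∫ x, bes 0 (r * x) * gam 0 a x ∂nu := by
      rw [← integral_comp_abs (f := fun x => bes 0 (r * x) * gam 0 a x)]
      have := integral_re hint
      simp only [RCLike.re_eq_complex_re] at this
      rw [← this]
      congr 1; ext x
      have h1 : Complex.I * r * x = ((r * x : ℝ) : ℂ) * Complex.I := by push_cast; ring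
      have h2 : -((a / 2 : ℝ) : ℂ) * (x : ℂ) ^ 2 = ((-(a * x ^ 2 / 2) : ℝ) : ℂ) := by
        push_cast; ring
      rw [h1, h2, ← Complex.ofReal_exp, Complex.re_mul_ofReal, Complex.exp_ofReal_mul_I_re]
      simp only [bes, gam, pow_zero, one_mul, sq_abs]
      congr 1
      rcases abs_cases x with ⟨h, _⟩ | ⟨h, _⟩ <;> rw [h]
      rw [mul_neg, Real.cos_neg]
    have e2 : ((Real.pi / ((a / 2 : ℝ) : ℂ)) ^ (1 / 2 : ℂ) *
        Complex.exp (-(r : ℂ) ^ 2 / (4 * ((a / 2 : ℝ) : ℂ)))).re =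
        (Real.pi / (a / 2)) ^ (1 / 2 : ℝ) * Real.exp (-(a⁻¹ * r ^ 2 / 2)) := by
      have h1 : (Real.pi / ((a / 2 : ℝ) : ℂ)) ^ (1 / 2 : ℂ) =
          (((Real.pi / (a / 2)) ^ (1 / 2 : ℝ) : ℝ) : ℂ) := by
        rw [Complex.ofReal_cpow (by positivity)]; push_cast; rfl
      have h2 : (-(r : ℂ) ^ 2 / (4 * ((a / 2 : ℝ) : ℂ))) = ((-(a⁻¹ * r ^ 2 / 2) : ℝ) : ℂ) := by
        push_cast
        field_simp
        ring
      rw [h1, h2, ← Complex.ofReal_exp, Complex.re_ofReal_mul, Complex.ofReal_re]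
    rw [e1, e2, ← Real.sqrt_eq_rpow] at hre
    have e3 : Real.sqrt (Real.pi / (a / 2)) =
        2 * (Real.sqrt (Real.pi / 2) * a ^ (-(((0 : ℕ) : ℝ) + 1 / 2))) := by
      rw [Nat.cast_zero, zero_add, Real.rpow_neg ha.le, ← Real.sqrt_eq_rpow, ← Real.sqrt_inv,
        ← Real.sqrt_mul (by positivity), show (2 : ℝ) = Real.sqrt (2 ^ 2) by simp,
        ← Real.sqrt_mul (by positivity)]
      congr 1
      field_simp
      norm_num
    rw [e3] at hre
    simp only [gam, pow_zero, one_mul] at hre ⊢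
    linarith
  | succ m ih =>
    set Ψ : ℝ → ℝ := fun r => ∫ ρ, bes m (r * ρ) * gam m a ρ ∂nu with hΨ
    obtain ⟨C, hC0, hC⟩ := exists_bes_bound m
    obtain ⟨C', hC0', hC'⟩ := exists_bes_bound (m + 1)
    have hgamsucc : ∀ ρ, gam (m + 1) a ρ = ρ * gam m a ρ := fun ρ => by unfold gam; ring
    have hmeas : ∀ (k j : ℕ) (x : ℝ), AEStronglyMeasurable (fun ρ => bes k (x * ρ) * gam j a ρ) nu := by
      intro k j x
      exact (((measurable_bes k).comp (measurable_const_mul x)).mul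
        (continuous_gam j a).measurable).aestronglyMeasurable
    have hint : ∀ (k j : ℕ) (x : ℝ), 0 < x → Integrable (fun ρ => bes k (x * ρ) * gam j a ρ) nu := by
      intro k j x hx
      obtain ⟨D, _, hD⟩ := exists_bes_bound k
      refine (integrable_gam j ha).bdd_mul (c := D)
        ((measurable_bes k).comp (measurable_const_mul x)).aestronglyMeasurable ?_
      rw [ae_restrict_iff' measurableSet_Ioi]
      exact Eventually.of_forall fun ρ hρ => hD _ (mul_pos hx hρ).ne'
    -- The identity of order m is differentiated in r. By the raising relation ∂_r b_m(rρ) = (m/r)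
    -- b_m(rρ) - ρ b_{m+1}(rρ), so the derivative contains the integral of order m + 1, and the
    -- remaining term is known by induction.
    have hder := hasDerivAt_integral_of_dominated_loc_of_deriv_le (μ := nu) (𝕜 := ℝ)
      (F := fun r ρ => bes m (r * ρ) * gam m a ρ)
      (F' := fun r ρ => (m / r) * (bes m (r * ρ) * gam m a ρ) - bes (m + 1) (r * ρ) * gam (m + 1) a ρ)
      (x₀ := r) (s := Ioi (r / 2))
      (bound := fun ρ => (m / (r / 2)) * (C * gam m a ρ) + C' * gam (m + 1) a ρ)
      (Ioi_mem_nhds (by linarith)) (Eventually.of_forall fun x => hmeas m m x) (hint m m r hr)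
      (((hmeas m m r).const_mul _).sub (hmeas (m + 1) (m + 1) r))
      (by
        rw [ae_restrict_iff' measurableSet_Ioi]
        refine Eventually.of_forall fun ρ hρ x hx => ?_
        have hr2 : 0 < r / 2 := by linarith
        have hx0 : 0 < x := hr2.trans hx
        have hρ0 : (0 : ℝ) < ρ := hρ
        have g1 := gam_nonneg m a ρ hρ
        have g2 := gam_nonneg (m + 1) a ρ hρ
        refine (norm_sub_le _ _).trans (add_le_add ?_ ?_)
        · rw [norm_mul, norm_mul, Real.norm_eq_abs, Real.norm_eq_abs, Real.norm_eq_abs,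
            abs_of_nonneg g1, abs_of_nonneg (by positivity)]
          have : x ≥ r / 2 := (mem_Ioi.1 hx).le
          gcongr
          exact hC _ (mul_pos hx0 hρ0).ne'
        · rw [norm_mul, Real.norm_eq_abs, Real.norm_eq_abs, abs_of_nonneg g2]
          gcongr
          exact hC' _ (mul_pos hx0 hρ0).ne')
      ((((integrable_gam m ha).const_mul C).const_mul _).add ((integrable_gam (m + 1) ha).const_mul C'))
      (by
        rw [ae_restrict_iff' measurableSet_Ioi]
        refine Eventually.of_forall fun ρ hρ x hx => ?_
        have hx0 : 0 < x := lt_trans (by linarith) hx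
        have hρ0 : (0 : ℝ) < ρ := hρ
        have h1 := (hasDerivAt_bes m (x * ρ) (mul_pos hx0 hρ0).ne').comp x
          ((hasDerivAt_id x).mul_const ρ)
        refine (h1.mul_const (gam m a ρ)).congr_deriv ?_
        rw [hgamsucc]
        field_simp)
    have hd2 := hder.2
    rw [integral_sub ((hint m m r hr).const_mul _) (hint (m + 1) (m + 1) r hr),
      integral_const_mul] at hd2
    have hev : (fun r => ∫ ρ, bes m (r * ρ) * gam m a ρ ∂nu) =ᶠ[𝓝 r] fun r =>
        Real.sqrt (Real.pi / 2) * a ^ (-((m : ℝ) + 1 / 2)) * gam m a⁻¹ r := by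
      filter_upwards [Ioi_mem_nhds hr] with x hx using ih hx
    have hd3 : HasDerivAt (gam m a⁻¹) (m / r * gam m a⁻¹ r - r / a * gam m a⁻¹ r) r := by
      have h1 : HasDerivAt (fun r : ℝ => -(a⁻¹ * r ^ 2 / 2)) (-(a⁻¹ * r)) r := by
        have := (((hasDerivAt_pow 2 r).const_mul a⁻¹).div_const 2).neg
        exact this.congr_deriv (by simp; ring)
      have h2 := (hasDerivAt_pow m r).mul h1.exp
      refine h2.congr_deriv ?_
      unfold gam
      rcases m with _ | m
      · simp; field_simp
      · simp only [Nat.add_sub_cancel]; field_simp; ring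
    have hu := hd2.unique (((hd3.const_mul (Real.sqrt (Real.pi / 2) *
      a ^ (-((m : ℝ) + 1 / 2)))).congr_of_eventuallyEq hev))
    rw [ih hr] at hu
    have e1 : a ^ (-(((m + 1 : ℕ) : ℝ) + 1 / 2)) = a ^ (-((m : ℝ) + 1 / 2)) / a := by
      rw [show -(((m + 1 : ℕ) : ℝ) + 1 / 2) = -((m : ℝ) + 1 / 2) - 1 by push_cast; ring,
        Real.rpow_sub_one ha.ne']
    have e2 : gam (m + 1) a⁻¹ r = r * gam m a⁻¹ r := by unfold gam; ring
    rw [e1, e2]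
    have : ∫ ρ, bes (m + 1) (r * ρ) * gam (m + 1) a ρ ∂nu =
        Real.sqrt (Real.pi / 2) * a ^ (-((m : ℝ) + 1 / 2)) * (r / a * gam m a⁻¹ r) := by linarith
    rw [this]; ring

/-! ### The Hankel transform as a unitary involution -/

/-- `L²(0,∞)`. -/
abbrev L2 : Type := Lp ℂ 2 nu

lemma integrable_mul_of_memLp {f g : ℝ → ℂ} {μ : Measure ℝ} (hf : MemLp f 2 μ) (hg : MemLp g 2 μ) :
    Integrable (fun r => f r * g r) μ := hf.integrable_mul hg

lemma memLp_conj {f : ℝ → ℂ} {μ : Measure ℝ} (hf : MemLp f 2 μ) :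
    MemLp (fun r => conj (f r)) 2 μ := by
  refine hf.of_le (Complex.continuous_conj.comp_aestronglyMeasurable hf.1)
    (Eventually.of_forall fun r => ?_)
  simp

/-- A function in `L²(0,∞)` that is orthogonal to all Gaussian test functions vanishes. -/
lemma ae_eq_zero_of_integral_gam {m : ℕ} (K : ℝ → ℂ)
    (hK : ∀ a : ℝ, 0 < a → Integrable (fun r => K r * (gam m a r : ℂ)) nu)
    (h0 : ∀ a : ℝ, 0 < a → ∫ r, K r * (gam m a r : ℂ) ∂nu = 0) : ∀ᵐ r ∂nu, K r = 0 := by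
  have e : ∀ a r, K r * (gam m a r : ℂ) = (K r * (r : ℂ) ^ m) * (gam 0 a r : ℂ) := fun a r => by
    unfold gam; push_cast; ring
  simp only [e] at hK h0
  have := ae_eq_zero_of_integral_gaussian _ hK h0
  filter_upwards [this, ae_restrict_mem measurableSet_Ioi] with r hr hr0
  have hr0 : (0 : ℝ) < r := hr0
  exact (mul_eq_zero.1 hr).resolve_right (by simp [hr0.ne'])

/-- The Gaussian test functions as elements of `L²`. -/
def gamLp (m : ℕ) (a : {a : ℝ // 0 < a}) : L2 := (memLp_gam m a.2).toLp

lemma inner_gamLp (m : ℕ) (a : {a : ℝ // 0 < a}) (h : L2) :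
    inner ℂ (gamLp m a) h = ∫ r, h r * (gam m a r : ℂ) ∂nu := by
  rw [L2.inner_def]
  refine integral_congr_ae ?_
  filter_upwards [(memLp_gam m a.2).coeFn_toLp] with r hr
  rw [gamLp, hr, RCLike.inner_apply]
  simp

lemma inner_gamLp_gamLp (m : ℕ) (a b : {a : ℝ // 0 < a}) :
    inner ℂ (gamLp m a) (gamLp m b) =
      ((((a.1 + b.1) / 2) ^ (-((m : ℝ) + 1 / 2)) * (1 / 2) * Real.Gamma ((m : ℝ) + 1 / 2) : ℝ) : ℂ) := by
  rw [inner_gamLp]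
  have h : ∫ r, gam (m + m) (b.1 + a.1) r ∂nu = _ := integral_gam (m + m) (add_pos b.2 a.2)
  have e1 : -(((m + m : ℕ) : ℝ) + 1) / 2 = -((m : ℝ) + 1 / 2) := by push_cast; ring
  have e2 : (((m + m : ℕ) : ℝ) + 1) / 2 = (m : ℝ) + 1 / 2 := by push_cast; ring
  rw [e1, e2, add_comm b.1] at h
  rw [← h, ← integral_complex_ofReal]
  refine integral_congr_ae ?_
  filter_upwards [(memLp_gam m b.2).coeFn_toLp] with r hr
  rw [gamLp, hr, add_comm a.1, ← gam_mul]
  push_cast; rfl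

/-- The inverse of a positive real. -/
def posInv (a : {a : ℝ // 0 < a}) : {a : ℝ // 0 < a} := ⟨a.1⁻¹, inv_pos.2 a.2⟩

/-- The image of a Gaussian test function under the Hankel transform. -/
def hankelGam (m : ℕ) (a : {a : ℝ // 0 < a}) : L2 :=
  ((a.1 ^ (-((m : ℝ) + 1 / 2)) : ℝ) : ℂ) • gamLp m (posInv a)

/-- The Gram matrix is a power of (a + b)/2, and ab(a⁻¹ + b⁻¹)/2 = (a + b)/2; the scalars
a^{-(m+1/2)} are exactly what this identity requires. No Plancherel theorem is needed for the
unitarity of the Hankel transform. -/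
lemma inner_hankelGam (m : ℕ) (a b : {a : ℝ // 0 < a}) :
    inner ℂ (hankelGam m a) (hankelGam m b) = inner ℂ (gamLp m a) (gamLp m b) := by
  unfold hankelGam
  rw [inner_smul_left, inner_smul_right, inner_gamLp_gamLp, inner_gamLp_gamLp, Complex.conj_ofReal,
    ← Complex.ofReal_mul, ← Complex.ofReal_mul]
  congr 1
  have ha := a.2
  have hb := b.2
  have e : a.1 ^ (-((m : ℝ) + 1 / 2)) * (b.1 ^ (-((m : ℝ) + 1 / 2)) *
      (((posInv a).1 + (posInv b).1) / 2) ^ (-((m : ℝ) + 1 / 2))) =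
      ((a.1 + b.1) / 2) ^ (-((m : ℝ) + 1 / 2)) := by
    rw [← Real.mul_rpow hb.le (by simp only [posInv]; positivity),
      ← Real.mul_rpow ha.le (by simp only [posInv]; positivity)]
    congr 1
    simp only [posInv]
    field_simp
    ring
  rw [← e]; ring

/-- Linear combinations of Gaussian test functions. -/
def gamSpan (m : ℕ) : ({a : ℝ // 0 < a} →₀ ℂ) →ₗ[ℂ] L2 := Finsupp.linearCombination ℂ (gamLp m)

/-- The images of linear combinations of Gaussian test functions. -/
def hankelSpan (m : ℕ) : ({a : ℝ // 0 < a} →₀ ℂ) →ₗ[ℂ] L2 :=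
  Finsupp.linearCombination ℂ (hankelGam m)

/-- Equality of the Gram matrices. It also shows that the image of a combination of Gaussians
depends only on its class in L², so that the map extends from their dense span. -/
lemma norm_hankelSpan (m : ℕ) (x : {a : ℝ // 0 < a} →₀ ℂ) : ‖hankelSpan m x‖ = ‖gamSpan m x‖ := by
  have h : inner ℂ (hankelSpan m x) (hankelSpan m x) = inner ℂ (gamSpan m x) (gamSpan m x) := by
    unfold hankelSpan gamSpan
    rw [Finsupp.linearCombination_apply, Finsupp.linearCombination_apply, Finsupp.sum, Finsupp.sum]
    simp only [sum_inner, inner_sum, inner_smul_left, inner_smul_right, inner_hankelGam]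
  rw [inner_self_eq_norm_sq_to_K, inner_self_eq_norm_sq_to_K] at h
  have h2 : ‖hankelSpan m x‖ ^ 2 = ‖gamSpan m x‖ ^ 2 := by exact_mod_cast h
  exact (pow_left_inj₀ (norm_nonneg _) (norm_nonneg _) two_ne_zero).1 h2

lemma denseRange_gamSpan (m : ℕ) : DenseRange (gamSpan m) := by
  have h : (LinearMap.range (gamSpan m)).topologicalClosure = ⊤ := by
    rw [Submodule.topologicalClosure_eq_top_iff, Submodule.eq_bot_iff]
    intro x hx
    rw [Submodule.mem_orthogonal] at hx
    have h1 : ∀ a : {a : ℝ // 0 < a}, ∫ r, x r * (gam m a r : ℂ) ∂nu = 0 := fun a => by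
      rw [← inner_gamLp]
      refine hx _ ⟨Finsupp.single a 1, ?_⟩
      simp [gamSpan]
    have h2 := ae_eq_zero_of_integral_gam (m := m) (x : ℝ → ℂ)
      (fun a ha => integrable_mul_of_memLp (Lp.memLp x) (memLp_gam m ha))
      (fun a ha => h1 ⟨a, ha⟩)
    exact (Lp.eq_zero_iff_ae_eq_zero).2 h2
  have := (Submodule.dense_iff_topologicalClosure_eq_top).2 h
  exact this

/-- The Hankel transform on `L²(0,∞)`. -/
def hankelCLM (m : ℕ) : L2 →L[ℂ] L2 := (hankelSpan m).extendOfNorm (gamSpan m)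

lemma hankelCLM_gamSpan (m : ℕ) (x : {a : ℝ // 0 < a} →₀ ℂ) :
    hankelCLM m (gamSpan m x) = hankelSpan m x :=
  LinearMap.extendOfNorm_eq (denseRange_gamSpan m)
    ⟨1, fun x => by rw [one_mul, norm_hankelSpan]⟩ x

lemma norm_hankelCLM (m : ℕ) (h : L2) : ‖hankelCLM m h‖ = ‖h‖ := by
  refine isClosed_property (p := fun h => ‖hankelCLM m h‖ = ‖h‖) (denseRange_gamSpan m)
    (isClosed_eq (by fun_prop) (by fun_prop)) (fun x => ?_) h
  rw [hankelCLM_gamSpan, norm_hankelSpan]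

lemma hankelCLM_gamLp (m : ℕ) (a : {a : ℝ // 0 < a}) : hankelCLM m (gamLp m a) = hankelGam m a := by
  have := hankelCLM_gamSpan m (Finsupp.single a 1)
  simpa [gamSpan, hankelSpan] using this

lemma inner_hankelCLM (m : ℕ) (h g : L2) : inner ℂ (hankelCLM m h) (hankelCLM m g) = inner ℂ h g :=
  LinearIsometry.inner_map_map
    (⟨(hankelCLM m).toLinearMap, norm_hankelCLM m⟩ : L2 →ₗᵢ[ℂ] L2) h g

lemma hankelCLM_hankelGam (m : ℕ) (a : {a : ℝ // 0 < a}) : hankelCLM m (hankelGam m a) = gamLp m a := by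
  unfold hankelGam
  rw [map_smul, hankelCLM_gamLp, hankelGam, smul_smul]
  have ha := a.2
  have : posInv (posInv a) = a := by ext; simp [posInv]
  rw [this, ← Complex.ofReal_mul, ← Real.mul_rpow ha.le (posInv a).2.le]
  simp [posInv, ha.ne']

lemma hankelCLM_hankelCLM (m : ℕ) (h : L2) : hankelCLM m (hankelCLM m h) = h := by
  refine isClosed_property (p := fun h => hankelCLM m (hankelCLM m h) = h) (denseRange_gamSpan m)
    (isClosed_eq (by fun_prop) (by fun_prop)) (fun x => ?_) h
  rw [hankelCLM_gamSpan, hankelSpan, Finsupp.linearCombination_apply, Finsupp.sum, map_sum]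
  simp only [map_smul, hankelCLM_hankelGam]
  rfl

open Classical in
/-- The Hankel transform of order `m - 1/2` of a function in `L²(0,∞)`, with kernel
`√(2/π) b_m(r ρ)`. -/
def hankel (m : ℕ) (h : ℝ → ℂ) : ℝ → ℂ :=
  if hh : MemLp h 2 nu then (hankelCLM m (hh.toLp h) : ℝ → ℂ) else 0

lemma hankel_def {m : ℕ} {h : ℝ → ℂ} (hh : MemLp h 2 nu) :
    hankel m h = (hankelCLM m (hh.toLp h) : ℝ → ℂ) := dif_pos hh

lemma memLp_hankel (m : ℕ) {h : ℝ → ℂ} (hh : MemLp h 2 nu) : MemLp (hankel m h) 2 nu := by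
  rw [hankel_def hh]; exact Lp.memLp _

lemma toLp_hankel {m : ℕ} {h : ℝ → ℂ} (hh : MemLp h 2 nu) :
    (memLp_hankel m hh).toLp (hankel m h) = hankelCLM m (hh.toLp h) := by
  apply Lp.ext
  refine (memLp_hankel m hh).coeFn_toLp.trans ?_
  rw [hankel_def hh]

lemma eLpNorm_hankel (m : ℕ) {h : ℝ → ℂ} (hh : MemLp h 2 nu) :
    eLpNorm (hankel m h) 2 nu = eLpNorm h 2 nu := by
  have h1 := norm_hankelCLM m (hh.toLp h)
  rw [← toLp_hankel hh, Lp.norm_toLp, Lp.norm_toLp,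
    ENNReal.toReal_eq_toReal_iff' (memLp_hankel m hh).2.ne hh.2.ne] at h1
  exact h1

lemma hankel_hankel (m : ℕ) {h : ℝ → ℂ} (hh : MemLp h 2 nu) : hankel m (hankel m h) =ᵐ[nu] h := by
  rw [hankel_def (memLp_hankel m hh), toLp_hankel hh, hankelCLM_hankelCLM]
  exact hh.coeFn_toLp

lemma hankel_congr (m : ℕ) {h g : ℝ → ℂ} (hh : MemLp h 2 nu) (e : h =ᵐ[nu] g) :
    hankel m h = hankel m g := by
  rw [hankel_def hh, hankel_def (hh.ae_eq e), MemLp.toLp_congr hh (hh.ae_eq e) e]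

lemma hankel_add (m : ℕ) {h g : ℝ → ℂ} (hh : MemLp h 2 nu) (hg : MemLp g 2 nu) :
    hankel m (fun r => h r + g r) =ᵐ[nu] fun r => hankel m h r + hankel m g r := by
  have e : (hh.add hg).toLp (h + g) = hh.toLp h + hg.toLp g := MemLp.toLp_add hh hg
  have e2 : hankel m (fun r => h r + g r) = (hankelCLM m ((hh.add hg).toLp (h + g)) : ℝ → ℂ) :=
    hankel_def (hh.add hg)
  rw [e2, e, map_add, hankel_def hh, hankel_def hg]
  exact Lp.coeFn_add _ _

lemma hankel_const_mul (m : ℕ) (c : ℂ) {h : ℝ → ℂ} (hh : MemLp h 2 nu) :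
    hankel m (fun r => c * h r) =ᵐ[nu] fun r => c * hankel m h r := by
  have e : (hh.const_smul c).toLp (c • h) = c • hh.toLp h := MemLp.toLp_const_smul c hh
  have e2 : hankel m (fun r => c * h r) = (hankelCLM m ((hh.const_smul c).toLp (c • h)) : ℝ → ℂ) :=
    hankel_def (hh.const_smul c)
  rw [e2, e, map_smul, hankel_def hh]
  exact Lp.coeFn_smul _ _

lemma hankel_sub (m : ℕ) {h g : ℝ → ℂ} (hh : MemLp h 2 nu) (hg : MemLp g 2 nu) :
    hankel m (fun r => h r - g r) =ᵐ[nu] fun r => hankel m h r - hankel m g r := by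
  have h1 := hankel_add m hh (hg.const_mul (-1))
  have h2 := hankel_const_mul m (-1) hg
  have e : (fun r => h r - g r) = fun r => h r + (-1) * g r := by ext; ring
  rw [e]
  filter_upwards [h1, h2] with r h1 h2
  rw [h1, h2]; ring

/-- The defining relation between `h` and its Hankel transform. -/
lemma integral_hankel_mul_gam (m : ℕ) {h : ℝ → ℂ} (hh : MemLp h 2 nu) {a : ℝ} (ha : 0 < a) :
    ∫ r, hankel m h r * (gam m a r : ℂ) ∂nu =
      ((a ^ (-((m : ℝ) + 1 / 2)) : ℝ) : ℂ) * ∫ r, h r * (gam m a⁻¹ r : ℂ) ∂nu := by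
  have h1 := inner_hankelCLM m (hankelGam m ⟨a, ha⟩) (hh.toLp h)
  rw [hankelCLM_hankelGam, inner_gamLp, hankelGam, inner_smul_left, inner_gamLp,
    Complex.conj_ofReal, ← hankel_def hh] at h1
  rw [h1]
  congr 1
  refine integral_congr_ae ?_
  filter_upwards [hh.coeFn_toLp] with r hr
  rw [hr]; rfl

/-- The Gaussian moments of H_m h are known explicitly and determine it. The candidate G need not be
in L² beforehand, so that distributional Fourier transforms and pointwise integrals can be
identified in this way. -/
lemma hankel_eq_of_integral (m : ℕ) {h G : ℝ → ℂ} (hh : MemLp h 2 nu)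
    (hG : ∀ a : ℝ, 0 < a → Integrable (fun r => G r * (gam m a r : ℂ)) nu)
    (e : ∀ a : ℝ, 0 < a → ∫ r, G r * (gam m a r : ℂ) ∂nu =
      ((a ^ (-((m : ℝ) + 1 / 2)) : ℝ) : ℂ) * ∫ r, h r * (gam m a⁻¹ r : ℂ) ∂nu) :
    hankel m h =ᵐ[nu] G := by
  have hi : ∀ a : ℝ, 0 < a → Integrable (fun r => hankel m h r * (gam m a r : ℂ)) nu :=
    fun a ha => integrable_mul_of_memLp (memLp_hankel m hh) (memLp_gam m ha)
  have h1 := ae_eq_zero_of_integral_gam (m := m) (fun r => hankel m h r - G r)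
    (fun a ha => by simpa only [sub_mul] using! (hi a ha).sub (hG a ha))
    (fun a ha => by
      simp only [sub_mul]
      rw [integral_sub (hi a ha) (hG a ha), e a ha, integral_hankel_mul_gam m hh ha, sub_self])
  filter_upwards [h1] with r hr using sub_eq_zero.1 hr

lemma integral_conj' {f : ℝ → ℂ} {μ : Measure ℝ} : ∫ r, conj (f r) ∂μ = conj (∫ r, f r ∂μ) :=
  integral_conj

lemma hankel_conj (m : ℕ) {h : ℝ → ℂ} (hh : MemLp h 2 nu) :
    hankel m (fun r => conj (h r)) =ᵐ[nu] fun r => conj (hankel m h r) := by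
  refine hankel_eq_of_integral m (memLp_conj hh)
    (fun a ha => integrable_mul_of_memLp (memLp_conj (memLp_hankel m hh)) (memLp_gam m ha))
    fun a ha => ?_
  have e : ∀ (f : ℝ → ℂ) (b : ℝ), ∫ r, conj (f r) * (gam m b r : ℂ) ∂nu =
      conj (∫ r, f r * (gam m b r : ℂ) ∂nu) := fun f b => by
    rw [← integral_conj']; simp
  rw [e, e, integral_hankel_mul_gam m hh ha, map_mul, Complex.conj_ofReal]

lemma inner_toLp {h g : ℝ → ℂ} (hh : MemLp h 2 nu) (hg : MemLp g 2 nu) :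
    inner ℂ (hh.toLp h) (hg.toLp g) = ∫ r, conj (h r) * g r ∂nu := by
  rw [L2.inner_def]
  refine integral_congr_ae ?_
  filter_upwards [hh.coeFn_toLp, hg.coeFn_toLp] with r h1 h2
  rw [h1, h2, RCLike.inner_apply, mul_comm]

/-- Unitarity and the involution property give a self-adjoint operator; since it commutes with
conjugation, it is also symmetric for the bilinear pairing. -/
lemma integral_hankel_mul (m : ℕ) {h g : ℝ → ℂ} (hh : MemLp h 2 nu) (hg : MemLp g 2 nu) :
    ∫ r, hankel m h r * g r ∂nu = ∫ r, h r * hankel m g r ∂nu := by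
  have hc := memLp_conj hh
  have h1 := inner_hankelCLM m (hc.toLp _) (hankelCLM m (hg.toLp g))
  rw [hankelCLM_hankelCLM, ← toLp_hankel hc, ← toLp_hankel hg, inner_toLp, inner_toLp] at h1
  have e1 : ∫ r, hankel m h r * g r ∂nu =
      ∫ r, conj (hankel m (fun r => conj (h r)) r) * g r ∂nu := by
    refine integral_congr_ae ?_
    filter_upwards [hankel_conj m hh] with r hr
    rw [hr, Complex.conj_conj]
  rw [e1, h1]
  simp

/-- On integrable functions the Hankel transform is given by an absolutely convergent integral. -/
lemma hankel_eq_integral (m : ℕ) {h : ℝ → ℂ} (hh : MemLp h 2 nu) (hi : Integrable h nu) :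
    hankel m h =ᵐ[nu] fun ρ => ∫ r, ((Real.sqrt (2 / Real.pi) * bes m (r * ρ) : ℝ) : ℂ) * h r ∂nu := by
  obtain ⟨C, hC0, hC⟩ := exists_bes_bound m
  have hprod : ∀ a : ℝ, 0 < a → Integrable (fun p : ℝ × ℝ =>
      ((Real.sqrt (2 / Real.pi) * bes m (p.2 * p.1) : ℝ) : ℂ) * ((gam m a p.1 : ℂ) * h p.2))
      (nu.prod nu) := fun a ha => by
    have h1 : Integrable (fun p : ℝ × ℝ => (gam m a p.1 : ℂ) * h p.2) (nu.prod nu) :=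
      ((integrable_gam m ha).ofReal (𝕜 := ℂ)).mul_prod hi
    refine h1.bdd_mul (c := Real.sqrt (2 / Real.pi) * C) ?_ ?_
    · apply Measurable.aestronglyMeasurable
      exact Complex.measurable_ofReal.comp (((measurable_bes m).comp
        (measurable_snd.mul measurable_fst)).const_mul _)
    · rw [Measure.prod_restrict, ae_restrict_iff' (measurableSet_Ioi.prod measurableSet_Ioi)]
      refine Eventually.of_forall fun p hp => ?_
      rw [Complex.norm_real, norm_mul, Real.norm_eq_abs, Real.norm_eq_abs,
        abs_of_nonneg (Real.sqrt_nonneg _)]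
      gcongr
      exact hC _ (mul_pos hp.2 hp.1).ne'
  have e0 : ∀ (a ρ : ℝ), (∫ r, ((Real.sqrt (2 / Real.pi) * bes m (r * ρ) : ℝ) : ℂ) * h r ∂nu) *
      (gam m a ρ : ℂ) =
      ∫ r, ((Real.sqrt (2 / Real.pi) * bes m (r * ρ) : ℝ) : ℂ) * ((gam m a ρ : ℂ) * h r) ∂nu := by
    intro a ρ
    rw [← integral_mul_const]
    congr 1; ext r; ring
  refine hankel_eq_of_integral m hh (fun a ha => ?_) (fun a ha => ?_)
  · simp only [e0]
    exact (hprod a ha).integral_prod_left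
  · simp only [e0]
    rw [integral_integral_swap (hprod a ha), ← integral_const_mul]
    refine integral_congr_ae ?_
    filter_upwards [ae_restrict_mem measurableSet_Ioi] with r hr
    have hr : (0 : ℝ) < r := hr
    have e1 : ∀ ρ, ((Real.sqrt (2 / Real.pi) * bes m (r * ρ) : ℝ) : ℂ) * ((gam m a ρ : ℂ) * h r) =
        ((bes m (r * ρ) * gam m a ρ : ℝ) : ℂ) * (Real.sqrt (2 / Real.pi) * h r) := fun ρ => by
      push_cast; ring
    simp only [e1]
    rw [integral_mul_const, integral_complex_ofReal, integral_bes_mul_gam m ha hr]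
    have e2 : Real.sqrt (Real.pi / 2) * Real.sqrt (2 / Real.pi) = 1 := by
      rw [← Real.sqrt_mul (by positivity)]
      have : Real.pi ≠ 0 := Real.pi_ne_zero
      field_simp
      simp
    have e3 : ((Real.sqrt (Real.pi / 2) : ℝ) : ℂ) * ((Real.sqrt (2 / Real.pi) : ℝ) : ℂ) = 1 := by
      rw [← Complex.ofReal_mul, e2, Complex.ofReal_one]
    push_cast
    linear_combination ((a ^ (-((m : ℝ) + 1 / 2)) : ℝ) : ℂ) * (gam m a⁻¹ r : ℂ) * h r * e3

/-! ### Norms and dominated convergence in L² -/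

lemma eLpNorm_two_eq {f : ℝ → ℂ} {μ : Measure ℝ} (hf : MemLp f 2 μ) :
    eLpNorm f 2 μ = ENNReal.ofReal (Real.sqrt (∫ r, ‖f r‖ ^ 2 ∂μ)) := by
  rw [hf.eLpNorm_eq_integral_rpow_norm two_ne_zero ENNReal.ofNat_ne_top, Real.sqrt_eq_rpow]
  simp

lemma eLpNorm_two_sq (f : ℝ → ℂ) (μ : Measure ℝ) :
    eLpNorm f 2 μ ^ 2 = ∫⁻ r, ‖f r‖ₑ ^ 2 ∂μ := by
  have h := eLpNorm_nnreal_pow_eq_lintegral (μ := μ) (f := f) (p := 2) two_ne_zero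
  simpa using h

lemma integral_norm_sq_eq {f : ℝ → ℂ} {μ : Measure ℝ} (hf : MemLp f 2 μ) :
    ∫ r, ‖f r‖ ^ 2 ∂μ = (eLpNorm f 2 μ).toReal ^ 2 := by
  rw [eLpNorm_two_eq hf, ENNReal.toReal_ofReal (Real.sqrt_nonneg _),
    Real.sq_sqrt (integral_nonneg fun r => by positivity)]

/-- Dominated convergence in `L²`. -/
lemma tendsto_eLpNorm_two_of_dominated {ι : Type*} {l : Filter ι} [l.IsCountablyGenerated]
    {μ : Measure ℝ} {F : ι → ℝ → ℂ} (bound : ℝ → ℝ)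
    (hF : ∀ᶠ i in l, AEStronglyMeasurable (F i) μ)
    (hb : ∀ᶠ i in l, ∀ᵐ r ∂μ, ‖F i r‖ ≤ bound r) (hbi : Integrable (fun r => bound r ^ 2) μ)
    (hlim : ∀ᵐ r ∂μ, Tendsto (fun i => F i r) l (𝓝 0)) :
    Tendsto (fun i => eLpNorm (F i) 2 μ) l (𝓝 0) := by
  have hb2 : ∀ᶠ i in l, ∀ᵐ r ∂μ, ‖‖F i r‖ ^ 2‖ ≤ bound r ^ 2 := by
    filter_upwards [hb] with i hi
    filter_upwards [hi] with r hr
    rw [Real.norm_eq_abs, abs_of_nonneg (by positivity)]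
    gcongr
  have h1 : Tendsto (fun i => ∫ r, ‖F i r‖ ^ 2 ∂μ) l (𝓝 (∫ _, (0 : ℝ) ∂μ)) := by
    refine tendsto_integral_filter_of_dominated_convergence (fun r => bound r ^ 2) ?_ hb2 hbi ?_
    · filter_upwards [hF] with i hi using hi.norm.pow 2
    · filter_upwards [hlim] with r hr
      simpa using (hr.norm.pow 2)
  rw [integral_zero] at h1
  have h2 : Tendsto (fun i => ENNReal.ofReal (Real.sqrt (∫ r, ‖F i r‖ ^ 2 ∂μ))) l (𝓝 0) := by
    have := ENNReal.tendsto_ofReal ((Real.continuous_sqrt.tendsto 0).comp h1)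
    simpa using this
  refine h2.congr' ?_
  filter_upwards [hF, hb2] with i hi hi2
  refine (eLpNorm_two_eq ((memLp_two_iff_integrable_sq_norm hi).2 ?_)).symm
  exact hbi.mono' (hi.norm.pow 2) hi2

/-! ### Multiplicative convolutions and Schur's test -/

lemma image_div_Ioi {s : ℝ} (hs : 0 < s) : (fun r => s / r) '' Ioi (0 : ℝ) = Ioi 0 := by
  ext u
  constructor
  · rintro ⟨r, hr, rfl⟩
    exact div_pos hs hr
  · intro hu
    refine ⟨s / u, div_pos hs hu, ?_⟩
    have : u ≠ 0 := (mem_Ioi.1 hu).ne'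
    field_simp

lemma injOn_div {s : ℝ} (hs : 0 < s) : InjOn (fun r => s / r) (Ioi (0 : ℝ)) := by
  intro a ha b hb h
  have ha : (0 : ℝ) < a := ha
  have hb : (0 : ℝ) < b := hb
  dsimp only at h
  field_simp at h
  linarith

lemma hasDerivWithinAt_div {s : ℝ} : ∀ r ∈ Ioi (0 : ℝ),
    HasDerivWithinAt (fun r => s / r) (-(s / r ^ 2)) (Ioi 0) r := by
  intro r hr
  have hr : (0 : ℝ) < r := hr
  have := ((hasDerivAt_const r s).div (hasDerivAt_id r) hr.ne').hasDerivWithinAt (s := Ioi 0)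
  refine this.congr_deriv ?_
  simp [neg_div]

lemma lintegral_comp_div {s : ℝ} (hs : 0 < s) (F : ℝ → ℝ≥0∞) :
    ∫⁻ r, ENNReal.ofReal r⁻¹ * F (s / r) ∂nu = ∫⁻ u, ENNReal.ofReal u⁻¹ * F u ∂nu := by
  have h := lintegral_image_eq_lintegral_abs_deriv_mul measurableSet_Ioi hasDerivWithinAt_div
    (injOn_div hs) (fun u => ENNReal.ofReal u⁻¹ * F u)
  rw [image_div_Ioi hs] at h
  rw [h]
  refine setLIntegral_congr_fun measurableSet_Ioi fun r hr => ?_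
  have hr : (0 : ℝ) < r := hr
  rw [← mul_assoc, ← ENNReal.ofReal_mul (abs_nonneg _), abs_neg, abs_of_pos (by positivity)]
  congr 2
  field_simp

lemma integral_comp_div {s : ℝ} (hs : 0 < s) (F : ℝ → ℂ) :
    ∫ r, ((r⁻¹ : ℝ) : ℂ) * F (s / r) ∂nu = ∫ u, ((u⁻¹ : ℝ) : ℂ) * F u ∂nu := by
  have h := integral_image_eq_integral_abs_deriv_smul measurableSet_Ioi hasDerivWithinAt_div
    (injOn_div hs) (fun u => ((u⁻¹ : ℝ) : ℂ) * F u)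
  rw [image_div_Ioi hs] at h
  rw [h]
  refine setIntegral_congr_fun measurableSet_Ioi fun r hr => ?_
  have hr : (0 : ℝ) < r := hr
  rw [Complex.real_smul, ← mul_assoc, ← Complex.ofReal_mul, abs_neg, abs_of_pos (by positivity)]
  congr 2
  field_simp

lemma lintegral_comp_div_right {r : ℝ} (hr : 0 < r) (F : ℝ → ℝ≥0∞) :
    ∫⁻ s, ENNReal.ofReal r⁻¹ * F (s / r) ∂nu = ∫⁻ u, F u ∂nu := by
  have himg : (fun s => s / r) '' Ioi (0 : ℝ) = Ioi 0 := by
    ext u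
    constructor
    · rintro ⟨s, hs, rfl⟩
      exact div_pos hs hr
    · intro hu
      exact ⟨u * r, mul_pos hu hr, by field_simp⟩
  have h := lintegral_image_eq_lintegral_abs_deriv_mul (s := Ioi (0 : ℝ)) (f := fun s => s / r)
    (f' := fun _ => r⁻¹)
    measurableSet_Ioi
    (fun s _ => by simpa [one_div] using ((hasDerivAt_id s).div_const r).hasDerivWithinAt)
    (fun a _ b _ h => by dsimp only at h; field_simp at h; exact h) F
  rw [himg] at h
  rw [h, abs_of_pos (inv_pos.2 hr)]

/-- Schur's bound for kernels that are homogeneous of degree `-1`. -/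
lemma schur_lintegral (a h : ℝ → ℝ≥0∞) (ha : Measurable a) (hh : AEMeasurable h nu) :
    ∫⁻ s, (∫⁻ r, ENNReal.ofReal r⁻¹ * a (s / r) * h r ∂nu) ^ 2 ∂nu ≤
      (∫⁻ u, a u * ENNReal.ofReal (u ^ (-(1 / 2) : ℝ)) ∂nu) ^ 2 * ∫⁻ r, h r ^ 2 ∂nu := by
  set N := ∫⁻ u, a u * ENNReal.ofReal (u ^ (-(1 / 2) : ℝ)) ∂nu with hN
  have hpow : ∀ x : ℝ≥0∞, (x ^ (1 / 2 : ℝ)) ^ (2 : ℝ) = x := fun x => by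
    rw [← ENNReal.rpow_mul]; norm_num
  have step1 : ∀ s : ℝ, 0 < s → (∫⁻ r, ENNReal.ofReal r⁻¹ * a (s / r) * h r ∂nu) ^ 2 ≤
      N * ∫⁻ r, ENNReal.ofReal r⁻¹ * (a (s / r) * ENNReal.ofReal ((s / r) ^ (-(1 / 2) : ℝ))) *
        h r ^ 2 ∂nu := by
    intro s hs
    -- Cauchy–Schwarz with the Schur weight (s/r)^{±1/2}. After u = s/r both the integral of A² in r
    -- and the integral of the kernel of B² in s become N = ∫ a(u) u^{-1/2} du, independently of the
    -- other variable.
    set A : ℝ → ℝ≥0∞ := fun r =>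
      (ENNReal.ofReal r⁻¹ * (a (s / r) * ENNReal.ofReal ((s / r) ^ (1 / 2 : ℝ)))) ^ (1 / 2 : ℝ)
    set B : ℝ → ℝ≥0∞ := fun r =>
      (ENNReal.ofReal r⁻¹ * (a (s / r) * ENNReal.ofReal ((s / r) ^ (-(1 / 2) : ℝ))) *
        h r ^ 2) ^ (1 / 2 : ℝ)
    have hm : Measurable fun r : ℝ => a (s / r) := ha.comp (measurable_const.div measurable_id)
    have hA : AEMeasurable A nu := by
      apply Measurable.aemeasurable
      fun_prop
    have hB : AEMeasurable B nu := by
      refine AEMeasurable.pow_const ?_ _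
      refine AEMeasurable.mul (Measurable.aemeasurable ?_) (hh.pow_const 2)
      fun_prop
    have hAB : ∫⁻ r, ENNReal.ofReal r⁻¹ * a (s / r) * h r ∂nu = ∫⁻ r, (A * B) r ∂nu := by
      refine setLIntegral_congr_fun measurableSet_Ioi fun r hr => ?_
      have hr : (0 : ℝ) < r := hr
      have hq : 0 < s / r := div_pos hs hr
      have e1 : ENNReal.ofReal ((s / r) ^ (1 / 2 : ℝ)) * ENNReal.ofReal ((s / r) ^ (-(1 / 2) : ℝ)) = 1 := by
        rw [← ENNReal.ofReal_mul (by positivity), ← Real.rpow_add hq]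
        simp
      simp only [A, B, Pi.mul_apply]
      rw [← ENNReal.mul_rpow_of_nonneg _ _ (by norm_num)]
      have e2 : ENNReal.ofReal r⁻¹ * (a (s / r) * ENNReal.ofReal ((s / r) ^ (1 / 2 : ℝ))) *
          (ENNReal.ofReal r⁻¹ * (a (s / r) * ENNReal.ofReal ((s / r) ^ (-(1 / 2) : ℝ))) * h r ^ 2) =
          (ENNReal.ofReal r⁻¹ * a (s / r) * h r) ^ 2 * (ENNReal.ofReal ((s / r) ^ (1 / 2 : ℝ)) *
            ENNReal.ofReal ((s / r) ^ (-(1 / 2) : ℝ))) := by ring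
      rw [e2, e1, mul_one, ← ENNReal.rpow_two, ← ENNReal.rpow_mul]
      norm_num
    have hH := ENNReal.lintegral_mul_le_Lp_mul_Lq nu Real.HolderConjugate.two_two hA hB
    rw [hAB]
    refine (pow_le_pow_left' hH 2).trans ?_
    rw [mul_pow, ← ENNReal.rpow_two, ← ENNReal.rpow_two, hpow, hpow]
    simp only [A, B, hpow]
    gcongr
    rw [lintegral_comp_div hs (fun u => a u * ENNReal.ofReal (u ^ (1 / 2 : ℝ)))]
    refine (setLIntegral_congr_fun measurableSet_Ioi fun u hu => ?_).le
    have hu : (0 : ℝ) < u := hu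
    rw [mul_left_comm, ← ENNReal.ofReal_mul (by positivity), ← Real.rpow_neg_one,
      ← Real.rpow_add hu]
    norm_num
  have hmeas : AEMeasurable (Function.uncurry fun s r => ENNReal.ofReal r⁻¹ *
      (a (s / r) * ENNReal.ofReal ((s / r) ^ (-(1 / 2) : ℝ))) * h r ^ 2) (nu.prod nu) := by
    refine AEMeasurable.mul (Measurable.aemeasurable ?_) ?_
    · have : Measurable fun p : ℝ × ℝ => a (p.1 / p.2) := ha.comp (measurable_fst.div measurable_snd)
      fun_prop
    · exact (hh.comp_snd).pow_const 2
  calc _ ≤ ∫⁻ s, N * ∫⁻ r, ENNReal.ofReal r⁻¹ *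
        (a (s / r) * ENNReal.ofReal ((s / r) ^ (-(1 / 2) : ℝ))) * h r ^ 2 ∂nu ∂nu :=
        setLIntegral_mono' measurableSet_Ioi fun s hs => step1 s hs
    _ = N * ∫⁻ s, ∫⁻ r, ENNReal.ofReal r⁻¹ *
        (a (s / r) * ENNReal.ofReal ((s / r) ^ (-(1 / 2) : ℝ))) * h r ^ 2 ∂nu ∂nu :=
        lintegral_const_mul'' _ hmeas.lintegral_prod_right'
    _ = N * ∫⁻ r, N * h r ^ 2 ∂nu := by
        rw [lintegral_lintegral_swap hmeas]
        congr 1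
        refine setLIntegral_congr_fun measurableSet_Ioi fun r hr => ?_
        have hr : (0 : ℝ) < r := hr
        rw [lintegral_mul_const, lintegral_comp_div_right hr
          (fun u => a u * ENNReal.ofReal (u ^ (-(1 / 2) : ℝ)))]
        have : Measurable fun s : ℝ => a (s / r) := ha.comp (measurable_id.div_const r)
        fun_prop
    _ = _ := by rw [lintegral_const_mul'' _ (hh.pow_const 2)]; ring

/-- The weighted norm `∫ |a(u)| u^{-1/2} du` of a kernel. -/
def kerN (a : ℝ → ℂ) : ℝ≥0∞ := ∫⁻ u, ‖a u‖ₑ * ENNReal.ofReal (u ^ (-(1 / 2) : ℝ)) ∂nu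

/-- The operator `h ↦ ∫ (1/r) a(s/r) h(r) dr`. -/
def dil (a h : ℝ → ℂ) (s : ℝ) : ℂ := ∫ r, ((r⁻¹ : ℝ) : ℂ) * a (s / r) * h r ∂nu

lemma enorm_dil_integrand (a h : ℝ → ℂ) (s : ℝ) {r : ℝ} (hr : 0 < r) :
    ‖((r⁻¹ : ℝ) : ℂ) * a (s / r) * h r‖ₑ = ENNReal.ofReal r⁻¹ * ‖a (s / r)‖ₑ * ‖h r‖ₑ := by
  rw [enorm_mul, enorm_mul]
  congr 2
  rw [← ofReal_norm, Complex.norm_real, Real.norm_eq_abs, abs_of_pos (inv_pos.2 hr)]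

lemma lintegral_dil (a h : ℝ → ℂ) (s : ℝ) :
    ∫⁻ r, ‖((r⁻¹ : ℝ) : ℂ) * a (s / r) * h r‖ₑ ∂nu =
      ∫⁻ r, ENNReal.ofReal r⁻¹ * ‖a (s / r)‖ₑ * ‖h r‖ₑ ∂nu :=
  setLIntegral_congr_fun measurableSet_Ioi fun _ hr => enorm_dil_integrand a h s hr

lemma aestronglyMeasurable_dil_uncurry {a h : ℝ → ℂ} (ha : Measurable a)
    (hh : AEStronglyMeasurable h nu) :
    AEStronglyMeasurable (fun p : ℝ × ℝ => ((p.2⁻¹ : ℝ) : ℂ) * a (p.1 / p.2) * h p.2) (nu.prod nu) := by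
  refine AEStronglyMeasurable.mul (Measurable.aestronglyMeasurable ?_) hh.comp_snd
  have : Measurable fun p : ℝ × ℝ => a (p.1 / p.2) := ha.comp (measurable_fst.div measurable_snd)
  fun_prop

lemma lintegral_sq_dil_le {a h : ℝ → ℂ} (ha : Measurable a) (hh : AEStronglyMeasurable h nu) :
    ∫⁻ s, (∫⁻ r, ENNReal.ofReal r⁻¹ * ‖a (s / r)‖ₑ * ‖h r‖ₑ ∂nu) ^ 2 ∂nu ≤
      kerN a ^ 2 * eLpNorm h 2 nu ^ 2 := by
  rw [eLpNorm_two_sq]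
  exact schur_lintegral (fun u => ‖a u‖ₑ) (fun r => ‖h r‖ₑ) ha.enorm hh.enorm

lemma ae_integrable_dil {a h : ℝ → ℂ} (ha : Measurable a) (hN : kerN a ≠ ⊤) (hh : MemLp h 2 nu) :
    ∀ᵐ s ∂nu, Integrable (fun r => ((r⁻¹ : ℝ) : ℂ) * a (s / r) * h r) nu := by
  have hm := aestronglyMeasurable_dil_uncurry ha hh.1
  have h1 : ∫⁻ s, (∫⁻ r, ENNReal.ofReal r⁻¹ * ‖a (s / r)‖ₑ * ‖h r‖ₑ ∂nu) ^ 2 ∂nu ≠ ⊤ :=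
    ((lintegral_sq_dil_le ha hh.1).trans_lt
      (ENNReal.mul_lt_top (ENNReal.pow_lt_top hN.lt_top) (ENNReal.pow_lt_top hh.2))).ne
  have h2 : AEMeasurable (fun s => (∫⁻ r, ENNReal.ofReal r⁻¹ * ‖a (s / r)‖ₑ * ‖h r‖ₑ ∂nu) ^ 2) nu := by
    simp only [← lintegral_dil]
    exact (hm.enorm.lintegral_prod_right').pow_const 2
  filter_upwards [ae_lt_top' h2 h1, hm.prodMk_left] with s hs hms
  refine ⟨hms, ?_⟩
  rw [hasFiniteIntegral_iff_enorm, lintegral_dil]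
  by_contra hcon
  rw [not_lt, top_le_iff] at hcon
  rw [hcon] at hs
  simp at hs

lemma eLpNorm_dil_le {a h : ℝ → ℂ} (ha : Measurable a) (hh : AEStronglyMeasurable h nu) :
    eLpNorm (dil a h) 2 nu ≤ kerN a * eLpNorm h 2 nu := by
  have h1 : eLpNorm (dil a h) 2 nu ^ 2 ≤ (kerN a * eLpNorm h 2 nu) ^ 2 := by
    rw [eLpNorm_two_sq, mul_pow]
    refine le_trans (lintegral_mono fun s => ?_) (lintegral_sq_dil_le ha hh)
    rw [← lintegral_dil]
    exact pow_le_pow_left' (enorm_integral_le_lintegral_enorm _) 2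
  exact (ENNReal.pow_le_pow_left_iff two_ne_zero).1 h1

lemma memLp_dil {a h : ℝ → ℂ} (ha : Measurable a) (hN : kerN a ≠ ⊤) (hh : MemLp h 2 nu) :
    MemLp (dil a h) 2 nu :=
  ⟨(aestronglyMeasurable_dil_uncurry ha hh.1).integral_prod_right',
    (eLpNorm_dil_le ha hh.1).trans_lt (ENNReal.mul_lt_top hN.lt_top hh.2)⟩

lemma dil_add_left {a b h : ℝ → ℂ} (ha : Measurable a) (hb : Measurable b) (hNa : kerN a ≠ ⊤)
    (hNb : kerN b ≠ ⊤) (hh : MemLp h 2 nu) :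
    dil (fun u => a u + b u) h =ᵐ[nu] fun s => dil a h s + dil b h s := by
  filter_upwards [ae_integrable_dil ha hNa hh, ae_integrable_dil hb hNb hh] with s h1 h2
  unfold dil
  rw [← integral_add h1 h2]
  congr 1; ext r; ring

lemma dil_sub_right {a h g : ℝ → ℂ} (ha : Measurable a) (hNa : kerN a ≠ ⊤)
    (hh : MemLp h 2 nu) (hg : MemLp g 2 nu) :
    dil a (fun r => h r - g r) =ᵐ[nu] fun s => dil a h s - dil a g s := by
  filter_upwards [ae_integrable_dil ha hNa hh, ae_integrable_dil ha hNa hg] with s h1 h2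
  unfold dil
  rw [← integral_sub h1 h2]
  congr 1; ext r; ring

lemma lintegral_rpow_neg_half (B : ℝ) :
    ∫⁻ u in Ioc 0 B, ENNReal.ofReal (u ^ (-(1 / 2) : ℝ)) < ⊤ := by
  have h : IntegrableOn (fun u : ℝ => u ^ (-(1 / 2) : ℝ)) (Ioc 0 B) := by
    rcases le_or_gt 0 B with hB | hB
    · exact (intervalIntegrable_iff_integrableOn_Ioc_of_le hB).1
        (intervalIntegral.intervalIntegrable_rpow' (by norm_num))
    · rw [Ioc_eq_empty (not_lt.2 hB.le)]; exact integrableOn_empty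
  have h2 := h.2
  rw [hasFiniteIntegral_iff_enorm] at h2
  refine lt_of_le_of_lt (setLIntegral_mono' measurableSet_Ioc fun u hu => ?_) h2
  rw [← ofReal_norm]
  exact ENNReal.ofReal_le_ofReal (le_abs_self _)

lemma kerN_ne_top_of_bounded {a : ℝ → ℂ} {B C : ℝ} (hb : ∀ u, 0 < u → ‖a u‖ ≤ C)
    (h0 : ∀ u, B < u → a u = 0) : kerN a ≠ ⊤ := by
  have h : kerN a ≤ ∫⁻ u in Ioc 0 B, ENNReal.ofReal C * ENNReal.ofReal (u ^ (-(1 / 2) : ℝ)) := by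
    unfold kerN
    rw [← lintegral_indicator measurableSet_Ioi, ← lintegral_indicator measurableSet_Ioc]
    refine lintegral_mono fun u => ?_
    by_cases hu : u ∈ Ioc 0 B
    · rw [indicator_of_mem hu, indicator_of_mem (show u ∈ Ioi 0 from hu.1), ← ofReal_norm]
      gcongr
      exact hb u hu.1
    · rw [indicator_of_notMem hu]
      by_cases hu0 : u ∈ Ioi (0 : ℝ)
      · rw [indicator_of_mem hu0, h0 u (not_le.1 fun h => hu ⟨hu0, h⟩)]; simp
      · rw [indicator_of_notMem hu0]
  refine (h.trans_lt ?_).ne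
  rw [lintegral_const_mul' _ _ ENNReal.ofReal_ne_top]
  exact ENNReal.mul_lt_top ENNReal.ofReal_lt_top (lintegral_rpow_neg_half B)

/-- Kernels that converge boundedly with common compact support converge in the weighted norm. -/
lemma tendsto_kerN_zero {a : ℝ → ℝ → ℂ} {B C : ℝ} (ha : ∀ᶠ ε in 𝓝[>] 0, Measurable (a ε))
    (hb : ∀ᶠ ε in 𝓝[>] 0, ∀ u, 0 < u → ‖a ε u‖ ≤ C)
    (h0 : ∀ᶠ ε in 𝓝[>] 0, ∀ u, B < u → a ε u = 0)
    (hlim : ∀ᵐ u ∂nu, Tendsto (fun ε => a ε u) (𝓝[>] 0) (𝓝 0)) :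
    Tendsto (fun ε => kerN (a ε)) (𝓝[>] 0) (𝓝 0) := by
  have h := tendsto_lintegral_filter_of_dominated_convergence (μ := nu) (l := 𝓝[>] (0 : ℝ))
    (F := fun ε u => ‖a ε u‖ₑ * ENNReal.ofReal (u ^ (-(1 / 2) : ℝ))) (f := fun _ => 0)
    ((Ioc 0 B).indicator fun u => ENNReal.ofReal C * ENNReal.ofReal (u ^ (-(1 / 2) : ℝ)))
    (by filter_upwards [ha] with ε h
        have := h.enorm
        fun_prop)
    (by filter_upwards [hb, h0] with ε hb h0
        rw [ae_restrict_iff' measurableSet_Ioi]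
        refine Eventually.of_forall fun u hu => ?_
        by_cases huB : u ≤ B
        · rw [indicator_of_mem (show u ∈ Ioc 0 B from ⟨hu, huB⟩), ← ofReal_norm]
          gcongr
          exact hb u hu
        · rw [h0 u (not_le.1 huB)]; simp)
    (by rw [lintegral_indicator measurableSet_Ioc, lintegral_const_mul' _ _ ENNReal.ofReal_ne_top]
        refine (ENNReal.mul_lt_top ENNReal.ofReal_lt_top
          (lt_of_le_of_lt ?_ (lintegral_rpow_neg_half B))).ne
        exact lintegral_mono' (Measure.restrict_mono le_rfl Measure.restrict_le_self) le_rfl)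
    (by filter_upwards [hlim] with u hu
        have h1 : Tendsto (fun ε => ‖a ε u‖ₑ) (𝓝[>] 0) (𝓝 0) := by
          simpa using hu.enorm
        have := ENNReal.Tendsto.mul_const (b := ENNReal.ofReal (u ^ (-(1 / 2) : ℝ))) h1
          (Or.inr ENNReal.ofReal_ne_top)
        simpa using this)
  simpa [kerN] using h

lemma tendsto_eLpNorm_dil_zero {a : ℝ → ℝ → ℂ} (ha : ∀ᶠ ε in 𝓝[>] 0, Measurable (a ε))
    (hN : Tendsto (fun ε => kerN (a ε)) (𝓝[>] 0) (𝓝 0)) {h : ℝ → ℂ} (hh : MemLp h 2 nu) :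
    Tendsto (fun ε => eLpNorm (dil (a ε) h) 2 nu) (𝓝[>] 0) (𝓝 0) := by
  have h1 : Tendsto (fun ε => kerN (a ε) * eLpNorm h 2 nu) (𝓝[>] 0) (𝓝 0) := by
    simpa using ENNReal.Tendsto.mul_const hN (Or.inr hh.2.ne)
  refine tendsto_of_tendsto_of_tendsto_of_le_of_le' tendsto_const_nhds h1
    (Eventually.of_forall fun _ => zero_le) ?_
  filter_upwards [ha] with ε hε using eLpNorm_dil_le hε hh.1

/-- The usual density argument: replacing the datum by an approximant at distance η costs K·η
uniformly, and for the approximant the quantity tends to zero. -/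
lemma tendsto_zero_of_approx {ι : Type*} {l : Filter ι} {N : ι → ℝ≥0∞} {K : ℝ≥0∞} (hK : K ≠ ⊤)
    (H : ∀ η : ℝ≥0∞, η ≠ 0 → ∃ N' : ι → ℝ≥0∞, Tendsto N' l (𝓝 0) ∧ ∀ᶠ i in l, N i ≤ N' i + K * η) :
    Tendsto N l (𝓝 0) := by
  rw [ENNReal.tendsto_nhds_zero]
  intro δ hδ
  rcases eq_or_ne δ ⊤ with rfl | hδt
  · exact Eventually.of_forall fun _ => le_top
  have h2 : 0 < δ / 2 := ENNReal.half_pos hδ.ne'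
  have hη : δ / 2 / (K + 1) ≠ 0 :=
    (ENNReal.div_pos h2.ne' (by simp [hK])).ne'
  obtain ⟨N', hN', hle⟩ := H _ hη
  have h3 : K * (δ / 2 / (K + 1)) ≤ δ / 2 := by
    calc K * (δ / 2 / (K + 1)) ≤ (K + 1) * (δ / 2 / (K + 1)) := by gcongr; exact le_self_add
      _ ≤ δ / 2 := ENNReal.mul_div_le
  filter_upwards [hle, ENNReal.tendsto_nhds_zero.1 hN' (δ / 2) h2] with i h4 h5
  calc N i ≤ δ / 2 + δ / 2 := h4.trans (add_le_add h5 h3)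
    _ = δ := ENNReal.add_halves δ

lemma aestronglyMeasurable_dil {a h : ℝ → ℂ} (ha : Measurable a) (hh : AEStronglyMeasurable h nu) :
    AEStronglyMeasurable (dil a h) nu :=
  (aestronglyMeasurable_dil_uncurry ha hh).integral_prod_right'

lemma dil_eq (a h : ℝ → ℂ) {s : ℝ} (hs : 0 < s) :
    dil a h s = ∫ u, ((u⁻¹ : ℝ) : ℂ) * (a u * h (s / u)) ∂nu := by
  rw [← integral_comp_div hs (fun u => a u * h (s / u))]
  refine setIntegral_congr_fun measurableSet_Ioi fun r hr => ?_
  have hr : (0 : ℝ) < r := hr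
  have : s / (s / r) = r := by field_simp
  rw [this]; ring

/-! ### Mollified kernels near the unit dilation -/

section Mollifier

variable {κ : ℝ → ℝ}

lemma mollifier_eq_zero (hs : Function.support κ ⊆ Icc (-1) 1) {ε x : ℝ} (hε : 0 < ε) (hx : ε < |x|) :
    mollifier κ ε x = 0 := by
  have : κ (x / ε) = 0 := by
    by_contra h
    have := hs (Function.mem_support.2 h)
    have h2 : |x / ε| ≤ 1 := abs_le.2 ⟨this.1, this.2⟩
    rw [abs_div, abs_of_pos hε, div_le_one hε] at h2
    linarith
  unfold mollifier
  rw [this, mul_zero]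

lemma continuous_mollifier (hc : Continuous κ) (ε : ℝ) : Continuous (mollifier κ ε) := by
  unfold mollifier; fun_prop

lemma hasCompactSupport_of_support (hs : Function.support κ ⊆ Icc (-1) 1) : HasCompactSupport κ :=
  HasCompactSupport.of_support_subset_isCompact isCompact_Icc hs

lemma integral_mollifier_smul {F : ℝ → ℂ} {ε : ℝ} (hε : 0 < ε) (c : ℝ) :
    ∫ u, (mollifier κ ε (u - c) : ℂ) * F u = ∫ y, (κ y : ℂ) * F (c + ε * y) := by
  rw [← integral_add_right_eq_self (fun u => (mollifier κ ε (u - c) : ℂ) * F u) c]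
  have h := Measure.integral_comp_mul_left (fun u => (mollifier κ ε (u + c - c) : ℂ) * F (u + c)) ε
  have h2 : ∫ u, (mollifier κ ε (u + c - c) : ℂ) * F (u + c) =
      (ε : ℂ) * ∫ y, (mollifier κ ε (ε * y + c - c) : ℂ) * F (ε * y + c) := by
    rw [h, abs_of_pos (inv_pos.2 hε), Complex.real_smul, ← mul_assoc, ← Complex.ofReal_mul,
      mul_inv_cancel₀ hε.ne', Complex.ofReal_one, one_mul]
  rw [h2, ← integral_const_mul]
  congr 1; ext y
  have : mollifier κ ε (ε * y + c - c) = ε⁻¹ * κ y := by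
    unfold mollifier
    rw [add_sub_cancel_right, one_div]
    congr 2
    field_simp
  have hεc : (ε : ℂ) ≠ 0 := Complex.ofReal_ne_zero.2 hε.ne'
  rw [this, add_comm c]
  push_cast
  field_simp

lemma integral_abs_mollifier {ε : ℝ} (hε : 0 < ε) (c : ℝ) :
    ∫ u, |mollifier κ ε (u - c)| = ∫ y, |κ y| := by
  rw [integral_sub_right_eq_self (fun u => |mollifier κ ε u|) c]
  have h := Measure.integral_comp_mul_left (fun u => |mollifier κ ε u|) ε
  rw [abs_of_pos (inv_pos.2 hε), smul_eq_mul] at h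
  have h2 : ∫ u, |mollifier κ ε u| = ε * ∫ y, |mollifier κ ε (ε * y)| := by
    rw [h, ← mul_assoc, mul_inv_cancel₀ hε.ne', one_mul]
  rw [h2, ← integral_const_mul]
  congr 1; ext y
  unfold mollifier
  rw [abs_mul, abs_of_pos (by positivity), mul_div_cancel_left₀ _ hε.ne']
  field_simp

lemma integrable_mollifier (hc : Continuous κ) (hs : Function.support κ ⊆ Icc (-1) 1) {ε : ℝ}
    (hε : 0 < ε) (c : ℝ) : Integrable fun u => mollifier κ ε (u - c) := by
  have hcont : Continuous fun u => mollifier κ ε (u - c) :=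
    (continuous_mollifier hc ε).comp (continuous_sub_right c)
  refine hcont.integrable_of_hasCompactSupport
    (HasCompactSupport.of_support_subset_isCompact (isCompact_Icc (a := c - ε) (b := c + ε)) ?_)
  intro u hu
  by_contra hcon
  refine hu (mollifier_eq_zero hs hε ?_)
  by_contra h
  rw [not_lt, abs_le] at h
  exact hcon ⟨by linarith [h.1], by linarith [h.2]⟩

/-- For ε ≤ 1/2 the bump sits in u ≥ 1/2, where u^{-1/2} ≤ 2. The bound is uniform in ε, as the
density argument for the approximate identity requires. -/
lemma kerN_mollifier_le (hc : Continuous κ) (hs : Function.support κ ⊆ Icc (-1) 1) {ε : ℝ}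
    (hε : 0 < ε) (hε2 : ε ≤ 1 / 2) :
    kerN (fun u => (mollifier κ ε (u - 1) : ℂ)) ≤ ENNReal.ofReal (2 * ∫ y, |κ y|) := by
  have hi := integrable_mollifier hc hs hε 1
  have h1 : kerN (fun u => (mollifier κ ε (u - 1) : ℂ)) ≤
      ∫⁻ u, 2 * ‖mollifier κ ε (u - 1)‖ₑ := by
    refine le_trans (lintegral_mono' Measure.restrict_le_self fun u => ?_) le_rfl
    dsimp only
    by_cases hu : u < 1 / 2
    · rw [mollifier_eq_zero hs hε (by rw [abs_of_neg (by linarith)]; linarith)]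
      simp
    · rw [not_lt] at hu
      rw [mul_comm]
      have e : ‖((mollifier κ ε (u - 1) : ℝ) : ℂ)‖ₑ = ‖mollifier κ ε (u - 1)‖ₑ := by
        rw [← ofReal_norm, ← ofReal_norm, Complex.norm_real]
      rw [e]
      gcongr
      rw [← ENNReal.ofReal_ofNat]
      apply ENNReal.ofReal_le_ofReal
      have h3 : u ^ (-(1 / 2) : ℝ) ≤ (1 / 2 : ℝ) ^ (-(1 / 2) : ℝ) :=
        Real.rpow_le_rpow_of_nonpos (by norm_num) hu (by norm_num)
      refine h3.trans ?_
      calc (1 / 2 : ℝ) ^ (-(1 / 2) : ℝ) ≤ (1 / 2 : ℝ) ^ (-1 : ℝ) :=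
            Real.rpow_le_rpow_of_exponent_ge (by norm_num) (by norm_num) (by norm_num)
        _ = 2 := by rw [Real.rpow_neg_one]; norm_num
  refine h1.trans ?_
  rw [lintegral_const_mul' _ _ ENNReal.ofNat_ne_top, ← ofReal_integral_norm_eq_lintegral_enorm hi,
    ENNReal.ofReal_mul zero_le_two, ENNReal.ofReal_ofNat]
  simp only [Real.norm_eq_abs]
  rw [integral_abs_mollifier hε]

lemma dil_mollifier_eq (hs : Function.support κ ⊆ Icc (-1) 1) {ε : ℝ} (hε : 0 < ε)
    (hε2 : ε ≤ 1 / 2) (g : ℝ → ℂ) {s : ℝ} (hs0 : 0 < s) :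
    dil (fun u => (mollifier κ ε (u - 1) : ℂ)) g s =
      ∫ y, (κ y : ℂ) * ((((1 + ε * y)⁻¹ : ℝ) : ℂ) * g (s / (1 + ε * y))) := by
  rw [dil_eq _ _ hs0]
  have e := integral_mollifier_smul (κ := κ) (F := fun u => ((u⁻¹ : ℝ) : ℂ) * g (s / u)) hε 1
  rw [← e, setIntegral_eq_integral_of_forall_compl_eq_zero]
  · congr 1; ext u; ring
  · intro u hu
    have hu : u ≤ 0 := not_lt.1 hu
    rw [mollifier_eq_zero hs hε (by rw [abs_of_neg (by linarith)]; linarith)]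
    simp

lemma tendsto_dil_mollifier_of_continuous (hc : Continuous κ)
    (hs : Function.support κ ⊆ Icc (-1) 1) {g : ℝ → ℂ} (hg : Continuous g)
    (hgc : HasCompactSupport g) :
    Tendsto (fun ε => eLpNorm (fun s => dil (fun u => (mollifier κ ε (u - 1) : ℂ)) g s -
      ((∫ y, κ y : ℝ) : ℂ) * g s) 2 nu) (𝓝[>] 0) (𝓝 0) := by
  obtain ⟨G, hG⟩ := hgc.exists_bound_of_continuous hg
  have hG0 : 0 ≤ G := (norm_nonneg _).trans (hG 0)
  obtain ⟨B, hB⟩ := hgc.isCompact.isBounded.subset_closedBall (0 : ℝ)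
  have hgB : ∀ x, B < x → g x = 0 := fun x hx => by
    by_contra h
    have := hB (subset_tsupport _ h)
    rw [Metric.mem_closedBall, dist_zero_right, Real.norm_eq_abs] at this
    linarith [le_abs_self x]
  have hκi : Integrable κ := hc.integrable_of_hasCompactSupport (hasCompactSupport_of_support hs)
  have hsmall : ∀ᶠ ε : ℝ in 𝓝[>] 0, 0 < ε ∧ ε ≤ 1 / 2 := by
    filter_upwards [self_mem_nhdsWithin, nhdsWithin_le_nhds (Iic_mem_nhds (show (0 : ℝ) < 1 / 2 by norm_num))]
      with ε h1 h2 using ⟨h1, h2⟩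
  have hy : ∀ y, κ y ≠ 0 → -1 ≤ y ∧ y ≤ 1 := fun y hy => hs hy
  have hyε : ∀ ε y : ℝ, 0 < ε → ε ≤ 1 / 2 → κ y ≠ 0 → 1 / 2 ≤ 1 + ε * y ∧ 1 + ε * y ≤ 3 / 2 := by
    intro ε y h1 h2 h3
    obtain ⟨h4, h5⟩ := hy y h3
    constructor <;> nlinarith
  have hbd : ∀ ε s y : ℝ, 0 < ε → ε ≤ 1 / 2 →
      ‖(κ y : ℂ) * ((((1 + ε * y)⁻¹ : ℝ) : ℂ) * g (s / (1 + ε * y)))‖ ≤ |κ y| * (2 * G) := by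
    intro ε s y h1 h2
    rw [norm_mul, Complex.norm_real, Real.norm_eq_abs]
    by_cases h0 : κ y = 0
    · rw [h0]; simp
    · obtain ⟨h3, h4⟩ := hyε ε y h1 h2 h0
      rw [norm_mul, Complex.norm_real, Real.norm_eq_abs, abs_of_pos (a := (1 + ε * y)⁻¹) (inv_pos.2 (by linarith))]
      refine mul_le_mul_of_nonneg_left (mul_le_mul ?_ (hG _) (norm_nonneg _) (by norm_num))
        (abs_nonneg _)
      rw [inv_le_comm₀ (by linarith) (by norm_num)]; linarith
  have hpt : ∀ s : ℝ, 0 < s → Tendsto (fun ε => dil (fun u => (mollifier κ ε (u - 1) : ℂ)) g s)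
      (𝓝[>] 0) (𝓝 (((∫ y, κ y : ℝ) : ℂ) * g s)) := by
    intro s hs0
    have e : ((∫ y, κ y : ℝ) : ℂ) * g s = ∫ y, (κ y : ℂ) * ((((1 + 0 * y)⁻¹ : ℝ) : ℂ) * g (s / (1 + 0 * y))) := by
      simp only [zero_mul, add_zero, inv_one, Complex.ofReal_one, one_mul, div_one]
      rw [integral_mul_const, integral_complex_ofReal]
    rw [e]
    refine Tendsto.congr' (f₁ := fun ε => ∫ y, (κ y : ℂ) *
      ((((1 + ε * y)⁻¹ : ℝ) : ℂ) * g (s / (1 + ε * y)))) ?_ ?_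
    · filter_upwards [hsmall] with ε hε using (dil_mollifier_eq hs hε.1 hε.2 g hs0).symm
    · refine tendsto_integral_filter_of_dominated_convergence (fun y => |κ y| * (2 * G)) ?_ ?_
        (hκi.abs.mul_const _) ?_
      · filter_upwards with ε
        have := hg.measurable
        have := hc.measurable
        apply Measurable.aestronglyMeasurable
        fun_prop
      · filter_upwards [hsmall] with ε hε
        exact Eventually.of_forall fun y => hbd ε s y hε.1 hε.2
      · refine Eventually.of_forall fun y => ?_
        refine Tendsto.mono_left ?_ nhdsWithin_le_nhds
        have hc1 : ContinuousAt (fun ε : ℝ => 1 + ε * y) 0 := by fun_prop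
        have hne : (1 : ℝ) + 0 * y ≠ 0 := by norm_num
        have h1 : ContinuousAt (fun ε : ℝ => (((1 + ε * y)⁻¹ : ℝ) : ℂ)) 0 :=
          Complex.continuous_ofReal.continuousAt.comp (hc1.inv₀ hne)
        have h2 : ContinuousAt (fun ε : ℝ => g (s / (1 + ε * y))) 0 :=
          hg.continuousAt.comp (continuousAt_const.div hc1 hne)
        exact (continuousAt_const.mul (h1.mul h2))
  set M := ∫ y, |κ y| with hM
  have hM0 : 0 ≤ M := integral_nonneg fun y => abs_nonneg _
  have hmM : |∫ y, κ y| ≤ M := abs_integral_le_integral_abs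
  -- If g lives in |x| ≤ B, then g(s/(1+εy)) ≠ 0 forces s ≤ (3/2)B, so (0, 2B] carries all the
  -- averages with ε ≤ 1/2.
  refine tendsto_eLpNorm_two_of_dominated ((Ioc 0 (2 * B)).indicator fun _ => M * (2 * G) + M * G)
    ?_ ?_ ?_ ?_
  · filter_upwards with ε
    refine AEStronglyMeasurable.sub (aestronglyMeasurable_dil ?_ hg.aestronglyMeasurable)
      (by fun_prop)
    have := (continuous_mollifier hc ε).measurable
    fun_prop
  · filter_upwards [hsmall] with ε hε
    rw [ae_restrict_iff' measurableSet_Ioi]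
    refine Eventually.of_forall fun s hs0 => ?_
    have hs0 : 0 < s := hs0
    rw [dil_mollifier_eq hs hε.1 hε.2 g hs0]
    by_cases hsB : s ≤ 2 * B
    · rw [indicator_of_mem (show s ∈ Ioc 0 (2 * B) from ⟨hs0, hsB⟩)]
      refine (norm_sub_le _ _).trans (add_le_add ?_ ?_)
      · rw [hM, ← integral_mul_const]
        exact norm_integral_le_of_norm_le (hκi.abs.mul_const _)
          (Eventually.of_forall fun y => hbd ε s y hε.1 hε.2)
      · rw [norm_mul, Complex.norm_real, Real.norm_eq_abs]
        gcongr
        exact hG s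
    · rw [not_le] at hsB
      rw [indicator_of_notMem (fun h => not_lt.2 h.2 hsB), norm_le_zero_iff]
      have h1 : g s = 0 := by
        by_cases hB0 : 0 ≤ B
        · exact hgB s (by linarith)
        · exact hgB s (by linarith)
      rw [h1, mul_zero, sub_zero]
      have : ∀ y, (κ y : ℂ) * ((((1 + ε * y)⁻¹ : ℝ) : ℂ) * g (s / (1 + ε * y))) = 0 := by
        intro y
        by_cases h0 : κ y = 0
        · rw [h0]; simp
        · obtain ⟨h3, h4⟩ := hyε ε y hε.1 hε.2 h0
          rw [hgB _ (by rw [lt_div_iff₀ (by linarith)]; by_cases hB0 : 0 ≤ B <;> nlinarith)]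
          simp
      simp only [this, integral_zero]
  · have : (fun r => (Ioc 0 (2 * B)).indicator (fun _ => M * (2 * G) + M * G) r ^ 2) =
        (Ioc 0 (2 * B)).indicator fun _ => (M * (2 * G) + M * G) ^ 2 := by
      ext r
      by_cases h : r ∈ Ioc 0 (2 * B) <;> simp [h]
    rw [this, integrable_indicator_iff measurableSet_Ioc]
    apply integrableOn_const
    · refine ((Measure.restrict_le_self _).trans_lt ?_).ne
      rw [Real.volume_Ioc]
      exact ENNReal.ofReal_lt_top
    · simp
  · rw [ae_restrict_iff' measurableSet_Ioi]
    refine Eventually.of_forall fun s hs0 => ?_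
    simpa using (hpt s hs0).sub_const (((∫ y, κ y : ℝ) : ℂ) * g s)

lemma exists_compactSupport_approx {h : ℝ → ℂ} (hh : MemLp h 2 nu) {η : ℝ≥0∞} (hη : η ≠ 0) :
    ∃ g : ℝ → ℂ, HasCompactSupport g ∧ Continuous g ∧ MemLp g 2 nu ∧
      eLpNorm (fun r => h r - g r) 2 nu ≤ η := by
  have h1 : MemLp ((Ioi (0 : ℝ)).indicator h) 2 volume := (memLp_indicator_iff_restrict measurableSet_Ioi).2 hh
  obtain ⟨g, hgc, hle, hg, hgm⟩ := h1.exists_hasCompactSupport_eLpNorm_sub_le ENNReal.ofNat_ne_top hη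
  refine ⟨g, hgc, hg, hgm.restrict _, ?_⟩
  refine le_trans (le_of_eq ?_) ((eLpNorm_mono_measure _
    (Measure.restrict_le_self (s := Ioi (0 : ℝ)))).trans hle)
  refine eLpNorm_congr_ae ?_
  filter_upwards [ae_restrict_mem measurableSet_Ioi] with r hr
  rw [Pi.sub_apply, indicator_of_mem hr]

lemma eLpNorm_add_le_two {μ : Measure ℝ} {f g : ℝ → ℂ} (hf : AEStronglyMeasurable f μ)
    (hg : AEStronglyMeasurable g μ) :
    eLpNorm (fun r => f r + g r) 2 μ ≤ eLpNorm f 2 μ + eLpNorm g 2 μ :=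
  eLpNorm_add_le hf hg one_le_two

lemma eLpNorm_const_mul_two {μ : Measure ℝ} (c : ℂ) (f : ℝ → ℂ) :
    eLpNorm (fun r => c * f r) 2 μ = ‖c‖ₑ * eLpNorm f 2 μ :=
  eLpNorm_const_smul c f 2 μ

/-- Averaging over dilations close to the identity is an approximate identity on `L²(0,∞)`. -/
lemma tendsto_dil_mollifier (hc : Continuous κ) (hs : Function.support κ ⊆ Icc (-1) 1)
    {h : ℝ → ℂ} (hh : MemLp h 2 nu) :
    Tendsto (fun ε => eLpNorm (fun s => dil (fun u => (mollifier κ ε (u - 1) : ℂ)) h s -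
      ((∫ y, κ y : ℝ) : ℂ) * h s) 2 nu) (𝓝[>] 0) (𝓝 0) := by
  have hsmall : ∀ᶠ ε : ℝ in 𝓝[>] 0, 0 < ε ∧ ε ≤ 1 / 2 := by
    filter_upwards [self_mem_nhdsWithin, nhdsWithin_le_nhds (Iic_mem_nhds (show (0 : ℝ) < 1 / 2 by norm_num))]
      with ε h1 h2 using ⟨h1, h2⟩
  refine tendsto_zero_of_approx (K := ENNReal.ofReal (2 * ∫ y, |κ y|) + ‖((∫ y, κ y : ℝ) : ℂ)‖ₑ)
    (ENNReal.add_ne_top.2 ⟨ENNReal.ofReal_ne_top, enorm_ne_top⟩) fun η hη => ?_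
  obtain ⟨g, hgc, hg, hgm, hle⟩ := exists_compactSupport_approx hh hη
  refine ⟨_, tendsto_dil_mollifier_of_continuous hc hs hg hgc, ?_⟩
  filter_upwards [hsmall] with ε hε
  have hm : Measurable fun u => (mollifier κ ε (u - 1) : ℂ) := by
    have := (continuous_mollifier hc ε).measurable
    fun_prop
  have hN := kerN_mollifier_le hc hs hε.1 hε.2
  have hN2 := (hN.trans_lt ENNReal.ofReal_lt_top).ne
  set a : ℝ → ℂ := fun u => (mollifier κ ε (u - 1) : ℂ) with ha
  set c : ℂ := ((∫ y, κ y : ℝ) : ℂ) with hcc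
  have hd : MemLp (fun r => h r - g r) 2 nu := hh.sub hgm
  have e : (fun s => dil a h s - c * h s) =ᵐ[nu] fun s => (dil a g s - c * g s) +
      (dil a (fun r => h r - g r) s + (-c) * (h s - g s)) := by
    filter_upwards [dil_sub_right hm hN2 hh hgm] with s hs
    rw [hs]; ring
  have m1 : AEStronglyMeasurable (fun s => dil a g s - c * g s) nu :=
    (memLp_dil hm hN2 hgm).1.sub (hgm.1.const_mul c)
  have m2 := (memLp_dil hm hN2 hd).1
  have m3 : AEStronglyMeasurable (fun s => (-c) * (h s - g s)) nu := hd.1.const_mul _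
  rw [eLpNorm_congr_ae e]
  refine (eLpNorm_add_le_two m1 (m2.add m3)).trans (add_le_add le_rfl ?_)
  refine (eLpNorm_add_le_two m2 m3).trans ?_
  rw [eLpNorm_const_mul_two, enorm_neg, add_mul]
  refine add_le_add ((eLpNorm_dil_le hm hd.1).trans (mul_le_mul' hN hle)) (mul_le_mul' le_rfl hle)

/-- The smoothed density `∫_0^1 q(t) κ_ε(u - t) dt`. -/
def smoothDensity (κ : ℝ → ℝ) (q : Polynomial ℝ) (ε u : ℝ) : ℝ :=
  ∫ t in (0 : ℝ)..1, q.eval t * mollifier κ ε (u - t)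

/-- The reflected smoothed density `∫_0^1 q(t) κ_ε(u + t) dt`. -/
def smoothDensityRefl (κ : ℝ → ℝ) (q : Polynomial ℝ) (ε u : ℝ) : ℝ :=
  ∫ t in (0 : ℝ)..1, q.eval t * mollifier κ ε (u + t)

/-- The density `q` on `(0,1)`. -/
def density (q : Polynomial ℝ) (u : ℝ) : ℂ := (Ioo (0 : ℝ) 1).indicator (fun u => ((q.eval u : ℝ) : ℂ)) u

lemma continuous_smoothDensity (hc : Continuous κ) (q : Polynomial ℝ) (ε : ℝ) :
    Continuous (smoothDensity κ q ε) := by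
  have := continuous_mollifier hc ε
  unfold smoothDensity
  apply intervalIntegral.continuous_parametric_intervalIntegral_of_continuous'
  fun_prop

lemma continuous_smoothDensityRefl (hc : Continuous κ) (q : Polynomial ℝ) (ε : ℝ) :
    Continuous (smoothDensityRefl κ q ε) := by
  have := continuous_mollifier hc ε
  unfold smoothDensityRefl
  apply intervalIntegral.continuous_parametric_intervalIntegral_of_continuous'
  fun_prop

lemma measurable_density (q : Polynomial ℝ) : Measurable (density q) := by
  unfold density
  refine Measurable.indicator ?_ measurableSet_Ioo
  have := q.continuous.measurable
  fun_prop

lemma exists_density_bound (q : Polynomial ℝ) : ∃ C : ℝ, 0 ≤ C ∧ (∀ u, ‖density q u‖ ≤ C) ∧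
    ∀ t ∈ Icc (0 : ℝ) 1, |q.eval t| ≤ C := by
  obtain ⟨C, hC⟩ := (isCompact_Icc (a := (0 : ℝ)) (b := 1)).exists_bound_of_continuousOn
    (f := fun t => q.eval t) q.continuous.continuousOn
  have hC0 : 0 ≤ C := (norm_nonneg _).trans (hC 0 (by simp))
  refine ⟨C, hC0, fun u => ?_, hC⟩
  unfold density
  by_cases h : u ∈ Ioo (0 : ℝ) 1
  · rw [indicator_of_mem h, Complex.norm_real]
    exact hC u ⟨h.1.le, h.2.le⟩
  · rw [indicator_of_notMem h]; simpa using hC0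

lemma kerN_density_ne_top (q : Polynomial ℝ) : kerN (density q) ≠ ⊤ := by
  obtain ⟨C, _, hC, _⟩ := exists_density_bound q
  refine kerN_ne_top_of_bounded (B := 1) (fun u _ => hC u) fun u hu => ?_
  exact indicator_of_notMem (fun h => not_lt.2 h.2.le hu) _

lemma abs_integral_density_mollifier_le {q : Polynomial ℝ} {C : ℝ} (hC0 : 0 ≤ C)
    (hC : ∀ t ∈ Icc (0 : ℝ) 1, |q.eval t| ≤ C) (F : ℝ → ℝ)
    (hF : Integrable F) (hFi : ∫ t, |F t| = ∫ y, |κ y|) :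
    |∫ t in (0 : ℝ)..1, q.eval t * F t| ≤ C * ∫ y, |κ y| := by
  rw [intervalIntegral.integral_of_le zero_le_one, ← hFi, ← integral_const_mul]
  have h1 : ‖∫ t in Ioc (0 : ℝ) 1, q.eval t * F t‖ ≤ ∫ t in Ioc (0 : ℝ) 1, C * |F t| := by
    refine norm_integral_le_of_norm_le ((hF.abs.const_mul C).integrableOn) ?_
    rw [ae_restrict_iff' measurableSet_Ioc]
    refine Eventually.of_forall fun t ht => ?_
    rw [norm_mul]
    exact mul_le_mul_of_nonneg_right (hC t ⟨ht.1.le, ht.2⟩) (norm_nonneg _)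
  refine h1.trans (setIntegral_le_integral (hF.abs.const_mul C) (Eventually.of_forall fun t => ?_))
  exact mul_nonneg hC0 (abs_nonneg _)

lemma abs_smoothDensity_le (hc : Continuous κ) (hs : Function.support κ ⊆ Icc (-1) 1)
    {q : Polynomial ℝ} {C : ℝ} (hC0 : 0 ≤ C) (hC : ∀ t ∈ Icc (0 : ℝ) 1, |q.eval t| ≤ C) {ε : ℝ}
    (hε : 0 < ε) (u : ℝ) : |smoothDensity κ q ε u| ≤ C * ∫ y, |κ y| := by
  have h0 := integrable_mollifier hc hs hε 0
  simp only [sub_zero] at h0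
  refine abs_integral_density_mollifier_le hC0 hC (fun t => mollifier κ ε (u - t))
    (h0.comp_sub_left u) ?_
  rw [integral_sub_left_eq_self (fun t => |mollifier κ ε t|)]
  simpa using integral_abs_mollifier (κ := κ) hε 0

lemma abs_smoothDensityRefl_le (hc : Continuous κ) (hs : Function.support κ ⊆ Icc (-1) 1)
    {q : Polynomial ℝ} {C : ℝ} (hC0 : 0 ≤ C) (hC : ∀ t ∈ Icc (0 : ℝ) 1, |q.eval t| ≤ C) {ε : ℝ}
    (hε : 0 < ε) (u : ℝ) : |smoothDensityRefl κ q ε u| ≤ C * ∫ y, |κ y| := by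
  have h0 := integrable_mollifier hc hs hε 0
  simp only [sub_zero] at h0
  refine abs_integral_density_mollifier_le hC0 hC (fun t => mollifier κ ε (u + t))
    (h0.comp_add_left u) ?_
  rw [integral_add_left_eq_self (fun t => |mollifier κ ε t|)]
  simpa using integral_abs_mollifier (κ := κ) hε 0

lemma smoothDensity_eq_zero (hs : Function.support κ ⊆ Icc (-1) 1) (q : Polynomial ℝ) {ε u : ℝ}
    (hε : 0 < ε) (hu : 1 + ε < u) : smoothDensity κ q ε u = 0 := by
  unfold smoothDensity
  rw [intervalIntegral.integral_zero_ae]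
  refine Eventually.of_forall fun t ht => ?_
  rw [uIoc_of_le zero_le_one] at ht
  rw [mollifier_eq_zero hs hε (by rw [abs_of_pos (by linarith [ht.2])]; linarith [ht.2]), mul_zero]

lemma smoothDensityRefl_eq_zero (hs : Function.support κ ⊆ Icc (-1) 1) (q : Polynomial ℝ) {ε u : ℝ}
    (hε : 0 < ε) (hu : ε < u) : smoothDensityRefl κ q ε u = 0 := by
  unfold smoothDensityRefl
  rw [intervalIntegral.integral_zero_ae]
  refine Eventually.of_forall fun t ht => ?_
  rw [uIoc_of_le zero_le_one] at ht
  rw [mollifier_eq_zero hs hε (by rw [abs_of_pos (by linarith [ht.1])]; linarith [ht.1]), mul_zero]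

lemma smoothDensity_eq (q : Polynomial ℝ) {ε : ℝ} (hε : 0 < ε) (u : ℝ) :
    (smoothDensity κ q ε u : ℂ) = ∫ y, (κ y : ℂ) * density q (u - ε * y) := by
  have h1 : (smoothDensity κ q ε u : ℂ) = ∫ t, (mollifier κ ε (u - t) : ℂ) * density q t := by
    unfold smoothDensity
    rw [intervalIntegral.integral_of_le zero_le_one, ← integral_complex_ofReal,
      integral_Ioc_eq_integral_Ioo, ← integral_indicator measurableSet_Ioo]
    congr 1; ext t
    unfold density
    by_cases h : t ∈ Ioo (0 : ℝ) 1
    · rw [indicator_of_mem h, indicator_of_mem h]; push_cast; ring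
    · rw [indicator_of_notMem h, indicator_of_notMem h, mul_zero]
  rw [h1, ← integral_sub_left_eq_self (fun t => (mollifier κ ε (u - t) : ℂ) * density q t) volume u]
  have h2 := integral_mollifier_smul (κ := κ) (F := fun t => density q (u - t)) hε 0
  simp only [sub_zero, zero_add] at h2
  rw [← h2]
  simp

lemma tendsto_smoothDensity (hc : Continuous κ) (hs : Function.support κ ⊆ Icc (-1) 1)
    (q : Polynomial ℝ) {u : ℝ} (hu0 : 0 < u) (hu1 : u ≠ 1) :
    Tendsto (fun ε => (smoothDensity κ q ε u : ℂ)) (𝓝[>] 0) (𝓝 (((∫ y, κ y : ℝ) : ℂ) * density q u)) := by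
  obtain ⟨C, hC0, hC, _⟩ := exists_density_bound q
  have hκi : Integrable κ := hc.integrable_of_hasCompactSupport (hasCompactSupport_of_support hs)
  have hcont : ContinuousAt (density q) u := by
    rcases lt_or_gt_of_ne hu1 with h | h
    · have e : density q =ᶠ[𝓝 u] fun u => ((q.eval u : ℝ) : ℂ) := by
        filter_upwards [Ioo_mem_nhds hu0 h] with x hx
        exact indicator_of_mem hx _
      refine ContinuousAt.congr_of_eventuallyEq ?_ e
      have := q.continuous
      fun_prop
    · have e : density q =ᶠ[𝓝 u] fun _ => 0 := by
        filter_upwards [Ioi_mem_nhds h] with x hx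
        exact indicator_of_notMem (fun hh => lt_asymm hh.2 hx) _
      exact continuousAt_const.congr_of_eventuallyEq e
  have e : ((∫ y, κ y : ℝ) : ℂ) * density q u = ∫ y, (κ y : ℂ) * density q (u - 0 * y) := by
    simp only [zero_mul, sub_zero]
    rw [integral_mul_const, integral_complex_ofReal]
  rw [e]
  refine Tendsto.congr' (f₁ := fun ε => ∫ y, (κ y : ℂ) * density q (u - ε * y)) ?_ ?_
  · filter_upwards [self_mem_nhdsWithin] with ε hε using (smoothDensity_eq q hε u).symm
  · refine tendsto_integral_filter_of_dominated_convergence (fun y => |κ y| * C) ?_ ?_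
      (hκi.abs.mul_const _) ?_
    · filter_upwards with ε
      have := measurable_density q
      have := hc.measurable
      apply Measurable.aestronglyMeasurable
      fun_prop
    · filter_upwards with ε
      refine Eventually.of_forall fun y => ?_
      rw [norm_mul, Complex.norm_real, Real.norm_eq_abs]
      gcongr
      exact hC _
    · refine Eventually.of_forall fun y => ?_
      refine Tendsto.mono_left ?_ nhdsWithin_le_nhds
      have h1 : ContinuousAt (fun ε : ℝ => density q (u - ε * y)) 0 :=
        ContinuousAt.comp (f := fun ε : ℝ => u - ε * y)
          (by rw [zero_mul, sub_zero]; exact hcont) (by fun_prop)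
      exact continuousAt_const.mul h1

/-- The Fourier transform of `b_m` smoothed at scale `ε`. -/
def molKer (κ : ℝ → ℝ) (m : ℕ) (q : Polynomial ℝ) (ε u : ℝ) : ℂ :=
  Real.pi * ((-Complex.I) ^ m * ((mollifier κ ε (u - 1) + smoothDensity κ q ε u : ℝ) : ℂ) +
    Complex.I ^ m * ((mollifier κ ε (u + 1) + smoothDensityRefl κ q ε u : ℝ) : ℂ))

lemma continuous_molKer (hc : Continuous κ) (m : ℕ) (q : Polynomial ℝ) (ε : ℝ) :
    Continuous (molKer κ m q ε) := by
  have h1 := continuous_mollifier hc ε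
  have h2 := continuous_smoothDensity hc q ε
  have h3 := continuous_smoothDensityRefl hc q ε
  unfold molKer
  fun_prop

lemma molKer_eq_zero (hs : Function.support κ ⊆ Icc (-1) 1) (m : ℕ) (q : Polynomial ℝ) {ε u : ℝ}
    (hε : 0 < ε) (hu : 1 + ε < u) : molKer κ m q ε u = 0 := by
  unfold molKer
  rw [smoothDensity_eq_zero hs q hε hu, smoothDensityRefl_eq_zero hs q hε (by linarith),
    mollifier_eq_zero hs hε (by rw [abs_of_pos (by linarith)]; linarith),
    mollifier_eq_zero hs hε (by rw [abs_of_pos (by linarith)]; linarith)]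
  simp

lemma kerN_ne_top_of_continuous {a : ℝ → ℂ} {B : ℝ} (ha : Continuous a) (h0 : ∀ u, B < u → a u = 0) :
    kerN a ≠ ⊤ := by
  obtain ⟨C, hC⟩ := (isCompact_Icc (a := (0 : ℝ)) (b := |B|)).exists_bound_of_continuousOn
    ha.continuousOn
  refine kerN_ne_top_of_bounded (B := B) (C := max C 0) (fun u hu => ?_) h0
  by_cases h : u ≤ |B|
  · exact (hC u ⟨hu.le, h⟩).trans (le_max_left _ _)
  · rw [h0 u ((le_abs_self B).trans_lt (not_le.1 h)), norm_zero]
    exact le_max_right _ _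

lemma kerN_molKer_ne_top (hc : Continuous κ) (hs : Function.support κ ⊆ Icc (-1) 1) (m : ℕ)
    (q : Polynomial ℝ) {ε : ℝ} (hε : 0 < ε) : kerN (molKer κ m q ε) ≠ ⊤ :=
  kerN_ne_top_of_continuous (continuous_molKer hc m q ε) fun _ hu => molKer_eq_zero hs m q hε hu

/-- On (0,∞) the four pieces of the kernel behave differently: κ_ε(u-1) is an approximate identity
up to its mass, κ_ε(u+1) vanishes for small ε, the smoothed density tends to ∫κ times q, and its
reflection is bounded and supported in (0,ε]. The last two converge in the weighted norm. No sign or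
normalization of κ is assumed, since the result is also applied to yκ'(y). -/
lemma tendsto_dil_molKer (hc : Continuous κ) (hs : Function.support κ ⊆ Icc (-1) 1) (m : ℕ)
    (q : Polynomial ℝ) {h : ℝ → ℂ} (hh : MemLp h 2 nu) :
    Tendsto (fun ε => eLpNorm (fun s => dil (molKer κ m q ε) h s -
      ((∫ y, κ y : ℝ) : ℂ) * (Real.pi * (-Complex.I) ^ m) * (h s + dil (density q) h s)) 2 nu)
      (𝓝[>] 0) (𝓝 0) := by
  set c : ℂ := ((∫ y, κ y : ℝ) : ℂ) with hcc
  set p : ℂ := Real.pi * (-Complex.I) ^ m with hp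
  obtain ⟨C, hC0, hC, hC'⟩ := exists_density_bound q
  set M := ∫ y, |κ y| with hM
  have hM0 : 0 ≤ M := integral_nonneg fun y => abs_nonneg _
  have hcM : ‖c‖ ≤ M := by
    rw [hcc, Complex.norm_real]; exact abs_integral_le_integral_abs
  have hsmall : ∀ᶠ ε : ℝ in 𝓝[>] 0, 0 < ε ∧ ε ≤ 1 / 2 := by
    filter_upwards [self_mem_nhdsWithin, nhdsWithin_le_nhds (Iic_mem_nhds (show (0 : ℝ) < 1 / 2 by norm_num))]
      with ε h1 h2 using ⟨h1, h2⟩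
  -- Everything in the error except the approximate identity and the vanishing bump at u = -1:
  -- bounded, supported in u ≤ 2 and tending to 0 for u ≠ 1.
  set rest : ℝ → ℝ → ℂ := fun ε u => p * ((smoothDensity κ q ε u : ℂ) - c * density q u) +
    Real.pi * Complex.I ^ m * (smoothDensityRefl κ q ε u : ℂ) with hrest
  have hmeas : ∀ ε, Measurable (rest ε) := fun ε => by
    have h2 := (continuous_smoothDensity hc q ε).measurable
    have h3 := (continuous_smoothDensityRefl hc q ε).measurable
    have h4 := measurable_density q
    fun_prop
  have hpn : ‖p‖ = Real.pi := by
    rw [hp, norm_mul, norm_pow, norm_neg, Complex.norm_I, one_pow, mul_one, Complex.norm_real,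
      Real.norm_eq_abs, abs_of_pos Real.pi_pos]
  have hpn2 : ‖(Real.pi * Complex.I ^ m : ℂ)‖ = Real.pi := by
    rw [norm_mul, norm_pow, Complex.norm_I, one_pow, mul_one, Complex.norm_real,
      Real.norm_eq_abs, abs_of_pos Real.pi_pos]
  have hbound : ∀ ε, 0 < ε → ∀ u, ‖rest ε u‖ ≤ Real.pi * (C * M + M * C) + Real.pi * (C * M) := by
    intro ε hε u
    refine (norm_add_le _ _).trans (add_le_add ?_ ?_)
    · rw [norm_mul, hpn]
      refine mul_le_mul_of_nonneg_left ((norm_sub_le _ _).trans (add_le_add ?_ ?_)) Real.pi_pos.le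
      · rw [Complex.norm_real]; exact abs_smoothDensity_le hc hs hC0 hC' hε u
      · rw [norm_mul]; exact mul_le_mul hcM (hC u) (norm_nonneg _) hM0
    · rw [norm_mul, hpn2, Complex.norm_real]
      exact mul_le_mul_of_nonneg_left (abs_smoothDensityRefl_le hc hs hC0 hC' hε u) Real.pi_pos.le
  have hzero : ∀ ε, 0 < ε → ε ≤ 1 / 2 → ∀ u, 2 < u → rest ε u = 0 := by
    intro ε hε hε2 u hu
    simp only [hrest]
    rw [smoothDensity_eq_zero hs q hε (by linarith), smoothDensityRefl_eq_zero hs q hε (by linarith),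
      show density q u = 0 from indicator_of_notMem (fun h => by linarith [h.2]) _]
    simp
  have hNrest : Tendsto (fun ε => kerN (rest ε)) (𝓝[>] 0) (𝓝 0) := by
    refine tendsto_kerN_zero (B := 2) (Eventually.of_forall hmeas)
      (by filter_upwards [hsmall] with ε hε u _ using hbound ε hε.1 u)
      (by filter_upwards [hsmall] with ε hε using hzero ε hε.1 hε.2) ?_
    have hne : ∀ᵐ u ∂nu, u ≠ 1 := ae_restrict_of_ae (Measure.ae_ne volume 1)
    filter_upwards [ae_restrict_mem measurableSet_Ioi, hne] with u hu0 hu1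
    have t1 := (tendsto_smoothDensity hc hs q hu0 hu1).sub_const (c * density q u)
    rw [← hcc, sub_self] at t1
    have t2 : Tendsto (fun ε => (smoothDensityRefl κ q ε u : ℂ)) (𝓝[>] 0) (𝓝 0) := by
      refine tendsto_const_nhds.congr' ?_
      filter_upwards [self_mem_nhdsWithin, nhdsWithin_le_nhds (Iio_mem_nhds hu0)] with ε h1 h2
      rw [smoothDensityRefl_eq_zero hs q h1 h2]; simp
    simpa [hrest] using (t1.const_mul p).add (t2.const_mul (Real.pi * Complex.I ^ m : ℂ))
  have T1 := tendsto_eLpNorm_dil_zero (Eventually.of_forall hmeas) hNrest hh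
  have T2 : Tendsto (fun ε => ‖p‖ₑ * eLpNorm (fun s => dil (fun u => (mollifier κ ε (u - 1) : ℂ)) h s -
      c * h s) 2 nu) (𝓝[>] 0) (𝓝 0) := by
    simpa using ENNReal.Tendsto.const_mul (a := ‖p‖ₑ) (tendsto_dil_mollifier hc hs hh) (Or.inr (by simp))
  have T := T2.add T1
  rw [add_zero] at T
  refine tendsto_of_tendsto_of_tendsto_of_le_of_le' tendsto_const_nhds T
    (Eventually.of_forall fun _ => zero_le) ?_
  filter_upwards [hsmall] with ε hε
  have hm : Measurable fun u => (mollifier κ ε (u - 1) : ℂ) := by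
    have := (continuous_mollifier hc ε).measurable
    fun_prop
  have hN := ((kerN_mollifier_le hc hs hε.1 hε.2).trans_lt ENNReal.ofReal_lt_top).ne
  have hNr : kerN (rest ε) ≠ ⊤ :=
    kerN_ne_top_of_bounded (fun u _ => hbound ε hε.1 u) (hzero ε hε.1 hε.2)
  have hNk := kerN_molKer_ne_top hc hs m q hε.1
  have hmk := (continuous_molKer hc m q ε).measurable
  have hmd := measurable_density q
  have hNd := kerN_density_ne_top q
  have e : (fun s => dil (molKer κ m q ε) h s - c * p * (h s + dil (density q) h s)) =ᵐ[nu]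
      fun s => p * (dil (fun u => (mollifier κ ε (u - 1) : ℂ)) h s - c * h s) + dil (rest ε) h s := by
    filter_upwards [ae_restrict_mem measurableSet_Ioi, ae_integrable_dil hm hN hh,
      ae_integrable_dil (hmeas ε) hNr hh, ae_integrable_dil hmk hNk hh,
      ae_integrable_dil hmd hNd hh] with s hs0 i1 i2 i3 i4
    have hs0 : 0 < s := hs0
    have key : dil (rest ε) h s = dil (molKer κ m q ε) h s -
        (p * dil (fun u => (mollifier κ ε (u - 1) : ℂ)) h s + c * p * dil (density q) h s) := by
      unfold dil
      have i5 : Integrable (fun r => p * (((r⁻¹ : ℝ) : ℂ) * (mollifier κ ε (s / r - 1) : ℂ) * h r) +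
          c * p * (((r⁻¹ : ℝ) : ℂ) * density q (s / r) * h r)) nu :=
        (i1.const_mul p).add (i4.const_mul (c * p))
      rw [← integral_const_mul, ← integral_const_mul,
        ← integral_add (i1.const_mul p) (i4.const_mul (c * p)), ← integral_sub i3 i5]
      refine setIntegral_congr_fun measurableSet_Ioi fun r hr => ?_
      have hr : (0 : ℝ) < r := hr
      have hsr : 0 < s / r := div_pos hs0 hr
      have hz : mollifier κ ε (s / r + 1) = 0 :=
        mollifier_eq_zero hs hε.1 (by rw [abs_of_pos (by linarith)]; linarith [hε.2])
      simp only [molKer, hrest, hz, hp]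
      push_cast
      ring
    rw [key]; ring
  rw [eLpNorm_congr_ae e, ← eLpNorm_const_mul_two]
  exact eLpNorm_add_le_two
    (((memLp_dil hm hN hh).1.sub (hh.1.const_mul c)).const_mul p) (memLp_dil (hmeas ε) hNr hh).1

end Mollifier

/-! ### Cosine and sine transforms and the factorization of the Hankel transform -/

lemma bes_one {z : ℝ} (hz : z ≠ 0) : bes 1 z = Real.sin z := by
  simp [bes, phiBessel, sphBessel, Real.sinc_of_ne_zero hz]
  field_simp

lemma cos_sin_nat_mul_pi_div_two (m : ℕ) :
    (∃ σ : ℝ, σ ^ 2 = 1 ∧ Real.cos (m * (Real.pi / 2)) = σ ∧ Real.sin (m * (Real.pi / 2)) = 0 ∧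
      (-1 : ℝ) ^ m = 1) ∨
    (∃ σ : ℝ, σ ^ 2 = 1 ∧ Real.cos (m * (Real.pi / 2)) = 0 ∧ Real.sin (m * (Real.pi / 2)) = σ ∧
      (-1 : ℝ) ^ m = -1) := by
  rcases Nat.even_or_odd' m with ⟨k, rfl | rfl⟩
  · left
    have e : ((2 * k : ℕ) : ℝ) * (Real.pi / 2) = k * Real.pi := by push_cast; ring
    rw [e]
    exact ⟨(-1) ^ k, by rw [← pow_mul, mul_comm k 2, pow_mul]; simp, Real.cos_nat_mul_pi k,
      Real.sin_nat_mul_pi k, by rw [pow_mul]; simp⟩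
  · right
    have e : ((2 * k + 1 : ℕ) : ℝ) * (Real.pi / 2) = k * Real.pi + Real.pi / 2 := by push_cast; ring
    rw [e, Real.cos_add_pi_div_two, Real.sin_add_pi_div_two, Real.sin_nat_mul_pi, neg_zero,
      Real.cos_nat_mul_pi]
    exact ⟨(-1) ^ k, by rw [← pow_mul, mul_comm k 2, pow_mul]; simp, rfl, rfl,
      by rw [pow_succ, pow_mul]; simp⟩

/-- The transform with kernel `√(2/π) cos(r ρ - β)`. -/
def cosT (β : ℝ) (w : ℝ → ℂ) (ρ : ℝ) : ℂ :=
  (Real.cos β : ℂ) * hankel 0 w ρ + (Real.sin β : ℂ) * hankel 1 w ρ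

lemma memLp_cosT (β : ℝ) {w : ℝ → ℂ} (hw : MemLp w 2 nu) : MemLp (cosT β w) 2 nu :=
  ((memLp_hankel 0 hw).const_mul _).add ((memLp_hankel 1 hw).const_mul _)

lemma eLpNorm_cosT_le (β : ℝ) {w : ℝ → ℂ} (hw : MemLp w 2 nu) :
    eLpNorm (cosT β w) 2 nu ≤ 2 * eLpNorm w 2 nu := by
  refine (eLpNorm_add_le_two ((memLp_hankel 0 hw).const_mul _).1
    ((memLp_hankel 1 hw).const_mul _).1).trans ?_
  rw [eLpNorm_const_mul_two, eLpNorm_const_mul_two, eLpNorm_hankel 0 hw, eLpNorm_hankel 1 hw, two_mul]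
  have h : ∀ x : ℝ, |x| ≤ 1 → ‖(x : ℂ)‖ₑ * eLpNorm w 2 nu ≤ eLpNorm w 2 nu := fun x hx => by
    have : ‖(x : ℂ)‖ₑ ≤ 1 := by
      rw [← ofReal_norm, Complex.norm_real, Real.norm_eq_abs]
      simpa using ENNReal.ofReal_le_ofReal hx
    simpa using mul_le_mul_left this (eLpNorm w 2 nu)
  exact add_le_add (h _ (Real.abs_cos_le_one β)) (h _ (Real.abs_sin_le_one β))

lemma cosT_sub (β : ℝ) {v w : ℝ → ℂ} (hv : MemLp v 2 nu) (hw : MemLp w 2 nu) :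
    cosT β (fun r => v r - w r) =ᵐ[nu] fun ρ => cosT β v ρ - cosT β w ρ := by
  filter_upwards [hankel_sub 0 hv hw, hankel_sub 1 hv hw] with ρ h0 h1
  unfold cosT
  rw [h0, h1]; ring

lemma cosT_congr (β : ℝ) {v w : ℝ → ℂ} (hv : MemLp v 2 nu) (e : v =ᵐ[nu] w) :
    cosT β v = cosT β w := by
  unfold cosT
  rw [hankel_congr 0 hv e, hankel_congr 1 hv e]

lemma integrable_bounded_mul {w : ℝ → ℂ} (hi : Integrable w nu) {c : ℝ → ℝ} (hc : Measurable c)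
    {C : ℝ} (hC : ∀ r, 0 < r → |c r| ≤ C) : Integrable (fun r => (c r : ℂ) * w r) nu := by
  refine hi.bdd_mul (c := C) (Complex.measurable_ofReal.comp hc).aestronglyMeasurable ?_
  rw [ae_restrict_iff' measurableSet_Ioi]
  refine Eventually.of_forall fun r hr => ?_
  rw [Complex.norm_real]; exact hC r hr

lemma cosT_eq_integral (β : ℝ) {w : ℝ → ℂ} (hw : MemLp w 2 nu) (hi : Integrable w nu) :
    cosT β w =ᵐ[nu] fun ρ => ∫ r, ((Real.sqrt (2 / Real.pi) * Real.cos (r * ρ - β) : ℝ) : ℂ) * w r ∂nu := by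
  filter_upwards [hankel_eq_integral 0 hw hi, hankel_eq_integral 1 hw hi,
    ae_restrict_mem measurableSet_Ioi] with ρ h0 h1 hρ
  have hρ : (0 : ℝ) < ρ := hρ
  have hint : ∀ i : ℕ, Integrable (fun r => ((Real.sqrt (2 / Real.pi) * bes i (r * ρ) : ℝ) : ℂ) * w r) nu := by
    intro i
    obtain ⟨C, _, hC⟩ := exists_bes_bound i
    refine integrable_bounded_mul hi (C := Real.sqrt (2 / Real.pi) * C) ?_ fun r hr => ?_
    · have := measurable_bes i
      fun_prop
    · rw [abs_mul, abs_of_nonneg (Real.sqrt_nonneg _)]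
      exact mul_le_mul_of_nonneg_left (hC _ (mul_pos hr hρ).ne') (Real.sqrt_nonneg _)
  unfold cosT
  rw [h0, h1, ← integral_const_mul, ← integral_const_mul, ← integral_add ((hint 0).const_mul _)
    ((hint 1).const_mul _)]
  refine setIntegral_congr_fun measurableSet_Ioi fun r hr => ?_
  have hr : (0 : ℝ) < r := hr
  simp only [bes_one (mul_pos hr hρ).ne', show bes 0 (r * ρ) = Real.cos (r * ρ) from rfl,
    Real.cos_sub]
  push_cast; ring

/-- For a phase mπ/2 only one of the two terms survives, with coefficient ±1, so the transform is
isometric; a general phase only has the bound by 2. -/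
lemma eLpNorm_cosT (m : ℕ) {w : ℝ → ℂ} (hw : MemLp w 2 nu) :
    eLpNorm (cosT (m * (Real.pi / 2)) w) 2 nu = eLpNorm w 2 nu := by
  have hσ : ∀ σ : ℝ, σ ^ 2 = 1 → ‖(σ : ℂ)‖ₑ = 1 := fun σ h => by
    rw [← ofReal_norm, Complex.norm_real, Real.norm_eq_abs, show |σ| = 1 by
      nlinarith [sq_abs σ, abs_nonneg σ, sq_nonneg (|σ| - 1)]]
    simp
  rcases cos_sin_nat_mul_pi_div_two m with ⟨σ, h1, h2, h3, _⟩ | ⟨σ, h1, h2, h3, _⟩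
  · have e : cosT (m * (Real.pi / 2)) w = fun ρ => (σ : ℂ) * hankel 0 w ρ := by
      ext ρ; unfold cosT; rw [h2, h3]; simp
    rw [e, eLpNorm_const_mul_two, hσ σ h1, one_mul, eLpNorm_hankel 0 hw]
  · have e : cosT (m * (Real.pi / 2)) w = fun ρ => (σ : ℂ) * hankel 1 w ρ := by
      ext ρ; unfold cosT; rw [h2, h3]; simp
    rw [e, eLpNorm_const_mul_two, hσ σ h1, one_mul, eLpNorm_hankel 1 hw]

/-- Approximation in `L²(0,∞)` by functions supported in a compact part of `(0,∞)`. -/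
lemma exists_truncation {h : ℝ → ℂ} (hh : MemLp h 2 nu) {η : ℝ≥0∞} (hη : η ≠ 0) :
    ∃ g : ℝ → ℂ, MemLp g 2 nu ∧ Integrable g nu ∧ Integrable (fun r => ((r⁻¹ : ℝ) : ℂ) * g r) nu ∧
      eLpNorm (fun r => h r - g r) 2 nu ≤ η := by
  set S : ℕ → Set ℝ := fun k => Icc (1 / ((k : ℝ) + 1)) (k + 1) with hS
  have hSm : ∀ k, MeasurableSet (S k) := fun k => measurableSet_Icc
  have ht : Tendsto (fun k => eLpNorm (fun r => h r - (S k).indicator h r) 2 nu) atTop (𝓝 0) := by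
    refine tendsto_eLpNorm_two_of_dominated (fun r => ‖h r‖)
      (Eventually.of_forall fun k => hh.1.sub (hh.1.indicator (hSm k)))
      (Eventually.of_forall fun k => Eventually.of_forall fun r => ?_) ((memLp_two_iff_integrable_sq_norm hh.1).1 hh) ?_
    · by_cases hr : r ∈ S k <;> simp [hr]
    · filter_upwards [ae_restrict_mem measurableSet_Ioi] with r hr
      have hr : (0 : ℝ) < r := hr
      refine tendsto_const_nhds.congr' ?_
      have t1 : ∀ᶠ k : ℕ in atTop, 1 / ((k : ℝ) + 1) < r :=
        (tendsto_one_div_add_atTop_nhds_zero_nat).eventually (gt_mem_nhds hr)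
      have t2 : ∀ᶠ k : ℕ in atTop, r ≤ (k : ℝ) :=
        tendsto_natCast_atTop_atTop.eventually (eventually_ge_atTop r)
      filter_upwards [t1, t2] with k h1 h2
      rw [indicator_of_mem (show r ∈ S k from ⟨h1.le, by linarith⟩), sub_self]
  obtain ⟨k, hk⟩ := ((ENNReal.tendsto_nhds_zero.1 ht) η (pos_iff_ne_zero.2 hη)).exists
  have hi : Integrable ((S k).indicator h) nu := by
    rw [integrable_indicator_iff (hSm k)]
    have : IsFiniteMeasure (nu.restrict (S k)) := ⟨by
      rw [Measure.restrict_apply_univ]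
      refine (Measure.restrict_apply_le _ _).trans_lt ?_
      simp only [hS, Real.volume_Icc]
      exact ENNReal.ofReal_lt_top⟩
    exact (hh.restrict (S k)).integrable one_le_two
  refine ⟨(S k).indicator h, hh.indicator (hSm k), hi, ?_, hk⟩
  refine (hi.norm.const_mul ((k : ℝ) + 1)).mono' ?_ ?_
  · refine AEStronglyMeasurable.mul (Measurable.aestronglyMeasurable (by fun_prop)) hi.1
  · refine Eventually.of_forall fun r => ?_
    by_cases hr : r ∈ S k
    · rw [norm_mul]
      refine mul_le_mul_of_nonneg_right ?_ (norm_nonneg _)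
      have hr0 : 0 < r := lt_of_lt_of_le (by positivity) hr.1
      rw [Complex.norm_real, Real.norm_eq_abs, abs_of_pos (inv_pos.2 hr0), inv_le_comm₀ hr0 (by positivity)]
      simpa using hr.1
    · rw [indicator_of_notMem hr]; simp

lemma integrable_dil_prod {a h : ℝ → ℂ} (ha : Measurable a) (hai : Integrable a nu)
    (hi : Integrable h nu) :
    Integrable (fun p : ℝ × ℝ => ((p.2⁻¹ : ℝ) : ℂ) * a (p.1 / p.2) * h p.2) (nu.prod nu) := by
  have hm := aestronglyMeasurable_dil_uncurry ha hi.1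
  refine ⟨hm, ?_⟩
  rw [hasFiniteIntegral_iff_enorm, lintegral_prod_symm _ hm.enorm]
  have e : ∫⁻ r, ∫⁻ s, ‖((r⁻¹ : ℝ) : ℂ) * a (s / r) * h r‖ₑ ∂nu ∂nu =
      ∫⁻ r, (∫⁻ u, ‖a u‖ₑ ∂nu) * ‖h r‖ₑ ∂nu := by
    refine setLIntegral_congr_fun measurableSet_Ioi fun r hr => ?_
    have hr : (0 : ℝ) < r := hr
    simp only [enorm_dil_integrand a h _ hr]
    rw [lintegral_mul_const' _ _ enorm_ne_top, lintegral_comp_div_right hr (fun u => ‖a u‖ₑ)]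
  rw [e, lintegral_const_mul'' _ hi.1.enorm]
  exact ENNReal.mul_lt_top hai.2 hi.2

lemma integrable_density (q : Polynomial ℝ) : Integrable (density q) nu := by
  have h : IntegrableOn (fun u => ((q.eval u : ℝ) : ℂ)) (Ioo 0 1) nu := by
    have : Continuous fun u : ℝ => ((q.eval u : ℝ) : ℂ) := by
      have := q.continuous
      fun_prop
    have h2 : IntegrableOn (fun u => ((q.eval u : ℝ) : ℂ)) (Icc 0 1) volume :=
      this.continuousOn.integrableOn_Icc
    exact (h2.mono_set Ioo_subset_Icc_self).mono_measure
      Measure.restrict_le_self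
  exact (integrable_indicator_iff measurableSet_Ioo).2 h

/-- The trigonometric form of b_m is inserted into the integral. In the second term s = rt turns ∫∫
q(t) cos(rtρ - β) h(r) dt dr into the integral of cos(sρ - β) against ∫ r⁻¹ q(s/r) h(r) dr; Fubini
applies because h is integrable. -/
lemma hankel_eq_cosT_of_integrable {m : ℕ} {q : Polynomial ℝ}
    (hq : ∀ z : ℝ, z ≠ 0 → bes m z = Real.cos (z - m * (Real.pi / 2)) +
      ∫ t in (0 : ℝ)..1, q.eval t * Real.cos (z * t - m * (Real.pi / 2)))
    {h : ℝ → ℂ} (hh : MemLp h 2 nu) (hi : Integrable h nu) :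
    hankel m h =ᵐ[nu] cosT (m * (Real.pi / 2)) (fun s => h s + dil (density q) h s) := by
  set β : ℝ := m * (Real.pi / 2) with hβ
  have hmd := measurable_density q
  have hNd := kerN_density_ne_top q
  have hprod := integrable_dil_prod hmd (integrable_density q) hi
  have hdi : Integrable (dil (density q) h) nu := hprod.integral_prod_left
  filter_upwards [hankel_eq_integral m hh hi, cosT_eq_integral β (hh.add (memLp_dil hmd hNd hh))
    (hi.add hdi), ae_restrict_mem measurableSet_Ioi] with ρ h1 h2 hρ
  have hρ : (0 : ℝ) < ρ := hρ
  have h2' : cosT β (fun s => h s + dil (density q) h s) ρ =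
    ∫ r, ((Real.sqrt (2 / Real.pi) * Real.cos (r * ρ - β) : ℝ) : ℂ) * (h r + dil (density q) h r) ∂nu := h2
  rw [h1, h2']
  set c : ℝ → ℝ := fun r => Real.sqrt (2 / Real.pi) * Real.cos (r * ρ - β) with hc
  have hcm : Measurable c := by fun_prop
  have hcb : ∀ r, |c r| ≤ Real.sqrt (2 / Real.pi) := fun r => by
    rw [hc, abs_mul, abs_of_nonneg (Real.sqrt_nonneg _)]
    exact mul_le_of_le_one_right (Real.sqrt_nonneg _) (Real.abs_cos_le_one _)
  have i1 := integrable_bounded_mul hi hcm (C := Real.sqrt (2 / Real.pi)) fun r _ => hcb r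
  have i2 := integrable_bounded_mul hdi hcm (C := Real.sqrt (2 / Real.pi)) fun r _ => hcb r
  have hprod2 : Integrable (fun p : ℝ × ℝ => (c p.1 : ℂ) *
      (((p.2⁻¹ : ℝ) : ℂ) * density q (p.1 / p.2) * h p.2)) (nu.prod nu) := by
    refine hprod.bdd_mul (c := Real.sqrt (2 / Real.pi))
      (Complex.measurable_ofReal.comp (hcm.comp measurable_fst)).aestronglyMeasurable
      (Eventually.of_forall fun p => ?_)
    rw [Complex.norm_real]; exact hcb _
  have e1 : ∫ s, (c s : ℂ) * dil (density q) h s ∂nu =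
      ∫ r, ((∫ t in (0 : ℝ)..1, q.eval t * c (r * t) : ℝ) : ℂ) * h r ∂nu := by
    unfold dil
    simp only [← integral_const_mul]
    rw [integral_integral_swap hprod2]
    refine setIntegral_congr_fun measurableSet_Ioi fun r hr => ?_
    have hr : (0 : ℝ) < r := hr
    have e2 : ∀ s, (c s : ℂ) * (((r⁻¹ : ℝ) : ℂ) * density q (s / r) * h r) =
        ((r⁻¹ : ℝ) : ℂ) * (h r * ((c s : ℂ) * density q (s / r))) := fun s => by ring
    simp only [e2]
    rw [integral_const_mul, integral_const_mul]
    have e3 := integral_comp_mul_left_Ioi (fun s => (c s : ℂ) * density q (s / r)) 0 hr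
    rw [mul_zero, Complex.real_smul] at e3
    have e4 : ∫ t in Ioi (0 : ℝ), (c (r * t) : ℂ) * density q (r * t / r) =
        ((∫ t in (0 : ℝ)..1, q.eval t * c (r * t) : ℝ) : ℂ) := by
      rw [intervalIntegral.integral_of_le zero_le_one, integral_Ioc_eq_integral_Ioo,
        ← integral_complex_ofReal, ← integral_indicator measurableSet_Ioo,
        setIntegral_eq_integral_of_forall_compl_eq_zero]
      · congr 1; ext t
        rw [mul_div_cancel_left₀ _ hr.ne']
        unfold density
        by_cases ht : t ∈ Ioo (0 : ℝ) 1
        · rw [indicator_of_mem ht, indicator_of_mem ht]; push_cast; ring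
        · rw [indicator_of_notMem ht, indicator_of_notMem ht, mul_zero]
      · intro t ht
        rw [mul_div_cancel_left₀ _ hr.ne', show density q t = 0 from
          indicator_of_notMem (fun h => ht h.1) _, mul_zero]
    rw [← e4, e3]; ring
  simp only [mul_add]
  rw [integral_add i1 i2, e1]
  have i3 : Integrable (fun r => ((∫ t in (0 : ℝ)..1, q.eval t * c (r * t) : ℝ) : ℂ) * h r) nu := by
    obtain ⟨D, hD0, _, hD⟩ := exists_density_bound q
    refine integrable_bounded_mul hi ?_ (C := D * Real.sqrt (2 / Real.pi)) fun r _ => ?_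
    · apply Continuous.measurable
      apply intervalIntegral.continuous_parametric_intervalIntegral_of_continuous'
      fun_prop
    · have := intervalIntegral.norm_integral_le_of_norm_le_const (a := 0) (b := 1)
        (f := fun t => q.eval t * c (r * t)) (C := D * Real.sqrt (2 / Real.pi)) fun t ht => by
          rw [uIoc_of_le zero_le_one] at ht
          rw [norm_mul]
          exact mul_le_mul (hD t ⟨ht.1.le, ht.2⟩) (hcb _) (norm_nonneg _) hD0
      simpa using this
  rw [← integral_add i1 i3]
  refine setIntegral_congr_fun measurableSet_Ioi fun r hr => ?_
  have hr : (0 : ℝ) < r := hr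
  rw [hq _ (mul_pos hr hρ).ne', ← add_mul, ← Complex.ofReal_add]
  congr 2
  rw [mul_add, hc]
  congr 1
  rw [← intervalIntegral.integral_const_mul]
  congr 1; ext t
  change _ = q.eval t * (Real.sqrt (2 / Real.pi) * Real.cos (r * t * ρ - β))
  rw [show r * t * ρ = r * ρ * t by ring]; ring

/-- The Hankel transform factors through the (co)sine transform. -/
lemma hankel_eq_cosT {m : ℕ} {q : Polynomial ℝ}
    (hq : ∀ z : ℝ, z ≠ 0 → bes m z = Real.cos (z - m * (Real.pi / 2)) +
      ∫ t in (0 : ℝ)..1, q.eval t * Real.cos (z * t - m * (Real.pi / 2)))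
    {h : ℝ → ℂ} (hh : MemLp h 2 nu) :
    hankel m h =ᵐ[nu] cosT (m * (Real.pi / 2)) (fun s => h s + dil (density q) h s) := by
  set β : ℝ := m * (Real.pi / 2) with hβ
  have hmd := measurable_density q
  have hNd := kerN_density_ne_top q
  have hV : ∀ {g : ℝ → ℂ}, MemLp g 2 nu → MemLp (fun s => g s + dil (density q) g s) 2 nu :=
    fun hg => hg.add (memLp_dil hmd hNd hg)
  have hz : eLpNorm (fun ρ => hankel m h ρ - cosT β (fun s => h s + dil (density q) h s) ρ) 2 nu = 0 := by
    have : Tendsto (fun _ : ℕ => eLpNorm (fun ρ => hankel m h ρ -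
        cosT β (fun s => h s + dil (density q) h s) ρ) 2 nu) atTop (𝓝 0) := by
      refine tendsto_zero_of_approx (K := 1 + 2 * (1 + kerN (density q))) ?_ fun η hη => ?_
      · exact ENNReal.add_ne_top.2 ⟨ENNReal.one_ne_top, ENNReal.mul_ne_top ENNReal.ofNat_ne_top
          (ENNReal.add_ne_top.2 ⟨ENNReal.one_ne_top, hNd⟩)⟩
      obtain ⟨g, hg, hgi, _, hle⟩ := exists_truncation hh hη
      refine ⟨fun _ => 0, tendsto_const_nhds, Eventually.of_forall fun _ => ?_⟩
      have hd : MemLp (fun r => h r - g r) 2 nu := hh.sub hg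
      have eV : (fun s => (h s + dil (density q) h s) - (g s + dil (density q) g s)) =ᵐ[nu]
          fun s => (h s - g s) + dil (density q) (fun r => h r - g r) s := by
        filter_upwards [dil_sub_right hmd hNd hh hg] with s hs
        rw [hs]; ring
      have e : (fun ρ => hankel m h ρ - cosT β (fun s => h s + dil (density q) h s) ρ) =ᵐ[nu]
          fun ρ => hankel m (fun r => h r - g r) ρ +
            (-1) * cosT β (fun s => (h s - g s) + dil (density q) (fun r => h r - g r) s) ρ := by
        rw [← cosT_congr β ((hV hh).sub (hV hg)) eV]
        filter_upwards [hankel_sub m hh hg, cosT_sub β (hV hh) (hV hg),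
          hankel_eq_cosT_of_integrable hq hg hgi] with ρ e1 e2 e3
        have e2' : cosT β ((fun s => h s + dil (density q) h s) - fun s => g s + dil (density q) g s) ρ =
          cosT β (fun s => h s + dil (density q) h s) ρ - cosT β (fun s => g s + dil (density q) g s) ρ := e2
        rw [e1, e2', e3]; ring
      rw [eLpNorm_congr_ae e, zero_add]
      refine (eLpNorm_add_le_two (memLp_hankel m hd).1 ((memLp_cosT β (hV hd)).const_mul (-1)).1).trans ?_
      rw [eLpNorm_const_mul_two, enorm_neg, enorm_one, one_mul, eLpNorm_hankel m hd, add_mul, one_mul]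
      refine add_le_add hle ((eLpNorm_cosT_le β (hV hd)).trans ?_)
      rw [mul_assoc]
      gcongr
      refine (eLpNorm_add_le_two hd.1 (memLp_dil hmd hNd hd).1).trans ?_
      rw [add_mul, one_mul]
      exact add_le_add hle ((eLpNorm_dil_le hmd hd.1).trans (by gcongr))
    exact tendsto_nhds_unique tendsto_const_nhds this
  have hm : AEStronglyMeasurable (fun ρ => hankel m h ρ -
      cosT β (fun s => h s + dil (density q) h s) ρ) nu :=
    (memLp_hankel m hh).1.sub (memLp_cosT β (hV hh)).1
  rw [eLpNorm_eq_zero_iff hm two_ne_zero] at hz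
  filter_upwards [hz] with ρ hρ using sub_eq_zero.1 hρ

/-! ### The sinc kernels and the asymptotic energy as a tail norm -/

/-- The kernel `∫₀ᴿ b_i(sρ₁) b_i(sρ₂) ds`. -/
def besKernel (i : ℕ) (R ρ₁ ρ₂ : ℝ) : ℝ := ∫ s in Ioo 0 R, bes i (s * ρ₁) * bes i (s * ρ₂)

/-- The function `s ↦ b_i(sρ)` cut off at `R`. -/
def cutBes (i : ℕ) (R ρ s : ℝ) : ℂ := (Iio R).indicator (fun s => ((bes i (s * ρ) : ℝ) : ℂ)) s

lemma memLp_cut {w : ℝ → ℂ} {p : ℝ≥0∞} (R : ℝ) (hw : MemLp w p nu) : MemLp ((Iio R).indicator w) p nu :=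
  hw.indicator measurableSet_Iio

lemma nu_Iio_lt_top (R : ℝ) : nu (Iio R) < ⊤ := by
  rw [Measure.restrict_apply measurableSet_Iio]
  exact (measure_mono (show Iio R ∩ Ioi 0 ⊆ Icc 0 R from fun x hx => ⟨(show 0 < x from hx.2).le, (show x < R from hx.1).le⟩)).trans_lt
    measure_Icc_lt_top

lemma memLp_cutBes (i : ℕ) (R : ℝ) {ρ : ℝ} (hρ : 0 < ρ) (p : ℝ≥0∞) : MemLp (cutBes i R ρ) p nu := by
  obtain ⟨C, _, hC⟩ := exists_bes_bound i
  have h1 : MemLp ((Iio R).indicator fun _ => (C : ℂ)) p nu :=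
    memLp_indicator_const p measurableSet_Iio _ (Or.inr (nu_Iio_lt_top R).ne)
  have hm := measurable_bes i
  refine h1.of_le (Measurable.aestronglyMeasurable ?_) ?_
  · refine Measurable.indicator ?_ measurableSet_Iio
    fun_prop
  · filter_upwards [ae_restrict_mem measurableSet_Ioi] with s hs
    have hs : (0 : ℝ) < s := hs
    unfold cutBes
    by_cases h : s ∈ Iio R
    · rw [indicator_of_mem h, indicator_of_mem h, Complex.norm_real, Complex.norm_real]
      exact (hC _ (mul_pos hs hρ).ne').trans (le_abs_self C)
    · rw [indicator_of_notMem h, indicator_of_notMem h]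

lemma setIntegral_nu_Iio (R : ℝ) (f : ℝ → ℂ) : ∫ s, (Iio R).indicator f s ∂nu = ∫ s in Ioo 0 R, f s := by
  rw [integral_indicator measurableSet_Iio, Measure.restrict_restrict measurableSet_Iio, inter_comm,
    Ioi_inter_Iio]

lemma hankel_cutBes (i : ℕ) (R : ℝ) {ρ : ℝ} (hρ : 0 < ρ) :
    hankel i (cutBes i R ρ) =ᵐ[nu] fun ρ₂ => ((Real.sqrt (2 / Real.pi) * besKernel i R ρ ρ₂ : ℝ) : ℂ) := by
  filter_upwards [hankel_eq_integral i (memLp_cutBes i R hρ 2)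
    (memLp_one_iff_integrable.1 (memLp_cutBes i R hρ 1))] with ρ₂ h
  rw [h]
  have e : ∀ r, ((Real.sqrt (2 / Real.pi) * bes i (r * ρ₂) : ℝ) : ℂ) * cutBes i R ρ r =
      (Iio R).indicator (fun r => ((Real.sqrt (2 / Real.pi) * (bes i (r * ρ) * bes i (r * ρ₂)) : ℝ) : ℂ)) r := by
    intro r
    unfold cutBes
    by_cases h : r ∈ Iio R
    · rw [indicator_of_mem h, indicator_of_mem h]; push_cast; ring
    · rw [indicator_of_notMem h, indicator_of_notMem h, mul_zero]
  simp only [e]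
  rw [setIntegral_nu_Iio, integral_complex_ofReal, integral_const_mul, besKernel]

lemma sqrt_two_div_pi_mul : Real.sqrt (2 / Real.pi) * Real.sqrt (2 / Real.pi) = 2 / Real.pi :=
  Real.mul_self_sqrt (by positivity)

lemma memLp_besKernel (i : ℕ) (R : ℝ) {ρ : ℝ} (hρ : 0 < ρ) :
    MemLp (fun ρ₂ => ((besKernel i R ρ ρ₂ : ℝ) : ℂ)) 2 nu := by
  have h := ((memLp_hankel i (memLp_cutBes i R hρ 2)).ae_eq (hankel_cutBes i R hρ)).const_mul
    (((Real.pi / 2) * Real.sqrt (2 / Real.pi) : ℝ) : ℂ)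
  refine h.ae_eq (Eventually.of_forall fun x => ?_)
  dsimp only
  rw [← Complex.ofReal_mul]
  congr 1
  rw [show Real.pi / 2 * Real.sqrt (2 / Real.pi) * (Real.sqrt (2 / Real.pi) * besKernel i R ρ x) =
    Real.pi / 2 * (Real.sqrt (2 / Real.pi) * Real.sqrt (2 / Real.pi)) * besKernel i R ρ x by ring,
    sqrt_two_div_pi_mul]
  have := Real.pi_pos
  field_simp

/-- Up to the factor π/2 the kernel represents H_i 1_{(0,R)} H_i. For fixed ρ it is the Hankel
transform of the cut-off function s ↦ b_i(sρ), and symmetry moves the transform onto w. -/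
lemma integral_besKernel_mul (i : ℕ) (R : ℝ) {w : ℝ → ℂ} (hw : MemLp w 2 nu) :
    ∀ᵐ ρ ∂nu, ∫ ρ₂, ((besKernel i R ρ ρ₂ : ℝ) : ℂ) * w ρ₂ ∂nu =
      ((Real.pi / 2 : ℝ) : ℂ) * hankel i ((Iio R).indicator (hankel i w)) ρ := by
  have hv := memLp_cut R (memLp_hankel i hw)
  have hvi : Integrable ((Iio R).indicator (hankel i w)) nu := by
    have h1 : MemLp ((Iio R).indicator fun _ => (1 : ℂ)) 2 nu :=
      memLp_indicator_const 2 measurableSet_Iio _ (Or.inr (nu_Iio_lt_top R).ne)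
    refine (integrable_mul_of_memLp h1 (memLp_hankel i hw)).congr (Eventually.of_forall fun x => ?_)
    by_cases h : x ∈ Iio R
    · simp [indicator_of_mem h]
    · simp [indicator_of_notMem h]
  filter_upwards [hankel_eq_integral i hv hvi, ae_restrict_mem measurableSet_Ioi] with ρ h1 hρ
  have hρ : (0 : ℝ) < ρ := hρ
  have h2 := integral_hankel_mul i (memLp_cutBes i R hρ 2) hw
  have h3 : ∫ r, hankel i (cutBes i R ρ) r * w r ∂nu =
      ((Real.sqrt (2 / Real.pi) : ℝ) : ℂ) * ∫ ρ₂, ((besKernel i R ρ ρ₂ : ℝ) : ℂ) * w ρ₂ ∂nu := by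
    rw [← integral_const_mul]
    refine integral_congr_ae ?_
    filter_upwards [hankel_cutBes i R hρ] with x hx
    rw [hx]; push_cast; ring
  have h4 : hankel i ((Iio R).indicator (hankel i w)) ρ =
      ((Real.sqrt (2 / Real.pi) : ℝ) : ℂ) * ∫ r, cutBes i R ρ r * hankel i w r ∂nu := by
    rw [h1, ← integral_const_mul]
    refine integral_congr_ae (Eventually.of_forall fun x => ?_)
    dsimp only
    unfold cutBes
    by_cases h : x ∈ Iio R
    · rw [indicator_of_mem h, indicator_of_mem h]; push_cast; ring
    · rw [indicator_of_notMem h, indicator_of_notMem h]; ring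
  rw [h4, ← h2, h3, ← mul_assoc, ← mul_assoc, ← Complex.ofReal_mul, ← Complex.ofReal_mul,
    mul_assoc, sqrt_two_div_pi_mul]
  have : Real.pi / 2 * (2 / Real.pi) = 1 := by have := Real.pi_pos; field_simp
  rw [this, Complex.ofReal_one, one_mul]

lemma integral_mul_hankel_cut (i : ℕ) (R : ℝ) {G : ℝ → ℂ} (hG : MemLp G 2 nu) :
    ∫ ρ, G ρ * hankel i ((Iio R).indicator (hankel i fun r => conj (G r))) ρ ∂nu =
      ((∫ ρ in Ioo 0 R, ‖hankel i G ρ‖ ^ 2 : ℝ) : ℂ) := by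
  have hc := memLp_conj hG
  rw [← integral_hankel_mul i hG (memLp_cut R (memLp_hankel i hc)), ← integral_complex_ofReal,
    ← setIntegral_nu_Iio]
  refine integral_congr_ae ?_
  filter_upwards [hankel_conj i hG] with ρ h
  by_cases hr : ρ ∈ Iio R
  · rw [indicator_of_mem hr, indicator_of_mem hr, h, Complex.mul_conj, Complex.normSq_eq_norm_sq]
  · rw [indicator_of_notMem hr, indicator_of_notMem hr, mul_zero]

/-- The addition formulas for the cosine, integrated over (0,R). The diagonal must be excluded
because there the quotient has the value 0 instead of R; it is a null set in the double integrals.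
-/
lemma besKernel_zero_eq {R : ℝ} (hR : 0 < R) {x y : ℝ} (hx : 0 < x) (hy : 0 < y) (hxy : x ≠ y) :
    Real.sin (R * (x - y)) / (x - y) = besKernel 0 R x y + besKernel 1 R x y ∧
    Real.sin (R * (x + y)) / (x + y) = besKernel 0 R x y - besKernel 1 R x y := by
  have key : ∀ c : ℝ, c ≠ 0 → ∫ s in Ioo 0 R, Real.cos (s * c) = Real.sin (R * c) / c := fun c hc => by
    rw [← integral_Ioc_eq_integral_Ioo, ← intervalIntegral.integral_of_le hR.le,
      intervalIntegral.integral_comp_mul_right Real.cos hc, integral_cos]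
    simp [div_eq_inv_mul]
  have hi : ∀ c : ℝ → ℝ, Continuous c → IntegrableOn c (Ioo 0 R) := fun c hc =>
    (hc.continuousOn.integrableOn_Icc (a := 0) (b := R)).mono_set Ioo_subset_Icc_self
  have e0 : besKernel 0 R x y = ∫ s in Ioo 0 R, Real.cos (s * x) * Real.cos (s * y) := rfl
  have e1 : besKernel 1 R x y = ∫ s in Ioo 0 R, Real.sin (s * x) * Real.sin (s * y) := by
    unfold besKernel
    refine setIntegral_congr_fun measurableSet_Ioo fun s hs => ?_
    rw [bes_one (mul_pos hs.1 hx).ne', bes_one (mul_pos hs.1 hy).ne']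
  rw [← key _ (sub_ne_zero.2 hxy), ← key _ (add_pos hx hy).ne', e0, e1]
  constructor
  · rw [← integral_add (hi _ (by fun_prop)) (hi _ (by fun_prop))]
    congr 1; ext s
    rw [mul_sub, Real.cos_sub]
  · rw [← integral_sub (hi _ (by fun_prop)) (hi _ (by fun_prop))]
    congr 1; ext s
    rw [mul_add, Real.cos_add]

/-- The two Hermitian forms in the asymptotic exterior energy. -/
lemma sinc_forms {R : ℝ} (hR : 0 < R) {G : ℝ → ℂ} (hG : MemLp G 2 nu) :
    (∫ x, ∫ y, ((Real.sin (R * (x - y)) / (x - y) : ℝ) : ℂ) * (G x * conj (G y)) ∂nu ∂nu =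
      (((Real.pi / 2) * ((∫ ρ in Ioo 0 R, ‖hankel 0 G ρ‖ ^ 2) + ∫ ρ in Ioo 0 R, ‖hankel 1 G ρ‖ ^ 2) : ℝ) : ℂ)) ∧
    (∫ x, ∫ y, ((Real.sin (R * (x + y)) / (x + y) : ℝ) : ℂ) * (G x * conj (G y)) ∂nu ∂nu =
      (((Real.pi / 2) * ((∫ ρ in Ioo 0 R, ‖hankel 0 G ρ‖ ^ 2) - ∫ ρ in Ioo 0 R, ‖hankel 1 G ρ‖ ^ 2) : ℝ) : ℂ)) := by
  have hc := memLp_conj hG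
  have hne : ∀ x : ℝ, ∀ᵐ y ∂nu, x ≠ y := fun x => by
    have : ∀ᵐ y ∂(volume : Measure ℝ), x ≠ y := by
      rw [ae_iff]; simp
    exact ae_restrict_of_ae this
  have hi : ∀ i, ∀ {x : ℝ}, 0 < x → Integrable (fun y => ((besKernel i R x y : ℝ) : ℂ) * conj (G y)) nu :=
    fun i x hx => integrable_mul_of_memLp (memLp_besKernel i R hx) hc
  have ho : ∀ i, Integrable (fun ρ => G ρ * hankel i ((Iio R).indicator (hankel i fun r => conj (G r))) ρ) nu :=
    fun i => integrable_mul_of_memLp hG (memLp_hankel i (memLp_cut R (memLp_hankel i hc)))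
  constructor
  · have e : ∀ᵐ x ∂nu, ∫ y, ((Real.sin (R * (x - y)) / (x - y) : ℝ) : ℂ) * (G x * conj (G y)) ∂nu =
        ((Real.pi / 2 : ℝ) : ℂ) * ((G x * hankel 0 ((Iio R).indicator (hankel 0 fun r => conj (G r))) x) +
        (G x * hankel 1 ((Iio R).indicator (hankel 1 fun r => conj (G r))) x)) := by
      filter_upwards [integral_besKernel_mul 0 R hc, integral_besKernel_mul 1 R hc,
        ae_restrict_mem measurableSet_Ioi] with x h0 h1 hx
      rw [← mul_add, mul_left_comm, mul_add, ← h0, ← h1, ← integral_add (hi 0 hx) (hi 1 hx),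
        ← integral_const_mul]
      refine integral_congr_ae ?_
      filter_upwards [hne x, ae_restrict_mem measurableSet_Ioi] with y hxy hy
      rw [(besKernel_zero_eq hR hx hy hxy).1]; push_cast; ring
    rw [integral_congr_ae e, integral_const_mul, integral_add (ho 0) (ho 1),
      integral_mul_hankel_cut 0 R hG, integral_mul_hankel_cut 1 R hG]
    push_cast; ring
  · have e : ∀ᵐ x ∂nu, ∫ y, ((Real.sin (R * (x + y)) / (x + y) : ℝ) : ℂ) * (G x * conj (G y)) ∂nu =
        ((Real.pi / 2 : ℝ) : ℂ) * ((G x * hankel 0 ((Iio R).indicator (hankel 0 fun r => conj (G r))) x) -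
        (G x * hankel 1 ((Iio R).indicator (hankel 1 fun r => conj (G r))) x)) := by
      filter_upwards [integral_besKernel_mul 0 R hc, integral_besKernel_mul 1 R hc,
        ae_restrict_mem measurableSet_Ioi] with x h0 h1 hx
      rw [← mul_sub, mul_left_comm, mul_sub, ← h0, ← h1, ← integral_sub (hi 0 hx) (hi 1 hx),
        ← integral_const_mul]
      refine integral_congr_ae ?_
      filter_upwards [hne x, ae_restrict_mem measurableSet_Ioi] with y hxy hy
      rw [(besKernel_zero_eq hR hx hy hxy).2]; push_cast; ring
    rw [integral_congr_ae e, integral_const_mul, integral_sub (ho 0) (ho 1),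
      integral_mul_hankel_cut 0 R hG, integral_mul_hankel_cut 1 R hG]
    push_cast; ring

lemma integrable_norm_sq {w : ℝ → ℂ} (hw : MemLp w 2 nu) : IntegrableOn (fun r => ‖w r‖ ^ 2) (Ioi 0) :=
  (memLp_two_iff_integrable_sq_norm hw.1).1 hw

lemma integral_norm_sq_split {R : ℝ} (hR : 0 < R) {w : ℝ → ℂ} (hw : MemLp w 2 nu) :
    ∫ r in Ioi (0 : ℝ), ‖w r‖ ^ 2 = (∫ r in Ioo 0 R, ‖w r‖ ^ 2) + ∫ r in Ioi R, ‖w r‖ ^ 2 := by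
  rw [← integral_Ioc_eq_integral_Ioo, ← setIntegral_union (Ioc_disjoint_Ioi le_rfl) measurableSet_Ioi
    ((integrable_norm_sq hw).mono_set Ioc_subset_Ioi_self)
    ((integrable_norm_sq hw).mono_set (Ioi_subset_Ioi hR.le)), Ioc_union_Ioi_eq_Ioi hR.le]

lemma integral_norm_sq_eq_of_eLpNorm {v w : ℝ → ℂ} (hv : MemLp v 2 nu) (hw : MemLp w 2 nu)
    (e : eLpNorm v 2 nu = eLpNorm w 2 nu) :
    ∫ r in Ioi (0 : ℝ), ‖v r‖ ^ 2 = ∫ r in Ioi (0 : ℝ), ‖w r‖ ^ 2 := by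
  rw [integral_norm_sq_eq hv, integral_norm_sq_eq hw, e]

/-- The asymptotic exterior energy form as a norm of a (co)sine transform over `(R,∞)`. -/
lemma asymptotic_form_eq {R : ℝ} (hR : 0 < R) (m : ℕ) {G : ℝ → ℂ} (hG : MemLp G 2 nu) :
    (1 / 2) * (∫ r in Ioi (0 : ℝ), ‖G r‖ ^ 2)
      - 1 / (2 * Real.pi) *
        (∫ x, ∫ y, ((Real.sin (R * (x - y)) / (x - y) : ℝ) : ℂ) * (G x * conj (G y)) ∂nu ∂nu).re
      - (-1) ^ m / (2 * Real.pi) *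
        (∫ x, ∫ y, ((Real.sin (R * (x + y)) / (x + y) : ℝ) : ℂ) * (G x * conj (G y)) ∂nu ∂nu).re =
    (1 / 2) * ∫ r in Ioi R, ‖cosT (m * (Real.pi / 2)) G r‖ ^ 2 := by
  obtain ⟨h1, h2⟩ := sinc_forms hR hG
  rw [h1, h2, Complex.ofReal_re, Complex.ofReal_re]
  have hpi := Real.pi_pos
  have e0 : ∀ i, ∫ r in Ioi (0 : ℝ), ‖G r‖ ^ 2 =
      (∫ r in Ioo 0 R, ‖hankel i G r‖ ^ 2) + ∫ r in Ioi R, ‖hankel i G r‖ ^ 2 := fun i => by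
    rw [← integral_norm_sq_split hR (memLp_hankel i hG)]
    exact integral_norm_sq_eq_of_eLpNorm hG (memLp_hankel i hG) (eLpNorm_hankel i hG).symm
  have hn : ∀ σ : ℝ, σ ^ 2 = 1 → ∀ z : ℂ, ‖(σ : ℂ) * z‖ ^ 2 = ‖z‖ ^ 2 := fun σ h z => by
    rw [norm_mul, mul_pow, Complex.norm_real, Real.norm_eq_abs, sq_abs, h, one_mul]
  -- With a and b the masses on (0,R) of the cosine and sine transforms, the two forms combine to
  -- ¼[(a+b) + (-1)^m (a-b)], which is a/2 for even m and b/2 for odd m. Only the transform that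
  -- occurs in `cosT` is left.
  rcases cos_sin_nat_mul_pi_div_two m with ⟨σ, s1, s2, s3, s4⟩ | ⟨σ, s1, s2, s3, s4⟩
  · have e : ∀ r, ‖cosT (m * (Real.pi / 2)) G r‖ ^ 2 = ‖hankel 0 G r‖ ^ 2 := fun r => by
      rw [← hn σ s1 (hankel 0 G r)]; unfold cosT; rw [s2, s3]; simp
    simp only [e]
    rw [e0 0, s4]
    field_simp
    ring
  · have e : ∀ r, ‖cosT (m * (Real.pi / 2)) G r‖ ^ 2 = ‖hankel 1 G r‖ ^ 2 := fun r => by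
      rw [← hn σ s1 (hankel 1 G r)]; unfold cosT; rw [s2, s3]; simp
    simp only [e]
    rw [e0 1, s4]
    field_simp
    ring

/-! ### Weights on radial profiles; both forms as tail norms -/

/-- Multiplication of a radial profile by `r^m`, which turns weighted spaces into `L²(0,∞)`. -/
def weighted (m : ℕ) (w : ℝ → ℂ) (r : ℝ) : ℂ := ((r ^ m : ℝ) : ℂ) * w r

lemma norm_weighted_sq (m : ℕ) (w : ℝ → ℂ) (r : ℝ) : ‖weighted m w r‖ ^ 2 = ‖w r‖ ^ 2 * r ^ (2 * m) := by
  unfold weighted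
  rw [norm_mul, mul_pow, Complex.norm_real, Real.norm_eq_abs, sq_abs, ← pow_mul, mul_comm m 2, mul_comm]

lemma asG_eq {m d : ℕ} (hd : d = 2 * m + 1) {R : ℝ} (hR : 0 < R) {ghat : ℝ → ℂ}
    (hG : MemLp (weighted m ghat) 2 nu) :
    asG d R ghat = (1 / 2) * ∫ r in Ioi R, ‖cosT (m * (Real.pi / 2)) (weighted m ghat) r‖ ^ 2 := by
  rw [← asymptotic_form_eq hR m hG]
  unfold asG
  have e1 : (d - 1) / 2 = m := by omega
  have e2 : d - 1 = 2 * m := by omega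
  rw [e1, e2]
  simp only [norm_weighted_sq]
  have e3 : ∀ (c x y : ℝ), ((c * (x * y) ^ m : ℝ) : ℂ) * (ghat x * conj (ghat y)) =
      (c : ℂ) * (weighted m ghat x * conj (weighted m ghat y)) := fun c x y => by
    unfold weighted
    rw [map_mul, Complex.conj_ofReal]; push_cast; ring
  simp only [e3]

lemma asF_eq {m d : ℕ} (hd : d = 2 * m + 1) {R : ℝ} (hR : 0 < R) {fhat : ℝ → ℂ}
    (hF : MemLp (weighted (m + 1) fhat) 2 nu) :
    asF d R fhat = (1 / 2) * ∫ r in Ioi R, ‖cosT ((m + 1 : ℕ) * (Real.pi / 2)) (weighted (m + 1) fhat) r‖ ^ 2 := by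
  rw [← asymptotic_form_eq hR (m + 1) hF]
  unfold asF
  have e1 : (d - 1) / 2 = m := by omega
  have e2 : d + 1 = 2 * (m + 1) := by omega
  rw [e1, e2]
  simp only [norm_weighted_sq]
  have e3 : ∀ (c x y : ℝ), ((c * (x * y) ^ (m + 1) : ℝ) : ℂ) * (fhat x * conj (fhat y)) =
      (c : ℂ) * (weighted (m + 1) fhat x * conj (weighted (m + 1) fhat y)) := fun c x y => by
    unfold weighted
    rw [map_mul, Complex.conj_ofReal]; push_cast; ring
  simp only [e3]
  -- The opposite sign in front of the second kernel in AS_d(f) is (-1)^{m+1}, which fits the order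
  -- m + 1.
  rw [pow_succ]
  ring

/-! ### Mollified Fourier transforms of the Hankel kernels -/

lemma fourierInt_eq_fourier (w : ℝ → ℂ) (z : ℝ) :
    fourierInt w z = FourierTransform.fourier w (z / (2 * Real.pi)) := by
  rw [Real.fourier_real_eq_integral_exp_smul, fourierInt]
  congr 1; ext x
  rw [smul_eq_mul]
  congr 2
  have := Real.pi_pos.ne'
  have e : -2 * Real.pi * x * (z / (2 * Real.pi)) = -(z * x) := by field_simp
  rw [e, show inner ℝ x z = z * x from rfl]
  push_cast; ring

section CompactSupport
variable {w : ℝ → ℂ}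

lemma integrable_fourierInt (hw : ContDiff ℝ ∞ w) (hc : HasCompactSupport w) :
    Integrable (fourierInt w) := by
  have h : Integrable (FourierTransform.fourier w) := by
    have := (FourierTransform.fourier (hc.toSchwartzMap hw)).integrable (μ := volume)
    exact this
  have e : fourierInt w = fun z => FourierTransform.fourier w (z / (2 * Real.pi)) := by
    ext z; exact fourierInt_eq_fourier w z
  rw [e]
  exact h.comp_div (by positivity)

lemma integral_exp_mul_fourierInt (hw : ContDiff ℝ ∞ w) (hc : HasCompactSupport w) (t : ℝ) :
    ∫ z : ℝ, Complex.exp (((t * z : ℝ) : ℂ) * Complex.I) * fourierInt w z = 2 * Real.pi * w t := by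
  have hF : Integrable (FourierTransform.fourier w) := by
    have := (FourierTransform.fourier (hc.toSchwartzMap hw)).integrable (μ := volume)
    exact this
  have h := congrFun (hw.continuous.fourierInv_fourier_eq
    (hw.continuous.integrable_of_hasCompactSupport hc) hF) t
  rw [Real.fourierInv_eq'] at h
  have e : ∀ z : ℝ, Complex.exp (((t * z : ℝ) : ℂ) * Complex.I) * fourierInt w z =
      (fun y : ℝ => Complex.exp (((2 * Real.pi * inner ℝ y t : ℝ) : ℂ) * Complex.I) •
        FourierTransform.fourier w y) (z / (2 * Real.pi)) := fun z => by
    dsimp only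
    rw [fourierInt_eq_fourier, smul_eq_mul]
    congr 4
    rw [show inner ℝ (z / (2 * Real.pi)) t = t * (z / (2 * Real.pi)) from rfl]
    have := Real.pi_pos.ne'
    field_simp
  rw [integral_congr_ae (Eventually.of_forall e), Measure.integral_comp_div (fun y : ℝ =>
    Complex.exp (((2 * Real.pi * inner ℝ y t : ℝ) : ℂ) * Complex.I) • FourierTransform.fourier w y), h, abs_of_pos (by positivity), Complex.real_smul]
  push_cast; ring

lemma fourierInt_deriv (hw : ContDiff ℝ ∞ w) (hc : HasCompactSupport w) (z : ℝ) :
    fourierInt (deriv w) z = Complex.I * z * fourierInt w z := by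
  have hd : Continuous (deriv w) := hw.continuous_deriv (by simp)
  rw [fourierInt_eq_fourier, fourierInt_eq_fourier, Real.fourier_deriv
    (hw.continuous.integrable_of_hasCompactSupport hc) (hw.differentiable (by simp))
    (hd.integrable_of_hasCompactSupport hc.deriv)]
  simp only [smul_eq_mul]
  have := Complex.ofReal_ne_zero.2 Real.pi_pos.ne'
  push_cast
  field_simp

lemma hasDerivAt_fourierInt (hw : ContDiff ℝ ∞ w) (hc : HasCompactSupport w) (z : ℝ) :
    HasDerivAt (fourierInt w) (-Complex.I * fourierInt (fun x : ℝ => (x : ℂ) * w x) z) z := by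
  have h1 : Integrable (fun x : ℝ => x • w x) :=
    (continuous_id.smul hw.continuous).integrable_of_hasCompactSupport hc.smul_left
  have h := Real.hasDerivAt_fourier (hw.continuous.integrable_of_hasCompactSupport hc) h1 (z / (2 * Real.pi))
  have h2 := h.scomp z ((hasDerivAt_id z).div_const (2 * Real.pi))
  have e : fourierInt w = FourierTransform.fourier w ∘ fun z => id z / (2 * Real.pi) := by
    ext z; exact fourierInt_eq_fourier w z
  rw [e]
  refine h2.congr_deriv ?_
  rw [fourierInt_eq_fourier, Real.fourier_real_eq_integral_exp_smul,
    Real.fourier_real_eq_integral_exp_smul, Complex.real_smul, ← integral_const_mul, ← integral_const_mul]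
  congr 1; ext x
  have := Complex.ofReal_ne_zero.2 Real.pi_pos.ne'
  simp only [smul_eq_mul]
  push_cast
  field_simp

lemma cos_eq_exp (m : ℕ) (x : ℝ) : ((Real.cos (x - m * (Real.pi / 2)) : ℝ) : ℂ) =
    (1 / 2) * ((-Complex.I) ^ m * Complex.exp ((x : ℂ) * Complex.I) +
      Complex.I ^ m * Complex.exp (((-x : ℝ) : ℂ) * Complex.I)) := by
  rw [Complex.ofReal_cos, Complex.cos]
  have e1 : Complex.exp (((x - m * (Real.pi / 2) : ℝ) : ℂ) * Complex.I) =
      (-Complex.I) ^ m * Complex.exp ((x : ℂ) * Complex.I) := by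
    rw [← Complex.exp_neg_pi_div_two_mul_I, ← Complex.exp_nat_mul, ← Complex.exp_add]
    congr 1; push_cast; ring
  have e2 : Complex.exp (-((x - m * (Real.pi / 2) : ℝ) : ℂ) * Complex.I) =
      Complex.I ^ m * Complex.exp (((-x : ℝ) : ℂ) * Complex.I) := by
    have : Complex.I ^ m = Complex.exp (Real.pi / 2 * Complex.I) ^ m := by
      rw [Complex.exp_pi_div_two_mul_I]
    rw [this, ← Complex.exp_nat_mul, ← Complex.exp_add]
    congr 1; push_cast; ring
  rw [e1, e2]; ring

lemma integrable_exp_mul_fourierInt (hw : ContDiff ℝ ∞ w) (hc : HasCompactSupport w) (t : ℝ) :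
    Integrable fun z : ℝ => Complex.exp (((t * z : ℝ) : ℂ) * Complex.I) * fourierInt w z := by
  refine (integrable_fourierInt hw hc).bdd_mul (c := 1) (Continuous.aestronglyMeasurable (by fun_prop))
    (Eventually.of_forall fun z => ?_)
  rw [Complex.norm_exp_ofReal_mul_I]

lemma integral_cos_mul_fourierInt (hw : ContDiff ℝ ∞ w) (hc : HasCompactSupport w) (m : ℕ) (t : ℝ) :
    ∫ z : ℝ, ((Real.cos (z * t - m * (Real.pi / 2)) : ℝ) : ℂ) * fourierInt w z =
      Real.pi * ((-Complex.I) ^ m * w t + Complex.I ^ m * w (-t)) := by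
  have e : ∀ z : ℝ, ((Real.cos (z * t - m * (Real.pi / 2)) : ℝ) : ℂ) * fourierInt w z =
      ((1 / 2) * (-Complex.I) ^ m) * (Complex.exp (((t * z : ℝ) : ℂ) * Complex.I) * fourierInt w z) +
      ((1 / 2) * Complex.I ^ m) * (Complex.exp (((-t * z : ℝ) : ℂ) * Complex.I) * fourierInt w z) :=
    fun z => by
      rw [cos_eq_exp, show -(z * t) = -t * z by ring, mul_comm z t]; ring
  simp only [e]
  rw [integral_add ((integrable_exp_mul_fourierInt hw hc t).const_mul _)
    ((integrable_exp_mul_fourierInt hw hc (-t)).const_mul _), integral_const_mul, integral_const_mul,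
    integral_exp_mul_fourierInt hw hc, integral_exp_mul_fourierInt hw hc]
  ring

/-- The pairing of a Hankel kernel with a Fourier transform. -/
lemma integral_bes_mul_fourierInt {m : ℕ} {q : Polynomial ℝ}
    (hq : ∀ z : ℝ, z ≠ 0 → bes m z = Real.cos (z - m * (Real.pi / 2)) +
      ∫ t in (0 : ℝ)..1, q.eval t * Real.cos (z * t - m * (Real.pi / 2)))
    (hw : ContDiff ℝ ∞ w) (hc : HasCompactSupport w) :
    ∫ z : ℝ, ((bes m z : ℝ) : ℂ) * fourierInt w z =
      Real.pi * ((-Complex.I) ^ m * (w 1 + ∫ t in (0 : ℝ)..1, ((q.eval t : ℝ) : ℂ) * w t) +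
        Complex.I ^ m * (w (-1) + ∫ t in (0 : ℝ)..1, ((q.eval t : ℝ) : ℂ) * w (-t))) := by
  have hi := integrable_fourierInt hw hc
  have hbound : ∀ c : ℝ → ℝ, Continuous c → (∀ z, |c z| ≤ 1) →
      Integrable fun z => ((c z : ℝ) : ℂ) * fourierInt w z := fun c hcc hb => by
    refine hi.bdd_mul (c := 1) (Complex.continuous_ofReal.comp hcc).aestronglyMeasurable
      (Eventually.of_forall fun z => ?_)
    rw [Complex.norm_real]; exact hb z
  have hqi : IntegrableOn (fun t => ((q.eval t : ℝ) : ℂ)) (Ioc 0 1) := by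
    have : Continuous fun u : ℝ => ((q.eval u : ℝ) : ℂ) := by
      have := q.continuous
      fun_prop
    exact (this.continuousOn.integrableOn_Icc).mono_set Ioc_subset_Icc_self
  have hprod : Integrable (fun p : ℝ × ℝ => ((Real.cos (p.1 * p.2 - m * (Real.pi / 2)) : ℝ) : ℂ) *
      (fourierInt w p.1 * ((q.eval p.2 : ℝ) : ℂ))) (volume.prod (volume.restrict (Ioc 0 1))) := by
    refine (Integrable.mul_prod hi hqi).bdd_mul (c := 1) (Continuous.aestronglyMeasurable (by fun_prop))
      (Eventually.of_forall fun z => ?_)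
    rw [Complex.norm_real]; exact Real.abs_cos_le_one _
  have e : (fun z : ℝ => ((bes m z : ℝ) : ℂ) * fourierInt w z) =ᵐ[volume]
      fun z => ((Real.cos (z * 1 - m * (Real.pi / 2)) : ℝ) : ℂ) * fourierInt w z +
        ∫ t in Ioc (0 : ℝ) 1, ((Real.cos (z * t - m * (Real.pi / 2)) : ℝ) : ℂ) *
          (fourierInt w z * ((q.eval t : ℝ) : ℂ)) := by
    have : ∀ᵐ z ∂(volume : Measure ℝ), z ≠ 0 := by rw [ae_iff]; simp
    filter_upwards [this] with z hz
    rw [hq z hz, intervalIntegral.integral_of_le zero_le_one, Complex.ofReal_add,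
      ← integral_complex_ofReal, add_mul, mul_one, ← integral_mul_const]
    congr 2; ext t; push_cast; ring
  rw [integral_congr_ae e, integral_add (hbound _ (by fun_prop) fun z => Real.abs_cos_le_one _)
    hprod.integral_prod_left, integral_integral_swap hprod, integral_cos_mul_fourierInt hw hc]
  have e2 : ∀ t : ℝ, ∫ z : ℝ, ((Real.cos (z * t - m * (Real.pi / 2)) : ℝ) : ℂ) *
      (fourierInt w z * ((q.eval t : ℝ) : ℂ)) =
      Real.pi * (-Complex.I) ^ m * (((q.eval t : ℝ) : ℂ) * w t) +
        Real.pi * Complex.I ^ m * (((q.eval t : ℝ) : ℂ) * w (-t)) := fun t => by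
    simp only [← mul_assoc]
    rw [integral_mul_const, integral_cos_mul_fourierInt hw hc]; ring
  simp only [e2]
  rw [← intervalIntegral.integral_of_le zero_le_one]
  have hwc := hw.continuous
  rw [intervalIntegral.integral_add, intervalIntegral.integral_const_mul, intervalIntegral.integral_const_mul]
  · ring
  · apply Continuous.intervalIntegrable; fun_prop
  · apply Continuous.intervalIntegrable; fun_prop

end CompactSupport

section Mollified
variable {κ : ℝ → ℝ}

/-- The reflected translate of the mollifier. -/
def moll (κ : ℝ → ℝ) (ε u x : ℝ) : ℂ := (mollifier κ ε (u - x) : ℂ)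

lemma contDiff_moll (hκ : ContDiff ℝ ∞ κ) (ε u : ℝ) : ContDiff ℝ ∞ (moll κ ε u) := by
  unfold moll mollifier
  have h : ContDiff ℝ ∞ fun x => κ ((u - x) / ε) :=
    hκ.comp ((contDiff_const.sub contDiff_id).div_const ε)
  exact Complex.ofRealCLM.contDiff.comp (contDiff_const.mul h)

lemma hasCompactSupport_moll (hs : Function.support κ ⊆ Icc (-1) 1) {ε : ℝ} (hε : 0 < ε) (u : ℝ) :
    HasCompactSupport (moll κ ε u) := by
  refine HasCompactSupport.of_support_subset_isCompact (isCompact_Icc (a := u - ε) (b := u + ε)) ?_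
  intro x hx
  by_contra h
  refine hx ?_
  unfold moll
  rw [mollifier_eq_zero hs hε, Complex.ofReal_zero]
  rw [lt_abs]
  rw [mem_Icc, not_and_or, not_le, not_le] at h
  rcases h with h | h
  · left; linarith
  · right; linarith

/-- The tempered Fourier transform of b_m consists of the masses at ±1 and the densities ±q on both
sides of 0, the phases being (∓i)^m; its value on the translated mollifier is the explicit kernel.
-/
lemma mollifiedFourier_bes (hκ : ContDiff ℝ ∞ κ) (hs : Function.support κ ⊆ Icc (-1) 1) {m : ℕ}
    {q : Polynomial ℝ}
    (hq : ∀ z : ℝ, z ≠ 0 → bes m z = Real.cos (z - m * (Real.pi / 2)) +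
      ∫ t in (0 : ℝ)..1, q.eval t * Real.cos (z * t - m * (Real.pi / 2)))
    {ε : ℝ} (hε : 0 < ε) (u : ℝ) :
    mollifiedFourier κ ε (bes m) u = molKer κ m q ε u := by
  have h := integral_bes_mul_fourierInt hq (contDiff_moll hκ ε u) (hasCompactSupport_moll hs hε u)
  have h0 : mollifiedFourier κ ε (bes m) u = ∫ z : ℝ, ((bes m z : ℝ) : ℂ) * fourierInt (moll κ ε u) z := rfl
  rw [h0, h]
  unfold molKer smoothDensity smoothDensityRefl moll
  simp only [sub_neg_eq_add, ← Complex.ofReal_mul]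
  rw [intervalIntegral.integral_ofReal, intervalIntegral.integral_ofReal]
  push_cast; rfl

end Mollified

lemma ae_ne_zero : ∀ᵐ z ∂(volume : Measure ℝ), z ≠ 0 := by rw [ae_iff]; simp

lemma abs_cosInt_le (q : Polynomial ℝ) (β : ℝ) : ∃ C, ∀ z, |cosInt q β z| ≤ C := by
  obtain ⟨C, hC⟩ := (isCompact_Icc (a := (-1 : ℝ)) (b := 1)).exists_bound_of_continuousOn
    (f := fun t => q.eval t) q.continuous.continuousOn
  refine ⟨C * |1 - -1|, fun z => ?_⟩
  rw [cosInt, ← Real.norm_eq_abs]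
  refine intervalIntegral.norm_integral_le_of_norm_le_const fun t ht => ?_
  rw [uIoc_of_le (by norm_num)] at ht
  rw [norm_mul]
  exact (mul_le_of_le_one_right (norm_nonneg _) (Real.abs_cos_le_one _)).trans (hC t ⟨ht.1.le, ht.2⟩)

/-- The Hankel kernels extend to `C¹` functions that are bounded together with the derivative. -/
lemma exists_bes_extension (m : ℕ) : ∃ b b' : ℝ → ℝ, (∀ z, HasDerivAt b (b' z) z) ∧ Continuous b' ∧
    (∃ C, (∀ z, |b z| ≤ C) ∧ ∀ z, |b' z| ≤ C) ∧
    (∀ z, z ≠ 0 → bes m z = b z) ∧ ∀ z, z ≠ 0 → deriv (bes m) z = b' z := by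
  obtain ⟨q, hq⟩ := bes_eq_cosInt m
  set β : ℝ := m * (Real.pi / 2) with hβ
  obtain ⟨C1, h1⟩ := abs_cosInt_le q β
  obtain ⟨C2, h2⟩ := abs_cosInt_le (Polynomial.X * q) (β + Real.pi / 2)
  have hd : ∀ z, HasDerivAt (fun z => Real.cos (z - β) + cosInt q β z)
      (-Real.sin (z - β) - cosInt (Polynomial.X * q) (β + Real.pi / 2) z) z := fun z => by
    have e1 := ((Real.hasDerivAt_cos (z - β)).comp z ((hasDerivAt_id z).sub_const β)).add
      (hasDerivAt_cosInt q β z)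
    refine e1.congr_deriv ?_
    simp; ring
  refine ⟨_, _, hd, ?_, ⟨1 + max C1 C2, fun z => ?_, fun z => ?_⟩, hq, fun z hz => ?_⟩
  · have : Continuous (cosInt (Polynomial.X * q) (β + Real.pi / 2)) :=
      continuous_iff_continuousAt.2 fun z => (hasDerivAt_cosInt _ _ z).continuousAt
    fun_prop
  · exact (abs_add_le _ _).trans (add_le_add (Real.abs_cos_le_one _) ((h1 z).trans (le_max_left _ _)))
  · refine (abs_sub _ _).trans (add_le_add ?_ ((h2 z).trans (le_max_right _ _)))
    rw [abs_neg]; exact Real.abs_sin_le_one _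
  · have e : bes m =ᶠ[𝓝 z] fun z => Real.cos (z - β) + cosInt q β z := by
      filter_upwards [isOpen_ne.mem_nhds hz] with y hy using hq y hy
    rw [e.deriv_eq, (hd z).deriv]

section CompactSupport
variable {w : ℝ → ℂ}

/-- Integration by parts in z. Since zŵ = -i(w')^, the derivative of zŵ is minus the transform of
xw', so z d/dz on the kernel becomes x d/dx on the test function. -/
lemma integral_deriv_bes_mul_fourierInt (m : ℕ) (hw : ContDiff ℝ ∞ w) (hc : HasCompactSupport w) :
    Integrable (fun z : ℝ => ((bes m z : ℝ) : ℂ) * fourierInt w z) ∧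
    Integrable (fun z : ℝ => ((z * deriv (bes m) z : ℝ) : ℂ) * fourierInt w z) ∧
    ∫ z : ℝ, ((z * deriv (bes m) z : ℝ) : ℂ) * fourierInt w z =
      ∫ z : ℝ, ((bes m z : ℝ) : ℂ) * fourierInt (fun x : ℝ => (x : ℂ) * deriv w x) z := by
  obtain ⟨b, b', hd, hb', ⟨C, hC, hC'⟩, e, e'⟩ := exists_bes_extension m
  have hb : Continuous b := continuous_iff_continuousAt.2 fun z => (hd z).continuousAt
  have hw1 : ContDiff ℝ ∞ (deriv w) := (contDiff_infty_iff_deriv.1 hw).2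
  have hw2 : ContDiff ℝ ∞ fun x : ℝ => (x : ℂ) * deriv w x :=
    (Complex.ofRealCLM.contDiff).mul hw1
  have hc2 : HasCompactSupport fun x : ℝ => (x : ℂ) * deriv w x := hc.deriv.mul_left
  have bdd : ∀ c : ℝ → ℝ, Continuous c → (∀ z, |c z| ≤ C) → ∀ F : ℝ → ℂ, Integrable F →
      Integrable fun z => ((c z : ℝ) : ℂ) * F z := fun c hcc hcb F hF => by
    refine hF.bdd_mul (c := C) (Complex.continuous_ofReal.comp hcc).aestronglyMeasurable
      (Eventually.of_forall fun z => ?_)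
    rw [Complex.norm_real]; exact hcb z
  set V : ℝ → ℂ := fun z => -Complex.I * fourierInt (deriv w) z with hV
  have hVe : ∀ z : ℝ, V z = z * fourierInt w z := fun z => by
    rw [hV]; dsimp only
    rw [fourierInt_deriv hw hc]
    linear_combination (-(z : ℂ) * fourierInt w z) * Complex.I_mul_I
  have hVi : Integrable V := (integrable_fourierInt hw1 hc.deriv).const_mul _
  have hVd : ∀ z, HasDerivAt V (-fourierInt (fun x : ℝ => (x : ℂ) * deriv w x) z) z := fun z => by
    refine ((hasDerivAt_fourierInt hw1 hc.deriv z).const_mul (-Complex.I)).congr_deriv ?_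
    linear_combination (fourierInt (fun x : ℝ => (x : ℂ) * deriv w x) z) * Complex.I_mul_I
  have a1 : (fun z : ℝ => ((bes m z : ℝ) : ℂ) * fourierInt w z) =ᵐ[volume]
      fun z => ((b z : ℝ) : ℂ) * fourierInt w z := by
    filter_upwards [ae_ne_zero] with z hz
    rw [e z hz]
  have a2 : (fun z : ℝ => ((z * deriv (bes m) z : ℝ) : ℂ) * fourierInt w z) =ᵐ[volume]
      fun z => ((b' z : ℝ) : ℂ) * V z := by
    filter_upwards [ae_ne_zero] with z hz
    rw [e' z hz, hVe]; push_cast; ring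
  have a3 : (fun z : ℝ => ((bes m z : ℝ) : ℂ) * fourierInt (fun x : ℝ => (x : ℂ) * deriv w x) z) =ᵐ[volume]
      fun z => ((b z : ℝ) : ℂ) * fourierInt (fun x : ℝ => (x : ℂ) * deriv w x) z := by
    filter_upwards [ae_ne_zero] with z hz
    rw [e z hz]
  have i2 := bdd b' hb' hC' V hVi
  have i3 := bdd b hb hC _ (integrable_fourierInt hw2 hc2)
  refine ⟨(bdd b hb hC _ (integrable_fourierInt hw hc)).congr a1.symm, i2.congr a2.symm, ?_⟩
  rw [integral_congr_ae a2, integral_congr_ae a3]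
  have key := integral_mul_deriv_eq_deriv_mul_of_integrable (u := fun z => ((b z : ℝ) : ℂ))
    (u' := fun z => ((b' z : ℝ) : ℂ)) (v := V)
    (v' := fun z => -fourierInt (fun x : ℝ => (x : ℂ) * deriv w x) z)
    (fun z _ => (hd z).ofReal_comp) (fun z _ => hVd z)
    (by simpa [Pi.mul_def, mul_neg] using i3.neg) i2 (bdd b hb hC V hVi)
  simp only [mul_neg, integral_neg] at key
  exact (neg_inj.1 key).symm

end CompactSupport

lemma fourierInt_add {v w : ℝ → ℂ} (hv : Integrable v) (hw : Integrable w) (z : ℝ) :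
    fourierInt (fun x => v x + w x) z = fourierInt v z + fourierInt w z := by
  unfold fourierInt
  have h : ∀ v : ℝ → ℂ, Integrable v →
      Integrable fun y : ℝ => Complex.exp (-(Complex.I * ((inner ℝ y z : ℝ) : ℂ))) * v y := fun v hv => by
    refine hv.bdd_mul (c := 1) (Continuous.aestronglyMeasurable (by fun_prop))
      (Eventually.of_forall fun y => ?_)
    rw [Complex.norm_exp]; simp
  rw [← integral_add (h v hv) (h w hw)]
  congr 1; ext y; ring

lemma fourierInt_const_mul (c : ℂ) (v : ℝ → ℂ) (z : ℝ) :
    fourierInt (fun x => c * v x) z = c * fourierInt v z := by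
  unfold fourierInt
  rw [← integral_const_mul]
  congr 1; ext y; ring

section Mollified
variable {κ : ℝ → ℝ}

lemma contDiff_deriv (hκ : ContDiff ℝ ∞ κ) : ContDiff ℝ ∞ (deriv κ) := (contDiff_infty_iff_deriv.1 hκ).2

lemma support_deriv (hs : Function.support κ ⊆ Icc (-1) 1) : Function.support (deriv κ) ⊆ Icc (-1) 1 :=
  (support_deriv_subset).trans (closure_minimal hs isClosed_Icc)

lemma support_id_mul (hs : Function.support κ ⊆ Icc (-1) 1) :
    Function.support (fun y => y * κ y) ⊆ Icc (-1) 1 :=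
  fun y hy => hs fun h => hy (by simp [h])

/-- By `psiBessel_eq` the test function becomes (n+1)w + xw' with w(x) = κ_ε(u - x). Putting x = u -
εy with y = (u - x)/ε, the term xw' splits into the mollifier built from yκ'(y) and -u/ε times the
one built from κ'. -/
lemma mollifiedFourier_psi (hκ : ContDiff ℝ ∞ κ) (hs : Function.support κ ⊆ Icc (-1) 1) {n : ℕ}
    {q : Polynomial ℝ}
    (hq : ∀ z : ℝ, z ≠ 0 → bes (n + 2) z = Real.cos (z - (n + 2 : ℕ) * (Real.pi / 2)) +
      ∫ t in (0 : ℝ)..1, q.eval t * Real.cos (z * t - (n + 2 : ℕ) * (Real.pi / 2)))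
    {ε : ℝ} (hε : 0 < ε) (u : ℝ) :
    mollifiedFourier κ ε (psiBessel n) u = ((n : ℂ) + 1) * molKer κ (n + 2) q ε u +
      molKer (fun y => y * deriv κ y) (n + 2) q ε u -
        u * (((1 / ε : ℝ) : ℂ) * molKer (deriv κ) (n + 2) q ε u) := by
  have hw := contDiff_moll hκ ε u
  have hc := hasCompactSupport_moll hs hε u
  have hκ1 := contDiff_deriv hκ
  have hs1 := support_deriv hs
  have hκ2 : ContDiff ℝ ∞ fun y => y * deriv κ y := contDiff_id.mul hκ1
  have hs2 := support_id_mul hs1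
  obtain ⟨i1, i2, h⟩ := integral_deriv_bes_mul_fourierInt (n + 2) hw hc
  have h0 : mollifiedFourier κ ε (psiBessel n) u = ∫ z : ℝ, ((psiBessel n z : ℝ) : ℂ) * fourierInt (moll κ ε u) z := rfl
  have hm : ∀ κ' : ℝ → ℝ, ContDiff ℝ ∞ κ' → Function.support κ' ⊆ Icc (-1) 1 →
      ∫ z : ℝ, ((bes (n + 2) z : ℝ) : ℂ) * fourierInt (moll κ' ε u) z = molKer κ' (n + 2) q ε u :=
    fun κ' h1 h2 => mollifiedFourier_bes h1 h2 hq hε u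
  have e1 : ∀ᵐ z ∂(volume : Measure ℝ), ((psiBessel n z : ℝ) : ℂ) * fourierInt (moll κ ε u) z =
      ((n : ℂ) + 1) * (((bes (n + 2) z : ℝ) : ℂ) * fourierInt (moll κ ε u) z) +
        ((z * deriv (bes (n + 2)) z : ℝ) : ℂ) * fourierInt (moll κ ε u) z := by
    filter_upwards [ae_ne_zero] with z hz
    rw [psiBessel_eq n z hz]; push_cast; ring
  rw [h0, integral_congr_ae e1, integral_add (i1.const_mul _) i2, integral_const_mul, hm κ hκ hs, h]
  have e2 : (fun x : ℝ => (x : ℂ) * deriv (moll κ ε u) x) = fun x =>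
      moll (fun y => y * deriv κ y) ε u x + (-(u * ((1 / ε : ℝ) : ℂ))) * moll (deriv κ) ε u x := by
    ext x
    have hd : HasDerivAt (moll κ ε u) (((1 / ε * (deriv κ ((u - x) / ε) * (-1 / ε)) : ℝ) : ℂ)) x := by
      have h1 : HasDerivAt κ (deriv κ ((u - x) / ε)) ((u - x) / ε) :=
        (hκ.differentiable (by simp)).differentiableAt.hasDerivAt
      have h2 := h1.comp x (((hasDerivAt_id x).const_sub u).div_const ε)
      exact (h2.const_mul (1 / ε)).ofReal_comp
    rw [hd.deriv]
    unfold moll mollifier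
    have : (ε : ℂ) ≠ 0 := Complex.ofReal_ne_zero.2 hε.ne'
    push_cast
    field_simp
    ring
  rw [e2]
  have hint : ∀ κ' : ℝ → ℝ, ContDiff ℝ ∞ κ' → Function.support κ' ⊆ Icc (-1) 1 →
      Integrable (moll κ' ε u) := fun κ' h1 h2 =>
    (contDiff_moll h1 ε u).continuous.integrable_of_hasCompactSupport (hasCompactSupport_moll h2 hε u)
  have e3 : ∀ z : ℝ, ((bes (n + 2) z : ℝ) : ℂ) * fourierInt (fun x =>
      moll (fun y => y * deriv κ y) ε u x + (-(u * ((1 / ε : ℝ) : ℂ))) * moll (deriv κ) ε u x) z =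
      ((bes (n + 2) z : ℝ) : ℂ) * fourierInt (moll (fun y => y * deriv κ y) ε u) z +
      (-(u * ((1 / ε : ℝ) : ℂ))) * (((bes (n + 2) z : ℝ) : ℂ) * fourierInt (moll (deriv κ) ε u) z) := fun z => by
    rw [fourierInt_add (hint _ hκ2 hs2) ((hint _ hκ1 hs1).const_mul _), fourierInt_const_mul]
    ring
  simp only [e3]
  rw [integral_add (integral_deriv_bes_mul_fourierInt (n + 2) (contDiff_moll hκ2 ε u)
    (hasCompactSupport_moll hs2 hε u)).1 ((integral_deriv_bes_mul_fourierInt (n + 2)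
    (contDiff_moll hκ1 ε u) (hasCompactSupport_moll hs1 hε u)).1.const_mul _), integral_const_mul,
    hm _ hκ1 hs1, hm _ hκ2 hs2]
  ring

lemma hasDerivAt_mollifier (hκ : ContDiff ℝ ∞ κ) (ε c u : ℝ) :
    HasDerivAt (fun u => mollifier κ ε (u + c)) (1 / ε * mollifier (deriv κ) ε (u + c)) u := by
  unfold mollifier
  have h1 : HasDerivAt κ (deriv κ ((u + c) / ε)) ((u + c) / ε) :=
    (hκ.differentiable (by simp)).differentiableAt.hasDerivAt
  have h2 := h1.comp u (((hasDerivAt_id u).add_const c).div_const ε)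
  refine (h2.const_mul (1 / ε)).congr_deriv ?_
  ring

lemma hasDerivAt_integral_mollifier (hκ : ContDiff ℝ ∞ κ) (hs : Function.support κ ⊆ Icc (-1) 1)
    (q : Polynomial ℝ) (ε : ℝ) {c : ℝ → ℝ} (hcc : Continuous c) (u : ℝ) :
    HasDerivAt (fun u => ∫ t in (0 : ℝ)..1, q.eval t * mollifier κ ε (u + c t))
      (1 / ε * ∫ t in (0 : ℝ)..1, q.eval t * mollifier (deriv κ) ε (u + c t)) u := by
  have hκ1 := contDiff_deriv hκ
  obtain ⟨D, hD⟩ := (hasCompactSupport_of_support (support_deriv hs)).exists_bound_of_continuous hκ1.continuous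
  have m0 := continuous_mollifier hκ.continuous ε
  have m1 := continuous_mollifier hκ1.continuous ε
  have key := intervalIntegral.hasDerivAt_integral_of_dominated_loc_of_deriv_le (μ := volume) (a := 0) (b := 1)
    (F := fun u t => q.eval t * mollifier κ ε (u + c t))
    (F' := fun u t => q.eval t * (1 / ε * mollifier (deriv κ) ε (u + c t)))
    (bound := fun t => |q.eval t| * (|1 / ε| * (|1 / ε| * D))) (x₀ := u) (s := univ) univ_mem
    (Eventually.of_forall fun v => Continuous.aestronglyMeasurable (by fun_prop))
    (Continuous.intervalIntegrable (by fun_prop) _ _)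
    (Continuous.aestronglyMeasurable (by fun_prop))
    (Eventually.of_forall fun t _ v _ => by
      rw [norm_mul, norm_mul, Real.norm_eq_abs, Real.norm_eq_abs]
      unfold mollifier
      rw [norm_mul, Real.norm_eq_abs]
      gcongr
      exact hD _)
    (Continuous.intervalIntegrable (by fun_prop) _ _)
    (Eventually.of_forall fun t _ v _ => (hasDerivAt_mollifier hκ ε (c t) v).const_mul _)
  refine key.2.congr_deriv ?_
  rw [← intervalIntegral.integral_const_mul]
  congr 1; ext t; ring

/-- It identifies the term with factor u in `mollifiedFourier_psi` as u times the derivative of the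
kernel, in the form needed by `dil_hardy`. -/
lemma hasDerivAt_molKer (hκ : ContDiff ℝ ∞ κ) (hs : Function.support κ ⊆ Icc (-1) 1) (m : ℕ)
    (q : Polynomial ℝ) (ε u : ℝ) :
    HasDerivAt (molKer κ m q ε) (((1 / ε : ℝ) : ℂ) * molKer (deriv κ) m q ε u) u := by
  have h1 := ((hasDerivAt_mollifier hκ ε (-1) u).add
    (hasDerivAt_integral_mollifier hκ hs q ε (c := fun t => -t) (by fun_prop) u)).ofReal_comp
  have h2 := ((hasDerivAt_mollifier hκ ε 1 u).add
    (hasDerivAt_integral_mollifier hκ hs q ε (c := fun t => t) (by fun_prop) u)).ofReal_comp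
  have h := ((h1.const_mul ((-Complex.I) ^ m)).add (h2.const_mul (Complex.I ^ m))).const_mul (Real.pi : ℂ)
  refine h.congr_deriv ?_
  unfold molKer smoothDensity smoothDensityRefl
  simp only [← sub_eq_add_neg]
  push_cast; ring

lemma bes_neg {m : ℕ} {z : ℝ} (hz : z ≠ 0) : bes m (-z) = (-1) ^ m * bes m z := by
  obtain ⟨q, hq⟩ := exists_bes_rep m
  have e : ∀ x : ℝ, Real.cos (-x - m * (Real.pi / 2)) = (-1) ^ m * Real.cos (x - m * (Real.pi / 2)) := fun x => by
    rw [← Real.cos_neg, show -(-x - (m : ℝ) * (Real.pi / 2)) = (x - m * (Real.pi / 2)) + m * Real.pi by ring,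
      Real.cos_add_nat_mul_pi]
  rw [hq z hz, hq (-z) (neg_ne_zero.2 hz), e, mul_add, ← intervalIntegral.integral_const_mul]
  congr 2; ext t
  rw [neg_mul, e]; ring

lemma mollifiedFourier_neg (he : ∀ x, κ (-x) = κ x) {φ : ℝ → ℝ} {σ : ℝ}
    (hφ : ∀ z, z ≠ 0 → φ (-z) = σ * φ z) (ε u : ℝ) :
    mollifiedFourier κ ε φ (-u) = σ * mollifiedFourier κ ε φ u := by
  have hm : ∀ x, mollifier κ ε (-x) = mollifier κ ε x := fun x => by
    unfold mollifier; rw [neg_div, he]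
  unfold mollifiedFourier
  have e1 : ∀ z, fourierInt (fun x : ℝ => (mollifier κ ε (-u - x) : ℂ)) z =
      fourierInt (fun x : ℝ => (mollifier κ ε (u - x) : ℂ)) (-z) := fun z => by
    unfold fourierInt
    rw [← integral_neg_eq_self]
    congr 1; ext x
    change _ * ((mollifier κ ε (-u - -x) : ℝ) : ℂ) = _ * ((mollifier κ ε (u - x) : ℝ) : ℂ)
    rw [← hm (-u - -x)]
    congr 2
    · rw [inner_neg_left, inner_neg_right]
    · ring_nf
  simp only [e1]
  rw [← integral_neg_eq_self, ← integral_const_mul]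
  refine integral_congr_ae ?_
  filter_upwards [ae_ne_zero] with z hz
  rw [hφ z hz, neg_neg]; push_cast; ring

lemma phiBessel_neg (n : ℕ) {z : ℝ} (hz : z ≠ 0) : phiBessel n (-z) = (-1) ^ (n + 1) * phiBessel n z :=
  bes_neg (m := n + 1) hz

lemma psiBessel_neg (n : ℕ) {z : ℝ} (hz : z ≠ 0) : psiBessel n (-z) = (-1) ^ n * psiBessel n z := by
  have e : ∀ x, psiBessel n x = x * phiBessel n x := fun x => by unfold psiBessel phiBessel; ring
  rw [e, e, phiBessel_neg n hz]; ring

end Mollified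

/-! ### Multiplicative convolution with the Hardy kernel -/

/-- Composition of two operators `dil`. -/
lemma dil_dil {a b h : ℝ → ℂ} (ha : Measurable a) (hNa : kerN a ≠ ⊤) (hb : Measurable b) (hNb : kerN b ≠ ⊤)
    (hh : MemLp h 2 nu) :
    ∀ᵐ s ∂nu, dil b (dil a h) s =
      ∫ x, (∫ r, ((r⁻¹ : ℝ) : ℂ) * b (s / r) * a (r / x) ∂nu) * (((x⁻¹ : ℝ) : ℂ) * h x) ∂nu := by
  set H : ℝ → ℝ≥0∞ := fun r => ∫⁻ x, ENNReal.ofReal x⁻¹ * ‖a (r / x)‖ₑ * ‖h x‖ₑ ∂nu with hH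
  have hHl : ∀ r, ∫⁻ x, ‖((x⁻¹ : ℝ) : ℂ) * a (r / x) * h x‖ₑ ∂nu = H r := lintegral_dil a h
  have hm := aestronglyMeasurable_dil_uncurry ha hh.1
  have hHm : AEMeasurable H nu := by
    have : AEMeasurable (fun r => ∫⁻ x, ‖((x⁻¹ : ℝ) : ℂ) * a (r / x) * h x‖ₑ ∂nu) nu :=
      hm.enorm.lintegral_prod_right'
    simpa only [hHl] using this
  have hH2 : ∫⁻ r, H r ^ 2 ∂nu ≠ ⊤ :=
    ((lintegral_sq_dil_le ha hh.1).trans_lt (ENNReal.mul_lt_top (ENNReal.pow_lt_top hNa.lt_top)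
      (ENNReal.pow_lt_top hh.2))).ne
  have h3 : ∫⁻ s, (∫⁻ r, ENNReal.ofReal r⁻¹ * ‖b (s / r)‖ₑ * H r ∂nu) ^ 2 ∂nu ≠ ⊤ :=
    ((schur_lintegral (fun u => ‖b u‖ₑ) H hb.enorm hHm).trans_lt
      (ENNReal.mul_lt_top (ENNReal.pow_lt_top hNb.lt_top) hH2.lt_top)).ne
  have hm3 : AEMeasurable (fun s => ∫⁻ r, ENNReal.ofReal r⁻¹ * ‖b (s / r)‖ₑ * H r ∂nu) nu := by
    have hbm : Measurable fun p : ℝ × ℝ => ENNReal.ofReal p.2⁻¹ * ‖b (p.1 / p.2)‖ₑ := by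
      have : Measurable fun p : ℝ × ℝ => b (p.1 / p.2) := hb.comp (measurable_fst.div measurable_snd)
      fun_prop
    exact (hbm.aemeasurable.mul hHm.comp_snd).lintegral_prod_right'
  have h4 := ae_lt_top' (hm3.pow_const 2) h3
  filter_upwards [h4, ae_restrict_mem measurableSet_Ioi] with s hs hs0
  have hs1 : ∫⁻ r, ENNReal.ofReal r⁻¹ * ‖b (s / r)‖ₑ * H r ∂nu < ⊤ := by
    by_contra hcon
    rw [not_lt, top_le_iff] at hcon
    rw [hcon] at hs
    simp at hs
  have hpm : AEStronglyMeasurable (fun p : ℝ × ℝ => (((p.1⁻¹ : ℝ) : ℂ) * b (s / p.1)) *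
      (((p.2⁻¹ : ℝ) : ℂ) * a (p.1 / p.2) * h p.2)) (nu.prod nu) := by
    refine AEStronglyMeasurable.mul (Measurable.aestronglyMeasurable ?_) hm
    fun_prop
  have hprod : Integrable (fun p : ℝ × ℝ => (((p.1⁻¹ : ℝ) : ℂ) * b (s / p.1)) *
      (((p.2⁻¹ : ℝ) : ℂ) * a (p.1 / p.2) * h p.2)) (nu.prod nu) := by
    refine ⟨hpm, ?_⟩
    rw [hasFiniteIntegral_iff_enorm, lintegral_prod _ hpm.enorm]
    refine lt_of_eq_of_lt ?_ hs1
    refine setLIntegral_congr_fun measurableSet_Ioi fun r hr => ?_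
    have hr : (0 : ℝ) < r := hr
    simp only [enorm_mul (((r⁻¹ : ℝ) : ℂ) * b (s / r))]
    rw [lintegral_const_mul' _ _ enorm_ne_top, hHl, enorm_mul]
    congr 2
    rw [← ofReal_norm, Complex.norm_real, Real.norm_eq_abs, abs_of_pos (inv_pos.2 hr)]
  have e1 : dil b (dil a h) s = ∫ r, ∫ x, (((r⁻¹ : ℝ) : ℂ) * b (s / r)) *
      (((x⁻¹ : ℝ) : ℂ) * a (r / x) * h x) ∂nu ∂nu := by
    unfold dil
    simp only [integral_const_mul]
  rw [e1, integral_integral_swap hprod]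
  congr 1; ext x
  rw [← integral_mul_const]
  congr 1; ext r; ring

/-- The kernel of the weighted primitive `r^n ∫_r^∞ r₁^{-(n+1)} h(r₁) dr₁`. -/
def hardyKer (n : ℕ) (v : ℝ) : ℂ := (Iio (1 : ℝ)).indicator (fun v => ((v ^ n : ℝ) : ℂ)) v

lemma measurable_hardyKer (n : ℕ) : Measurable (hardyKer n) := by
  unfold hardyKer
  refine Measurable.indicator ?_ measurableSet_Iio
  fun_prop

lemma kerN_hardyKer_ne_top (n : ℕ) : kerN (hardyKer n) ≠ ⊤ := by
  refine kerN_ne_top_of_bounded (B := 1) (C := 1) (fun u hu => ?_) fun u hu => ?_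
  · unfold hardyKer
    by_cases h : u ∈ Iio 1
    · rw [indicator_of_mem h, Complex.norm_real, norm_pow, Real.norm_eq_abs]
      have hu0 : (0 : ℝ) < u := hu
      have hu1 : u < 1 := h
      exact pow_le_one₀ (abs_nonneg _) (by rw [abs_of_pos hu0]; exact hu1.le)
    · rw [indicator_of_notMem h]; simp
  · rw [hardyKer, indicator_of_notMem]
    exact not_lt.2 hu.le

/-- The integrand is the derivative of r^n A(s/r) x^{-n} for r < x and zero beyond, so only the
value at r = x remains; near r = 0 everything vanishes because A has bounded support. -/
lemma integral_hardyKer {A A' : ℝ → ℂ} {B : ℝ} (hB : 0 < B) (hA : ∀ u, HasDerivAt A (A' u) u)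
    (hA' : Continuous A') (h0 : ∀ u, B < u → A u = 0) (h0' : ∀ u, B < u → A' u = 0) (n : ℕ)
    {s x : ℝ} (hs : 0 < s) (hx : 0 < x) :
    ∫ r, ((r⁻¹ : ℝ) : ℂ) * (n * A (s / r) - ((s / r : ℝ) : ℂ) * A' (s / r)) * hardyKer n (r / x) ∂nu =
      A (s / x) := by
  -- Below δ one has s/r > B, so the integrand vanishes there, and the fundamental theorem is
  -- applied on [δ, x], away from the singularity at 0.
  set δ := min x (s / (B + 1)) with hδ
  have hδ0 : 0 < δ := lt_min hx (by positivity)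
  have hδx : δ ≤ x := min_le_left _ _
  have hBlt : ∀ r, 0 < r → r ≤ δ → B < s / r := fun r hr h => by
    rw [lt_div_iff₀ hr]
    have := h.trans (min_le_right _ _)
    rw [le_div_iff₀ (by positivity)] at this
    nlinarith
  have hAc : Continuous A := continuous_iff_continuousAt.2 fun u => (hA u).continuousAt
  have hxc : (x : ℂ) ≠ 0 := Complex.ofReal_ne_zero.2 hx.ne'
  set F : ℝ → ℂ := fun r => (((r ^ n : ℝ) : ℂ) * A (s / r)) * (((x ^ n : ℝ) : ℂ))⁻¹ with hF
  set F' : ℝ → ℂ := fun r => ((r⁻¹ : ℝ) : ℂ) * (n * A (s / r) - ((s / r : ℝ) : ℂ) * A' (s / r)) *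
    (((r / x) ^ n : ℝ) : ℂ) with hF'
  have hd : ∀ r ∈ uIcc δ x, HasDerivAt F (F' r) r := by
    intro r hr
    rw [uIcc_of_le hδx] at hr
    have hr0 : 0 < r := hδ0.trans_le hr.1
    have hrc : (r : ℂ) ≠ 0 := Complex.ofReal_ne_zero.2 hr0.ne'
    have d1 : HasDerivAt (fun r : ℝ => s / r) (-(s / r ^ 2)) r := by
      have := (hasDerivAt_const r s).div (hasDerivAt_id r) hr0.ne'
      refine this.congr_deriv ?_
      simp; ring
    have d2 := HasDerivAt.scomp r (hA (s / r)) d1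
    have d3 := (((hasDerivAt_pow n r).ofReal_comp).mul d2).mul_const (((x ^ n : ℝ) : ℂ))⁻¹
    refine d3.congr_deriv ?_
    rw [hF', Complex.real_smul]
    cases n with
    | zero => push_cast; simp only [Function.comp_apply]; field_simp; simp
    | succ k =>
      rw [Nat.add_sub_cancel]
      push_cast
      simp only [Function.comp_apply]
      generalize A (s / r) = α
      generalize A' (s / r) = α'
      rw [div_pow]
      field_simp
      ring
  have hc' : ContinuousOn F' (uIcc δ x) := by
    rw [uIcc_of_le hδx]
    have hne : ∀ r ∈ Icc δ x, r ≠ 0 := fun r hr => (hδ0.trans_le hr.1).ne'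
    have c1 : ContinuousOn (fun r : ℝ => s / r) (Icc δ x) := continuousOn_const.div continuousOn_id hne
    have c2 : ContinuousOn (fun r : ℝ => r⁻¹) (Icc δ x) := continuousOn_id.inv₀ hne
    have c3 := hAc.comp_continuousOn c1
    have c4 := hA'.comp_continuousOn c1
    have c5 := Complex.continuous_ofReal.comp_continuousOn c1
    have c6 := Complex.continuous_ofReal.comp_continuousOn c2
    exact (c6.mul ((continuousOn_const.mul c3).sub (c5.mul c4))).mul (Continuous.continuousOn (by fun_prop))
  have key := intervalIntegral.integral_eq_sub_of_hasDerivAt hd hc'.intervalIntegrable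
  have e0 : F δ = 0 := by rw [hF]; dsimp only; rw [h0 _ (hBlt δ hδ0 le_rfl)]; simp
  have e1 : F x = A (s / x) := by
    rw [hF]; dsimp only
    have : ((x ^ n : ℝ) : ℂ) ≠ 0 := by push_cast; exact pow_ne_zero _ hxc
    field_simp
  rw [e0, e1, sub_zero, intervalIntegral.integral_of_le hδx, integral_Ioc_eq_integral_Ioo] at key
  rw [← key, ← integral_indicator measurableSet_Ioi, ← integral_indicator measurableSet_Ioo]
  congr 1; ext r
  by_cases h1 : r ∈ Ioi (0 : ℝ)
  · have hr : (0 : ℝ) < r := h1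
    rw [indicator_of_mem h1]
    by_cases h2 : r ∈ Ioo δ x
    · rw [indicator_of_mem h2, hF', hardyKer, indicator_of_mem]
      exact (div_lt_one hx).2 h2.2
    · rw [indicator_of_notMem h2]
      by_cases h3 : r ≤ δ
      · rw [h0 _ (hBlt r hr h3), h0' _ (hBlt r hr h3)]; simp
      · have h4 : x ≤ r := by
          by_contra h4
          exact h2 ⟨not_le.1 h3, not_le.1 h4⟩
        rw [hardyKer, indicator_of_notMem, mul_zero]
        exact not_lt.2 ((one_le_div hx).2 h4)
  · rw [indicator_of_notMem h1, indicator_of_notMem]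
    exact fun h => h1 (hδ0.trans h.1)

/-- Multiplicative convolution with nA - uA' is convolution with A followed by the inverse of the
Hardy operator. For a mollified point mass, uA' alone has weighted norm of order 1/ε; only on
functions in the range of the Hardy operator is this term controlled. -/
lemma dil_hardy {A A' : ℝ → ℂ} {B : ℝ} (hB : 0 < B) (hA : ∀ u, HasDerivAt A (A' u) u)
    (hA' : Continuous A') (h0 : ∀ u, B < u → A u = 0) (h0' : ∀ u, B < u → A' u = 0) (n : ℕ)
    {h : ℝ → ℂ} (hh : MemLp h 2 nu) :
    dil (fun u => n * A u - (u : ℂ) * A' u) (dil (hardyKer n) h) =ᵐ[nu] dil A h := by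
  have hAc : Continuous A := continuous_iff_continuousAt.2 fun u => (hA u).continuousAt
  have hc : Continuous fun u : ℝ => n * A u - (u : ℂ) * A' u := by fun_prop
  have hN : kerN (fun u : ℝ => n * A u - (u : ℂ) * A' u) ≠ ⊤ :=
    kerN_ne_top_of_continuous (B := B) hc fun u hu => by simp [h0 u hu, h0' u hu]
  filter_upwards [dil_dil (measurable_hardyKer n) (kerN_hardyKer_ne_top n) hc.measurable hN hh,
    ae_restrict_mem measurableSet_Ioi] with s hs hs0
  rw [hs]
  unfold dil
  refine setIntegral_congr_fun measurableSet_Ioi fun x hx => ?_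
  rw [integral_hardyKer hB hA hA' h0 h0' n hs0 hx]
  ring

/-! ### The radial Fourier transform as a Hankel transform -/

lemma pow_mul_exp_neg_sq_le {a : ℝ} (ha : 0 < a) (N : ℕ) : ∃ C, ∀ r : ℝ,
    (1 + r) ^ N * Real.exp (-(a * r ^ 2 / 2)) ≤ C ∨ r < 0 := by
  -- From (1+r)^N ≤ N! e^{1+r} and r ≤ 1/(2a) + ar²/2.
  refine ⟨N.factorial * Real.exp (1 + 1 / (2 * a)), fun r => ?_⟩
  rcases lt_or_ge r 0 with h | h
  · exact Or.inr h
  left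
  have h1 : (1 + r) ^ N ≤ N.factorial * Real.exp (1 + r) := by
    have := Real.pow_div_factorial_le_exp (1 + r) (by linarith) N
    rwa [div_le_iff₀ (by positivity), mul_comm] at this
  have h2 : 1 + r ≤ 1 + 1 / (2 * a) + a * r ^ 2 / 2 := by
    have : 0 ≤ a / 2 * (r - 1 / a) ^ 2 := by positivity
    have e : a / 2 * (r - 1 / a) ^ 2 = a * r ^ 2 / 2 - r + 1 / (2 * a) := by field_simp; ring
    linarith
  calc (1 + r) ^ N * Real.exp (-(a * r ^ 2 / 2))
      ≤ (N.factorial * Real.exp (1 + 1 / (2 * a) + a * r ^ 2 / 2)) * Real.exp (-(a * r ^ 2 / 2)) := by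
        refine mul_le_mul_of_nonneg_right (h1.trans ?_) (Real.exp_nonneg _)
        gcongr
    _ = N.factorial * Real.exp (1 + 1 / (2 * a)) := by
        rw [mul_assoc, ← Real.exp_add]; congr 2; ring

lemma norm_iteratedFDeriv_exp (i : ℕ) (t : ℝ) : ‖iteratedFDeriv ℝ i Real.exp t‖ = Real.exp t := by
  rw [norm_iteratedFDeriv_eq_norm_iteratedDeriv, iteratedDeriv_eq_iterate, Real.iter_deriv_exp,
    Real.norm_eq_abs, Real.abs_exp]

/-- The Gaussian `e^{-a|x|²/2}` as a Schwartz function. -/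
def gaussianSchwartz (d : ℕ) {a : ℝ} (ha : 0 < a) : 𝓢(Space d, ℂ) where
  toFun x := ((Real.exp (-(a * ‖x‖ ^ 2 / 2)) : ℝ) : ℂ)
  smooth' := by
    refine Complex.ofRealCLM.contDiff.comp (Real.contDiff_exp.comp ?_)
    exact ((contDiff_const.mul (contDiff_norm_sq ℝ)).div_const 2).neg
  decay' k n := by
    set f : Space d → ℝ := fun x => -(a * ‖x‖ ^ 2 / 2) with hf
    have hfg : f.HasTemperateGrowth := by
      have h := (Function.HasTemperateGrowth.const (E := Space d) (-(a / 2))).mul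
        (Function.hasTemperateGrowth_norm_sq (H := Space d))
      refine cast ?_ h
      congr 1; ext x; rw [hf]; simp; ring
    obtain ⟨j, C, hC0, hC⟩ := hfg.norm_iteratedFDeriv_le_uniform n
    obtain ⟨D, hD⟩ := pow_mul_exp_neg_sq_le ha (k + j * n)
    refine ⟨n.factorial * (1 + C) ^ n * D, fun x => ?_⟩
    have e1 : (fun x : Space d => ((Real.exp (-(a * ‖x‖ ^ 2 / 2)) : ℝ) : ℂ)) =
        Complex.ofRealLI ∘ (Real.exp ∘ f) := rfl
    have hfs : ContDiff ℝ ∞ f := hfg.1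
    have hes : ContDiff ℝ ∞ (Real.exp ∘ f) := Real.contDiff_exp.comp hfs
    rw [e1, LinearIsometry.norm_iteratedFDeriv_comp_left Complex.ofRealLI hes.contDiffAt (by exact_mod_cast le_top)]
    have hx1 : 1 ≤ 1 + ‖x‖ := by linarith [norm_nonneg x]
    have h1 : ‖iteratedFDeriv ℝ n (Real.exp ∘ f) x‖ ≤
        n.factorial * Real.exp (f x) * ((1 + C) * (1 + ‖x‖) ^ j) ^ n := by
      refine norm_iteratedFDeriv_comp_le (N := ∞) Real.contDiff_exp hfs (by exact_mod_cast le_top) x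
        (fun i _ => (norm_iteratedFDeriv_exp i _).le) fun i hi hin => ?_
      -- The chain rule estimate wants the i-th derivative of the exponent bounded by an i-th power;
      -- as the base is at least 1 and i ≥ 1, the uniform polynomial bound suffices.
      have hp : (1 : ℝ) ≤ (1 + C) * (1 + ‖x‖) ^ j := by
        have := one_le_pow₀ hx1 (n := j)
        nlinarith
      refine ((hC i hin x).trans ?_).trans (le_self_pow₀ hp (by omega))
      gcongr; linarith
    have h2 := (hD ‖x‖).resolve_right (not_lt.2 (norm_nonneg x))
    calc ‖x‖ ^ k * ‖iteratedFDeriv ℝ n (Real.exp ∘ f) x‖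
        ≤ (1 + ‖x‖) ^ k * (n.factorial * Real.exp (f x) * ((1 + C) * (1 + ‖x‖) ^ j) ^ n) := by
          gcongr; linarith
      _ = n.factorial * (1 + C) ^ n * ((1 + ‖x‖) ^ (k + j * n) * Real.exp (-(a * ‖x‖ ^ 2 / 2))) := by
          rw [mul_pow, ← pow_mul, pow_add, hf]; ring
      _ ≤ n.factorial * (1 + C) ^ n * D := by gcongr

lemma gaussianSchwartz_apply (d : ℕ) {a : ℝ} (ha : 0 < a) (x : Space d) :
    gaussianSchwartz d ha x = ((Real.exp (-(a * ‖x‖ ^ 2 / 2)) : ℝ) : ℂ) := rfl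

lemma fourierInt_gaussian (d : ℕ) {a : ℝ} (ha : 0 < a) (x : Space d) :
    fourierInt (gaussianSchwartz d ha : Space d → ℂ) x =
      (((2 * Real.pi / a) ^ ((d : ℝ) / 2) * Real.exp (-(a⁻¹ * ‖x‖ ^ 2 / 2)) : ℝ) : ℂ) := by
  have h := GaussianFourier.integral_cexp_neg_mul_sq_norm_add (V := Space d) (b := ((a / 2 : ℝ) : ℂ))
    (by simpa using ha) (-Complex.I) x
  have e : fourierInt (gaussianSchwartz d ha : Space d → ℂ) x =
      ∫ v : Space d, Complex.exp (-((a / 2 : ℝ) : ℂ) * ‖v‖ ^ 2 + -Complex.I * inner ℝ x v) := by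
    unfold fourierInt
    congr 1; ext v
    rw [gaussianSchwartz_apply, Complex.ofReal_exp, ← Complex.exp_add, real_inner_comm]
    congr 1; push_cast; ring
  rw [e, h, finrank_euclideanSpace, Fintype.card_fin, Complex.ofReal_mul, Complex.ofReal_exp,
    Complex.ofReal_cpow (by positivity)]
  have hac : (a : ℂ) ≠ 0 := Complex.ofReal_ne_zero.2 ha.ne'
  congr 1
  · push_cast; congr 1; field_simp
  · congr 1
    rw [neg_sq, Complex.I_sq]; push_cast; field_simp; ring

lemma integral_radial {d : ℕ} (hd : 1 ≤ d) {f : ℝ → ℂ} {a : ℝ} :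
    (Integrable (fun x : Space d => f ‖x‖ * ((Real.exp (-(a * ‖x‖ ^ 2 / 2)) : ℝ) : ℂ)) →
      Integrable (fun r => f r * (gam (d - 1) a r : ℂ)) nu) ∧
    ∫ x : Space d, f ‖x‖ * ((Real.exp (-(a * ‖x‖ ^ 2 / 2)) : ℝ) : ℂ) =
      ((d * volume.real (Metric.ball (0 : Space d) 1) : ℝ) : ℂ) * ∫ r, f r * (gam (d - 1) a r : ℂ) ∂nu := by
  have : Nontrivial (Space d) := by
    have : Nonempty (Fin d) := ⟨⟨0, hd⟩⟩
    infer_instance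
  have e : ∀ r : ℝ, r ^ (d - 1) • (f r * ((Real.exp (-(a * r ^ 2 / 2)) : ℝ) : ℂ)) =
      f r * (gam (d - 1) a r : ℂ) := fun r => by
    unfold gam
    rw [Complex.real_smul]; push_cast; ring
  constructor
  · intro h
    have := (integrable_fun_norm_addHaar (E := Space d) volume
      (f := fun r : ℝ => f r * ((Real.exp (-(a * r ^ 2 / 2)) : ℝ) : ℂ))).1 h
    rw [finrank_euclideanSpace, Fintype.card_fin] at this
    simp only [e] at this
    exact this
  · have := integral_fun_norm_addHaar (E := Space d) volume
      (fun r : ℝ => f r * ((Real.exp (-(a * r ^ 2 / 2)) : ℝ) : ℂ))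
    rw [finrank_euclideanSpace, Fintype.card_fin] at this
    simp only [e] at this
    rw [this, nsmul_eq_mul, Complex.real_smul]
    push_cast; ring

/-- The Fourier transform of radial functions tested against Gaussians. -/
lemma radial_fourier_gaussian {d : ℕ} (hd : 1 ≤ d) {f F : ℝ → ℂ} (h : IsRadialFourier d f F) {a : ℝ}
    (ha : 0 < a) :
    Integrable (fun r => f r * (gam (d - 1) a r : ℂ)) nu ∧
    Integrable (fun r => F r * (gam (d - 1) a r : ℂ)) nu ∧
    ∫ r, F r * (gam (d - 1) a r : ℂ) ∂nu =
      (((2 * Real.pi / a) ^ ((d : ℝ) / 2) : ℝ) : ℂ) * ∫ r, f r * (gam (d - 1) a⁻¹ r : ℂ) ∂nu := by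
  obtain ⟨h1, h2, h3⟩ := h
  refine ⟨(integral_radial hd).1 (h1 (gaussianSchwartz d ha)),
    (integral_radial hd).1 (h2 (gaussianSchwartz d ha)), ?_⟩
  have h4 := h3 (gaussianSchwartz d ha)
  simp only [fourierInt_gaussian, gaussianSchwartz_apply] at h4
  rw [(integral_radial hd).2] at h4
  have e : ∀ x : Space d, f ‖x‖ * (((2 * Real.pi / a) ^ ((d : ℝ) / 2) *
      Real.exp (-(a⁻¹ * ‖x‖ ^ 2 / 2)) : ℝ) : ℂ) = (((2 * Real.pi / a) ^ ((d : ℝ) / 2) : ℝ) : ℂ) *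
        (f ‖x‖ * ((Real.exp (-(a⁻¹ * ‖x‖ ^ 2 / 2)) : ℝ) : ℂ)) := fun x => by push_cast; ring
  simp only [e] at h4
  rw [integral_const_mul, (integral_radial hd).2, mul_left_comm] at h4
  refine mul_left_cancel₀ ?_ h4
  rw [Complex.ofReal_ne_zero]
  refine mul_ne_zero (by exact_mod_cast (by omega : d ≠ 0)) ?_
  have : Nonempty (Fin d) := ⟨⟨0, hd⟩⟩
  exact (ENNReal.toReal_pos (Metric.measure_ball_pos _ _ one_pos).ne' measure_ball_lt_top.ne).ne'

lemma measurable_radialDensity (d : ℕ) : Measurable fun r : ℝ => ENNReal.ofReal (r ^ (d - 1)) := by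
  fun_prop

lemma eLpNorm_weighted {m d : ℕ} (hd : d = 2 * m + 1) (w : ℝ → ℂ) :
    eLpNorm (weighted m w) 2 nu = eLpNorm w 2 (radialMeasure d) := by
  have h : eLpNorm (weighted m w) 2 nu ^ 2 = eLpNorm w 2 (radialMeasure d) ^ 2 := by
    rw [eLpNorm_two_sq, eLpNorm_two_sq, radialMeasure, lintegral_withDensity_eq_lintegral_mul_non_measurable _
      (measurable_radialDensity d) (Eventually.of_forall fun r => ENNReal.ofReal_lt_top)]
    refine setLIntegral_congr_fun measurableSet_Ioi fun r hr => ?_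
    have hr : (0 : ℝ) < r := hr
    rw [Pi.mul_apply, weighted, enorm_mul, mul_pow, show d - 1 = 2 * m by omega]
    congr 1
    rw [← ofReal_norm, Complex.norm_real, Real.norm_eq_abs, abs_of_nonneg (by positivity),
      ← ENNReal.ofReal_pow (by positivity), ← pow_mul, mul_comm m 2]
  exact le_antisymm ((ENNReal.pow_le_pow_left_iff two_ne_zero).1 h.le)
    ((ENNReal.pow_le_pow_left_iff two_ne_zero).1 h.ge)

lemma memLp_weighted_iff {m d : ℕ} (hd : d = 2 * m + 1) {w : ℝ → ℂ} :
    MemLp (weighted m w) 2 nu ↔ MemLp w 2 (radialMeasure d) := by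
  have hac1 : radialMeasure d ≪ nu := withDensity_absolutelyContinuous _ _
  have hac2 : nu ≪ radialMeasure d := by
    refine withDensity_absolutelyContinuous' (measurable_radialDensity d).aemeasurable ?_
    filter_upwards [ae_restrict_mem measurableSet_Ioi] with r hr
    have hr : (0 : ℝ) < r := hr
    rw [Ne, ENNReal.ofReal_eq_zero, not_le]; positivity
  have hc : Continuous fun r : ℝ => ((r ^ m : ℝ) : ℂ) := by fun_prop
  constructor
  · intro h
    refine ⟨?_, by rw [← eLpNorm_weighted hd]; exact h.2⟩
    have h1 : AEStronglyMeasurable (fun r : ℝ => (((r ^ m)⁻¹ : ℝ) : ℂ) * weighted m w r) nu := by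
      refine AEStronglyMeasurable.mul (Measurable.aestronglyMeasurable ?_) h.1
      fun_prop
    refine (h1.mono_ac hac1).congr (hac1.ae_le ?_)
    filter_upwards [ae_restrict_mem measurableSet_Ioi] with r hr
    have hr : (0 : ℝ) < r := hr
    have : (r : ℂ) ≠ 0 := Complex.ofReal_ne_zero.2 hr.ne'
    unfold weighted
    push_cast; field_simp
  · intro h
    exact ⟨hc.aestronglyMeasurable.mul (h.1.mono_ac hac2), by rw [eLpNorm_weighted hd]; exact h.2⟩

/-- Powers of r can be moved between the profile and the test function. The weight r^{d-1} of polar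
coordinates is split as m + m for L² data, and as n + (n + 2) for Ḣ¹ profiles, where only r^n f is
known to be in L². -/
lemma weighted_mul_gam (m k : ℕ) (w : ℝ → ℂ) (a r : ℝ) :
    weighted m w r * (gam k a r : ℂ) = w r * (gam (m + k) a r : ℂ) := by
  unfold weighted gam
  push_cast; rw [pow_add]; ring

/-- The Gaussian constant on ℝ^d is (2π)^{d/2} times the constant of H_m, which explains the
normalization factor in front of the profiles. -/
lemma two_pi_div_rpow {m d : ℕ} (hd : d = 2 * m + 1) {a : ℝ} (ha : 0 < a) :
    (2 * Real.pi / a) ^ ((d : ℝ) / 2) = (2 * Real.pi) ^ ((d : ℝ) / 2) * a ^ (-((m : ℝ) + 1 / 2)) := by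
  rw [Real.div_rpow (by positivity) ha.le, Real.rpow_neg ha.le, div_eq_mul_inv]
  congr 3
  rw [hd]; push_cast; ring

/-- The Fourier transform of a radial `L²` function is a Hankel transform. -/
lemma hankel_of_radial_fourier {m d : ℕ} (hd : d = 2 * m + 1) {g ghat : ℝ → ℂ}
    (hg : MemLp (weighted m g) 2 nu) (h : IsRadialFourier d g ghat) :
    hankel m (fun r => (((2 * Real.pi) ^ ((d : ℝ) / 2) : ℝ) : ℂ) * weighted m g r) =ᵐ[nu] weighted m ghat := by
  have e : ∀ (w : ℝ → ℂ) a r, weighted m w r * (gam m a r : ℂ) = w r * (gam (d - 1) a r : ℂ) := fun w a r => by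
    rw [weighted_mul_gam, hd]; congr 3; omega
  refine hankel_eq_of_integral m (hg.const_mul _) (fun a ha => ?_) fun a ha => ?_
  · simp only [e]
    exact (radial_fourier_gaussian (by omega) h ha).2.1
  · simp only [mul_assoc, e]
    rw [(radial_fourier_gaussian (by omega) h ha).2.2, integral_const_mul, two_pi_div_rpow hd ha]
    push_cast; ring

/-! ### Weak derivatives, decaying primitives and Ḣ¹ profiles -/

lemma memLp_ofReal_norm {h : ℝ → ℂ} {μ : Measure ℝ} (hh : MemLp h 2 μ) :
    MemLp (fun r => ((‖h r‖ : ℝ) : ℂ)) 2 μ :=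
  hh.of_le (Complex.continuous_ofReal.comp_aestronglyMeasurable hh.1.norm)
    (Eventually.of_forall fun r => by simp)

/-- The pairing of `dil a h` with a function in `L²` converges absolutely. -/
lemma integrable_dil_mul {a h w : ℝ → ℂ} (ha : Measurable a) (hN : kerN a ≠ ⊤) (hh : MemLp h 2 nu)
    (hw : MemLp w 2 nu) :
    Integrable (fun p : ℝ × ℝ => ((p.2⁻¹ : ℝ) : ℂ) * a (p.1 / p.2) * h p.2 * w p.1) (nu.prod nu) := by
  have hm := aestronglyMeasurable_dil_uncurry ha hh.1
  have hm2 : AEStronglyMeasurable (fun p : ℝ × ℝ => ((p.2⁻¹ : ℝ) : ℂ) * a (p.1 / p.2) * h p.2 * w p.1)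
    (nu.prod nu) := hm.mul hw.1.comp_fst
  rw [integrable_prod_iff hm2]
  constructor
  · filter_upwards [ae_integrable_dil ha hN hh] with s hs using hs.mul_const _
  · have hN' : kerN (fun u => ((‖a u‖ : ℝ) : ℂ)) ≠ ⊤ := by
      have : kerN (fun u => ((‖a u‖ : ℝ) : ℂ)) = kerN a := by
        unfold kerN
        congr 1; ext u
        congr 1
        rw [← ofReal_norm, ← ofReal_norm]; simp
      rwa [this]
    have h1 := integrable_mul_of_memLp (memLp_dil (a := fun u => ((‖a u‖ : ℝ) : ℂ)) (by fun_prop) hN'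
      (memLp_ofReal_norm hh)) (memLp_ofReal_norm hw)
    refine h1.norm.congr ?_
    filter_upwards with s
    have e : dil (fun u => ((‖a u‖ : ℝ) : ℂ)) (fun r => ((‖h r‖ : ℝ) : ℂ)) s =
        ((∫ r, ‖((r⁻¹ : ℝ) : ℂ) * a (s / r) * h r‖ ∂nu : ℝ) : ℂ) := by
      unfold dil
      rw [← integral_complex_ofReal]
      refine setIntegral_congr_fun measurableSet_Ioi fun r hr => ?_
      have hr : (0 : ℝ) < r := hr
      rw [norm_mul, norm_mul, Complex.norm_real, Real.norm_eq_abs, abs_of_pos (inv_pos.2 hr)]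
      push_cast; ring
    rw [e, norm_mul, Complex.norm_real, Complex.norm_real, Real.norm_eq_abs,
      abs_of_nonneg (integral_nonneg fun r => norm_nonneg _), norm_norm, ← integral_mul_const]
    simp only [norm_mul]

/-- Integration by parts for the weighted primitive. -/
lemma integral_dil_hardyKer_mul {n : ℕ} {h w W W' : ℝ → ℂ} (hh : MemLp h 2 nu) (hw : MemLp w 2 nu)
    (hW : ∀ s, HasDerivAt W (W' s) s) (hW' : Continuous W') (h0 : W 0 = 0)
    (e : ∀ s, 0 < s → W' s = (s : ℂ) ^ n * w s) :
    ∫ s, dil (hardyKer n) h s * w s ∂nu = ∫ r, h r * ((((r ^ (n + 1))⁻¹ : ℝ) : ℂ) * W r) ∂nu := by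
  have hp := integrable_dil_mul (measurable_hardyKer n) (kerN_hardyKer_ne_top n) hh hw
  have e1 : ∀ s, dil (hardyKer n) h s * w s =
      ∫ r, ((r⁻¹ : ℝ) : ℂ) * hardyKer n (s / r) * h r * w s ∂nu := fun s => by
    unfold dil; rw [integral_mul_const]
  simp only [e1]
  rw [integral_integral_swap hp]
  refine setIntegral_congr_fun measurableSet_Ioi fun r hr => ?_
  have hr : (0 : ℝ) < r := hr
  have hrc : (r : ℂ) ≠ 0 := Complex.ofReal_ne_zero.2 hr.ne'
  have key := intervalIntegral.integral_eq_sub_of_hasDerivAt (fun s _ => hW s) (hW'.intervalIntegrable 0 r)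
  rw [h0, sub_zero, intervalIntegral.integral_of_le hr.le, integral_Ioc_eq_integral_Ioo,
    ← integral_indicator measurableSet_Ioo] at key
  rw [← key, ← integral_const_mul, ← integral_const_mul, ← integral_indicator measurableSet_Ioi]
  congr 1; ext s
  by_cases h1 : s ∈ Ioi (0 : ℝ)
  · have hs : (0 : ℝ) < s := h1
    rw [indicator_of_mem h1]
    by_cases h2 : s < r
    · rw [indicator_of_mem (show s ∈ Ioo 0 r from ⟨hs, h2⟩), hardyKer,
        indicator_of_mem (show s / r ∈ Iio 1 from (div_lt_one hr).2 h2), e s hs]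
      push_cast
      rw [div_pow]
      field_simp
      ring
    · rw [indicator_of_notMem (fun h => h2 h.2), hardyKer,
        indicator_of_notMem (show s / r ∉ Iio 1 from fun h => h2 ((div_lt_one hr).1 h))]
      ring
  · rw [indicator_of_notMem h1, indicator_of_notMem (fun h => h1 h.1)]
    ring

lemma integrable_mul_test {w : ℝ → ℂ} (hw : LocallyIntegrableOn w (Ioi 0)) {φ : ℝ → ℝ} (hφ : Continuous φ)
    (hc : HasCompactSupport φ) (hs : tsupport φ ⊆ Ioi 0) :
    Integrable fun r => w r * ((φ r : ℝ) : ℂ) := by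
  obtain ⟨C, hC⟩ := hc.exists_bound_of_continuous hφ
  have h1 : IntegrableOn w (tsupport φ) := hw.integrableOn_compact_subset hs hc
  have h2 : IntegrableOn (fun r => w r * ((φ r : ℝ) : ℂ)) (tsupport φ) := by
    refine Integrable.mul_bdd (c := C) h1 (Complex.continuous_ofReal.comp hφ).aestronglyMeasurable
      (Eventually.of_forall fun r => ?_)
    rw [Complex.norm_real]; exact hC r
  refine (integrableOn_iff_integrable_of_support_subset ?_).1 h2
  intro r hr
  by_contra h
  exact hr (by simp [image_eq_zero_of_notMem_tsupport h])

lemma setIntegral_mul_test (w : ℝ → ℂ) {φ : ℝ → ℝ} (hs : tsupport φ ⊆ Ioi 0) :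
    ∫ r in Ioi (0 : ℝ), w r * ((φ r : ℝ) : ℂ) = ∫ r, w r * ((φ r : ℝ) : ℂ) := by
  refine setIntegral_eq_integral_of_forall_compl_eq_zero fun r hr => ?_
  rw [image_eq_zero_of_notMem_tsupport fun h => hr (hs h)]; simp

/-- A locally integrable function on `(0,∞)` whose weak derivative vanishes is constant. -/
lemma ae_eq_const_of_weak_deriv_zero {w : ℝ → ℂ} (hw : LocallyIntegrableOn w (Ioi 0))
    (h : ∀ φ : ℝ → ℝ, ContDiff ℝ ∞ φ → HasCompactSupport φ → tsupport φ ⊆ Ioi 0 →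
      ∫ r in Ioi (0 : ℝ), w r * ((deriv φ r : ℝ) : ℂ) = 0) : ∃ C : ℂ, ∀ᵐ r ∂nu, w r = C := by
  let b : ContDiffBump (2 : ℝ) := ⟨1 / 2, 1, by norm_num, by norm_num⟩
  set χ : ℝ → ℝ := b.normed volume with hχ
  have hχc : Continuous χ := b.continuous_normed
  have hχs : tsupport χ = Metric.closedBall 2 1 := b.tsupport_normed_eq
  have hχ1 : ∫ x, χ x = 1 := b.integral_normed
  have hχk : HasCompactSupport χ := b.hasCompactSupport_normed
  have hχp : tsupport χ ⊆ Ioi 0 := by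
    rw [hχs, Real.closedBall_eq_Icc]
    intro x hx
    have : (2 : ℝ) - 1 ≤ x := hx.1
    show (0 : ℝ) < x
    linarith
  refine ⟨∫ r, w r * ((χ r : ℝ) : ℂ), ?_⟩
  set C := ∫ r, w r * ((χ r : ℝ) : ℂ) with hC
  rw [ae_restrict_iff' measurableSet_Ioi]
  have key := isOpen_Ioi.ae_eq_zero_of_integral_contDiff_smul_eq_zero (μ := volume) (f := fun r => w r - C)
    (hw.sub ((locallyIntegrable_const C).locallyIntegrableOn _)) (fun g hg hgc hgs => ?_)
  · filter_upwards [key] with r hr h0 using sub_eq_zero.1 (hr h0)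
  set I : ℝ := ∫ x, g x with hI
  -- Subtracting (∫g)χ makes the mean zero, so the primitive φ of ψ has compact support in (0,∞) and
  -- is an admissible test function. Testing with φ' = ψ gives ∫wg = C∫g.
  set ψ : ℝ → ℝ := fun x => g x - I * χ x with hψ
  have hψd : ContDiff ℝ ∞ ψ := hg.sub (contDiff_const.mul b.contDiff_normed)
  have hgi : Integrable g := hg.continuous.integrable_of_hasCompactSupport hgc
  have hχi : Integrable χ := hχc.integrable_of_hasCompactSupport hχk
  have hψi : Integrable ψ := hgi.sub (hχi.const_mul I)
  have hψ0 : ∫ x, ψ x = 0 := by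
    rw [hψ, integral_sub hgi (hχi.const_mul I), integral_const_mul, hχ1, ← hI]; ring
  set K : Set ℝ := tsupport g ∪ tsupport χ with hK
  have hKc : IsCompact K := hgc.isCompact.union hχk.isCompact
  have hKne : K.Nonempty := ⟨2, Or.inr (by rw [hχs]; simp)⟩
  obtain ⟨δ, hδK, hδ⟩ := hKc.exists_isLeast hKne
  obtain ⟨M, _, hM⟩ := hKc.exists_isGreatest hKne
  have hδ0 : 0 < δ := (union_subset hgs hχp) hδK
  have hψz : ∀ x, x ∉ K → ψ x = 0 := fun x hx => by
    rw [hψ]; dsimp only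
    rw [image_eq_zero_of_notMem_tsupport fun h => hx (Or.inl h),
      image_eq_zero_of_notMem_tsupport fun h => hx (Or.inr h)]; ring
  set φ : ℝ → ℝ := fun x => ∫ y in Iic x, ψ y with hφ
  have hφe : ∀ x, φ x = (∫ y in Iic 0, ψ y) + ∫ y in (0 : ℝ)..x, ψ y := fun x => by
    have := intervalIntegral.integral_Iic_sub_Iic (μ := volume) (a := 0) (b := x) (f := ψ)
      hψi.integrableOn hψi.integrableOn
    rw [← this]; ring
  have hφd : ∀ x, HasDerivAt φ (ψ x) x := fun x => by
    rw [show φ = fun x => (∫ y in Iic 0, ψ y) + ∫ y in (0 : ℝ)..x, ψ y from funext hφe]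
    exact (intervalIntegral.integral_hasDerivAt_right (hψd.continuous.intervalIntegrable _ _)
      (hψd.continuous.stronglyMeasurableAtFilter _ _) hψd.continuous.continuousAt).const_add _
  have hφd' : deriv φ = ψ := funext fun x => (hφd x).deriv
  have hφs : Function.support φ ⊆ Icc δ M := by
    intro x hx
    by_contra hcon
    refine hx ?_
    rw [mem_Icc, not_and_or, not_le, not_le] at hcon
    rcases hcon with hcon | hcon
    · refine setIntegral_eq_zero_of_forall_eq_zero fun y hy => hψz y fun hyK => ?_
      exact absurd ((hδ hyK).trans hy) (not_le.2 hcon)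
    · rw [← hψ0]
      refine setIntegral_eq_integral_of_forall_compl_eq_zero fun y hy => hψz y fun hyK => ?_
      exact hy ((hM hyK).trans hcon.le)
  have hφt : tsupport φ ⊆ Icc δ M := closure_minimal hφs isClosed_Icc
  have h1 := h φ (contDiff_infty_iff_deriv.2 ⟨fun x => (hφd x).differentiableAt, by rw [hφd']; exact hψd⟩)
    (HasCompactSupport.of_support_subset_isCompact isCompact_Icc hφs)
    (hφt.trans fun x hx => hδ0.trans_le hx.1)
  have hψs : tsupport ψ ⊆ Ioi 0 := by
    have : tsupport ψ ⊆ K := closure_minimal (fun x hx => by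
      by_contra hxK
      exact hx (hψz x hxK)) hKc.isClosed
    exact this.trans (union_subset hgs hχp)
  rw [hφd', setIntegral_mul_test w hψs] at h1
  have e1 : ∀ r, w r * ((ψ r : ℝ) : ℂ) = w r * ((g r : ℝ) : ℂ) - I * (w r * ((χ r : ℝ) : ℂ)) := fun r => by
    rw [hψ]; push_cast; ring
  have i1 := integrable_mul_test hw hg.continuous hgc hgs
  have i2 := integrable_mul_test hw hχc hχk hχp
  simp only [e1] at h1
  rw [integral_sub i1 (i2.const_mul _), integral_const_mul, ← hC] at h1
  have e2 : ∀ r, g r • (w r - C) = w r * ((g r : ℝ) : ℂ) - C * ((g r : ℝ) : ℂ) := fun r => by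
    rw [Complex.real_smul]; ring
  simp only [e2]
  have i3 : Integrable (fun r => C * ((g r : ℝ) : ℂ)) := hgi.ofReal.const_mul C
  rw [integral_sub i1 i3, integral_const_mul, integral_complex_ofReal, ← hI]
  linear_combination h1

lemma hasDerivAt_gam_param (k : ℕ) (a r : ℝ) :
    HasDerivAt (fun a => gam k a r) (-(1 / 2) * gam (k + 2) a r) a := by
  have h1 : HasDerivAt (fun a : ℝ => -(a * r ^ 2 / 2)) (-(r ^ 2 / 2)) a := by
    have := (((hasDerivAt_id a).mul_const (r ^ 2)).div_const 2).neg
    refine this.congr_deriv ?_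
    simp
  refine (h1.exp.const_mul (r ^ k)).congr_deriv ?_
  unfold gam
  ring

lemma hasDerivAt_gam (k : ℕ) (a r : ℝ) :
    HasDerivAt (gam (k + 1) a) ((k + 1) * gam k a r - a * gam (k + 2) a r) r := by
  have h1 : HasDerivAt (fun r : ℝ => -(a * r ^ 2 / 2)) (-(a * r)) r := by
    have := (((hasDerivAt_pow 2 r).const_mul a).div_const 2).neg
    refine this.congr_deriv ?_
    simp; ring
  have h := (hasDerivAt_pow (k + 1) r).mul h1.exp
  refine h.congr_deriv ?_
  unfold gam
  rw [Nat.add_sub_cancel]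
  push_cast
  ring

/-- Differentiation of Gaussian moments. -/
lemma hasDerivAt_integral_gam {K : ℝ → ℂ} {k : ℕ}
    (h1 : ∀ a : ℝ, 0 < a → Integrable (fun r => K r * (gam k a r : ℂ)) nu)
    (h2 : ∀ a : ℝ, 0 < a → Integrable (fun r => K r * (gam (k + 2) a r : ℂ)) nu) {a : ℝ} (ha : 0 < a) :
    HasDerivAt (fun a => ∫ r, K r * (gam k a r : ℂ) ∂nu)
      (-(1 / 2) * ∫ r, K r * (gam (k + 2) a r : ℂ) ∂nu) a := by
  have ha2 : 0 < a / 2 := by positivity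
  have hs : Ioi (a / 2) ∈ 𝓝 a := Ioi_mem_nhds (by linarith)
  have key := hasDerivAt_integral_of_dominated_loc_of_deriv_le (μ := nu) (𝕜 := ℝ)
    (F := fun a r => K r * (gam k a r : ℂ)) (F' := fun a r => -(1 / 2) * (K r * (gam (k + 2) a r : ℂ)))
    (x₀ := a) (s := Ioi (a / 2)) (bound := fun r => ‖K r * (gam (k + 2) (a / 2) r : ℂ)‖) hs
    (by filter_upwards [hs] with x hx using (h1 x (ha2.trans hx)).1) (h1 a ha) ((h2 a ha).const_mul _).1
    ?_ (h2 _ ha2).norm ?_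
  · rw [integral_const_mul] at key
    exact key.2
  · filter_upwards [ae_restrict_mem measurableSet_Ioi] with r hr x hx
    have hr : (0 : ℝ) < r := hr
    have hx : a / 2 < x := hx
    rw [norm_mul, norm_mul, norm_mul, Complex.norm_real, Complex.norm_real, Real.norm_eq_abs,
      Real.norm_eq_abs, abs_of_nonneg (gam_nonneg _ _ _ hr), abs_of_nonneg (gam_nonneg _ _ _ hr)]
    have h3 : gam (k + 2) x r ≤ gam (k + 2) (a / 2) r := by
      unfold gam
      gcongr
    have h4 : ‖(-(1 / 2) : ℂ)‖ ≤ 1 := by norm_num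
    calc ‖(-(1 / 2) : ℂ)‖ * (‖K r‖ * gam (k + 2) x r)
        ≤ 1 * (‖K r‖ * gam (k + 2) (a / 2) r) := by
          have := gam_nonneg (k + 2) x r hr
          gcongr
      _ = _ := one_mul _
  · filter_upwards with r x _
    have := ((hasDerivAt_gam_param k x r).ofReal_comp).const_mul (K r)
    refine this.congr_deriv ?_
    push_cast; ring

lemma locallyIntegrableOn_of_memLp_weighted {n : ℕ} {w : ℝ → ℂ} (hw : MemLp (weighted n w) 2 nu) :
    LocallyIntegrableOn w (Ioi 0) := by
  have h1 : LocallyIntegrable (weighted n w) nu := hw.locallyIntegrable one_le_two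
  have h2 : LocallyIntegrableOn (weighted n w) (Ioi 0) := by
    rw [locallyIntegrableOn_iff (isOpen_Ioi.isLocallyClosed)]
    intro k hk hkc
    have := h1.integrableOn_isCompact hkc
    rwa [IntegrableOn, Measure.restrict_restrict hkc.measurableSet, inter_eq_left.2 hk] at this
  have hc : ContinuousOn (fun r : ℝ => (((r ^ n)⁻¹ : ℝ) : ℂ)) (Ioi 0) := by
    refine Complex.continuous_ofReal.comp_continuousOn (ContinuousOn.inv₀ (by fun_prop) fun r hr => ?_)
    have hr : (0 : ℝ) < r := hr
    positivity
  have h3 := h2.continuousOn_mul hc isOpen_Ioi.isLocallyClosed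
  rw [locallyIntegrableOn_iff isOpen_Ioi.isLocallyClosed] at h3 ⊢
  intro k hk hkc
  refine (h3 k hk hkc).congr_fun (fun r hr => ?_) hkc.measurableSet
  have hr : (0 : ℝ) < r := hk hr
  have : (r : ℂ) ≠ 0 := Complex.ofReal_ne_zero.2 hr.ne'
  unfold weighted
  push_cast; field_simp

/-- The primitive `-∫_r^∞ w(x) dx`, through its weighted version. -/
def decayPrimitive (n : ℕ) (w : ℝ → ℂ) (r : ℝ) : ℂ :=
  -((((r ^ n)⁻¹ : ℝ) : ℂ) * dil (hardyKer n) (weighted (n + 1) w) r)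

lemma weighted_decayPrimitive (n : ℕ) (w : ℝ → ℂ) {r : ℝ} (hr : 0 < r) :
    weighted n (decayPrimitive n w) r = -dil (hardyKer n) (weighted (n + 1) w) r := by
  have : (r : ℂ) ≠ 0 := Complex.ofReal_ne_zero.2 hr.ne'
  change ((r ^ n : ℝ) : ℂ) * -((((r ^ n)⁻¹ : ℝ) : ℂ) * _) = _
  push_cast; field_simp

lemma weighted_decayPrimitive_ae (n : ℕ) (w : ℝ → ℂ) :
    weighted n (decayPrimitive n w) =ᵐ[nu] fun r => -dil (hardyKer n) (weighted (n + 1) w) r := by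
  filter_upwards [ae_restrict_mem measurableSet_Ioi] with r hr using weighted_decayPrimitive n w hr

lemma memLp_weighted_decayPrimitive {n : ℕ} {w : ℝ → ℂ} (hw : MemLp (weighted (n + 1) w) 2 nu) :
    MemLp (weighted n (decayPrimitive n w)) 2 nu :=
  ((memLp_dil (measurable_hardyKer n) (kerN_hardyKer_ne_top n) hw).neg).ae_eq
    (weighted_decayPrimitive_ae n w).symm

lemma weak_deriv_decayPrimitive {n : ℕ} {w : ℝ → ℂ} (hw : MemLp (weighted (n + 1) w) 2 nu) {φ : ℝ → ℝ}
    (hφ : ContDiff ℝ ∞ φ) (hc : HasCompactSupport φ) (hs : tsupport φ ⊆ Ioi 0) :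
    ∫ r in Ioi (0 : ℝ), decayPrimitive n w r * ((deriv φ r : ℝ) : ℂ) =
      -∫ r in Ioi (0 : ℝ), w r * ((φ r : ℝ) : ℂ) := by
  have hφ1 : Continuous (deriv φ) := hφ.continuous_deriv (by simp)
  -- With this v one has s^n v = φ', so the transposed Hardy operator integrates it back to φ; it is
  -- continuous because φ' vanishes near 0.
  set v : ℝ → ℂ := fun s => (((s ^ n)⁻¹ * deriv φ s : ℝ) : ℂ) with hv
  have hφt : tsupport (deriv φ) ⊆ Ioi 0 := (tsupport_deriv_subset (𝕜 := ℝ)).trans hs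
  have hvc : Continuous fun s : ℝ => (s ^ n)⁻¹ * deriv φ s := by
    rw [continuous_iff_continuousAt]
    intro s
    by_cases h : s ∈ tsupport (deriv φ)
    · have h0 : (0 : ℝ) < s := hφt h
      exact ((continuousAt_id.pow n).inv₀ (pow_ne_zero n h0.ne')).mul hφ1.continuousAt
    · have : (fun s : ℝ => (s ^ n)⁻¹ * deriv φ s) =ᶠ[𝓝 s] fun _ => 0 := by
        filter_upwards [(isClosed_tsupport (deriv φ)).isOpen_compl.mem_nhds h] with y hy
        rw [image_eq_zero_of_notMem_tsupport hy, mul_zero]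
      exact continuousAt_const.congr this.symm
  have hvm : MemLp v 2 nu := by
    have hvcs : HasCompactSupport fun s : ℝ => (s ^ n)⁻¹ * deriv φ s := hc.deriv.mul_left
    have : HasCompactSupport v := hvcs.comp_left (g := fun x : ℝ => (x : ℂ)) Complex.ofReal_zero
    exact ((Complex.continuous_ofReal.comp hvc).memLp_of_hasCompactSupport this).restrict _
  have key := integral_dil_hardyKer_mul (n := n) hw hvm (W := fun s => ((φ s : ℝ) : ℂ))
    (W' := fun s => ((deriv φ s : ℝ) : ℂ))
    (fun s => ((hφ.differentiable (by simp)).differentiableAt.hasDerivAt (x := s)).ofReal_comp)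
    (by fun_prop) (by
      rw [image_eq_zero_of_notMem_tsupport fun h => lt_irrefl (0 : ℝ) (hs h)]; simp)
    (fun s hs => by
      have : (s : ℂ) ≠ 0 := Complex.ofReal_ne_zero.2 hs.ne'
      rw [hv]; push_cast; field_simp)
  have e1 : ∫ r in Ioi (0 : ℝ), decayPrimitive n w r * ((deriv φ r : ℝ) : ℂ) =
      -∫ s, dil (hardyKer n) (weighted (n + 1) w) s * v s ∂nu := by
    rw [← integral_neg]
    congr 1; ext s
    rw [hv]; unfold decayPrimitive
    push_cast; ring
  rw [e1, key]
  congr 1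
  refine setIntegral_congr_fun measurableSet_Ioi fun r hr => ?_
  have hr : (0 : ℝ) < r := hr
  have : (r : ℂ) ≠ 0 := Complex.ofReal_ne_zero.2 hr.ne'
  unfold weighted
  push_cast; field_simp

/-- The Gaussian moments of the primitive, by parts. -/
lemma integral_decayPrimitive_gam {n : ℕ} {w : ℝ → ℂ} (hw : MemLp (weighted (n + 1) w) 2 nu) {b : ℝ}
    (hb : 0 < b) :
    (2 * n + 3) * ∫ r, decayPrimitive n w r * (gam (2 * n + 2) b r : ℂ) ∂nu -
      b * ∫ r, decayPrimitive n w r * (gam (2 * n + 4) b r : ℂ) ∂nu =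
      -∫ r, weighted (n + 1) w r * (gam (n + 2) b r : ℂ) ∂nu := by
  have hp := memLp_weighted_decayPrimitive hw
  have hv : MemLp (fun s => (2 * n + 3) * (gam (n + 2) b s : ℂ) - b * (gam (n + 4) b s : ℂ)) 2 nu :=
    ((memLp_gam (n + 2) hb).const_mul _).sub ((memLp_gam (n + 4) hb).const_mul _)
  have key := integral_dil_hardyKer_mul (n := n) hw hv (W := fun s => ((gam (2 * n + 2 + 1) b s : ℝ) : ℂ))
    (W' := fun s => (((((2 * n + 2 : ℕ) : ℝ) + 1) * gam (2 * n + 2) b s - b * gam (2 * n + 2 + 2) b s : ℝ) : ℂ))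
    (fun s => (hasDerivAt_gam (2 * n + 2) b s).ofReal_comp)
    (by have h1 := continuous_gam (2 * n + 2) b
        have h2 := continuous_gam (2 * n + 2 + 2) b
        fun_prop) (by simp [gam])
    (fun s hs => by
      unfold gam
      push_cast; ring)
  have e0 : ∀ k r, decayPrimitive n w r * (gam (n + k) b r : ℂ) =
      weighted n (decayPrimitive n w) r * (gam k b r : ℂ) := fun k r => (weighted_mul_gam n k _ b r).symm
  rw [show 2 * n + 2 = n + (n + 2) by ring, show 2 * n + 4 = n + (n + 4) by ring]
  simp only [e0]
  have i1 := integrable_mul_of_memLp hp (memLp_gam (n + 2) hb)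
  have i2 := integrable_mul_of_memLp hp (memLp_gam (n + 4) hb)
  rw [← integral_const_mul, ← integral_const_mul, ← integral_sub (i1.const_mul _) (i2.const_mul _)]
  have e1 : ∫ r, (2 * n + 3) * (weighted n (decayPrimitive n w) r * (gam (n + 2) b r : ℂ)) -
      b * (weighted n (decayPrimitive n w) r * (gam (n + 4) b r : ℂ)) ∂nu =
      -∫ s, dil (hardyKer n) (weighted (n + 1) w) s *
        ((2 * n + 3) * (gam (n + 2) b s : ℂ) - b * (gam (n + 4) b s : ℂ)) ∂nu := by
    rw [← integral_neg]
    refine integral_congr_ae ?_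
    filter_upwards [weighted_decayPrimitive_ae n w] with r hr
    rw [hr]; ring
  rw [e1, key]
  congr 1
  refine setIntegral_congr_fun measurableSet_Ioi fun r hr => ?_
  have hr : (0 : ℝ) < r := hr
  have : (r : ℂ) ≠ 0 := Complex.ofReal_ne_zero.2 hr.ne'
  unfold gam
  push_cast
  rw [show 2 * n + 2 + 1 = (n + 2) + (n + 1) by ring, pow_add (r : ℂ) (n + 2) (n + 1)]
  field_simp

/-- The factor aρ² is absorbed by half of the Gaussian, through x ≤ e^x with x = aρ²/4. The
resulting bound decreases in a, which allows dominated convergence as a → ∞. -/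
lemma mul_gam_le {n : ℕ} {a ρ : ℝ} (hρ : 0 < ρ) :
    a * gam (n + 2) a ρ ≤ 4 * gam n (a / 2) ρ := by
  have h1 : a * ρ ^ 2 / 4 ≤ Real.exp (a * ρ ^ 2 / 4) := by
    have := Real.add_one_le_exp (a * ρ ^ 2 / 4); linarith
  unfold gam
  calc a * (ρ ^ (n + 2) * Real.exp (-(a * ρ ^ 2 / 2)))
      = 4 * ρ ^ n * ((a * ρ ^ 2 / 4) * Real.exp (-(a * ρ ^ 2 / 2))) := by ring
    _ ≤ 4 * ρ ^ n * (Real.exp (a * ρ ^ 2 / 4) * Real.exp (-(a * ρ ^ 2 / 2))) := by gcongr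
    _ = 4 * (ρ ^ n * Real.exp (-(a / 2 * ρ ^ 2 / 2))) := by
        rw [← Real.exp_add, mul_assoc]; congr 3; ring

lemma tendsto_gam_atTop (n : ℕ) {ρ : ℝ} (hρ : 0 < ρ) : Tendsto (fun a => gam n a ρ) atTop (𝓝 0) := by
  have h1 : Tendsto (fun a : ℝ => -(a * ρ ^ 2 / 2)) atTop atBot := by
    have : Tendsto (fun a : ℝ => a * (ρ ^ 2 / 2)) atTop atTop :=
      tendsto_id.atTop_mul_const (by positivity)
    refine (tendsto_neg_atTop_atBot.comp this).congr fun a => ?_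
    simp only [Function.comp_apply]; ring
  have h2 := (Real.tendsto_exp_atBot.comp h1).const_mul (ρ ^ n)
  rw [mul_zero] at h2
  exact h2

/-- An `Ḣ¹` profile is the decaying primitive of its derivative. -/
lemma hdot1_eq_decayPrimitive {n d : ℕ} (hd : d = 2 * (n + 1) + 1) {f f' fhat : ℝ → ℂ}
    (hf : IsRadialHdot1 d f f' fhat) (hF : MemLp (weighted (n + 2) fhat) 2 nu) :
    f =ᵐ[nu] decayPrimitive n f' := by
  have hd1 : 1 ≤ d := by omega
  have hd2 : d - 1 = 2 * n + 2 := by omega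
  have h1 : MemLp (weighted (n + 1) f') 2 nu := (memLp_weighted_iff hd).2 hf.memLp_deriv
  set p := decayPrimitive n f' with hp
  have hpm : MemLp (weighted n p) 2 nu := memLp_weighted_decayPrimitive h1
  have hpl := locallyIntegrableOn_of_memLp_weighted hpm
  -- f and the decaying primitive of f' have the same weak derivative, so they differ by a constant
  -- C. It remains to exclude a point mass of the Fourier transform at the origin.
  obtain ⟨C, hC⟩ := ae_eq_const_of_weak_deriv_zero (w := fun r => f r - p r) (hf.weakDeriv.1.sub hpl)
    (fun φ hφ hc hs => by
      have hφ1 : Continuous (deriv φ) := hφ.continuous_deriv (by simp)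
      have hφt : tsupport (deriv φ) ⊆ Ioi 0 := (tsupport_deriv_subset (𝕜 := ℝ)).trans hs
      simp only [sub_mul]
      rw [integral_sub (integrable_mul_test hf.weakDeriv.1 hφ1 hc.deriv hφt).integrableOn
        (integrable_mul_test hpl hφ1 hc.deriv hφt).integrableOn, hf.weakDeriv.2.2 φ hφ hc hs,
        weak_deriv_decayPrimitive h1 hφ hc hs, sub_self])
  set H := hankel (n + 2) (weighted n p) with hH
  have hHm : MemLp H 2 nu := memLp_hankel _ hpm
  -- The Fourier pairing with the Gaussian of parameter a. The constant C contributes a term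
  -- independent of a, by scaling, whereas the other terms tend to 0 as a → ∞. Since r^n p is in L²,
  -- its contribution is expressed by the Hankel transform of order n + 2.
  have hKey : ∀ a : ℝ, 0 < a → ∫ r, weighted (n + 2) fhat r * (gam n a r : ℂ) ∂nu =
      ((2 * Real.pi) ^ ((d : ℝ) / 2) : ℝ) * (((((1 / 2 : ℝ)) ^ (-((2 * n + 3 : ℝ)) / 2) * (1 / 2) *
        Real.Gamma ((2 * n + 3) / 2) : ℝ) : ℂ) * C + ∫ r, H r * ((a * gam (n + 2) a r : ℝ) : ℂ) ∂nu) := by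
    intro a ha
    have hai : 0 < a⁻¹ := inv_pos.2 ha
    have h2 := (radial_fourier_gaussian hd1 hf.fourier ha).2.2
    rw [hd2] at h2
    have e1 : ∀ r, weighted (n + 2) fhat r * (gam n a r : ℂ) = fhat r * (gam (2 * n + 2) a r : ℂ) := fun r => by
      rw [weighted_mul_gam, show n + 2 + n = 2 * n + 2 by ring]
    simp only [e1]
    have e2 : ∀ r, p r * (gam (2 * n + 2) a⁻¹ r : ℂ) = weighted n p r * (gam (n + 2) a⁻¹ r : ℂ) := fun r => by
      rw [weighted_mul_gam, show n + (n + 2) = 2 * n + 2 by ring]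
    have e3 : ∫ r, f r * (gam (2 * n + 2) a⁻¹ r : ℂ) ∂nu =
        C * ∫ r, ((gam (2 * n + 2) a⁻¹ r : ℝ) : ℂ) ∂nu +
          ∫ r, weighted n p r * (gam (n + 2) a⁻¹ r : ℂ) ∂nu := by
      have i1 : Integrable (fun r => C * ((gam (2 * n + 2) a⁻¹ r : ℝ) : ℂ)) nu :=
        ((integrable_gam (2 * n + 2) hai).ofReal).const_mul C
      have i2 : Integrable (fun r => weighted n p r * (gam (n + 2) a⁻¹ r : ℂ)) nu :=
        integrable_mul_of_memLp hpm (memLp_gam (n + 2) hai)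
      rw [← integral_const_mul, ← integral_add i1 i2]
      refine integral_congr_ae ?_
      filter_upwards [hC] with r hr
      rw [← e2, ← hr]; ring
    have e4 := integral_hankel_mul_gam (n + 2) hpm ha
    have e5 : ∫ r, H r * ((a * gam (n + 2) a r : ℝ) : ℂ) ∂nu =
        a * (((a ^ (-(((n + 2 : ℕ) : ℝ) + 1 / 2)) : ℝ) : ℂ) *
          ∫ r, weighted n p r * (gam (n + 2) a⁻¹ r : ℂ) ∂nu) := by
      rw [← e4, ← integral_const_mul]
      congr 1; ext r
      push_cast; ring
    rw [h2, e3, integral_complex_ofReal, integral_gam _ hai, e5, two_pi_div_rpow hd ha]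
    have e6 : a ^ (-(((n + 1 : ℕ) : ℝ) + 1 / 2)) = a * a ^ (-(((n + 2 : ℕ) : ℝ) + 1 / 2)) := by
      conv_rhs => rw [← Real.rpow_one_add' ha.le (by push_cast; intro h; have : (0:ℝ) ≤ n := Nat.cast_nonneg n; linarith)]
      congr 1; push_cast; ring
    have e7 : a ^ (-(((n + 1 : ℕ) : ℝ) + 1 / 2)) * (a⁻¹ / 2) ^ (-(((2 * n + 2 : ℕ) : ℝ) + 1) / 2) =
        (1 / 2 : ℝ) ^ (-((2 * n + 3 : ℝ)) / 2) := by
      rw [show a⁻¹ / 2 = a⁻¹ * (1 / 2) by ring, Real.mul_rpow hai.le (by norm_num), ← mul_assoc,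
        Real.inv_rpow ha.le, ← Real.rpow_neg ha.le, ← Real.rpow_add ha]
      have : -(((n + 1 : ℕ) : ℝ) + 1 / 2) + -(-(((2 * n + 2 : ℕ) : ℝ) + 1) / 2) = 0 := by push_cast; ring
      rw [this, Real.rpow_zero, one_mul]
      congr 1; push_cast; ring
    rw [← e7, show (((2 * n + 2 : ℕ) : ℝ) + 1) / 2 = (2 * n + 3) / 2 by push_cast; ring]
    rw [mul_add, mul_add]
    congr 1
    · push_cast; ring
    · rw [e6]; push_cast; ring
  have hlim1 : Tendsto (fun a => ∫ r, weighted (n + 2) fhat r * (gam n a r : ℂ) ∂nu) atTop (𝓝 0) := by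
    have := tendsto_integral_filter_of_dominated_convergence (μ := nu) (l := (atTop : Filter ℝ))
      (F := fun a r => weighted (n + 2) fhat r * (gam n a r : ℂ)) (f := fun _ => 0)
      (fun r => ‖weighted (n + 2) fhat r * (gam n 1 r : ℂ)‖)
      (by filter_upwards [eventually_gt_atTop 0] with a ha
          exact (integrable_mul_of_memLp hF (memLp_gam n ha)).1)
      (by filter_upwards [eventually_ge_atTop 1] with a ha
          filter_upwards [ae_restrict_mem measurableSet_Ioi] with r hr
          have hr : (0 : ℝ) < r := hr
          rw [norm_mul, norm_mul, Complex.norm_real, Complex.norm_real, Real.norm_eq_abs, Real.norm_eq_abs,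
            abs_of_nonneg (gam_nonneg _ _ _ hr), abs_of_nonneg (gam_nonneg _ _ _ hr)]
          refine mul_le_mul_of_nonneg_left ?_ (norm_nonneg _)
          unfold gam
          gcongr)
      (integrable_mul_of_memLp hF (memLp_gam n one_pos)).norm
      (by filter_upwards [ae_restrict_mem measurableSet_Ioi] with r hr
          have := ((tendsto_gam_atTop n hr).ofReal).const_mul (weighted (n + 2) fhat r)
          simpa using this)
    simpa using this
  have hlim2 : Tendsto (fun a => ∫ r, H r * ((a * gam (n + 2) a r : ℝ) : ℂ) ∂nu) atTop (𝓝 0) := by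
    have hle : ∀ a r : ℝ, 0 < a → 0 < r → ‖((a * gam (n + 2) a r : ℝ) : ℂ)‖ ≤ 4 * gam n (a / 2) r :=
      fun a r ha hr => by
        rw [Complex.norm_real, Real.norm_eq_abs, abs_of_nonneg (mul_nonneg ha.le (gam_nonneg _ _ _ hr))]
        exact mul_gam_le hr
    have := tendsto_integral_filter_of_dominated_convergence (μ := nu) (l := (atTop : Filter ℝ))
      (F := fun a r => H r * ((a * gam (n + 2) a r : ℝ) : ℂ)) (f := fun _ => 0)
      (fun r => ‖H r * ((4 * gam n (1 / 2) r : ℝ) : ℂ)‖)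
      (by filter_upwards [eventually_gt_atTop 0] with a ha
          refine hHm.1.mul (Continuous.aestronglyMeasurable ?_)
          have := continuous_gam (n + 2) a
          fun_prop)
      (by filter_upwards [eventually_ge_atTop 1] with a ha
          filter_upwards [ae_restrict_mem measurableSet_Ioi] with r hr
          have hr : (0 : ℝ) < r := hr
          rw [norm_mul, norm_mul]
          refine mul_le_mul_of_nonneg_left ((hle a r (by linarith) hr).trans ?_) (norm_nonneg _)
          rw [Complex.norm_real, Real.norm_eq_abs]
          refine le_trans ?_ (le_abs_self _)
          unfold gam
          gcongr)
      (by have := integrable_mul_of_memLp hHm ((memLp_gam n (show (0 : ℝ) < 1 / 2 by norm_num)).const_mul 4)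
          refine this.norm.congr (Eventually.of_forall fun r => ?_)
          dsimp only
          push_cast; rfl)
      (by filter_upwards [ae_restrict_mem measurableSet_Ioi] with r hr
          have hr : (0 : ℝ) < r := hr
          have h3 : Tendsto (fun a : ℝ => 4 * gam n (a / 2) r) atTop (𝓝 0) := by
            have := ((tendsto_gam_atTop n hr).comp (tendsto_id.atTop_div_const (show (0 : ℝ) < 2 by norm_num))).const_mul 4
            simpa using this
          have h4 : Tendsto (fun a : ℝ => ((a * gam (n + 2) a r : ℝ) : ℂ)) atTop (𝓝 0) := by
            refine squeeze_zero_norm' ?_ h3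
            filter_upwards [eventually_gt_atTop 0] with a ha using hle a r ha hr
          have := h4.const_mul (H r)
          simpa using this)
    simpa using this
  have hlim3 := (hlim2.const_add (((((1 / 2 : ℝ)) ^ (-((2 * n + 3 : ℝ)) / 2) * (1 / 2) *
        Real.Gamma ((2 * n + 3) / 2) : ℝ) : ℂ) * C)).const_mul (((2 * Real.pi) ^ ((d : ℝ) / 2) : ℝ) : ℂ)
  have h0 := tendsto_nhds_unique (hlim1.congr' (by
    filter_upwards [eventually_gt_atTop 0] with a ha using hKey a ha)) hlim3
  rw [add_zero, eq_comm, mul_eq_zero, mul_eq_zero] at h0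
  have hC0 : C = 0 := by
    rcases h0 with h0 | h0 | h0
    · exfalso
      have : (0 : ℝ) < (2 * Real.pi) ^ ((d : ℝ) / 2) := Real.rpow_pos_of_pos (by positivity) _
      exact this.ne' (Complex.ofReal_eq_zero.1 h0)
    · exfalso
      have hG : 0 < Real.Gamma ((2 * n + 3) / 2) := Real.Gamma_pos_of_pos (by positivity)
      have : (0 : ℝ) < (1 / 2 : ℝ) ^ (-((2 * n + 3 : ℝ)) / 2) * (1 / 2) * Real.Gamma ((2 * n + 3) / 2) :=
        mul_pos (mul_pos (Real.rpow_pos_of_pos (by norm_num) _) (by norm_num)) hG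
      exact this.ne' (Complex.ofReal_eq_zero.1 h0)
    · exact h0
  filter_upwards [hC] with r hr
  rw [hC0] at hr
  exact sub_eq_zero.1 hr

/-- The Fourier transform of an `Ḣ¹` profile is the Hankel transform of its derivative. -/
lemma hankel_of_hdot1 {n d : ℕ} (hd : d = 2 * (n + 1) + 1) {f f' fhat : ℝ → ℂ}
    (hf : IsRadialHdot1 d f f' fhat) (hF : MemLp (weighted (n + 2) fhat) 2 nu) :
    hankel (n + 2) (fun r => (((-(2 * Real.pi) ^ ((d : ℝ) / 2)) : ℝ) : ℂ) * weighted (n + 1) f' r) =ᵐ[nu]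
      weighted (n + 2) fhat := by
  have hd1 : 1 ≤ d := by omega
  have hd2 : d - 1 = 2 * n + 2 := by omega
  have h1 : MemLp (weighted (n + 1) f') 2 nu := (memLp_weighted_iff hd).2 hf.memLp_deriv
  have hfp := hdot1_eq_decayPrimitive hd hf hF
  set p := decayPrimitive n f' with hp
  have hpm : MemLp (weighted n p) 2 nu := memLp_weighted_decayPrimitive h1
  refine hankel_eq_of_integral (n + 2) (h1.const_mul _)
    (fun a ha => integrable_mul_of_memLp hF (memLp_gam _ ha)) fun a ha => ?_
  have hai : 0 < a⁻¹ := inv_pos.2 ha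
  have ep : ∀ k a r, p r * (gam (2 * n + 2 + k) a r : ℂ) = weighted n p r * (gam (n + 2 + k) a r : ℂ) :=
    fun k a r => by rw [weighted_mul_gam, show n + (n + 2 + k) = 2 * n + 2 + k by ring]
  have eF : ∀ k a r, fhat r * (gam (2 * n + 2 + k) a r : ℂ) = weighted (n + 2) fhat r * (gam (n + k) a r : ℂ) :=
    fun k a r => by rw [weighted_mul_gam, show n + 2 + (n + k) = 2 * n + 2 + k by ring]
  have ip : ∀ k a, 0 < a → Integrable (fun r => p r * (gam (2 * n + 2 + k) a r : ℂ)) nu := fun k a ha => by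
    simp only [ep]; exact integrable_mul_of_memLp hpm (memLp_gam _ ha)
  have iF : ∀ k a, 0 < a → Integrable (fun r => fhat r * (gam (2 * n + 2 + k) a r : ℂ)) nu := fun k a ha => by
    simp only [eF]; exact integrable_mul_of_memLp hF (memLp_gam _ ha)
  set J : ℝ → ℂ := fun b => ∫ r, p r * (gam (2 * n + 2) b r : ℂ) ∂nu with hJ
  have hFJ : ∀ b : ℝ, 0 < b → ∫ r, fhat r * (gam (2 * n + 2) b r : ℂ) ∂nu =
      (((2 * Real.pi) ^ ((d : ℝ) / 2) : ℝ) : ℂ) * (((b ^ (-(((n + 1 : ℕ) : ℝ) + 1 / 2)) : ℝ) : ℂ) * J b⁻¹) := fun b hb => by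
    have h2 := (radial_fourier_gaussian hd1 hf.fourier hb).2.2
    rw [hd2, two_pi_div_rpow hd hb] at h2
    rw [h2, hJ]
    dsimp only
    have : ∫ r, f r * (gam (2 * n + 2) b⁻¹ r : ℂ) ∂nu = ∫ r, p r * (gam (2 * n + 2) b⁻¹ r : ℂ) ∂nu := by
      refine integral_congr_ae ?_
      filter_upwards [hfp] with r hr
      rw [hr]
    rw [this]; push_cast; ring
  -- The order-(n+2) moments needed here carry r^{2n+4} on the Fourier side, two powers more than
  -- the Gaussian on ℝ^d provides. They are obtained by differentiating the moment identity in a; on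
  -- the other side `integral_decayPrimitive_gam` recognizes the result as a moment of f'.
  have d1 := hasDerivAt_integral_gam (K := fhat) (k := 2 * n + 2) (iF 0) (iF 2) ha
  have dJ := hasDerivAt_integral_gam (K := p) (k := 2 * n + 2) (ip 0) (ip 2) hai
  have d2 : HasDerivAt (fun b => (((2 * Real.pi) ^ ((d : ℝ) / 2) : ℝ) : ℂ) *
      (((b ^ (-(((n + 1 : ℕ) : ℝ) + 1 / 2)) : ℝ) : ℂ) * J b⁻¹)) _ a :=
    (((Real.hasDerivAt_rpow_const (p := -(((n + 1 : ℕ) : ℝ) + 1 / 2)) (Or.inl ha.ne')).ofReal_comp).mul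
      (HasDerivAt.scomp a dJ (hasDerivAt_inv ha.ne'))).const_mul _
  have d3 := d1.unique (d2.congr_of_eventuallyEq (by
    filter_upwards [Ioi_mem_nhds ha] with b hb using hFJ b hb))
  have key := integral_decayPrimitive_gam h1 hai
  rw [← hp] at key
  have e1 : ∫ r, weighted (n + 2) fhat r * (gam (n + 2) a r : ℂ) ∂nu =
      ∫ r, fhat r * (gam (2 * n + 2 + 2) a r : ℂ) ∂nu := by simp only [eF]
  have hr1 : a ^ (-(((n + 1 : ℕ) : ℝ) + 1 / 2) - 1) = a ^ (-(((n + 2 : ℕ) : ℝ) + 1 / 2)) := by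
    congr 1; push_cast; ring
  have hr2 : a ^ (-(((n + 1 : ℕ) : ℝ) + 1 / 2)) = a * a ^ (-(((n + 2 : ℕ) : ℝ) + 1 / 2)) := by
    conv_rhs => rw [← Real.rpow_one_add' ha.le (by push_cast; intro h; have : (0:ℝ) ≤ n := Nat.cast_nonneg n; linarith)]
    congr 1; push_cast; ring
  rw [hr1, hr2] at d3
  have hac : (a : ℂ) ≠ 0 := Complex.ofReal_ne_zero.2 ha.ne'
  rw [e1]
  have e2 : ∀ r, (((-(2 * Real.pi) ^ ((d : ℝ) / 2)) : ℝ) : ℂ) * weighted (n + 1) f' r * (gam (n + 2) a⁻¹ r : ℂ) =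
      (((-(2 * Real.pi) ^ ((d : ℝ) / 2)) : ℝ) : ℂ) * (weighted (n + 1) f' r * (gam (n + 2) a⁻¹ r : ℂ)) := fun r => by ring
  simp only [e2]
  rw [integral_const_mul]
  simp only [Function.comp_apply, Complex.real_smul] at d3
  push_cast at d3 key ⊢
  generalize (∫ r, fhat r * (gam (2 * n + 2 + 2) a r : ℂ) ∂nu) = X at d3 ⊢
  have key' : ∫ r, weighted (n + 1) f' r * (gam (n + 2) a⁻¹ r : ℂ) ∂nu =
    -((2 * n + 3) * J a⁻¹ - (a : ℂ)⁻¹ * ∫ r, p r * (gam (2 * n + 4) a⁻¹ r : ℂ) ∂nu) := by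
    rw [key, neg_neg]
  rw [key']
  rw [show 2 * n + 2 + 2 = 2 * n + 4 by ring] at d3
  generalize (∫ r, p r * (gam (2 * n + 4) a⁻¹ r : ℂ) ∂nu) = Y at d3 ⊢
  rw [show X = -2 * (-(1 / 2) * X) by ring, d3]
  have hZ : J a⁻¹ = ∫ r, p r * (gam (2 * n + 2) a⁻¹ r : ℂ) ∂nu := rfl
  rw [← hZ]
  generalize J a⁻¹ = Z
  field_simp
  ring

/-! ### Large-time asymptotics of oscillating Hankel transforms -/

lemma eLpNorm_sub_comm_two {μ : Measure ℝ} (f g : ℝ → ℂ) :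
    eLpNorm (fun r => f r - g r) 2 μ = eLpNorm (fun r => g r - f r) 2 μ :=
  eLpNorm_sub_comm f g 2 μ

/-- Strong convergence in `L²` implies the convergence of the squared norms. -/
lemma tendsto_integral_norm_sq {ι : Type*} {l : Filter ι} {μ : Measure ℝ} {F : ι → ℝ → ℂ} {Y : ℝ → ℂ}
    (hF : ∀ᶠ i in l, MemLp (F i) 2 μ) (hY : MemLp Y 2 μ)
    (h : Tendsto (fun i => eLpNorm (fun r => F i r - Y r) 2 μ) l (𝓝 0)) :
    Tendsto (fun i => ∫ r, ‖F i r‖ ^ 2 ∂μ) l (𝓝 (∫ r, ‖Y r‖ ^ 2 ∂μ)) := by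
  have h' : Tendsto (fun i => (eLpNorm (fun r => F i r - Y r) 2 μ).toReal) l (𝓝 0) := by
    have := (ENNReal.tendsto_toReal ENNReal.zero_ne_top).comp h
    simpa [Function.comp_def] using this
  have hn : Tendsto (fun i => (eLpNorm (F i) 2 μ).toReal) l (𝓝 (eLpNorm Y 2 μ).toReal) := by
    rw [tendsto_iff_dist_tendsto_zero]
    refine squeeze_zero' (Eventually.of_forall fun _ => dist_nonneg) ?_ h'
    filter_upwards [hF] with i hi
    have hd : MemLp (fun r => F i r - Y r) 2 μ := hi.sub hY
    have h1 : eLpNorm (F i) 2 μ ≤ eLpNorm (fun r => F i r - Y r) 2 μ + eLpNorm Y 2 μ := by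
      have := eLpNorm_add_le_two hd.1 hY.1
      simpa using this
    have h2 : eLpNorm Y 2 μ ≤ eLpNorm (fun r => F i r - Y r) 2 μ + eLpNorm (F i) 2 μ := by
      have := eLpNorm_add_le_two (hY.sub hi).1 hi.1
      rw [eLpNorm_sub_comm_two]
      simpa only [sub_add_cancel, Pi.sub_apply] using! this
    have h1' := ENNReal.toReal_mono (ENNReal.add_ne_top.2 ⟨hd.2.ne, hY.2.ne⟩) h1
    have h2' := ENNReal.toReal_mono (ENNReal.add_ne_top.2 ⟨hd.2.ne, hi.2.ne⟩) h2
    rw [ENNReal.toReal_add hd.2.ne hY.2.ne] at h1'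
    rw [ENNReal.toReal_add hd.2.ne hi.2.ne] at h2'
    rw [Real.dist_eq, abs_le]
    constructor <;> linarith
  rw [integral_norm_sq_eq hY]
  refine (hn.pow 2).congr' ?_
  filter_upwards [hF] with i hi using (integral_norm_sq_eq hi).symm

lemma measurePreserving_shift (τ : ℝ) :
    MeasurePreserving (fun s : ℝ => s + τ) nu (volume.restrict (Ioi τ)) := by
  have := (measurePreserving_add_right volume τ).restrict_preimage (measurableSet_Ioi (a := τ))
  simpa using this

lemma restrict_Ioi_le_nu {τ : ℝ} (hτ : 0 ≤ τ) : volume.restrict (Ioi τ) ≤ nu :=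
  Measure.restrict_mono (Ioi_subset_Ioi hτ) le_rfl

lemma ae_shift {τ : ℝ} (hτ : 0 ≤ τ) {p : ℝ → Prop} (h : ∀ᵐ s ∂nu, p s) : ∀ᵐ s ∂nu, p (s + τ) :=
  (measurePreserving_shift τ).quasiMeasurePreserving.ae (ae_mono (restrict_Ioi_le_nu hτ) h)

lemma memLp_shift {τ : ℝ} (hτ : 0 ≤ τ) {w : ℝ → ℂ} (hw : MemLp w 2 nu) :
    MemLp (fun s => w (s + τ)) 2 nu :=
  (hw.mono_measure (restrict_Ioi_le_nu hτ)).comp_measurePreserving (measurePreserving_shift τ)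

lemma eLpNorm_shift {τ : ℝ} (hτ : 0 ≤ τ) {w : ℝ → ℂ} (hw : MemLp w 2 nu) :
    eLpNorm (fun s => w (s + τ)) 2 nu = eLpNorm w 2 (volume.restrict (Ioi τ)) :=
  eLpNorm_comp_measurePreserving (hw.mono_measure (restrict_Ioi_le_nu hτ)).1 (measurePreserving_shift τ)

lemma eLpNorm_shift_le {τ : ℝ} (hτ : 0 ≤ τ) {w : ℝ → ℂ} (hw : MemLp w 2 nu) :
    eLpNorm (fun s => w (s + τ)) 2 nu ≤ eLpNorm w 2 nu := by
  rw [eLpNorm_shift hτ hw]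
  exact eLpNorm_mono_measure _ (restrict_Ioi_le_nu hτ)

lemma tendsto_eLpNorm_shift {w : ℝ → ℂ} (hw : MemLp w 2 nu) :
    Tendsto (fun τ : ℝ => eLpNorm (fun s => w (s + τ)) 2 nu) atTop (𝓝 0) := by
  have h := tendsto_eLpNorm_two_of_dominated (μ := nu) (l := (atTop : Filter ℝ))
    (F := fun τ => (Ioi τ).indicator w) (fun r => ‖w r‖)
    (Eventually.of_forall fun τ => hw.1.indicator measurableSet_Ioi)
    (Eventually.of_forall fun τ => Eventually.of_forall fun r => norm_indicator_le_norm_self _ _)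
    (integrable_norm_sq hw)
    (Eventually.of_forall fun r => by
      refine tendsto_const_nhds.congr' ?_
      filter_upwards [eventually_ge_atTop r] with τ hτ
      rw [indicator_of_notMem (by simpa using hτ)])
  refine h.congr' ?_
  filter_upwards [eventually_ge_atTop 0] with τ hτ
  rw [eLpNorm_shift hτ hw, eLpNorm_indicator_eq_eLpNorm_restrict measurableSet_Ioi,
    Measure.restrict_restrict measurableSet_Ioi, inter_eq_left.2 (Ioi_subset_Ioi hτ)]

lemma tendsto_eLpNorm_inv_shift (C : ℝ) :
    Tendsto (fun τ : ℝ => eLpNorm (fun s : ℝ => ((C / (s + τ) : ℝ) : ℂ)) 2 nu) atTop (𝓝 0) := by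
  have hw : MemLp ((Ioi 1).indicator fun r : ℝ => ((C / r : ℝ) : ℂ)) 2 nu := by
    rw [memLp_indicator_iff_restrict measurableSet_Ioi, Measure.restrict_restrict measurableSet_Ioi,
      inter_eq_left.2 (Ioi_subset_Ioi zero_le_one)]
    have hm : AEStronglyMeasurable (fun r : ℝ => ((C / r : ℝ) : ℂ)) (volume.restrict (Ioi 1)) :=
      (by fun_prop : Measurable fun r : ℝ => ((C / r : ℝ) : ℂ)).aestronglyMeasurable
    rw [memLp_two_iff_integrable_sq_norm hm]
    have hi := (integrableOn_Ioi_rpow_of_lt (show (-2 : ℝ) < -1 by norm_num) zero_lt_one).const_mul (C ^ 2)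
    refine hi.congr ?_
    filter_upwards [ae_restrict_mem measurableSet_Ioi] with r hr
    have hr : (1 : ℝ) < r := hr
    rw [Complex.norm_real, Real.norm_eq_abs, sq_abs, div_pow, Real.rpow_neg (by linarith), div_eq_mul_inv]
    norm_num
  refine (tendsto_eLpNorm_shift hw).congr' ?_
  filter_upwards [eventually_ge_atTop 1] with τ hτ
  refine eLpNorm_congr_ae ?_
  filter_upwards [ae_restrict_mem measurableSet_Ioi] with s hs
  have hs : (0 : ℝ) < s := hs
  rw [indicator_of_mem (show s + τ ∈ Ioi (1 : ℝ) by simp only [mem_Ioi]; linarith)]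

lemma memLp_bounded_mul {c : ℝ → ℝ} (hc : Measurable c) (h1 : ∀ r, |c r| ≤ 1) {w : ℝ → ℂ}
    (hw : MemLp w 2 nu) : MemLp (fun r => (c r : ℂ) * w r) 2 nu := by
  refine hw.mono ((by fun_prop : Measurable fun r => (c r : ℂ)).aestronglyMeasurable.mul hw.1)
    (Eventually.of_forall fun r => ?_)
  rw [norm_mul, Complex.norm_real, Real.norm_eq_abs]
  exact mul_le_of_le_one_left (norm_nonneg _) (h1 r)

lemma memLp_cos_mul (τ α : ℝ) {w : ℝ → ℂ} (hw : MemLp w 2 nu) :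
    MemLp (fun ρ => (Real.cos (τ * ρ - α) : ℂ) * w ρ) 2 nu :=
  memLp_bounded_mul (c := fun ρ => Real.cos (τ * ρ - α)) (by fun_prop) (fun _ => Real.abs_cos_le_one _) hw

lemma eLpNorm_cos_mul_le (τ α : ℝ) (w : ℝ → ℂ) :
    eLpNorm (fun ρ => (Real.cos (τ * ρ - α) : ℂ) * w ρ) 2 nu ≤ eLpNorm w 2 nu := by
  refine eLpNorm_mono fun r => ?_
  rw [norm_mul, Complex.norm_real, Real.norm_eq_abs]
  exact mul_le_of_le_one_left (norm_nonneg _) (Real.abs_cos_le_one _)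

/-- The outgoing profile of an oscillating Hankel transform, for integrable data. -/
lemma norm_hankel_cos_sub_le {k : ℕ} {C : ℝ}
    (hC : ∀ z : ℝ, z ≠ 0 → |bes k z - Real.cos (z - k * (Real.pi / 2))| ≤ C / |z|) (α : ℝ) {w : ℝ → ℂ}
    (hw : MemLp w 2 nu) (hi : Integrable w nu) (hi' : Integrable (fun r => ((r⁻¹ : ℝ) : ℂ) * w r) nu)
    {τ : ℝ} (hτ : 0 ≤ τ) :
    ∀ᵐ s ∂nu, ‖hankel k (fun ρ => (Real.cos (τ * ρ - α) : ℂ) * w ρ) (s + τ) -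
        (1 / 2 : ℂ) * cosT (k * (Real.pi / 2) - α) w s‖ ≤
      norm (((Real.sqrt (2 / Real.pi) * C * ∫ r, ‖((r⁻¹ : ℝ) : ℂ) * w r‖ ∂nu) / (s + τ) : ℝ) : ℂ) +
        ‖(1 / 2 : ℂ) * cosT (k * (Real.pi / 2) + α) w (s + 2 * τ)‖ := by
  have hwc := memLp_cos_mul τ α hw
  have hic : Integrable (fun ρ => (Real.cos (τ * ρ - α) : ℂ) * w ρ) nu :=
    integrable_bounded_mul hi (c := fun ρ => Real.cos (τ * ρ - α)) (by fun_prop)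
      (fun _ _ => Real.abs_cos_le_one _)
  have hC0 : 0 ≤ C := by
    have := (abs_nonneg _).trans (hC 1 one_ne_zero); simpa using this
  filter_upwards [ae_shift hτ (hankel_eq_integral k hwc hic), cosT_eq_integral (k * (Real.pi / 2) - α) hw hi,
    ae_shift (mul_nonneg zero_le_two hτ) (cosT_eq_integral (k * (Real.pi / 2) + α) hw hi),
    ae_restrict_mem measurableSet_Ioi] with s h1 h2 h3 hs
  have hs : (0 : ℝ) < s := hs
  obtain ⟨B, hB0, hB⟩ := exists_bes_bound k
  have i1 : Integrable (fun r => ((Real.sqrt (2 / Real.pi) * bes k (r * (s + τ)) : ℝ) : ℂ) *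
      ((Real.cos (τ * r - α) : ℂ) * w r)) nu := by
    refine integrable_bounded_mul hic (c := fun r => Real.sqrt (2 / Real.pi) * bes k (r * (s + τ)))
      ((measurable_bes k).comp (by fun_prop) |>.const_mul _) (C := Real.sqrt (2 / Real.pi) * B) fun r hr => ?_
    rw [abs_mul, abs_of_nonneg (Real.sqrt_nonneg _)]
    exact mul_le_mul_of_nonneg_left (hB _ (by positivity)) (Real.sqrt_nonneg _)
  have ic : ∀ β x : ℝ, Integrable (fun r => ((Real.sqrt (2 / Real.pi) * Real.cos (r * x - β) : ℝ) : ℂ) * w r) nu :=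
    fun β x => by
      refine integrable_bounded_mul hi (c := fun r => Real.sqrt (2 / Real.pi) * Real.cos (r * x - β))
        (by fun_prop) (C := Real.sqrt (2 / Real.pi)) fun r hr => ?_
      rw [abs_mul, abs_of_nonneg (Real.sqrt_nonneg _)]
      exact mul_le_of_le_one_right (Real.sqrt_nonneg _) (Real.abs_cos_le_one _)
  -- b_k is replaced by its cosine, and the product with cos(τr - α) becomes half the sum of cosines
  -- of rs and of r(s + 2τ). The first gives the profile; the second is the same type of transform
  -- translated by 2τ.
  have key : hankel k (fun ρ => (Real.cos (τ * ρ - α) : ℂ) * w ρ) (s + τ) -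
      (1 / 2 : ℂ) * cosT (k * (Real.pi / 2) - α) w s =
      (∫ r, ((Real.sqrt (2 / Real.pi) * (bes k (r * (s + τ)) - Real.cos (r * (s + τ) - k * (Real.pi / 2))) : ℝ) : ℂ) *
        ((Real.cos (τ * r - α) : ℂ) * w r) ∂nu) +
      (1 / 2 : ℂ) * cosT (k * (Real.pi / 2) + α) w (s + 2 * τ) := by
    rw [h1, h2, h3, sub_eq_iff_eq_add, ← integral_const_mul, ← integral_const_mul]
    have e : ∀ r : ℝ, ((Real.sqrt (2 / Real.pi) * (bes k (r * (s + τ)) - Real.cos (r * (s + τ) - k * (Real.pi / 2))) : ℝ) : ℂ) *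
        ((Real.cos (τ * r - α) : ℂ) * w r) = ((Real.sqrt (2 / Real.pi) * bes k (r * (s + τ)) : ℝ) : ℂ) *
      ((Real.cos (τ * r - α) : ℂ) * w r) - ((1 / 2 : ℂ) * (((Real.sqrt (2 / Real.pi) * Real.cos (r * (s + 2 * τ) - (k * (Real.pi / 2) + α)) : ℝ) : ℂ) * w r)
        + (1 / 2 : ℂ) * (((Real.sqrt (2 / Real.pi) * Real.cos (r * s - (k * (Real.pi / 2) - α)) : ℝ) : ℂ) * w r)) := fun r => by
      have hcc : Real.cos (r * (s + τ) - k * (Real.pi / 2)) * Real.cos (τ * r - α) =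
          (1 / 2) * Real.cos (r * (s + 2 * τ) - (k * (Real.pi / 2) + α)) +
          (1 / 2) * Real.cos (r * s - (k * (Real.pi / 2) - α)) := by
        rw [show r * (s + 2 * τ) - (k * (Real.pi / 2) + α) = (r * (s + τ) - k * (Real.pi / 2)) + (τ * r - α) by ring,
          show r * s - (k * (Real.pi / 2) - α) = (r * (s + τ) - k * (Real.pi / 2)) - (τ * r - α) by ring,
          Real.cos_add (r * (s + τ) - k * (Real.pi / 2)), Real.cos_sub (r * (s + τ) - k * (Real.pi / 2))]
        ring
      have hcc' := congrArg (fun x : ℝ => (x : ℂ)) hcc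
      push_cast at hcc' ⊢
      linear_combination (-(((Real.sqrt (2 / Real.pi) : ℝ) : ℂ)) * w r) * hcc'
    simp only [e]
    have i2 := (ic (k * (Real.pi / 2) + α) (s + 2 * τ)).const_mul (1 / 2 : ℂ)
    have i3 := (ic (k * (Real.pi / 2) - α) s).const_mul (1 / 2 : ℂ)
    have i23 : Integrable (fun r => (1 / 2 : ℂ) * (((Real.sqrt (2 / Real.pi) * Real.cos (r * (s + 2 * τ) - (k * (Real.pi / 2) + α)) : ℝ) : ℂ) * w r)
        + (1 / 2 : ℂ) * (((Real.sqrt (2 / Real.pi) * Real.cos (r * s - (k * (Real.pi / 2) - α)) : ℝ) : ℂ) * w r)) nu :=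
      i2.add i3
    rw [integral_sub i1 i23, integral_add i2 i3]
    ring
  rw [key]
  refine (norm_add_le _ _).trans (add_le_add_left ?_ _)
  refine (norm_integral_le_integral_norm _).trans ?_
  have hD : 0 ≤ ∫ r, ‖((r⁻¹ : ℝ) : ℂ) * w r‖ ∂nu := integral_nonneg fun _ => norm_nonneg _
  rw [Complex.norm_real, Real.norm_eq_abs, abs_of_nonneg (by positivity),
    show Real.sqrt (2 / Real.pi) * C * (∫ r, ‖((r⁻¹ : ℝ) : ℂ) * w r‖ ∂nu) / (s + τ) =
      ∫ r, (Real.sqrt (2 / Real.pi) * C / (s + τ)) * ‖((r⁻¹ : ℝ) : ℂ) * w r‖ ∂nu by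
      rw [integral_const_mul]; ring]
  refine integral_mono_of_nonneg (Eventually.of_forall fun _ => norm_nonneg _) (hi'.norm.const_mul _) ?_
  filter_upwards [ae_restrict_mem measurableSet_Ioi] with r hr
  have hr : (0 : ℝ) < r := hr
  have hz : 0 < r * (s + τ) := by positivity
  have hb := hC (r * (s + τ)) hz.ne'
  rw [abs_of_pos hz] at hb
  simp only [norm_mul, Complex.norm_real, Real.norm_eq_abs]
  rw [abs_of_nonneg (Real.sqrt_nonneg _), abs_of_pos (inv_pos.2 hr)]
  calc Real.sqrt (2 / Real.pi) * |bes k (r * (s + τ)) - Real.cos (r * (s + τ) - k * (Real.pi / 2))| *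
        (|Real.cos (τ * r - α)| * ‖w r‖)
      ≤ Real.sqrt (2 / Real.pi) * (C / (r * (s + τ))) * (1 * ‖w r‖) := by
        gcongr
        exact Real.abs_cos_le_one _
    _ = _ := by field_simp

/-- The outgoing profile of an oscillating Hankel transform. -/
lemma tendsto_hankel_cos (k : ℕ) (α : ℝ) {A : ℝ → ℂ} (hA : MemLp A 2 nu) :
    Tendsto (fun τ : ℝ => eLpNorm (fun s => hankel k (fun ρ => (Real.cos (τ * ρ - α) : ℂ) * A ρ) (s + τ) -
        (1 / 2 : ℂ) * cosT (k * (Real.pi / 2) - α) A s) 2 nu) atTop (𝓝 0) := by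
  obtain ⟨C, hC⟩ := exists_bes_sub_cos_bound k
  -- One η for the Hankel transform, which is unitary and acts on data multiplied by a cosine, and
  -- one for half of `cosT`, whose norm is at most 2.
  refine tendsto_zero_of_approx (K := 2) (by norm_num) fun η hη => ?_
  obtain ⟨w, hw, hi, hi', hle⟩ := exists_truncation hA hη
  set D := Real.sqrt (2 / Real.pi) * C * ∫ r, ‖((r⁻¹ : ℝ) : ℂ) * w r‖ ∂nu with hD
  set T := cosT (k * (Real.pi / 2) + α) w with hT
  have hTm : MemLp T 2 nu := memLp_cosT _ hw
  refine ⟨fun τ => eLpNorm (fun s : ℝ => ((D / (s + τ) : ℝ) : ℂ)) 2 nu +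
    ‖(1 / 2 : ℂ)‖ₑ * eLpNorm (fun s => T (s + 2 * τ)) 2 nu, ?_, ?_⟩
  · have h1 := tendsto_eLpNorm_inv_shift D
    have h2 : Tendsto (fun τ : ℝ => eLpNorm (fun s => T (s + 2 * τ)) 2 nu) atTop (𝓝 0) :=
      (tendsto_eLpNorm_shift hTm).comp (tendsto_id.const_mul_atTop zero_lt_two)
    have := h1.add (ENNReal.Tendsto.const_mul h2 (a := ‖(1 / 2 : ℂ)‖ₑ) (Or.inr (by simp)))
    simpa using this
  · filter_upwards [eventually_ge_atTop 0] with τ hτ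
    have hAw : MemLp (fun r => A r - w r) 2 nu := hA.sub hw
    have hc1 := memLp_cos_mul τ α hA
    have hc2 := memLp_cos_mul τ α hw
    have hc3 := memLp_cos_mul τ α hAw
    have hX := memLp_shift hτ (memLp_hankel k hc2)
    have hX3 := memLp_shift hτ (memLp_hankel k hc3)
    have hY := (memLp_cosT (k * (Real.pi / 2) - α) hw).const_mul (1 / 2 : ℂ)
    have hY3 := (memLp_cosT (k * (Real.pi / 2) - α) hAw).const_mul (1 / 2 : ℂ)
    have e1 : hankel k (fun ρ => (Real.cos (τ * ρ - α) : ℂ) * (A ρ - w ρ)) =ᵐ[nu] fun r =>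
        hankel k (fun ρ => (Real.cos (τ * ρ - α) : ℂ) * A ρ) r - hankel k (fun ρ => (Real.cos (τ * ρ - α) : ℂ) * w ρ) r := by
      have := hankel_sub k hc1 hc2
      simpa only [mul_sub] using this
    have e2 := cosT_sub (k * (Real.pi / 2) - α) hA hw
    have e3 : (fun s => hankel k (fun ρ => (Real.cos (τ * ρ - α) : ℂ) * A ρ) (s + τ) -
        (1 / 2 : ℂ) * cosT (k * (Real.pi / 2) - α) A s) =ᵐ[nu] fun s =>
        (hankel k (fun ρ => (Real.cos (τ * ρ - α) : ℂ) * w ρ) (s + τ) -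
          (1 / 2 : ℂ) * cosT (k * (Real.pi / 2) - α) w s) +
        (hankel k (fun ρ => (Real.cos (τ * ρ - α) : ℂ) * (A ρ - w ρ)) (s + τ) +
          (-(1 / 2 : ℂ)) * cosT (k * (Real.pi / 2) - α) (fun r => A r - w r) s) := by
      filter_upwards [ae_shift hτ e1, e2] with s h1 h2
      rw [h1, h2]; ring
    rw [eLpNorm_congr_ae e3]
    refine (eLpNorm_add_le_two (hX.sub hY).1 (hX3.1.add ((memLp_cosT _ hAw).const_mul _).1)).trans (add_le_add ?_ ?_)
    · refine (eLpNorm_mono_ae_real (g := fun s => ‖((D / (s + τ) : ℝ) : ℂ)‖ + ‖(1 / 2 : ℂ) * T (s + 2 * τ)‖)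
        (norm_hankel_cos_sub_le hC α hw hi hi' hτ)).trans ?_
      have hTs := memLp_shift (mul_nonneg zero_le_two hτ) hTm
      refine (eLpNorm_add_le (f := fun s : ℝ => ‖((D / (s + τ) : ℝ) : ℂ)‖) (g := fun s => ‖(1 / 2 : ℂ) * T (s + 2 * τ)‖)
        (by fun_prop : Measurable fun s : ℝ => ‖((D / (s + τ) : ℝ) : ℂ)‖).aestronglyMeasurable
        (hTs.const_mul _).1.norm one_le_two).trans ?_
      rw [eLpNorm_norm, eLpNorm_norm, eLpNorm_const_mul_two]
    · refine (eLpNorm_add_le_two hX3.1 ((memLp_cosT _ hAw).const_mul _).1).trans ?_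
      rw [two_mul, eLpNorm_const_mul_two]
      refine add_le_add ((eLpNorm_shift_le hτ (memLp_hankel k hc3)).trans ?_) ?_
      · rw [eLpNorm_hankel k hc3]
        exact (eLpNorm_cos_mul_le _ _ _).trans hle
      · calc ‖-(1 / 2 : ℂ)‖ₑ * eLpNorm (cosT (k * (Real.pi / 2) - α) fun r => A r - w r) 2 nu
            ≤ ‖-(1 / 2 : ℂ)‖ₑ * (2 * η) := by
              gcongr
              exact (eLpNorm_cosT_le _ hAw).trans (by gcongr)
          _ = η := by
              rw [← mul_assoc]
              have : ‖-(1 / 2 : ℂ)‖ₑ * 2 = 1 := by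
                rw [enorm_neg, ← ofReal_norm, show ‖(1 / 2 : ℂ)‖ = (1 / 2 : ℝ) by simp,
                  show (2 : ℝ≥0∞) = ENNReal.ofReal 2 by simp, ← ENNReal.ofReal_mul (by norm_num)]
                norm_num
              rw [this, one_mul]

/-- The exterior mass of a wave in the limit of large times. -/
lemma tendsto_exterior_mass (k : ℕ) {R : ℝ} (hR : 0 ≤ R) {A B : ℝ → ℂ} (hA : MemLp A 2 nu)
    (hB : MemLp B 2 nu) :
    Tendsto (fun τ : ℝ => ∫ r in Ici (τ + R), ‖hankel k (fun ρ => (Real.cos (τ * ρ) : ℂ) * A ρ +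
        (Real.sin (τ * ρ) : ℂ) * B ρ) r‖ ^ 2) atTop
      (𝓝 ((1 / 4) * ∫ s in Ioi R, ‖cosT (k * (Real.pi / 2)) A s +
        cosT (k * (Real.pi / 2) - Real.pi / 2) B s‖ ^ 2)) := by
  have hcA : ∀ τ, MemLp (fun ρ => (Real.cos (τ * ρ) : ℂ) * A ρ) 2 nu := fun τ => by
    simpa using memLp_cos_mul τ 0 hA
  have hsB : ∀ τ, MemLp (fun ρ => (Real.sin (τ * ρ) : ℂ) * B ρ) 2 nu := fun τ => by
    have := memLp_cos_mul τ (Real.pi / 2) hB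
    simpa only [Real.cos_sub_pi_div_two] using this
  have hW : ∀ τ, MemLp (fun ρ => (Real.cos (τ * ρ) : ℂ) * A ρ + (Real.sin (τ * ρ) : ℂ) * B ρ) 2 nu :=
    fun τ => (hcA τ).add (hsB τ)
  -- The sine is a cosine with phase π/2, which lowers the phase of the profile of B by π/2.
  set Y : ℝ → ℂ := fun s => (1 / 2 : ℂ) * (cosT (k * (Real.pi / 2)) A s +
    cosT (k * (Real.pi / 2) - Real.pi / 2) B s) with hY
  have hYm : MemLp Y 2 nu := ((memLp_cosT _ hA).add (memLp_cosT _ hB)).const_mul _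
  have h1 : Tendsto (fun τ : ℝ => eLpNorm (fun s => hankel k (fun ρ => (Real.cos (τ * ρ) : ℂ) * A ρ +
        (Real.sin (τ * ρ) : ℂ) * B ρ) (s + τ) - Y s) 2 nu) atTop (𝓝 0) := by
    have hA1 := tendsto_hankel_cos k 0 hA
    have hB1 := tendsto_hankel_cos k (Real.pi / 2) hB
    simp only [sub_zero] at hA1
    simp only [Real.cos_sub_pi_div_two] at hB1
    have hs := hA1.add hB1
    rw [add_zero] at hs
    refine tendsto_of_tendsto_of_tendsto_of_le_of_le' tendsto_const_nhds hs
      (Eventually.of_forall fun _ => bot_le) ?_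
    filter_upwards [eventually_ge_atTop 0] with τ hτ
    refine le_trans (le_of_eq (eLpNorm_congr_ae ?_)) (eLpNorm_add_le_two
      ((memLp_shift hτ (memLp_hankel k (hcA τ))).sub ((memLp_cosT _ hA).const_mul (1 / 2 : ℂ))).1
      ((memLp_shift hτ (memLp_hankel k (hsB τ))).sub ((memLp_cosT _ hB).const_mul (1 / 2 : ℂ))).1)
    filter_upwards [ae_shift hτ (hankel_add k (hcA τ) (hsB τ))] with s h
    rw [h, hY]; ring
  have hmono : volume.restrict (Ioi R) ≤ nu := restrict_Ioi_le_nu hR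
  have h2 := tendsto_integral_norm_sq (μ := volume.restrict (Ioi R)) (l := (atTop : Filter ℝ))
    (F := fun τ s => hankel k (fun ρ => (Real.cos (τ * ρ) : ℂ) * A ρ +
        (Real.sin (τ * ρ) : ℂ) * B ρ) (s + τ)) (Y := Y)
    (by filter_upwards [eventually_ge_atTop 0] with τ hτ
        exact (memLp_shift hτ (memLp_hankel k (hW τ))).mono_measure hmono)
    (hYm.mono_measure hmono)
    (tendsto_of_tendsto_of_tendsto_of_le_of_le tendsto_const_nhds h1 (fun _ => bot_le)
      fun τ => eLpNorm_mono_measure _ hmono)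
  have e : ∫ s in Ioi R, ‖Y s‖ ^ 2 = (1 / 4) * ∫ s in Ioi R, ‖cosT (k * (Real.pi / 2)) A s +
        cosT (k * (Real.pi / 2) - Real.pi / 2) B s‖ ^ 2 := by
    rw [← integral_const_mul]
    congr 1; ext s
    rw [hY]
    simp only [norm_mul, mul_pow]
    norm_num
  rw [e] at h2
  refine h2.congr fun τ => ?_
  rw [integral_Ici_eq_integral_Ioi]
  have hp := (measurePreserving_add_right volume τ).setIntegral_preimage_emb
    (measurableEmbedding_addRight τ) (fun r => ‖hankel k (fun ρ => (Real.cos (τ * ρ) : ℂ) * A ρ +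
        (Real.sin (τ * ρ) : ℂ) * B ρ) r‖ ^ 2) (Ioi (τ + R))
  rw [← hp]
  congr 2
  ext s
  simp only [mem_preimage, mem_Ioi]
  constructor <;> intro h <;> linarith

/-! ### The wave on the Fourier side and its exterior energy -/

lemma memLp_oscillation (τ : ℝ) {A B : ℝ → ℂ} (hA : MemLp A 2 nu) (hB : MemLp B 2 nu) :
    MemLp (fun ρ => (Real.cos (τ * ρ) : ℂ) * A ρ + (Real.sin (τ * ρ) : ℂ) * B ρ) 2 nu := by
  have h1 : MemLp (fun ρ => (Real.cos (τ * ρ) : ℂ) * A ρ) 2 nu := by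
    simpa using memLp_cos_mul τ 0 hA
  have h2 := memLp_cos_mul τ (Real.pi / 2) hB
  simp only [Real.cos_sub_pi_div_two] at h2
  exact h1.add h2

lemma weighted_congr_succ (m : ℕ) (w : ℝ → ℂ) :
    weighted m (fun ρ : ℝ => (ρ : ℂ) * w ρ) = weighted (m + 1) w := by
  ext r; unfold weighted; push_cast; ring

section Wave

variable {n d : ℕ} {f f' fhat g ghat : ℝ → ℂ} {u ut ur : ℝ → ℝ → ℂ}

lemma memLp_weighted_fhat {m : ℕ} (hd : d = 2 * m + 1) (hf : IsRadialHdot1 d f f' fhat) :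
    MemLp (weighted (m + 1) fhat) 2 nu := by
  rw [← weighted_congr_succ]
  exact (memLp_weighted_iff hd).2 hf.memLp_fourier

lemma memLp_weighted_ghat {m : ℕ} (hd : d = 2 * m + 1) (hg : IsRadialL2 d g ghat) :
    MemLp (weighted m ghat) 2 nu := by
  have h := (memLp_weighted_iff hd).2 hg.memLp
  exact (memLp_hankel m (h.const_mul _)).ae_eq (hankel_of_radial_fourier hd h hg.fourier)

/-- The profile of the Fourier transform of `u(t)`. -/
def waveHat (fhat ghat : ℝ → ℂ) (t ρ : ℝ) : ℂ :=
  (Real.cos (t * ρ) : ℂ) * fhat ρ + ((Real.sin (t * ρ) / ρ : ℝ) : ℂ) * ghat ρ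

lemma weighted_waveHat (m : ℕ) (fhat ghat : ℝ → ℂ) (t : ℝ) {ρ : ℝ} (hρ : 0 < ρ) :
    weighted (m + 1) (waveHat fhat ghat t) ρ =
      (Real.cos (t * ρ) : ℂ) * weighted (m + 1) fhat ρ + (Real.sin (t * ρ) : ℂ) * weighted m ghat ρ := by
  have : (ρ : ℂ) ≠ 0 := Complex.ofReal_ne_zero.2 hρ.ne'
  unfold weighted waveHat
  push_cast
  field_simp
  ring

/-- The radial derivative of the wave on the Fourier side. -/
lemma weighted_ur (hd : d = 2 * (n + 1) + 1) (hf : IsRadialHdot1 d f f' fhat) (hg : IsRadialL2 d g ghat)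
    (hu : IsRadialEnergySolution d fhat ghat u ut ur) (t : ℝ) :
    (fun r => (((2 * Real.pi) ^ ((d : ℝ) / 2) : ℝ) : ℂ) * weighted (n + 1) (ur t) r) =ᵐ[nu] fun r =>
      -hankel (n + 2) (fun ρ => (Real.cos (t * ρ) : ℂ) * weighted (n + 2) fhat ρ +
        (Real.sin (t * ρ) : ℂ) * weighted (n + 1) ghat ρ) r := by
  have hF := memLp_weighted_fhat hd hf
  have hG := memLp_weighted_ghat hd hg
  have hW := memLp_oscillation t hF hG
  have e : (fun ρ => (Real.cos (t * ρ) : ℂ) * weighted (n + 2) fhat ρ +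
        (Real.sin (t * ρ) : ℂ) * weighted (n + 1) ghat ρ) =ᵐ[nu] weighted (n + 2) (waveHat fhat ghat t) := by
    filter_upwards [ae_restrict_mem measurableSet_Ioi] with ρ hρ
    exact (weighted_waveHat (n + 1) fhat ghat t hρ).symm
  have hWu : MemLp (weighted (n + 2) (waveHat fhat ghat t)) 2 nu := hW.ae_eq e
  -- At each fixed time u(t) is itself an Ḣ¹ profile with Fourier profile `waveHat`: the extra
  -- factor ρ in the weight cancels the denominator of sin(tρ)/ρ. The formula for f' therefore
  -- applies to ∂ᵣu, and the involution property inverts it.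
  have hH : IsRadialHdot1 d (u t) (ur t) (waveHat fhat ghat t) :=
    ⟨hu.propagator t, (memLp_weighted_iff hd).1 (by rw [weighted_congr_succ]; exact hWu), hu.weakDeriv t,
      hu.memLp_ur t⟩
  have h1 := hankel_of_hdot1 hd hH hWu
  have hm := ((memLp_weighted_iff hd).2 (hu.memLp_ur t)).const_mul (((-(2 * Real.pi) ^ ((d : ℝ) / 2)) : ℝ) : ℂ)
  have h2 := hankel_hankel (n + 2) hm
  rw [hankel_congr (n + 2) (memLp_hankel _ hm) (h1.trans e.symm)] at h2
  filter_upwards [h2] with r hr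
  rw [hr]; push_cast; ring

lemma abs_sin_sub_sin_le (x y : ℝ) : |Real.sin x - Real.sin y| ≤ |x - y| := by
  have := (Real.lipschitzWith_sin).dist_le_mul x y
  simpa [Real.dist_eq] using this

lemma abs_cos_sub_cos_le (x y : ℝ) : |Real.cos x - Real.cos y| ≤ |x - y| := by
  have := (Real.lipschitzWith_cos).dist_le_mul x y
  simpa [Real.dist_eq] using this

lemma norm_integral_mul_le {μ : Measure ℝ} {p q : ℝ → ℂ} (hp : MemLp p 2 μ) (hq : MemLp q 2 μ) :
    ‖∫ r, p r * q r ∂μ‖ ≤ (eLpNorm p 2 μ * eLpNorm q 2 μ).toReal := by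
  have h1 : eLpNorm (fun r => p r * q r) 1 μ ≤ eLpNorm p 2 μ * eLpNorm q 2 μ :=
    eLpNorm_smul_le_mul_eLpNorm (p := 2) (q := 2) (r := 1) (φ := p) (f := q) hq.1 hp.1
  rw [eLpNorm_one_eq_lintegral_enorm] at h1
  have h2 := ENNReal.toReal_mono (ENNReal.mul_ne_top hp.2.ne hq.2.ne)
    ((enorm_integral_le_lintegral_enorm (fun r => p r * q r)).trans h1)
  simpa using h2

/-- Weak convergence of the difference quotients. -/
lemma tendsto_pairing_ut (hd : d = 2 * (n + 1) + 1)
    (hu : IsRadialEnergySolution d fhat ghat u ut ur) (t : ℝ) {b : ℝ} (hb : 0 < b) :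
    Tendsto (fun h : ℝ => ((∫ r, u (t + h) r * (gam (d - 1) b r : ℂ) ∂nu) -
      ∫ r, u t r * (gam (d - 1) b r : ℂ) ∂nu) / (h : ℂ)) (𝓝[≠] 0)
      (𝓝 (∫ r, weighted (n + 1) (ut t) r * (gam (n + 1) b r : ℂ) ∂nu)) := by
  have hd1 : 1 ≤ d := by omega
  have hd2 : d - 1 = (n + 1) + (n + 1) := by omega
  have hUt : MemLp (weighted (n + 1) (ut t)) 2 nu := (memLp_weighted_iff hd).2 (hu.memLp_ut t)
  have hgauss : ∀ s, Integrable (fun r => u s r * (gam (d - 1) b r : ℂ)) nu := fun s =>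
    (radial_fourier_gaussian hd1 (hu.propagator s) hb).1
  have hum : ∀ s, AEStronglyMeasurable (u s) nu := fun s =>
    (hu.weakDeriv s).1.aestronglyMeasurable
  have ht := hu.timeDeriv t
  simp only [← eLpNorm_weighted hd] at ht
  rw [tendsto_iff_norm_sub_tendsto_zero]
  set D : ℝ → ℝ → ℂ := fun h => weighted (n + 1) fun r => (u (t + h) r - u t r) / (h : ℂ) - ut t r with hD
  have hcm := memLp_gam (n + 1) hb
  have hb' : Tendsto (fun h => (eLpNorm (D h) 2 nu * eLpNorm (fun r => (gam (n + 1) b r : ℂ)) 2 nu).toReal) (𝓝[≠] 0) (𝓝 0) := by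
    have := ENNReal.Tendsto.mul_const (b := eLpNorm (fun r => (gam (n + 1) b r : ℂ)) 2 nu) ht (Or.inr hcm.2.ne)
    rw [zero_mul] at this
    have := (ENNReal.tendsto_toReal ENNReal.zero_ne_top).comp this
    simpa only [Function.comp_def, ENNReal.toReal_zero] using! this
  refine squeeze_zero' (Eventually.of_forall fun _ => norm_nonneg _) ?_ hb'
  filter_upwards [ht.eventually (gt_mem_nhds (show (0 : ℝ≥0∞) < 1 by simp))] with h hlt
  have hmeas : AEStronglyMeasurable (D h) nu := by
    have h1 : AEStronglyMeasurable (fun r => (u (t + h) r - u t r) / (h : ℂ)) nu := by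
      simp only [div_eq_mul_inv]
      exact ((hum (t + h)).sub (hum t)).mul_const _
    have h2 : AEStronglyMeasurable (weighted (n + 1) fun r => (u (t + h) r - u t r) / (h : ℂ)) nu :=
      (by fun_prop : Continuous fun r : ℝ => ((r ^ (n + 1) : ℝ) : ℂ)).aestronglyMeasurable.mul h1
    refine (h2.sub hUt.1).congr (Eventually.of_forall fun r => ?_)
    simp only [Pi.sub_apply, hD]
    unfold weighted; ring
  have hml : MemLp (D h) 2 nu := ⟨hmeas, hlt.trans ENNReal.one_lt_top⟩
  have e : ((∫ r, u (t + h) r * (gam (d - 1) b r : ℂ) ∂nu) -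
      ∫ r, u t r * (gam (d - 1) b r : ℂ) ∂nu) / (h : ℂ) -
      ∫ r, weighted (n + 1) (ut t) r * (gam (n + 1) b r : ℂ) ∂nu = ∫ r, D h r * (gam (n + 1) b r : ℂ) ∂nu := by
    have i1 : Integrable (fun r => (u (t + h) r * (gam (d - 1) b r : ℂ) - u t r * (gam (d - 1) b r : ℂ)) / (h : ℂ)) nu :=
      ((hgauss (t + h)).sub (hgauss t)).div_const (h : ℂ)
    have i2 : Integrable (fun r => weighted (n + 1) (ut t) r * (gam (n + 1) b r : ℂ)) nu :=
      integrable_mul_of_memLp hUt hcm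
    rw [← integral_sub (hgauss (t + h)) (hgauss t), ← integral_div, ← integral_sub i1 i2]
    congr 1; ext r
    rw [hD]
    dsimp only
    rw [weighted_mul_gam, weighted_mul_gam, hd2]
    ring
  rw [e]
  exact norm_integral_mul_le hml hcm

/-- The difference quotients on the Fourier side. -/
lemma tendsto_pairing_waveHat (hd : d = 2 * (n + 1) + 1)
    (hF : MemLp (weighted (n + 2) fhat) 2 nu) (hG : MemLp (weighted (n + 1) ghat) 2 nu) {a : ℝ} (ha : 0 < a)
    (hhat : ∀ s, Integrable (fun r => waveHat fhat ghat s r * (gam (d - 1) a r : ℂ)) nu) (t : ℝ) :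
    Tendsto (fun h : ℝ => ((∫ r, waveHat fhat ghat (t + h) r * (gam (d - 1) a r : ℂ) ∂nu) -
      ∫ r, waveHat fhat ghat t r * (gam (d - 1) a r : ℂ) ∂nu) / (h : ℂ)) (𝓝[≠] 0)
      (𝓝 (∫ r, ((Real.cos (t * r) : ℂ) * weighted (n + 1) ghat r +
        (Real.sin (t * r) : ℂ) * -weighted (n + 2) fhat r) * (gam (n + 1) a r : ℂ) ∂nu)) := by
  have hd2 : d - 1 = (n + 1) + (n + 1) := by omega
  have hdc := tendsto_integral_filter_of_dominated_convergence (μ := nu) (l := 𝓝[≠] (0 : ℝ))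
    (F := fun h r => (waveHat fhat ghat (t + h) r * (gam (d - 1) a r : ℂ) -
      waveHat fhat ghat t r * (gam (d - 1) a r : ℂ)) / (h : ℂ)) (f := fun r => ((Real.cos (t * r) : ℂ) * weighted (n + 1) ghat r +
        (Real.sin (t * r) : ℂ) * -weighted (n + 2) fhat r) * (gam (n + 1) a r : ℂ))
    (fun r => ‖weighted (n + 2) fhat r * (gam (n + 1) a r : ℂ)‖ + ‖weighted (n + 1) ghat r * (gam (n + 1) a r : ℂ)‖)
    (Eventually.of_forall fun h => (((hhat (t + h)).sub (hhat t)).div_const (h : ℂ)).1)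
    (by filter_upwards [self_mem_nhdsWithin] with h hh
        have hh : h ≠ 0 := hh
        filter_upwards [ae_restrict_mem measurableSet_Ioi] with r hr
        have hr : (0 : ℝ) < r := hr
        have hrc : (r : ℂ) ≠ 0 := Complex.ofReal_ne_zero.2 hr.ne'
        -- Division by hr instead of h makes the quotients of cosine and sine bounded by 1, and the
        -- factor r thus gained raises the weight of `fhat` to n + 2, where it is in L².
        have e : (waveHat fhat ghat (t + h) r * (gam (d - 1) a r : ℂ) -
          waveHat fhat ghat t r * (gam (d - 1) a r : ℂ)) / (h : ℂ) =
          (((Real.cos ((t + h) * r) - Real.cos (t * r)) / (h * r) : ℝ) : ℂ) * (weighted (n + 2) fhat r * (gam (n + 1) a r : ℂ)) +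
          (((Real.sin ((t + h) * r) - Real.sin (t * r)) / (h * r) : ℝ) : ℂ) * (weighted (n + 1) ghat r * (gam (n + 1) a r : ℂ)) := by
          have hhc : (h : ℂ) ≠ 0 := Complex.ofReal_ne_zero.2 hh
          unfold waveHat weighted gam
          rw [hd2]
          push_cast
          field_simp
          ring
        rw [e]
        have hhr : h * r ≠ 0 := mul_ne_zero hh hr.ne'
        refine (norm_add_le _ _).trans (add_le_add ?_ ?_) <;>
        · rw [norm_mul, Complex.norm_real, Real.norm_eq_abs, abs_div]
          refine mul_le_of_le_one_left (norm_nonneg _) ?_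
          rw [div_le_one (abs_pos.2 hhr)]
          first
            | refine (abs_cos_sub_cos_le _ _).trans (le_of_eq ?_)
              congr 1; ring
            | refine (abs_sin_sub_sin_le _ _).trans (le_of_eq ?_)
              congr 1; ring)
    ((integrable_mul_of_memLp hF (memLp_gam _ ha)).norm.add (integrable_mul_of_memLp hG (memLp_gam _ ha)).norm)
    (by filter_upwards [ae_restrict_mem measurableSet_Ioi] with r hr
        have hr : (0 : ℝ) < r := hr
        have hrc : (r : ℂ) ≠ 0 := Complex.ofReal_ne_zero.2 hr.ne'
        have d1 : HasDerivAt (fun s : ℝ => ((Real.cos (s * r) : ℝ) : ℂ)) _ t :=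
          (((hasDerivAt_id t).mul_const r).cos).ofReal_comp
        have d2 : HasDerivAt (fun s : ℝ => ((Real.sin (s * r) / r : ℝ) : ℂ)) _ t :=
          ((((hasDerivAt_id t).mul_const r).sin).div_const r).ofReal_comp
        have d3 := ((d1.mul_const (fhat r)).add (d2.mul_const (ghat r))).mul_const (gam (d - 1) a r : ℂ)
        have d4 := hasDerivAt_iff_tendsto_slope_zero.1 d3
        convert d4 using 1
        · ext h
          simp only [waveHat, Pi.add_apply, Complex.real_smul, Complex.ofReal_inv]
          ring
        · congr 1
          unfold weighted gam
          rw [hd2]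
          simp only [id]
          push_cast
          field_simp
          ring)
  refine hdc.congr fun h => ?_
  rw [integral_div, integral_sub (hhat (t + h)) (hhat t)]

/-- The time derivative of the wave on the Fourier side. -/
lemma weighted_ut (hd : d = 2 * (n + 1) + 1) (hf : IsRadialHdot1 d f f' fhat) (hg : IsRadialL2 d g ghat)
    (hu : IsRadialEnergySolution d fhat ghat u ut ur) (t : ℝ) :
    (fun r => (((2 * Real.pi) ^ ((d : ℝ) / 2) : ℝ) : ℂ) * weighted (n + 1) (ut t) r) =ᵐ[nu]
      hankel (n + 1) (fun ρ => (Real.cos (t * ρ) : ℂ) * weighted (n + 1) ghat ρ +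
        (Real.sin (t * ρ) : ℂ) * -weighted (n + 2) fhat ρ) := by
  have hd1 : 1 ≤ d := by omega
  have hd2 : d - 1 = (n + 1) + (n + 1) := by omega
  have hF := memLp_weighted_fhat hd hf
  have hG := memLp_weighted_ghat hd hg
  have hW := memLp_oscillation t hG hF.neg
  have hUt : MemLp (weighted (n + 1) (ut t)) 2 nu := (memLp_weighted_iff hd).2 (hu.memLp_ut t)
  set W : ℝ → ℂ := fun ρ => (Real.cos (t * ρ) : ℂ) * weighted (n + 1) ghat ρ +
        (Real.sin (t * ρ) : ℂ) * -weighted (n + 2) fhat ρ with hWd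
  have hm := hUt.const_mul (((2 * Real.pi) ^ ((d : ℝ) / 2) : ℝ) : ℂ)
  suffices h : hankel (n + 1) (fun r => (((2 * Real.pi) ^ ((d : ℝ) / 2) : ℝ) : ℂ) * weighted (n + 1) (ut t) r) =ᵐ[nu] W by
    have h2 := hankel_hankel (n + 1) hm
    rw [hankel_congr (n + 1) (memLp_hankel _ hm) h] at h2
    exact h2.symm
  refine hankel_eq_of_integral (n + 1) hm (fun a ha => integrable_mul_of_memLp hW (memLp_gam _ ha)) fun a ha => ?_
  have hai : 0 < a⁻¹ := inv_pos.2 ha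
  have hhat : ∀ s b, 0 < b → Integrable (fun r => waveHat fhat ghat s r * (gam (d - 1) b r : ℂ)) nu := fun s b hb =>
    (radial_fourier_gaussian hd1 (hu.propagator s) hb).2.1
  have hpair : ∀ s, ∫ r, waveHat fhat ghat s r * (gam (d - 1) a r : ℂ) ∂nu =
      (((2 * Real.pi / a) ^ ((d : ℝ) / 2) : ℝ) : ℂ) * ∫ r, u s r * (gam (d - 1) a⁻¹ r : ℂ) ∂nu := fun s =>
    (radial_fourier_gaussian hd1 (hu.propagator s) ha).2.2
  -- The Fourier relation tested on a Gaussian holds at every time; its difference quotients are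
  -- computed on both sides, in L² in physical space and by dominated convergence in frequency, and
  -- the limits must agree.
  have lim1 := tendsto_pairing_ut hd hu t hai
  have lim2 := tendsto_pairing_waveHat hd hF hG ha (fun s => hhat s a ha) t
  have lim3 := lim1.const_mul (((2 * Real.pi / a) ^ ((d : ℝ) / 2) : ℝ) : ℂ)
  have := tendsto_nhds_unique lim2 (lim3.congr fun h => by rw [hpair, hpair]; ring)
  rw [this, two_pi_div_rpow hd ha]
  simp only [mul_assoc]
  rw [integral_const_mul]
  push_cast; ring

/-- The exterior energy on the Fourier side. -/
lemma extEnergy_eq (hd : d = 2 * (n + 1) + 1) (hf : IsRadialHdot1 d f f' fhat) (hg : IsRadialL2 d g ghat)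
    (hu : IsRadialEnergySolution d fhat ghat u ut ur) {R : ℝ} (hR : 0 < R) (t : ℝ) :
    (2 * Real.pi) ^ d * extEnergy d R ut ur t =
      (∫ r in Ici (|t| + R), ‖hankel (n + 1) (fun ρ => (Real.cos (t * ρ) : ℂ) * weighted (n + 1) ghat ρ +
        (Real.sin (t * ρ) : ℂ) * -weighted (n + 2) fhat ρ) r‖ ^ 2) +
      ∫ r in Ici (|t| + R), ‖hankel (n + 2) (fun ρ => (Real.cos (t * ρ) : ℂ) * weighted (n + 2) fhat ρ +
        (Real.sin (t * ρ) : ℂ) * weighted (n + 1) ghat ρ) r‖ ^ 2 := by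
  have hsub : Ici (|t| + R) ⊆ Ioi 0 := fun r hr => by
    have h1 : |t| + R ≤ r := hr
    have h2 := abs_nonneg t
    simp only [mem_Ioi]; linarith
  have hd2 : d - 1 = 2 * (n + 1) := by omega
  have hc : ‖(((2 * Real.pi) ^ ((d : ℝ) / 2) : ℝ) : ℂ)‖ ^ 2 = (2 * Real.pi) ^ d := by
    rw [Complex.norm_real, Real.norm_eq_abs, sq_abs, ← Real.rpow_natCast, ← Real.rpow_mul (by positivity),
      ← Real.rpow_natCast]
    congr 1; push_cast; ring
  have key : ∀ w v : ℝ → ℂ, (∀ᵐ r ∂nu, ‖(((2 * Real.pi) ^ ((d : ℝ) / 2) : ℝ) : ℂ) * weighted (n + 1) w r‖ = ‖v r‖) →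
      (2 * Real.pi) ^ d * ∫ r in Ici (|t| + R), ‖w r‖ ^ 2 * r ^ (d - 1) = ∫ r in Ici (|t| + R), ‖v r‖ ^ 2 := by
    intro w v h
    rw [← integral_const_mul]
    refine integral_congr_ae ?_
    filter_upwards [ae_restrict_of_ae_restrict_of_subset hsub h] with r hr
    rw [← hr, norm_mul, mul_pow (norm _), hc, norm_weighted_sq, hd2]
  unfold extEnergy
  rw [mul_add]
  congr 1
  · refine key _ _ ?_
    filter_upwards [weighted_ut hd hf hg hu t] with r hr using congrArg norm hr
  · refine key _ _ ?_
    filter_upwards [weighted_ur hd hf hg hu t] with r hr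
    exact (congrArg norm hr).trans (norm_neg _)

lemma cosT_sub_pi (β : ℝ) (w : ℝ → ℂ) (r : ℝ) : cosT (β - Real.pi) w r = -cosT β w r := by
  unfold cosT
  rw [Real.cos_sub_pi, Real.sin_sub_pi]
  push_cast; ring

lemma hankel_neg_ae (k : ℕ) {w : ℝ → ℂ} (hw : MemLp w 2 nu) :
    hankel k (fun r => -w r) =ᵐ[nu] fun r => -hankel k w r := by
  have := hankel_const_mul k (-1) hw
  simpa using this

lemma cosT_neg (β : ℝ) {w : ℝ → ℂ} (hw : MemLp w 2 nu) :
    cosT β (fun r => -w r) =ᵐ[nu] fun r => -cosT β w r := by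
  filter_upwards [hankel_neg_ae 0 hw, hankel_neg_ae 1 hw] with r h0 h1
  unfold cosT
  rw [h0, h1]; ring

/-- The limits of the exterior energy. -/
lemma tendsto_extEnergy (hd : d = 2 * (n + 1) + 1) (hf : IsRadialHdot1 d f f' fhat) (hg : IsRadialL2 d g ghat)
    (hu : IsRadialEnergySolution d fhat ghat u ut ur) {R : ℝ} (hR : 0 < R) :
    Tendsto (fun t : ℝ => (2 * Real.pi) ^ d * extEnergy d R ut ur t) atTop
      (𝓝 ((1 / 2) * ∫ r in Ioi R, ‖cosT ((n + 1 : ℕ) * (Real.pi / 2)) (weighted (n + 1) ghat) r +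
        cosT ((n + 2 : ℕ) * (Real.pi / 2)) (weighted (n + 2) fhat) r‖ ^ 2)) ∧
    Tendsto (fun t : ℝ => (2 * Real.pi) ^ d * extEnergy d R ut ur t) atBot
      (𝓝 ((1 / 2) * ∫ r in Ioi R, ‖cosT ((n + 1 : ℕ) * (Real.pi / 2)) (weighted (n + 1) ghat) r -
        cosT ((n + 2 : ℕ) * (Real.pi / 2)) (weighted (n + 2) fhat) r‖ ^ 2)) := by
  have hF := memLp_weighted_fhat hd hf
  have hG := memLp_weighted_ghat hd hg
  set F := weighted (n + 2) fhat with hFd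
  set G := weighted (n + 1) ghat with hGd
  have hsub : ∀ {p : ℝ → Prop}, (∀ᵐ r ∂nu, p r) → ∀ᵐ r ∂(volume.restrict (Ioi R)), p r := fun h =>
    ae_mono (restrict_Ioi_le_nu hR.le) h
  -- The phases of ∂ₜu and ∂ᵣu coincide up to π, so that both contribute the same outgoing profile,
  -- each with the factor ¼.
  have b1 : ((n + 2 : ℕ) : ℝ) * (Real.pi / 2) - Real.pi / 2 = (n + 1 : ℕ) * (Real.pi / 2) := by
    push_cast; ring
  have b2 : ((n + 1 : ℕ) : ℝ) * (Real.pi / 2) - Real.pi / 2 = (n + 2 : ℕ) * (Real.pi / 2) - Real.pi := by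
    push_cast; ring
  have p1 := tendsto_exterior_mass (n + 1) hR.le hG hF.neg
  have p2 := tendsto_exterior_mass (n + 2) hR.le hF hG
  have p3 := tendsto_exterior_mass (n + 1) hR.le hG hF
  have p4 := tendsto_exterior_mass (n + 2) hR.le hF hG.neg
  rw [b2] at p1 p3
  rw [b1] at p2 p4
  constructor
  · have e1 : ∫ s in Ioi R, ‖cosT ((n + 1 : ℕ) * (Real.pi / 2)) G s +
        cosT ((n + 2 : ℕ) * (Real.pi / 2) - Real.pi) (-F) s‖ ^ 2 =
        ∫ s in Ioi R, ‖cosT ((n + 1 : ℕ) * (Real.pi / 2)) G s + cosT ((n + 2 : ℕ) * (Real.pi / 2)) F s‖ ^ 2 := by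
      refine integral_congr_ae ?_
      filter_upwards [hsub (cosT_neg ((n + 2 : ℕ) * (Real.pi / 2)) hF)] with s hs
      have hs' : cosT ((n + 2 : ℕ) * (Real.pi / 2)) (-F) s = -cosT ((n + 2 : ℕ) * (Real.pi / 2)) F s := hs
      rw [cosT_sub_pi, hs', neg_neg]
    have e2 : ∫ s in Ioi R, ‖cosT ((n + 2 : ℕ) * (Real.pi / 2)) F s +
        cosT ((n + 1 : ℕ) * (Real.pi / 2)) G s‖ ^ 2 =
        ∫ s in Ioi R, ‖cosT ((n + 1 : ℕ) * (Real.pi / 2)) G s + cosT ((n + 2 : ℕ) * (Real.pi / 2)) F s‖ ^ 2 := by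
      congr 1; ext s; rw [add_comm]
    rw [e1] at p1
    rw [e2] at p2
    have := p1.add p2
    refine (this.congr' ?_).trans_eq ?_
    · filter_upwards [eventually_ge_atTop 0] with t ht
      rw [extEnergy_eq hd hf hg hu hR, abs_of_nonneg ht]
      rfl
    · ring_nf
  · have e3 : ∫ s in Ioi R, ‖cosT ((n + 1 : ℕ) * (Real.pi / 2)) G s +
        cosT ((n + 2 : ℕ) * (Real.pi / 2) - Real.pi) F s‖ ^ 2 =
        ∫ s in Ioi R, ‖cosT ((n + 1 : ℕ) * (Real.pi / 2)) G s - cosT ((n + 2 : ℕ) * (Real.pi / 2)) F s‖ ^ 2 := by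
      congr 1; ext s; rw [cosT_sub_pi, sub_eq_add_neg]
    have e4 : ∫ s in Ioi R, ‖cosT ((n + 2 : ℕ) * (Real.pi / 2)) F s +
        cosT ((n + 1 : ℕ) * (Real.pi / 2)) (-G) s‖ ^ 2 =
        ∫ s in Ioi R, ‖cosT ((n + 1 : ℕ) * (Real.pi / 2)) G s - cosT ((n + 2 : ℕ) * (Real.pi / 2)) F s‖ ^ 2 := by
      refine integral_congr_ae ?_
      filter_upwards [hsub (cosT_neg ((n + 1 : ℕ) * (Real.pi / 2)) hG)] with s hs
      have hs' : cosT ((n + 1 : ℕ) * (Real.pi / 2)) (-G) s = -cosT ((n + 1 : ℕ) * (Real.pi / 2)) G s := hs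
      rw [hs', ← sub_eq_add_neg, norm_sub_rev]
    rw [e3] at p3
    rw [e4] at p4
    -- Time reversal keeps cos(tρ) and changes the sign of sin(tρ), so negative times amount to F →
    -- -F in the first term and G → -G in the second.
    have := (p3.add p4).comp tendsto_neg_atBot_atTop
    refine (this.congr' ?_).trans_eq ?_
    · filter_upwards [eventually_le_atBot 0] with t ht
      rw [extEnergy_eq hd hf hg hu hR, abs_of_nonpos ht]
      simp only [Function.comp_apply, neg_mul, Real.cos_neg, Real.sin_neg, Pi.neg_apply, Complex.ofReal_neg,
        mul_neg, neg_neg]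
      rfl
    · ring_nf

lemma integral_norm_sq_add_sub {μ : Measure ℝ} {P Q : ℝ → ℂ} (hP : MemLp P 2 μ) (hQ : MemLp Q 2 μ) :
    (∫ r, ‖P r + Q r‖ ^ 2 ∂μ) + ∫ r, ‖P r - Q r‖ ^ 2 ∂μ =
      2 * ((∫ r, ‖P r‖ ^ 2 ∂μ) + ∫ r, ‖Q r‖ ^ 2 ∂μ) := by
  have i1 := (memLp_two_iff_integrable_sq_norm (hP.add hQ).1).1 (hP.add hQ)
  have i2 := (memLp_two_iff_integrable_sq_norm (hP.sub hQ).1).1 (hP.sub hQ)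
  have i3 := (memLp_two_iff_integrable_sq_norm hP.1).1 hP
  have i4 := (memLp_two_iff_integrable_sq_norm hQ.1).1 hQ
  simp only [Pi.add_apply, Pi.sub_apply] at i1 i2
  rw [← integral_add i1 i2, ← integral_add i3 i4, ← integral_const_mul]
  congr 1; ext r
  have := parallelogram_law_with_norm ℝ (P r) (Q r)
  nlinarith [this]

lemma radial_fourier_eq_zero (hd : 1 ≤ d) (h : IsRadialFourier d f fhat) (h0 : f =ᵐ[nu] 0) :
    fhat =ᵐ[nu] 0 := by
  refine ae_eq_zero_of_integral_gam (m := d - 1) fhat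
    (fun a ha => (radial_fourier_gaussian hd h ha).2.1) fun a ha => ?_
  rw [(radial_fourier_gaussian hd h ha).2.2]
  have : ∫ r, f r * (gam (d - 1) a⁻¹ r : ℂ) ∂nu = 0 := by
    rw [← integral_zero ℝ ℂ (μ := nu)]
    refine integral_congr_ae ?_
    filter_upwards [h0] with r hr
    rw [hr]; simp
  rw [this, mul_zero]

lemma cosT_eq_zero (β : ℝ) {w : ℝ → ℂ} (h0 : w =ᵐ[nu] 0) : cosT β w =ᵐ[nu] 0 := by
  have hw : MemLp w 2 nu := (MemLp.zero' : MemLp (fun _ : ℝ => (0 : ℂ)) 2 nu).ae_eq h0.symm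
  have h1 := eLpNorm_cosT_le β hw
  rw [eLpNorm_congr_ae h0, eLpNorm_zero, mul_zero] at h1
  exact (eLpNorm_eq_zero_iff (memLp_cosT β hw).1 two_ne_zero).1 (le_antisymm h1 bot_le)

/-- The exterior energies in both time directions. -/
theorem exterior_energy_limits (hd : d = 2 * (n + 1) + 1) (hf : IsRadialHdot1 d f f' fhat)
    (hg : IsRadialL2 d g ghat) (hu : IsRadialEnergySolution d fhat ghat u ut ur) {R : ℝ} (hR : 0 < R) :
    ∃ Lplus Lminus : ℝ,
      Tendsto (fun t : ℝ => (2 * Real.pi) ^ d * extEnergy d R ut ur t) atTop (𝓝 Lplus) ∧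
      Tendsto (fun t : ℝ => (2 * Real.pi) ^ d * extEnergy d R ut ur t) atBot (𝓝 Lminus) ∧
      asF d R fhat + asG d R ghat ≤ max Lplus Lminus ∧
      ((f =ᵐ[volume.restrict (Ioi 0)] 0 ∨ g =ᵐ[volume.restrict (Ioi 0)] 0) →
        Lplus = asF d R fhat + asG d R ghat ∧ Lminus = asF d R fhat + asG d R ghat) := by
  obtain ⟨h1, h2⟩ := tendsto_extEnergy hd hf hg hu hR
  have hF := memLp_weighted_fhat hd hf
  have hG := memLp_weighted_ghat hd hg
  have hmono : volume.restrict (Ioi R) ≤ nu := restrict_Ioi_le_nu hR.le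
  rw [asF_eq hd hR hF, asG_eq hd hR hG]
  refine ⟨_, _, h1, h2, ?_, ?_⟩
  -- By the parallelogram law the two limits add up to twice AS_d(f) + AS_d(g), so they cannot both
  -- be smaller.
  · have := integral_norm_sq_add_sub (μ := volume.restrict (Ioi R))
      ((memLp_cosT ((n + 1 : ℕ) * (Real.pi / 2)) hG).mono_measure hmono)
      ((memLp_cosT ((n + 2 : ℕ) * (Real.pi / 2)) hF).mono_measure hmono)
    rw [le_max_iff]
    by_contra! hc
    obtain ⟨c1, c2⟩ := hc
    simp only [show n + 1 + 1 = n + 2 from rfl] at c1 c2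
    linarith
  · rintro (h0 | h0)
    · have e0 : weighted (n + 2) fhat =ᵐ[nu] 0 := by
        filter_upwards [radial_fourier_eq_zero (by omega) hf.fourier h0] with r hr
        unfold weighted; rw [hr]; simp
      have e1 := ae_mono hmono (cosT_eq_zero ((n + 2 : ℕ) * (Real.pi / 2)) e0)
      have e2 : ∫ r in Ioi R, ‖cosT ((n + 2 : ℕ) * (Real.pi / 2)) (weighted (n + 2) fhat) r‖ ^ 2 = 0 := by
        rw [← integral_zero ℝ ℝ (μ := volume.restrict (Ioi R))]
        refine integral_congr_ae ?_
        filter_upwards [e1] with r hr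
        rw [hr]; simp
      simp only [show n + 1 + 1 = n + 2 from rfl]
      rw [e2, mul_zero, zero_add]
      constructor <;>
      · congr 1
        refine integral_congr_ae ?_
        filter_upwards [e1] with r hr
        rw [hr]; simp
    · have e0 : weighted (n + 1) ghat =ᵐ[nu] 0 := by
        filter_upwards [radial_fourier_eq_zero (by omega) hg.fourier h0] with r hr
        unfold weighted; rw [hr]; simp
      have e1 := ae_mono hmono (cosT_eq_zero ((n + 1 : ℕ) * (Real.pi / 2)) e0)
      have e2 : ∫ r in Ioi R, ‖cosT ((n + 1 : ℕ) * (Real.pi / 2)) (weighted (n + 1) ghat) r‖ ^ 2 = 0 := by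
        rw [← integral_zero ℝ ℝ (μ := volume.restrict (Ioi R))]
        refine integral_congr_ae ?_
        filter_upwards [e1] with r hr
        rw [hr]; simp
      simp only [show n + 1 + 1 = n + 2 from rfl]
      rw [e2, mul_zero, add_zero]
      constructor <;>
      · congr 1
        refine integral_congr_ae ?_
        filter_upwards [e1] with r hr
        rw [hr]; simp

end Wave

/-! ### Quadratic forms of the mollified kernels -/

/-- The kernel `(2 r₁ r₂)⁻¹ ∫_{-R}^R M(ξ/r₁) \overline{M(ξ/r₂)} dξ`. -/
def quadKer (M : ℝ → ℂ) (R r₁ r₂ : ℝ) : ℂ :=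
  ((1 / (2 * r₁ * r₂) : ℝ) : ℂ) * ∫ ξ in (-R)..R, M (ξ / r₁) * conj (M (ξ / r₂))

/-- M is even or odd, so the product is even in ξ and the integral over (-R,R) is twice the one over
(0,R), which cancels the factor ½. What remains is a superposition of rank-one kernels, the reason
why the quadratic form is a square norm. -/
lemma quadKer_eq {M : ℝ → ℂ} (hM : Continuous M) {σ : ℝ} (hσ : σ ^ 2 = 1) (hp : ∀ u, M (-u) = σ * M u)
    {R : ℝ} (hR : 0 < R) (r₁ r₂ : ℝ) :
    quadKer M R r₁ r₂ = ∫ s in Ioo 0 R, (((r₁⁻¹ : ℝ) : ℂ) * M (s / r₁)) * conj (((r₂⁻¹ : ℝ) : ℂ) * M (s / r₂)) := by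
  have hc : Continuous fun ξ : ℝ => M (ξ / r₁) * conj (M (ξ / r₂)) := by fun_prop
  have hev : ∀ ξ : ℝ, M (-ξ / r₁) * conj (M (-ξ / r₂)) = M (ξ / r₁) * conj (M (ξ / r₂)) := fun ξ => by
    have hσ' : (σ : ℂ) ^ 2 = 1 := by exact_mod_cast hσ
    rw [neg_div, neg_div, hp, hp, map_mul, Complex.conj_ofReal]
    linear_combination (M (ξ / r₁) * conj (M (ξ / r₂))) * hσ'
  have h1 : ∫ ξ in (-R)..0, M (ξ / r₁) * conj (M (ξ / r₂)) = ∫ ξ in (0 : ℝ)..R, M (ξ / r₁) * conj (M (ξ / r₂)) := by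
    have := intervalIntegral.integral_comp_neg (a := 0) (b := R) (fun ξ => M (ξ / r₁) * conj (M (ξ / r₂)))
    rw [neg_zero] at this
    rw [← this]
    exact intervalIntegral.integral_congr fun ξ _ => hev ξ
  have h2 : ∫ ξ in (-R)..R, M (ξ / r₁) * conj (M (ξ / r₂)) = 2 * ∫ ξ in (0 : ℝ)..R, M (ξ / r₁) * conj (M (ξ / r₂)) := by
    rw [← intervalIntegral.integral_add_adjacent_intervals (hc.intervalIntegrable (-R) 0) (hc.intervalIntegrable 0 R),
      h1]
    ring
  unfold quadKer
  rw [h2, intervalIntegral.integral_of_le hR.le, integral_Ioc_eq_integral_Ioo, ← mul_assoc, ← integral_const_mul]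
  congr 1; ext s
  rw [map_mul, Complex.conj_ofReal]
  push_cast
  ring

/-- The quadratic form of `quadKer` is absolutely convergent and nonnegative. -/
lemma quadratic_form_eq {M : ℝ → ℂ} (hM : Continuous M) (hN : kerN M ≠ ⊤) {σ : ℝ} (hσ : σ ^ 2 = 1)
    (hp : ∀ u, M (-u) = σ * M u) {R : ℝ} (hR : 0 < R) {w : ℝ → ℂ} (hw : MemLp w 2 nu) :
    Integrable (fun r : ℝ × ℝ => quadKer M R r.1 r.2 * (w r.1 * conj (w r.2))) (nu.prod nu) ∧
    ∫ r : ℝ × ℝ, quadKer M R r.1 r.2 * (w r.1 * conj (w r.2)) ∂(nu.prod nu) =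
      ((∫ s in Ioo 0 R, ‖dil M w s‖ ^ 2 : ℝ) : ℂ) := by
  have hsub : Ioo 0 R ⊆ Ioi 0 := fun s hs => hs.1
  set ν : Measure ℝ := volume.restrict (Ioo 0 R) with hν
  have hνle : ν ≤ nu := Measure.restrict_mono hsub le_rfl
  set ψ : ℝ → ℝ → ℂ := fun s r => ((r⁻¹ : ℝ) : ℂ) * M (s / r) * w r with hψ
  set Φ : ℝ × (ℝ × ℝ) → ℂ := fun p => ψ p.1 p.2.1 * conj (ψ p.1 p.2.2) with hΦ
  have hm : AEStronglyMeasurable Φ (ν.prod (nu.prod nu)) := by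
    have h1 : Measurable fun p : ℝ × (ℝ × ℝ) => (((p.2.1⁻¹ : ℝ) : ℂ) * M (p.1 / p.2.1)) *
        conj (((p.2.2⁻¹ : ℝ) : ℂ) * M (p.1 / p.2.2)) := by
      have m1 : Measurable fun p : ℝ × (ℝ × ℝ) => M (p.1 / p.2.1) :=
        hM.measurable.comp (measurable_fst.div (measurable_fst.comp measurable_snd))
      have m2 : Measurable fun p : ℝ × (ℝ × ℝ) => M (p.1 / p.2.2) :=
        hM.measurable.comp (measurable_fst.div (measurable_snd.comp measurable_snd))
      have m3 : Measurable fun p : ℝ × (ℝ × ℝ) => ((p.2.1⁻¹ : ℝ) : ℂ) := by fun_prop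
      have m4 : Measurable fun p : ℝ × (ℝ × ℝ) => ((p.2.2⁻¹ : ℝ) : ℂ) := by fun_prop
      exact (m3.mul m1).mul (Complex.continuous_conj.measurable.comp (m4.mul m2))
    have h2 : AEStronglyMeasurable (fun p : ℝ × ℝ => w p.1 * conj (w p.2)) (nu.prod nu) :=
      hw.1.comp_fst.mul (Complex.continuous_conj.comp_aestronglyMeasurable hw.1).comp_snd
    have h3 : AEStronglyMeasurable (fun p : ℝ × (ℝ × ℝ) => w p.2.1 * conj (w p.2.2)) (ν.prod (nu.prod nu)) :=
      h2.comp_snd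
    refine (h1.aestronglyMeasurable.mul h3).congr (Eventually.of_forall fun p => ?_)
    simp only [hΦ, hψ, Pi.mul_apply, map_mul]
    ring
  have hψm : ∀ s, AEStronglyMeasurable (ψ s) nu := fun s => by
    have h1 : Measurable fun r : ℝ => ((r⁻¹ : ℝ) : ℂ) * M (s / r) :=
      (by fun_prop : Measurable fun r : ℝ => ((r⁻¹ : ℝ) : ℂ)).mul (hM.measurable.comp (measurable_const.div measurable_id))
    exact h1.aestronglyMeasurable.mul hw.1
  -- For fixed s the absolute integral over (r₁, r₂) is the square of a single integral, and Schur's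
  -- bound makes that square integrable in s. Hence the form converges absolutely and Fubini
  -- applies.
  have hfin : ∫⁻ p, ‖Φ p‖ₑ ∂(ν.prod (nu.prod nu)) < ⊤ := by
    rw [lintegral_prod _ hm.enorm]
    have e1 : ∀ s, ∫⁻ r, ‖Φ (s, r)‖ₑ ∂(nu.prod nu) = (∫⁻ r, ENNReal.ofReal r⁻¹ * ‖M (s / r)‖ₑ * ‖w r‖ₑ ∂nu) ^ 2 := fun s => by
      have e2 : ∫⁻ r, ‖ψ s r‖ₑ ∂nu = ∫⁻ r, ENNReal.ofReal r⁻¹ * ‖M (s / r)‖ₑ * ‖w r‖ₑ ∂nu :=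
        setLIntegral_congr_fun measurableSet_Ioi fun r hr => enorm_dil_integrand M w s hr
      rw [sq, ← e2, ← lintegral_prod_mul (hψm s).enorm (hψm s).enorm]
      congr 1; ext r
      simp only [hΦ, enorm_mul, RCLike.enorm_conj]
    simp only [e1]
    refine (lintegral_mono' hνle le_rfl).trans_lt ((lintegral_sq_dil_le hM.measurable hw.1).trans_lt ?_)
    exact ENNReal.mul_lt_top (ENNReal.pow_lt_top hN.lt_top) (ENNReal.pow_lt_top hw.2)
  have hint : Integrable Φ (ν.prod (nu.prod nu)) := ⟨hm, hfin⟩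
  have e0 : ∀ r : ℝ × ℝ, ∫ s, Φ (s, r) ∂ν = quadKer M R r.1 r.2 * (w r.1 * conj (w r.2)) := fun r => by
    rw [quadKer_eq hM hσ hp hR, ← integral_mul_const]
    congr 1; ext s
    simp only [hΦ, hψ, map_mul]
    ring
  have h1 := hint.integral_prod_right
  simp only [e0] at h1
  refine ⟨h1, ?_⟩
  have h2 := integral_prod_symm Φ hint
  have h3 := integral_prod Φ hint
  simp only [e0] at h2
  rw [← h2, h3, ← integral_complex_ofReal]
  congr 1; ext s
  simp only [hΦ]
  rw [integral_prod_mul (ψ s) (fun r => conj (ψ s r)), integral_conj]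
  change dil M w s * conj (dil M w s) = _
  rw [Complex.mul_conj, Complex.normSq_eq_norm_sq]

lemma cosT_cosT (m : ℕ) {w : ℝ → ℂ} (hw : MemLp w 2 nu) :
    cosT (m * (Real.pi / 2)) (cosT (m * (Real.pi / 2)) w) =ᵐ[nu] w := by
  rcases cos_sin_nat_mul_pi_div_two m with ⟨σ, h1, h2, h3, _⟩ | ⟨σ, h1, h2, h3, _⟩
  · have e : ∀ v, cosT (m * (Real.pi / 2)) v = fun ρ => (σ : ℂ) * hankel 0 v ρ := fun v => by
      ext ρ; unfold cosT; rw [h2, h3]; simp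
    have hσ' : (σ : ℂ) ^ 2 = 1 := by exact_mod_cast h1
    rw [e, e]
    filter_upwards [hankel_const_mul 0 (σ : ℂ) (memLp_hankel 0 hw), hankel_hankel 0 hw] with r h4 h5
    rw [h4, h5]
    linear_combination w r * hσ'
  · have e : ∀ v, cosT (m * (Real.pi / 2)) v = fun ρ => (σ : ℂ) * hankel 1 v ρ := fun v => by
      ext ρ; unfold cosT; rw [h2, h3]; simp
    have hσ' : (σ : ℂ) ^ 2 = 1 := by exact_mod_cast h1
    rw [e, e]
    filter_upwards [hankel_const_mul 1 (σ : ℂ) (memLp_hankel 1 hw), hankel_hankel 1 hw] with r h4 h5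
    rw [h4, h5]
    linear_combination w r * hσ'

/-- The regularized quadratic forms converge to the asymptotic exterior energy. -/
lemma tendsto_regularized {k : ℕ} {q : Polynomial ℝ}
    (hq : ∀ z : ℝ, z ≠ 0 → bes k z = Real.cos (z - k * (Real.pi / 2)) +
      ∫ t in (0 : ℝ)..1, q.eval t * Real.cos (z * t - k * (Real.pi / 2)))
    {h G : ℝ → ℂ} (hh : MemLp h 2 nu) (hG : hankel k h =ᵐ[nu] G) {D : ℝ → ℝ → ℂ}
    (hD : ∀ᶠ ε in 𝓝[>] (0 : ℝ), MemLp (D ε) 2 nu)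
    (hlim : Tendsto (fun ε => eLpNorm (fun s => D ε s -
      (Real.pi * (-Complex.I) ^ k) * (h s + dil (density q) h s)) 2 nu) (𝓝[>] 0) (𝓝 0)) {R : ℝ} (hR : 0 < R) :
    Tendsto (fun ε => (1 / 2) * (∫ r in Ioi (0 : ℝ), ‖h r‖ ^ 2) -
      1 / (2 * Real.pi ^ 2) * ∫ s in Ioo 0 R, ‖D ε s‖ ^ 2) (𝓝[>] 0)
      (𝓝 ((1 / 2) * ∫ r in Ioi R, ‖cosT (k * (Real.pi / 2)) G r‖ ^ 2)) := by
  set V : ℝ → ℂ := fun s => h s + dil (density q) h s with hV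
  have hVm : MemLp V 2 nu := hh.add (memLp_dil (measurable_density q) (kerN_density_ne_top q) hh)
  have hGm : MemLp G 2 nu := (memLp_hankel k hh).ae_eq hG
  -- G = H_k h = C_k V by the factorization, and C_k is an involution.
  have hcG : cosT (k * (Real.pi / 2)) G =ᵐ[nu] V := by
    rw [cosT_congr _ hGm (hG.symm.trans (hankel_eq_cosT hq hh))]
    exact cosT_cosT k hVm
  have hsub : Ioo 0 R ⊆ Ioi 0 := fun s hs => hs.1
  have hνle : volume.restrict (Ioo 0 R) ≤ nu := Measure.restrict_mono hsub le_rfl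
  have hYm : MemLp (fun s => (Real.pi * (-Complex.I) ^ k) * V s) 2 nu := hVm.const_mul _
  have h1 := tendsto_integral_norm_sq (μ := volume.restrict (Ioo 0 R)) (l := 𝓝[>] (0 : ℝ)) (F := D)
    (hD.mono fun ε h => h.mono_measure hνle) (hYm.mono_measure hνle)
    (tendsto_of_tendsto_of_tendsto_of_le_of_le tendsto_const_nhds hlim (fun _ => bot_le)
      fun ε => eLpNorm_mono_measure _ hνle)
  have e1 : ∫ s in Ioo 0 R, ‖(Real.pi * (-Complex.I) ^ k) * V s‖ ^ 2 =
      Real.pi ^ 2 * ∫ s in Ioo 0 R, ‖cosT (k * (Real.pi / 2)) G s‖ ^ 2 := by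
    rw [← integral_const_mul]
    refine integral_congr_ae ?_
    filter_upwards [ae_mono hνle hcG] with s hs
    rw [hs]
    simp [mul_pow]
  -- C_k and H_k are unitary, so ‖h‖ = ‖C_k G‖; subtracting the part on (0,R) leaves the tail.
  have e2 : ∫ r in Ioi (0 : ℝ), ‖h r‖ ^ 2 =
      (∫ r in Ioo 0 R, ‖cosT (k * (Real.pi / 2)) G r‖ ^ 2) + ∫ r in Ioi R, ‖cosT (k * (Real.pi / 2)) G r‖ ^ 2 := by
    rw [← integral_norm_sq_split hR (memLp_cosT _ hGm)]
    refine integral_norm_sq_eq_of_eLpNorm hh (memLp_cosT _ hGm) ?_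
    rw [eLpNorm_cosT k hGm, ← eLpNorm_congr_ae hG, eLpNorm_hankel k hh]
  rw [e1] at h1
  have h2 := (h1.const_mul (1 / (2 * Real.pi ^ 2))).const_sub ((1 / 2) * (∫ r in Ioi (0 : ℝ), ‖h r‖ ^ 2))
  refine h2.trans_eq ?_
  congr 1
  rw [e2]
  have := Real.pi_ne_zero
  field_simp
  ring

/-! ### The formulas in physical space -/

section PhysicalSpace

variable {n d : ℕ} {f f' fhat g ghat : ℝ → ℂ} {κ : ℝ → ℝ}

lemma restrict_quadrant : (volume.restrict (Ioi (0 : ℝ) ×ˢ Ioi (0 : ℝ)) : Measure (ℝ × ℝ)) = nu.prod nu := by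
  rw [Measure.volume_eq_prod, Measure.prod_restrict]

lemma half_integral_weighted {m : ℕ} (hd : d = 2 * m + 1) {c : ℂ} (hc : ‖c‖ ^ 2 = (2 * Real.pi) ^ d) (w : ℝ → ℂ) :
    (1 / 2) * (∫ r in Ioi (0 : ℝ), ‖c * weighted m w r‖ ^ 2) =
      2 ^ (d - 1) * Real.pi ^ d * ∫ r in Ioi (0 : ℝ), ‖w r‖ ^ 2 * r ^ (d - 1) := by
  have hd2 : d - 1 = 2 * m := by omega
  have e : ∀ r : ℝ, ‖c * weighted m w r‖ ^ 2 = (2 * Real.pi) ^ d * (‖w r‖ ^ 2 * r ^ (d - 1)) := fun r => by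
    rw [norm_mul, mul_pow (norm _), hc, norm_weighted_sq, hd2]
  simp only [e]
  rw [integral_const_mul, ← mul_assoc, hd2, hd, mul_pow, pow_succ (2 : ℝ)]
  ring

/-- The normalization |c|² = (2π)^d of the Fourier transform, divided by 2π², is the constant
2^{d-1}π^{d-2} in front of the double integrals. -/
lemma integral_const_mul_sq (hd : 2 ≤ d) {c : ℂ} (hc : ‖c‖ ^ 2 = (2 * Real.pi) ^ d) (D : ℝ → ℂ) (R : ℝ) :
    1 / (2 * Real.pi ^ 2) * ∫ s in Ioo 0 R, ‖c * D s‖ ^ 2 =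
      2 ^ (d - 1) * Real.pi ^ (d - 2) * ∫ s in Ioo 0 R, ‖D s‖ ^ 2 := by
  obtain ⟨k, rfl⟩ := Nat.exists_eq_add_of_le hd
  have e : ∀ s : ℝ, ‖c * D s‖ ^ 2 = (2 * Real.pi) ^ (2 + k) * ‖D s‖ ^ 2 := fun s => by
    rw [norm_mul, mul_pow (norm _), hc]
  simp only [e]
  have := Real.pi_ne_zero
  rw [integral_const_mul, ← mul_assoc, show 2 + k - 1 = k + 1 by omega, show 2 + k - 2 = k by omega]
  congr 1
  field_simp
  ring

lemma norm_sq_two_pi (d : ℕ) : ‖(((2 * Real.pi) ^ ((d : ℝ) / 2) : ℝ) : ℂ)‖ ^ 2 = (2 * Real.pi) ^ d := by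
  rw [Complex.norm_real, Real.norm_eq_abs, sq_abs, ← Real.rpow_natCast, ← Real.rpow_mul (by positivity),
    ← Real.rpow_natCast]
  congr 1; push_cast; ring

lemma dil_const_mul_right (c : ℂ) (a h : ℝ → ℂ) (s : ℝ) : dil a (fun r => c * h r) s = c * dil a h s := by
  unfold dil
  rw [← integral_const_mul]
  congr 1; ext r; ring

lemma dil_congr_right (a : ℝ → ℂ) {h w : ℝ → ℂ} (e : h =ᵐ[nu] w) (s : ℝ) : dil a h s = dil a w s := by
  refine integral_congr_ae ?_
  filter_upwards [e] with r hr
  rw [hr]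

lemma neg_one_pow_sq (k : ℕ) : (((-1 : ℝ) ^ k)) ^ 2 = 1 := by
  rw [← pow_mul, mul_comm, pow_mul]; simp

/-- The formula for `AS_d(g)` in physical space. -/
theorem asG_physical (hκ : IsNormalizedBump κ) (hd : d = 2 * (n + 1) + 1) {R : ℝ} (hR : 0 < R)
    (hg : IsRadialL2 d g ghat) :
    (∀ ε : ℝ, 0 < ε → IntegrableOn (formIntegrand d (kernelG κ n R ε) g) (Ioi 0 ×ˢ Ioi 0)) ∧
      Tendsto (fun ε : ℝ =>
          ((2 ^ (d - 1) * Real.pi ^ d * ∫ r in Ioi (0 : ℝ), ‖g r‖ ^ 2 * r ^ (d - 1) : ℝ) : ℂ)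
          - ((2 ^ (d - 1) * Real.pi ^ (d - 2) : ℝ) : ℂ) *
            ∫ r in Ioi (0 : ℝ) ×ˢ Ioi (0 : ℝ), formIntegrand d (kernelG κ n R ε) g r)
        (𝓝[>] 0) (𝓝 (asG d R ghat : ℂ)) := by
  obtain ⟨q, hq⟩ := exists_bes_rep (n + 1)
  have hm : (d - 1) / 2 = n + 1 := by omega
  have hw : MemLp (weighted (n + 1) g) 2 nu := (memLp_weighted_iff hd).2 hg.memLp
  have hM : ∀ ε, 0 < ε → ∀ u, mollifiedFourier κ ε (phiBessel n) u = molKer κ (n + 1) q ε u := fun ε hε u =>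
    mollifiedFourier_bes hκ.smooth hκ.support hq hε u
  have hform : ∀ ε, 0 < ε → formIntegrand d (kernelG κ n R ε) g = fun r => quadKer (molKer κ (n + 1) q ε) R r.1 r.2 *
      (weighted (n + 1) g r.1 * conj (weighted (n + 1) g r.2)) := fun ε hε => by
    ext r
    unfold formIntegrand kernelG quadKer weighted
    simp only [hM ε hε, hm, map_mul, Complex.conj_ofReal]
    push_cast
    ring
  have hQ := fun ε (hε : 0 < ε) => quadratic_form_eq (continuous_molKer hκ.smooth.continuous (n + 1) q ε)
    (kerN_molKer_ne_top hκ.smooth.continuous hκ.support (n + 1) q hε) (neg_one_pow_sq (n + 1))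
    (fun u => by
      rw [← hM ε hε, ← hM ε hε]
      exact mollifiedFourier_neg hκ.even (fun z hz => phiBessel_neg n hz) ε u) hR hw
  refine ⟨fun ε hε => ?_, ?_⟩
  · rw [IntegrableOn, restrict_quadrant, hform ε hε]
    exact (hQ ε hε).1
  · set c : ℂ := (((2 * Real.pi) ^ ((d : ℝ) / 2) : ℝ) : ℂ) with hc
    have hcn : ‖c‖ ^ 2 = (2 * Real.pi) ^ d := norm_sq_two_pi d
    have hh : MemLp (fun r => c * weighted (n + 1) g r) 2 nu := hw.const_mul c
    have hlim := tendsto_dil_molKer hκ.smooth.continuous hκ.support (n + 1) q hh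
    rw [hκ.integral_eq_one] at hlim
    simp only [Complex.ofReal_one, one_mul] at hlim
    have h1 := tendsto_regularized hq hh (hankel_of_radial_fourier hd hw hg.fourier)
      (D := fun ε => dil (molKer κ (n + 1) q ε) fun r => c * weighted (n + 1) g r)
      (by filter_upwards [self_mem_nhdsWithin] with ε hε
          exact memLp_dil (continuous_molKer hκ.smooth.continuous (n + 1) q ε).measurable
            (kerN_molKer_ne_top hκ.smooth.continuous hκ.support (n + 1) q hε) hh) hlim hR
    rw [← asG_eq hd hR (memLp_weighted_ghat hd hg)] at h1
    refine ((Complex.continuous_ofReal.tendsto _).comp h1).congr' ?_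
    filter_upwards [self_mem_nhdsWithin] with ε hε
    rw [restrict_quadrant, hform ε hε, (hQ ε hε).2]
    simp only [Function.comp_apply, dil_const_mul_right]
    rw [half_integral_weighted hd hcn, integral_const_mul_sq (by omega) hcn]
    push_cast; ring

/-- The mass -1 of yκ'(y), against the mass 1 of κ, is what removes the lower-order terms in the
formula for f. -/
lemma integral_id_mul_deriv (hκ : IsNormalizedBump κ) : ∫ y, y * deriv κ y = -1 := by
  have hc : HasCompactSupport κ := hasCompactSupport_of_support hκ.support
  have hd1 : Continuous (deriv κ) := hκ.smooth.continuous_deriv (by simp)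
  have i1 : Integrable (fun y => y * deriv κ y) :=
    (by fun_prop : Continuous fun y => y * deriv κ y).integrable_of_hasCompactSupport hc.deriv.mul_left
  have i2 : Integrable κ := hκ.smooth.continuous.integrable_of_hasCompactSupport hc
  have i3 : Integrable (fun y => y * κ y) :=
    (continuous_id.mul hκ.smooth.continuous).integrable_of_hasCompactSupport hc.mul_left
  have := integral_mul_deriv_eq_deriv_mul_of_integrable (u := fun y : ℝ => y) (v := κ) (u' := fun _ => 1)
    (v' := deriv κ) (fun y _ => hasDerivAt_id y)
    (fun y _ => ((hκ.smooth.differentiable (by simp)) y).hasDerivAt) i1 (by convert i2 using 1; ext y; simp) i3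
  rw [this]
  simp [hκ.integral_eq_one]

/-- The formula for `AS_d(f)` in physical space. -/
theorem asF_physical (hκ : IsNormalizedBump κ) (hd : d = 2 * (n + 1) + 1) {R : ℝ} (hR : 0 < R)
    (hf : IsRadialHdot1 d f f' fhat) :
    (∀ ε : ℝ, 0 < ε → IntegrableOn (formIntegrand d (kernelF κ n R ε) f) (Ioi 0 ×ˢ Ioi 0)) ∧
      Tendsto (fun ε : ℝ =>
          ((2 ^ (d - 1) * Real.pi ^ d * ∫ r in Ioi (0 : ℝ), ‖f' r‖ ^ 2 * r ^ (d - 1) : ℝ) : ℂ)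
          - ((2 ^ (d - 1) * Real.pi ^ (d - 2) : ℝ) : ℂ) *
            ∫ r in Ioi (0 : ℝ) ×ˢ Ioi (0 : ℝ), formIntegrand d (kernelF κ n R ε) f r)
        (𝓝[>] 0) (𝓝 (asF d R fhat : ℂ)) := by
  obtain ⟨q, hq⟩ := exists_bes_rep (n + 2)
  have hm : (d - 1) / 2 = n + 1 := by omega
  have hF := memLp_weighted_fhat hd hf
  have hf1 : MemLp (weighted (n + 1) f') 2 nu := (memLp_weighted_iff hd).2 hf.memLp_deriv
  have hκc := hκ.smooth.continuous
  have hκ1 := contDiff_deriv hκ.smooth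
  have hs1 := support_deriv hκ.support
  have hκ2 : Continuous fun y => y * deriv κ y := continuous_id.mul hκ1.continuous
  have hs2 := support_id_mul hs1
  -- f occurs here only with the weight r^n, one power less than for L² data; Hardy's inequality
  -- gives r^n f ∈ L² from r^{n+1} f' ∈ L².
  have hfp : weighted n f =ᵐ[nu] fun r => -dil (hardyKer n) (weighted (n + 1) f') r := by
    filter_upwards [hdot1_eq_decayPrimitive hd hf hF, weighted_decayPrimitive_ae n f'] with r h1 h2
    rw [← h2]; unfold weighted; rw [h1]
  have hw : MemLp (weighted n f) 2 nu :=
    (memLp_dil (measurable_hardyKer n) (kerN_hardyKer_ne_top n) hf1).neg.ae_eq hfp.symm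
  set M : ℝ → ℝ → ℂ := fun ε u => ((n : ℂ) + 1) * molKer κ (n + 2) q ε u +
      molKer (fun y => y * deriv κ y) (n + 2) q ε u -
        u * (((1 / ε : ℝ) : ℂ) * molKer (deriv κ) (n + 2) q ε u) with hMd
  have hM : ∀ ε, 0 < ε → ∀ u, mollifiedFourier κ ε (psiBessel n) u = M ε u := fun ε hε u =>
    mollifiedFourier_psi hκ.smooth hκ.support hq hε u
  have hcA := fun ε => continuous_molKer hκc (n + 2) q ε
  have hcA1 := fun ε => continuous_molKer hκ1.continuous (n + 2) q ε
  have hcA2 := fun ε => continuous_molKer hκ2 (n + 2) q ε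
  have hMc : ∀ ε, Continuous (M ε) := fun ε => by
    have h0 := hcA ε
    have h1 := hcA1 ε
    have h2 := hcA2 ε
    rw [hMd]; fun_prop
  have hMN : ∀ ε, 0 < ε → kerN (M ε) ≠ ⊤ := fun ε hε =>
    kerN_ne_top_of_continuous (B := 1 + ε) (hMc ε) fun u hu => by
      rw [hMd]
      simp only [molKer_eq_zero hκ.support (n + 2) q hε hu, molKer_eq_zero hs1 (n + 2) q hε hu,
        molKer_eq_zero hs2 (n + 2) q hε hu]
      simp
  -- The prefactor (r₁r₂)^{-2} and the weight (r₁r₂)^{n+1} combine to the (r₁r₂)^{-1} of `quadKer`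
  -- and a weight r^n on each f. Positivity of r₁ and r₂ is needed for the cancellation, so the
  -- identity is stated on the quadrant only.
  have hform : ∀ ε, 0 < ε → ∀ r ∈ Ioi (0 : ℝ) ×ˢ Ioi (0 : ℝ), quadKer (M ε) R r.1 r.2 *
      (weighted n f r.1 * conj (weighted n f r.2)) = formIntegrand d (kernelF κ n R ε) f r := fun ε hε r hr => by
    have h1 : (r.1 : ℂ) ≠ 0 := Complex.ofReal_ne_zero.2 (ne_of_gt hr.1)
    have h2 : (r.2 : ℂ) ≠ 0 := Complex.ofReal_ne_zero.2 (ne_of_gt hr.2)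
    unfold formIntegrand kernelF quadKer weighted
    simp only [hM ε hε, hm, map_mul, Complex.conj_ofReal]
    push_cast
    field_simp
    ring
  have hQ := fun ε (hε : 0 < ε) => quadratic_form_eq (hMc ε) (hMN ε hε) (neg_one_pow_sq n)
    (fun u => by
      rw [← hM ε hε, ← hM ε hε]
      exact mollifiedFourier_neg hκ.even (fun z hz => psiBessel_neg n hz) ε u) hR hw
  have hmeas : MeasurableSet (Ioi (0 : ℝ) ×ˢ Ioi (0 : ℝ)) := measurableSet_Ioi.prod measurableSet_Ioi
  refine ⟨fun ε hε => ?_, ?_⟩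
  · have h := (hQ ε hε).1
    rw [← restrict_quadrant] at h
    exact IntegrableOn.congr_fun h (hform ε hε) hmeas
  · set c : ℂ := (((2 * Real.pi) ^ ((d : ℝ) / 2) : ℝ) : ℂ) with hc
    have hcn : ‖c‖ ^ 2 = (2 * Real.pi) ^ d := norm_sq_two_pi d
    have hcn' : ‖-c‖ ^ 2 = (2 * Real.pi) ^ d := by rw [norm_neg, hcn]
    set h : ℝ → ℂ := fun r => -c * weighted (n + 1) f' r with hhd
    have hh : MemLp h 2 nu := hf1.const_mul (-c)
    set v := dil (hardyKer n) h with hv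
    have hvm : MemLp v 2 nu := memLp_dil (measurable_hardyKer n) (kerN_hardyKer_ne_top n) hh
    have hvw : v =ᵐ[nu] fun r => c * weighted n f r := by
      filter_upwards [hfp] with r hr
      rw [hv, hhd, dil_const_mul_right, hr]; ring
    have hG : hankel (n + 2) h =ᵐ[nu] weighted (n + 2) fhat := by
      have := hankel_of_hdot1 hd hf hF
      simpa only [hhd, hc, Complex.ofReal_neg] using! this
    set P : ℂ := Real.pi * (-Complex.I) ^ (n + 2) with hP
    have l1 := tendsto_dil_molKer hκc hκ.support (n + 2) q hh
    have l2 := tendsto_dil_molKer hκc hκ.support (n + 2) q hvm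
    have l3 := tendsto_dil_molKer hκ2 hs2 (n + 2) q hvm
    rw [hκ.integral_eq_one] at l1 l2
    rw [integral_id_mul_deriv hκ] at l3
    have hVm : ∀ w : ℝ → ℂ, MemLp w 2 nu → MemLp (fun s => w s + dil (density q) w s) 2 nu := fun w hw =>
      hw.add (memLp_dil (measurable_density q) (kerN_density_ne_top q) hw)
    -- The kernel acts on v, a Hardy operator applied to h. The three limits l1, l2, l3 are for A on
    -- h, A on v and A₂ on v; the masses 1 and -1 make the last two cancel, and only the limit of A
    -- on h is left.
    have hlim : Tendsto (fun ε => eLpNorm (fun s => dil (M ε) v s - P * (h s + dil (density q) h s)) 2 nu)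
        (𝓝[>] 0) (𝓝 0) := by
      have hs := (l1.add l2).add l3
      rw [add_zero, add_zero] at hs
      refine tendsto_of_tendsto_of_tendsto_of_le_of_le' tendsto_const_nhds hs
        (Eventually.of_forall fun _ => bot_le) ?_
      filter_upwards [self_mem_nhdsWithin] with ε hε
      have hε : 0 < ε := hε
      have N0 := kerN_molKer_ne_top hκc hκ.support (n + 2) q hε
      have N2 := kerN_molKer_ne_top hκ2 hs2 (n + 2) q hε
      set A := molKer κ (n + 2) q ε with hA
      set A' : ℝ → ℂ := fun u => ((1 / ε : ℝ) : ℂ) * molKer (deriv κ) (n + 2) q ε u with hA'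
      set A2 := molKer (fun y => y * deriv κ y) (n + 2) q ε with hA2
      have hA'c : Continuous A' := continuous_const.mul (hcA1 ε)
      have hz : ∀ u, 1 + ε < u → A u = 0 := fun u hu => molKer_eq_zero hκ.support (n + 2) q hε hu
      have hz' : ∀ u, 1 + ε < u → A' u = 0 := fun u hu => by
        rw [hA']; simp only [molKer_eq_zero hs1 (n + 2) q hε hu, mul_zero]
      have hAc : Continuous A := hcA ε
      have hBc : Continuous fun u : ℝ => n * A u - (u : ℂ) * A' u := by fun_prop
      have NB : kerN (fun u : ℝ => n * A u - (u : ℂ) * A' u) ≠ ⊤ :=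
        kerN_ne_top_of_continuous (B := 1 + ε) hBc fun u hu => by rw [hz u hu, hz' u hu]; simp
      have hSc : Continuous fun u : ℝ => A u + A2 u := hAc.add (hcA2 ε)
      have NS : kerN (fun u : ℝ => A u + A2 u) ≠ ⊤ :=
        kerN_ne_top_of_continuous (B := 1 + ε) hSc fun u hu => by
          rw [hz u hu, hA2, molKer_eq_zero hs2 (n + 2) q hε hu, add_zero]
      -- The coefficient n + 1 of A is split as n + 1, because nA - uA' is exactly the combination
      -- that undoes the Hardy operator of order n.
      have hMs : M ε = fun u : ℝ => (n * A u - (u : ℂ) * A' u) + (A u + A2 u) := by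
        ext u; rw [hMd]; ring
      have e1 := dil_add_left hBc.measurable hSc.measurable NB NS hvm
      have e2 := dil_add_left hAc.measurable (hcA2 ε).measurable N0 N2 hvm
      have e3 := dil_hardy (by linarith : 0 < 1 + ε)
        (fun u => hasDerivAt_molKer hκ.smooth hκ.support (n + 2) q ε u) hA'c hz hz' n hh
      have m1 : MemLp (fun s => dil A h s - ((1 : ℝ) : ℂ) * P * (h s + dil (density q) h s)) 2 nu :=
        (memLp_dil hAc.measurable N0 hh).sub ((hVm h hh).const_mul _)
      have m2 : MemLp (fun s => dil A v s - ((1 : ℝ) : ℂ) * P * (v s + dil (density q) v s)) 2 nu :=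
        (memLp_dil hAc.measurable N0 hvm).sub ((hVm v hvm).const_mul _)
      have m3 : MemLp (fun s => dil A2 v s - ((-1 : ℝ) : ℂ) * P * (v s + dil (density q) v s)) 2 nu :=
        (memLp_dil (hcA2 ε).measurable N2 hvm).sub ((hVm v hvm).const_mul _)
      refine le_trans (le_of_eq (eLpNorm_congr_ae ?_)) ((eLpNorm_add_le_two (m1.add m2).1 m3.1).trans
        (add_le_add_left (eLpNorm_add_le_two m1.1 m2.1) _))
      filter_upwards [e1, e2, e3] with s h1 h2 h3
      rw [hMs, h1, h2]
      change dil (fun u : ℝ => n * A u - (u : ℂ) * A' u) v s = _ at h3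
      rw [h3]
      simp only [Pi.add_apply]
      push_cast
      ring
    have h1 := tendsto_regularized hq hh hG (D := fun ε => dil (M ε) v)
      (by filter_upwards [self_mem_nhdsWithin] with ε hε
          exact memLp_dil (hMc ε).measurable (hMN ε hε) hvm) hlim hR
    rw [← asF_eq hd hR hF] at h1
    refine ((Complex.continuous_ofReal.tendsto _).comp h1).congr' ?_
    filter_upwards [self_mem_nhdsWithin] with ε hε
    rw [← setIntegral_congr_fun hmeas (hform ε hε), restrict_quadrant, (hQ ε hε).2]
    simp only [Function.comp_apply, dil_congr_right _ hvw, dil_const_mul_right]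
    rw [hhd, half_integral_weighted hd hcn', integral_const_mul_sq (by omega) hcn]
    push_cast; ring

end PhysicalSpace

end ExteriorEnergy

end

/-! ### The theorem for general odd d -/

theorem lemma2p1 (κ : ℝ → ℝ) (hκ : ExteriorEnergy.IsNormalizedBump κ)
    (d : ℕ) (hd : Odd d) (hd3 : 3 ≤ d) (R : ℝ) (hR : 0 < R)
    (f f' fhat g ghat : ℝ → ℂ)
    (hf : ExteriorEnergy.IsRadialHdot1 d f f' fhat)
    (hg : ExteriorEnergy.IsRadialL2 d g ghat)
    (u ut ur : ℝ → ℝ → ℂ)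
    (hu : ExteriorEnergy.IsRadialEnergySolution d fhat ghat u ut ur) :
    -- the formula for `AS_d(g)` in physical space
    ((∀ ε : ℝ, 0 < ε → IntegrableOn (ExteriorEnergy.formIntegrand d
        (ExteriorEnergy.kernelG κ ((d - 3) / 2) R ε) g) (Ioi 0 ×ˢ Ioi 0)) ∧
      Tendsto (fun ε : ℝ =>
          ((2 ^ (d - 1) * Real.pi ^ d * ∫ r in Ioi (0 : ℝ), ‖g r‖ ^ 2 * r ^ (d - 1) : ℝ) : ℂ)
          - ((2 ^ (d - 1) * Real.pi ^ (d - 2) : ℝ) : ℂ) *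
            ∫ r in Ioi (0 : ℝ) ×ˢ Ioi (0 : ℝ), ExteriorEnergy.formIntegrand d
              (ExteriorEnergy.kernelG κ ((d - 3) / 2) R ε) g r)
        (𝓝[>] 0) (𝓝 (ExteriorEnergy.asG d R ghat : ℂ))) ∧
    -- the formula for `AS_d(f)` in physical space
    ((∀ ε : ℝ, 0 < ε → IntegrableOn (ExteriorEnergy.formIntegrand d
        (ExteriorEnergy.kernelF κ ((d - 3) / 2) R ε) f) (Ioi 0 ×ˢ Ioi 0)) ∧
      Tendsto (fun ε : ℝ =>
          ((2 ^ (d - 1) * Real.pi ^ d * ∫ r in Ioi (0 : ℝ), ‖f' r‖ ^ 2 * r ^ (d - 1) : ℝ) : ℂ)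
          - ((2 ^ (d - 1) * Real.pi ^ (d - 2) : ℝ) : ℂ) *
            ∫ r in Ioi (0 : ℝ) ×ˢ Ioi (0 : ℝ), ExteriorEnergy.formIntegrand d
              (ExteriorEnergy.kernelF κ ((d - 3) / 2) R ε) f r)
        (𝓝[>] 0) (𝓝 (ExteriorEnergy.asF d R fhat : ℂ))) ∧
    -- the lower bound, and equality in both time directions for data `(f,0)` or `(0,g)`
    ∃ Lplus Lminus : ℝ,
      Tendsto (fun t : ℝ => (2 * Real.pi) ^ d * ExteriorEnergy.extEnergy d R ut ur t)
        atTop (𝓝 Lplus) ∧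
      Tendsto (fun t : ℝ => (2 * Real.pi) ^ d * ExteriorEnergy.extEnergy d R ut ur t)
        atBot (𝓝 Lminus) ∧
      ExteriorEnergy.asF d R fhat + ExteriorEnergy.asG d R ghat ≤ max Lplus Lminus ∧
      ((f =ᵐ[volume.restrict (Ioi 0)] 0 ∨ g =ᵐ[volume.restrict (Ioi 0)] 0) →
        Lplus = ExteriorEnergy.asF d R fhat + ExteriorEnergy.asG d R ghat ∧
        Lminus = ExteriorEnergy.asF d R fhat + ExteriorEnergy.asG d R ghat) := by
  obtain ⟨n, hn⟩ : ∃ n, d = 2 * (n + 1) + 1 := by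
    obtain ⟨k, hk⟩ := hd
    -- From d = 2k + 1 and d ≥ 3 one has k ≥ 1, so the truncated subtraction is harmless.
    exact ⟨k - 1, by omega⟩
  have hn3 : (d - 3) / 2 = n := by omega
  rw [hn3]
  exact ⟨ExteriorEnergy.asG_physical hκ hn hR hg, ExteriorEnergy.asF_physical hκ hn hR hf,
    ExteriorEnergy.exterior_energy_limits hn hf hg hu hR⟩
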